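/- **Setting.** Let $n\ge 2$, $G=\mathbb Z_n$ (written additively), and let $\rho\colon G\to\mathbb C$ be a faithful one-dimensional unitary representation. For $N\ge 1$ let $B_N=[-N,N]^4\cap\mathbb Z^4$. Let $C_1(B_N)$ and $C_2(B_N)$ be the sets of oriented edges and oriented plaquettes of $\mathbb Z^4$ with all corners in $B_N$, let $\Omega^1(B_N,G)$ be the set of functions $\sigma\colon C_1(B_N)\to G$ with $\sigma(-e)=-\sigma(e)$, and let $\Omega^0(B_N,G)$ be the set of functions $\phi\colon B_N\to G$. Put $d\sigma(p)=\sigma(\partial p)$ and $\phi(\partial e)=\phi(y)-\phi(x)$ for an edge $e$ from $x$ to $y$. Let $\Omega^1_0(B_N,G)=\{\sigma\in\Omega^1(B_N,G): d\sigma=0\}$. For $\beta,\kappa\ge 0$ let $\mu_{N,\beta,\kappa,\infty}$ be the probability measure on $\Omega^1(B_N,G)\times\Omega^0(B_N,G)$ with $$\mu_{N,\beta,\kappa,\infty}(\sigma,\phi)\propto \exp\Bigl(\beta\sum_{p\in C_2(B_N)}\rho(d\sigma(p))+\kappa\sum_{e\in C_1(B_N)}\rho(\sigma(e)-\phi(\partial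 e))\Bigr),$$ and let $\mu_{N,\infty,\kappa,\infty}$ be the probability measure supported on $\{d\sigma=0\}$ with weight proportional to $\exp(\kappa\sum_{e\in C_1(B_N)}\rho(\sigma(e)-\phi(\partial e)))$ there. For a function $f$ of finitely many of the variables, $\langle f\rangle_{\beta,\kappa,\infty}$, $\beta\in[0,\infty]$, denotes the limit as $N\to\infty$ of the expectation of $f$ under $\mu_{N,\beta,\kappa,\infty}$. A *path* is a finite integer $1$-chain $\gamma$ on $\mathbb Z^4$ with coefficients in $\{-1,0,1\}$ such that either $\partial\gamma=0$ or $\partial\gamma=x_2-x_1$ for two vertices $x_1,x_2$. We write $|\operatorname{supp}q|$ for the number of unoriented edges with non-zero coefficient in a chain $q$, and $e\in\gamma$ if the oriented edge $e$ occurs in $\gamma$ with coefficient $+1$. Let $L_\gamma(\sigma,\phi)=\rho(\sigma(\gamma)-\phi(\partial\gamma))$. An edge of $\gamma$ is a *corner edge* if some plaquette contains it and another edge of $\gamma$ (up to orientation); $\gamma_c$ is the restriction of $\gamma$ to its corner edges. For $\sigma,\sigma'\in\Omega^1(B_N,G)$ let $\mathcal G(\sigma,\sigma')$ be the graph with vertex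 set $C_1(B_N)$ in which distinct edges $e,e'$ are adjacent if $e'=-e$, or if both belong to $\operatorname{supp}\sigma\cup\operatorname{supp}\sigma'$ and some plaquette of $B_N$ contains both (up to orientation); let $\mathcal C_{\mathcal G(\sigma,\sigma')}(e)$ be the connected component of $e$. Let $$\operatorname{dist}_0(e,E)=\tfrac12\min\bigl\{|\mathcal C_{\mathcal G(\sigma,\sigma')}(e)| : \sigma,\sigma'\in\Omega^1_0(B_N,G),\ \mathcal C_{\mathcal G(\sigma,\sigma')}(e)\cap E\ne\emptyset\bigr\},$$ which depends on $N$. Put $\varphi_r(g)=e^{r\operatorname{Re}(\rho(g)-\rho(0))}$ and $$\theta_{\beta,\kappa}(h)=\frac{\sum_{g\in G}\rho(g)\varphi_\beta(g)^{12}\varphi_\kappa(g+h)^2}{\sum_{g\in G}\varphi_\beta(g)^{12}\varphi_\kappa(g+h)^2},\quad \alpha_0(r)=\sum_{g\ne0}\varphi_r(g)^2,\quad \alpha_1(r)=\max_{g\neq0}\varphi_r(g)^2,\quad \alpha_2=\alpha_0(\beta)\alpha_0(\kappa)^{1/6},$$ $$\alpha_3=|1-\theta_{\beta,\kappa}(0)|,\quad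 \alpha_4=\max_{g\in G}|\theta_{\beta,\kappa}(g)-\theta_{\beta,\kappa}(0)|,\quad \alpha_5=\min_{g_1,\dots,g_6\in G}\Bigl(1-\Bigl|\frac{\sum_{g}\rho(g)\prod_{k=1}^6\varphi_\beta(g+g_k)^2\,\varphi_\kappa(g)^2}{\sum_{g}\prod_{k=1}^6\varphi_\beta(g+g_k)^2\,\varphi_\kappa(g)^2}\Bigr|\Bigr).$$ With $a=\alpha_0(\kappa)$ and $b=\alpha_1(\beta)/\alpha_0(\beta)$, put $$K=\frac{18^{-3}}{1-18^2(2+a)a},\quad K'=18^2(2+a),\quad K''=4\Bigl(18^2+\frac{18a}{1-18^2a}\Bigr)b^6,\quad K_3=18^4\,\frac{18^{-3}+18^{-1}}{1-18^2a},$$ $$K_4=18^{10}K\bigl(2^8a^{-1}((1+a/2)^8-1)+2^8K'\bigr),\quad K_5=2\cdot18^8(18^2+1)(2+a)^7K,\quad K_6=\frac{18^{13}}{1-18^2a},\quad K_7=6K''.$$ **Theorem.** Let $\beta,\kappa\ge0$ satisfy $18^2\alpha_0(\kappa)(2+\alpha_0(\kappa))<1$, let $\gamma\neq0$ be a path, and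 let $\gamma_0$ be any path with $\partial\gamma_0=-\partial\gamma$. Then the infinite volume limits $$\langle L_\gamma\rangle_{\beta,\kappa,\infty},\qquad \Theta_{\beta,\kappa}(\gamma)=\Bigl\langle\prod_{e\in\gamma}\theta_{\beta,\kappa}(\sigma(e)-\phi(\partial e))\Bigr\rangle_{\infty,\kappa,\infty},\qquad H_\kappa(\gamma)=\langle L_\gamma\rangle_{\infty,\kappa,\infty}$$ exist, and for all sufficiently large $N$ $$\bigl|\langle L_\gamma\rangle_{\beta,\kappa,\infty}-\Theta_{\beta,\kappa}(\gamma)H_\kappa(\gamma)\bigr|\le\mathbf K\Bigl(\alpha_2+\sqrt{\tfrac{\max(1,|\operatorname{supp}\gamma_c|)}{|\operatorname{supp}\gamma|}}\Bigr)^{\mathbf K'},$$ where, with $s=|\operatorname{supp}\gamma|$ and $s'=|\operatorname{supp}(\gamma-\gamma_c)|$, $\mathbf K'=s'/(s'+2s)$ and, with $\operatorname{dist}_0$ computed in $B_N$, $$\begin{aligned}\mathbf K=2^{2s/(2s+s')}\Bigl[&\mathbb 1(\partial\gamma\ne0)\,2K(K')^8a^7\sum_{e\in\gamma}\bigl(1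8^2(2+a)a\bigr)^{\max(0,\operatorname{dist}_0(e,\operatorname{supp}\gamma_0)-8)}\,b^6\frac{\alpha_2^6}{\alpha_5}+K''\frac{\alpha_2^6}{\alpha_5}+K(K')^2a^{5/6}b^7\frac{\alpha_2^6}{\alpha_5}\\&+\frac{K_3\alpha_2^5}{2}b^{12}\frac{\alpha_2^6}{\alpha_5}+\sqrt{\frac{2K_5a^5\alpha_4\max(a,\alpha_1(\beta)^6)}{\alpha_5}}\sqrt{b^6}\sqrt{\frac{\alpha_2^6}{\alpha_5}}+2\sqrt{\frac{2K_4a^8\alpha_4}{\alpha_5}}\sqrt{b^6}\sqrt{\frac{\alpha_2^6}{\alpha_5}}\\&+\sqrt{2K_7}\sqrt{\frac{\alpha_2^6}{\alpha_5}}\sqrt{\frac{\alpha_3}{\alpha_5}}+\sqrt{\frac{K_6a^8\alpha_4}{\alpha_5}}+\sqrt{\frac{\alpha_3}{\alpha_5}}\Bigr]^{\mathbf K'}.\end{aligned}$$ -/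

import Mathlib

open scoped BigOperators Topology

noncomputable section

namespace LatticeHiggs

/-! ### The cell complex of the lattice `ℤ⁴`

Every cell is represented by its positively oriented version. A `k`-form is determined by its
values on positively oriented cells, its value on the reversed cell being the negative. -/

/-- Points of `ℤ⁴`. -/
abbrev Vertex := Fin 4 → ℤ

/-- `(a, j)` is the positively oriented edge from `a` to `a + e_j`. -/
abbrev Edge := Vertex × Fin 4

/-- `(a, (i, j))` with `i < j` is the positively oriented plaquette spanned by `e_i`, `e_j` at
`a`. -/
abbrev Plaquette := Vertex × {d : Fin 4 × Fin 4 // d.1 < d.2}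

/-- The unit vector `e_j`. -/
def unit (j : Fin 4) : Vertex := Pi.single j 1

/-- The boundary `(a + e_j) - a` of an edge, a `0`-chain. -/
def edgeBoundary (e : Edge) : Vertex →₀ ℤ :=
  Finsupp.single (e.1 + unit e.2) 1 - Finsupp.single e.1 1

/-- The boundary of a `1`-chain. -/
def boundary (q : Edge →₀ ℤ) : Vertex →₀ ℤ :=
  q.sum fun e c => c • edgeBoundary e

/-- The oriented boundary of a plaquette, a `1`-chain. -/
def plaquetteBoundary (p : Plaquette) : Edge →₀ ℤ :=
  Finsupp.single (p.1, p.2.1.1) 1 + Finsupp.single (p.1 + unit p.2.1.1, p.2.1.2) 1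
    - Finsupp.single (p.1 + unit p.2.1.2, p.2.1.1) 1 - Finsupp.single (p.1, p.2.1.2) 1

/-- The vertices of the box `B_N = [-N, N]⁴ ∩ ℤ⁴`. -/
def boxVertices (N : ℕ) : Finset Vertex :=
  Finset.Icc (fun _ => -(N : ℤ)) (fun _ => (N : ℤ))

/-- The positively oriented edges with both endpoints in `B_N`. -/
def boxEdges (N : ℕ) : Finset Edge :=
  (boxVertices N ×ˢ Finset.univ).filter fun e => e.1 + unit e.2 ∈ boxVertices N

/-- The positively oriented plaquettes with all corners in `B_N`. -/
def boxPlaquettes (N : ℕ) : Finset Plaquette :=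
  (boxVertices N ×ˢ Finset.univ).filter fun p =>
    p.1 + unit p.2.1.1 ∈ boxVertices N ∧ p.1 + unit p.2.1.2 ∈ boxVertices N ∧
      p.1 + unit p.2.1.1 + unit p.2.1.2 ∈ boxVertices N

/-! ### Paths -/

/-- A `1`-chain with coefficients in `{-1, 0, 1}` and empty boundary. -/
def IsGeneralizedLoop (γ : Edge →₀ ℤ) : Prop :=
  (∀ e, γ e = -1 ∨ γ e = 0 ∨ γ e = 1) ∧ boundary γ = 0

/-- A `1`-chain with coefficients in `{-1, 0, 1}` and boundary `x₂ - x₁`. -/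
def IsOpenPath (γ : Edge →₀ ℤ) (x₁ x₂ : Vertex) : Prop :=
  (∀ e, γ e = -1 ∨ γ e = 0 ∨ γ e = 1) ∧
    boundary γ = Finsupp.single x₂ 1 - Finsupp.single x₁ 1

/-- A path is an open path or a generalized loop. -/
def IsPath (γ : Edge →₀ ℤ) : Prop :=
  IsGeneralizedLoop γ ∨ ∃ x₁ x₂, IsOpenPath γ x₁ x₂

/-- `e` is a corner edge of `γ`: some other edge of `γ` lies in a common plaquette with `e`. -/
def IsCornerEdge (γ : Edge →₀ ℤ) (e : Edge) : Prop :=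
  e ∈ γ.support ∧ ∃ e' ∈ γ.support, e' ≠ e ∧
    ∃ p : Plaquette, e ∈ (plaquetteBoundary p).support ∧ e' ∈ (plaquetteBoundary p).support

open Classical in
/-- The part `γ_c` of `γ` carried by its corner edges. -/
def cornerPart (γ : Edge →₀ ℤ) : Edge →₀ ℤ :=
  γ.filter (IsCornerEdge γ)

/-! ### Forms with values in `ℤ/n` -/

section Forms

variable {n : ℕ}

/-- The value `σ(q)` of a form on a chain. -/
def evalChain {α : Type} (σ : α → ZMod n) (q : α →₀ ℤ) : ZMod n :=
  q.sum fun a c => c • σ a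

/-- The exterior derivative `dσ(p) = σ(∂p)` of a `1`-form. -/
def curl (σ : Edge → ZMod n) (p : Plaquette) : ZMod n :=
  evalChain σ (plaquetteBoundary p)

/-- A form on a finite set of cells, seen as a form on all cells, equal to `0` elsewhere. -/
def extend {α : Type} [DecidableEq α] {s : Finset α} (f : s → ZMod n) (a : α) : ZMod n :=
  if h : a ∈ s then f ⟨a, h⟩ else 0

/-- The `1`-form `σ` is closed on `B_N`. -/
def IsClosedOn (N : ℕ) (σ : Edge → ZMod n) : Prop :=
  ∀ p ∈ boxPlaquettes N, curl σ p = 0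

/-! ### Clusters and the distance `dist₀` -/

/-- The cluster graph of two `1`-forms on `B_N`. Two distinct edges are adjacent if both lie in
the union of the supports and they lie in a common plaquette of `B_N`. Since an edge and its
reversal always belong to the same cluster, it is enough to use positively oriented edges. -/
def clusterGraph (N : ℕ) (σ σ' : boxEdges N → ZMod n) : SimpleGraph Edge where
  Adj e e' := e ≠ e' ∧
    (extend σ e ≠ 0 ∨ extend σ' e ≠ 0) ∧ (extend σ e' ≠ 0 ∨ extend σ' e' ≠ 0) ∧
    ∃ p ∈ boxPlaquettes N,
      e ∈ (plaquetteBoundary p).support ∧ e' ∈ (plaquetteBoundary p).support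
  symm := ⟨fun _ _ ⟨h, h₁, h₂, p, hp, h₃, h₄⟩ => ⟨h.symm, h₂, h₁, p, hp, h₄, h₃⟩⟩
  loopless := ⟨fun _ h => h.1 rfl⟩

/-- The cluster of `e`: all (positively oriented) edges connected to `e`. -/
def cluster (N : ℕ) (σ σ' : boxEdges N → ZMod n) (e : Edge) : Set Edge :=
  {e' | (clusterGraph N σ σ').Reachable e e'}

variable (n) in
/-- `dist₀(e, E)` in `B_N`: the least number of positively oriented edges (half the number of
oriented edges) in a cluster of `e` that meets `E`, over all pairs of closed `1`-forms. -/
def distZero (N : ℕ) (e : Edge) (E : Set Edge) : ℕ :=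
  sInf {k | ∃ σ σ' : boxEdges N → ZMod n, IsClosedOn N (extend σ) ∧ IsClosedOn N (extend σ') ∧
    (cluster N σ σ' e ∩ E).Nonempty ∧ k = (cluster N σ σ' e).ncard}

end Forms

section Model

variable {n : ℕ} (ρ : AddChar (ZMod n) Circle)

/-! ### The fixed length lattice Higgs model -/

/-- The action of the fixed length lattice Higgs model on `B_N`. The sums run over both
orientations of every plaquette and every edge, hence the action is a real number. -/
def action (N : ℕ) (β κ : ℝ) (σ : Edge → ZMod n) (φ : Vertex → ZMod n) : ℂ :=
  -(β : ℂ) * ∑ p ∈ boxPlaquettes N, ((ρ (curl σ p) : ℂ) + (ρ (-curl σ p) : ℂ))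
    - (κ : ℂ) * ∑ e ∈ boxEdges N,
      ((ρ (σ e - evalChain φ (edgeBoundary e)) : ℂ) +
        (ρ (-(σ e - evalChain φ (edgeBoundary e))) : ℂ))

/-- Unnormalised Gibbs weight at `0 ≤ β < ∞`. -/
def weight (N : ℕ) (β κ : ℝ) (σ : Edge → ZMod n) (φ : Vertex → ZMod n) : ℝ :=
  Real.exp (-(action ρ N β κ σ φ).re)

open Classical in
/-- Unnormalised Gibbs weight at `β = ∞`: the gauge field is closed, and only the interaction
term of the action remains. -/
def weightInfty (N : ℕ) (κ : ℝ) (σ : Edge → ZMod n) (φ : Vertex → ZMod n) : ℝ :=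
  if IsClosedOn N σ then Real.exp (-(action ρ N 0 κ σ φ).re) else 0

/-- The expectation of `f(σ, φ)` under the probability measure on the gauge and Higgs field
configurations on `B_N` that is proportional to `w`. -/
def expectation [NeZero n] (N : ℕ) (w : (Edge → ZMod n) → (Vertex → ZMod n) → ℝ)
    (f : (Edge → ZMod n) → (Vertex → ZMod n) → ℂ) : ℂ :=
  (∑ ω : (boxEdges N → ZMod n) × (boxVertices N → ZMod n),
      (w (extend ω.1) (extend ω.2) : ℂ) * f (extend ω.1) (extend ω.2)) /
    ∑ ω : (boxEdges N → ZMod n) × (boxVertices N → ZMod n),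
      (w (extend ω.1) (extend ω.2) : ℂ)

/-- The infinite volume expectation `⟨f(σ, φ)⟩_{β,κ,∞}` exists and equals `a`. -/
def HasInfiniteVolumeLimit [NeZero n] (β κ : ℝ)
    (f : (Edge → ZMod n) → (Vertex → ZMod n) → ℂ) (a : ℂ) : Prop :=
  Filter.Tendsto (fun N : ℕ => expectation N (weight ρ N β κ) f) Filter.atTop (𝓝 a)

/-- The infinite volume expectation `⟨f(σ, φ)⟩_{∞,κ,∞}` exists and equals `a`. -/
def HasInfiniteVolumeLimitInfty [NeZero n] (κ : ℝ)
    (f : (Edge → ZMod n) → (Vertex → ZMod n) → ℂ) (a : ℂ) : Prop :=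
  Filter.Tendsto (fun N : ℕ => expectation N (weightInfty ρ N κ) f) Filter.atTop (𝓝 a)

/-- The Wilson line observable `L_γ(σ, φ) = ρ(σ(γ) - φ(∂γ))`. -/
def wilsonLine (γ : Edge →₀ ℤ) (σ : Edge → ZMod n) (φ : Vertex → ZMod n) : ℂ :=
  (ρ (evalChain σ γ - evalChain φ (boundary γ)) : ℂ)

/-! ### The functions `φ_r`, `θ_{β,κ}` and `α_0, …, α_5` -/

/-- `φ_r(g) = exp(r Re(ρ(g) - ρ(0)))`. -/
def varphi (r : ℝ) (g : ZMod n) : ℝ :=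
  Real.exp (r * ((ρ g : ℂ) - (ρ 0 : ℂ)).re)

variable [NeZero n]

/-- The function `θ_{β,κ}` on the structure group. -/
def theta (β κ : ℝ) (h : ZMod n) : ℂ :=
  (∑ g : ZMod n, (ρ g : ℂ) * ((varphi ρ β g ^ 12 * varphi ρ κ (g + h) ^ 2 : ℝ) : ℂ)) /
    ∑ g : ZMod n, ((varphi ρ β g ^ 12 * varphi ρ κ (g + h) ^ 2 : ℝ) : ℂ)

/-- The observable `∏_{e ∈ γ} θ_{β,κ}(σ(e) - φ(∂e))`, each edge being taken with the orientation
it has in `γ`. -/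
def thetaProd (β κ : ℝ) (γ : Edge →₀ ℤ) (σ : Edge → ZMod n) (φ : Vertex → ZMod n) : ℂ :=
  ∏ e ∈ γ.support, theta ρ β κ (γ e • (σ e - evalChain φ (edgeBoundary e)))

def alpha0 (r : ℝ) : ℝ := ∑ g ∈ Finset.univ.erase (0 : ZMod n), varphi ρ r g ^ 2

/-- A maximum over the non-zero group elements. -/
def alpha1 (r : ℝ) : ℝ := ⨆ g : {g : ZMod n // g ≠ 0}, varphi ρ r g.1 ^ 2

def alpha2 (β κ : ℝ) : ℝ := alpha0 ρ β * alpha0 ρ κ ^ (1 / 6 : ℝ)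

def alpha3 (β κ : ℝ) : ℝ := ‖1 - theta ρ β κ 0‖

/-- A maximum over the finite group. -/
def alpha4 (β κ : ℝ) : ℝ := ⨆ g : ZMod n, ‖theta ρ β κ g - theta ρ β κ 0‖

/-- A minimum over the finitely many `6`-tuples of group elements. -/
def alpha5 (β κ : ℝ) : ℝ :=
  ⨅ v : Fin 6 → ZMod n,
    (1 - ‖(∑ g : ZMod n,
          (ρ g : ℂ) * (((∏ k, varphi ρ β (g + v k) ^ 2) * varphi ρ κ g ^ 2 : ℝ) : ℂ)) /
        ∑ g : ZMod n, (((∏ k, varphi ρ β (g + v k) ^ 2) * varphi ρ κ g ^ 2 : ℝ) : ℂ)‖)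

/-! ### The constants -/

/-- `K`. -/
def constK (κ : ℝ) : ℝ :=
  ((18 : ℝ) ^ 3)⁻¹ * (1 - 18 ^ 2 * (2 + alpha0 ρ κ) * alpha0 ρ κ)⁻¹

/-- `K'`. -/
def constKp (κ : ℝ) : ℝ := 18 ^ 2 * (2 + alpha0 ρ κ)

/-- `K''`. -/
def constKpp (β κ : ℝ) : ℝ :=
  4 * (18 ^ 2 + 18 * alpha0 ρ κ * (1 - 18 ^ 2 * alpha0 ρ κ)⁻¹) *
    (alpha1 ρ β ^ 6 / alpha0 ρ β ^ 6)

/-- `K'''`. -/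
def constKppp (κ : ℝ) : ℝ :=
  (((18 : ℝ) ^ 3)⁻¹ + (18 : ℝ)⁻¹) * (1 - 18 ^ 2 * alpha0 ρ κ)⁻¹

def constK3 (κ : ℝ) : ℝ := 18 ^ 4 * constKppp ρ κ

def constK4 (κ : ℝ) : ℝ :=
  constK ρ κ * 18 ^ 10 *
    (2 ^ 8 * (alpha0 ρ κ)⁻¹ * ((1 + alpha0 ρ κ / 2) ^ 8 - 1) + 2 ^ 8 * constKp ρ κ)

def constK5 (κ : ℝ) : ℝ :=
  constK ρ κ * 2 * 18 ^ 8 * (18 ^ 2 + 1) * (2 + alpha0 ρ κ) ^ 7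

def constK6 (κ : ℝ) : ℝ := 18 ^ 13 * (1 - 18 ^ 2 * alpha0 ρ κ)⁻¹

def constK7 (β κ : ℝ) : ℝ := 6 * constKpp ρ β κ

end Model

section Bounds

variable {n : ℕ} [NeZero n] (ρ : AddChar (ZMod n) Circle)

/-- `|supp q|`, as a real number. -/
def suppCard (q : Edge →₀ ℤ) : ℝ := (q.support.card : ℝ)

/-- The exponent `|supp(γ - γ_c)| / (|supp(γ - γ_c)| + 2|supp γ|)`. -/
def boldKp (γ : Edge →₀ ℤ) : ℝ :=
  suppCard (γ - cornerPart γ) / (suppCard (γ - cornerPart γ) + 2 * suppCard γ)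

open Classical in
/-- The constant in front of the error term, with `dist₀` computed in `B_N`. The natural number
subtraction `d - 8` is `max(0, d - 8)`. -/
def boldK (N : ℕ) (β κ : ℝ) (γ γ₀ : Edge →₀ ℤ) : ℝ :=
  (2 : ℝ) ^ (2 * suppCard γ / (2 * suppCard γ + suppCard (γ - cornerPart γ))) *
  ((if boundary γ ≠ 0 then
      2 * constK ρ κ * constKp ρ κ ^ 8 * alpha0 ρ κ ^ 7 *
        (∑ e ∈ γ.support,
          (18 ^ 2 * (2 + alpha0 ρ κ) * alpha0 ρ κ) ^ (distZero n N e γ₀.support - 8)) *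
        (alpha1 ρ β / alpha0 ρ β) ^ 6 * (alpha2 ρ β κ ^ 6 / alpha5 ρ β κ)
    else 0)
    + constKpp ρ β κ * (alpha2 ρ β κ ^ 6 / alpha5 ρ β κ)
    + constK ρ κ * constKp ρ κ ^ 2 * alpha0 ρ κ ^ (5 / 6 : ℝ) *
        (alpha1 ρ β / alpha0 ρ β) ^ 7 * (alpha2 ρ β κ ^ 6 / alpha5 ρ β κ)
    + constK3 ρ κ * alpha2 ρ β κ ^ 5 / 2 *
        (alpha1 ρ β / alpha0 ρ β) ^ 12 * (alpha2 ρ β κ ^ 6 / alpha5 ρ β κ)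
    + √(2 * constK5 ρ κ * alpha0 ρ κ ^ 5 * alpha4 ρ β κ *
          max (alpha0 ρ κ) (alpha1 ρ β ^ 6) / alpha5 ρ β κ) *
        √((alpha1 ρ β / alpha0 ρ β) ^ 6) * √(alpha2 ρ β κ ^ 6 / alpha5 ρ β κ)
    + 2 * √(2 * constK4 ρ κ * alpha0 ρ κ ^ 8 * alpha4 ρ β κ / alpha5 ρ β κ) *
        √((alpha1 ρ β / alpha0 ρ β) ^ 6) * √(alpha2 ρ β κ ^ 6 / alpha5 ρ β κ)
    + √(2 * constK7 ρ β κ) * √(alpha2 ρ β κ ^ 6 / alpha5 ρ β κ) *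
        √(alpha3 ρ β κ / alpha5 ρ β κ)
    + √(constK6 ρ κ * alpha0 ρ κ ^ 8 * alpha4 ρ β κ / alpha5 ρ β κ)
    + √(alpha3 ρ β κ / alpha5 ρ β κ)) ^ boldKp γ

end Bounds

end LatticeHiggs

end

open LatticeHiggs

/-!
Summing out `φ` (unitary gauge, `expectation_eq_avg`) leaves a single `ℤ/n`-valued 1-form, with
weight `φ_κ²` per edge and `φ_β²` of the curl per plaquette (`wt`, `avg`). Let `a = α₀(κ)`,
`α = α₁(β)`, and let `δ` be the base of the power in the claim. Two bounds on `‖L - Θ * H‖` are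
interpolated (`interpolate`).

The first is `2 * exp (-α₅ * s')`. Distinct edges of `γ` that are not corner edges lie in no common
plaquette (`separated_straightEdges`), so they are independent given all other edges, and by
definition of `α₅` the conditional mean of the phase of each has norm at most `1 - α₅`
(`PhaseBound`, `norm_sum_wt_le`).

The second is proportional to `s * δ` (`norm_avg_sub_mul_le_numeric`). Two terms of the bracket in
`boldK` already dominate it (`le_bracket`): both carry a factor `1 / α₅`, and the factor `s * α₅`
that is then left over is absorbed by the exponential (`le_mul_exp`). It is needed only when the
bracket times `δ` is less than 2, and this forces `δ ≤ 1 / 324`.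

For the second bound, call an edge pinned if its six plaquettes become flat when the edge takes one
of a set `H` of admissible values. Fluctuations of the edges in the separated family `T` about their
pinned values can be summed out one by one. This changes the weight of the value `h` by the factor
`gain h` and replaces the phase of the edge by the mean `θ(h)`. Four comparisons follow:
the model with its tilted version, in which all edges of `T` have their pinned values
(`norm_avg_wt_sub_tilt_le`); the tilted model with the model of flat configurations
(`norm_avg_tilt_sub_le`); the mean of the product of the phases and the means with the product of
their means (`norm_avg_phase_mean_sub_le`); and the normalised means with the product of `θ` over
all of `γ` (`norm_avg_mean_sub_le`). If `a ≤ δ`, only the value zero is admitted; otherwise every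
value is, and then `α ≤ a ^ (5 / 6)`. When `α` is small, `α₀(β)` is comparable to it (`alpha0_le`).

All comparisons of two models, and the limits, rest on one device in place of a cluster expansion.
The difference of two averages is a sum over pairs of configurations, whose weights factorise over
the connected components of the joint support. Removing one site at a time bounds it by a sum over
single connected sets `C` of the total weight of the pairs that live on `C`, each counted with the
difference of the two observables (`norm_polyZ_sub_le`, `norm_avg_sub_le`). Many `C` drop out by
symmetry under exchange of the pair, and connected sets are counted by comparison with percolation
(`sum_isConn_le`), as an edge has 18 neighbours. The weights of the remaining `C` are small for
geometric reasons: a form with finite support that is not closed has curl on at least six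
plaquettes, with equality only around a single edge (`curl_support`); a non-zero closed form has at
least seven edges (`seven_le_card`); and if it does not integrate to zero along a path, it surrounds
an endpoint of the path (`exists_ray`). In the infinite volume limit the sets `C` well inside the
box drop out, so that the averages form Cauchy sequences (`exists_limit`).
-/

set_option linter.unusedSectionVars false

noncomputable section

namespace LatticeHiggs

open Finset (univ range mem_filter sum_congr sum_le_sum mul_sum mem_univ sum_nonneg mem_erase
  prod_congr prod_nonneg mem_powerset prod_mul_distrib mem_product sum_add_distrib prod_const
  sum_mul mem_sdiff)
open Function (update update_of_ne)

/-! ### Connected sets and polymer sums -/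

section Polymer

variable {E : Type*} [DecidableEq E] (nb : E → Finset E)

/-- `u` is reached from `v` by a path that stays in `U` after its first vertex. -/
def Reach (U : Finset E) (v u : E) : Prop :=
  Relation.ReflTransGen (fun a b => b ∈ nb a ∧ b ∈ U) v u

open Classical in
/-- The connected component of `v` in `U`. -/
def comp (U : Finset E) (v : E) : Finset E := {u ∈ U | Reach nb U v u}

/-- `C` is connected and contains `v`. -/
def IsConn (v : E) (C : Finset E) : Prop := v ∈ C ∧ ∀ u ∈ C, Reach nb C v u

/-- `C` together with all neighbours of its points. -/
def hull (C : Finset E) : Finset E := C ∪ C.biUnion nb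

variable {nb}

lemma Reach.mono {U W : Finset E} (h : U ⊆ W) {v u : E} (hr : Reach nb U v u) :
    Reach nb W v u := by
  induction hr with
  | refl => exact .refl
  | tail _ hbc ih => exact .tail ih ⟨hbc.1, h hbc.2⟩

lemma Reach.symm (hs : ∀ a b, b ∈ nb a → a ∈ nb b) {U : Finset E} {v u : E} (hv : v ∈ U)
    (hr : Reach nb U v u) : Reach nb U u v := by
  have key : u ∈ U ∧ Reach nb U u v := by
    induction hr with
    | refl => exact ⟨hv, .refl⟩
    | tail _ hbc ih => exact ⟨hbc.2, .head ⟨hs _ _ hbc.1, ih.1⟩ ih.2⟩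
  exact key.2

lemma comp_subset (U : Finset E) (v : E) : comp nb U v ⊆ U := by
  classical exact Finset.filter_subset _ _

lemma isConn_comp {U : Finset E} {v : E} (hv : v ∈ U) : IsConn nb v (comp nb U v) := by
  classical
  have hvc : v ∈ comp nb U v := by
    simp only [comp, mem_filter]; exact ⟨hv, .refl⟩
  refine ⟨hvc, fun u hu => ?_⟩
  have hu' : Reach nb U v u := (mem_filter.1 hu).2
  clear hu
  induction hu' with
  | refl => exact .refl
  | tail hab hbc ih =>
    refine .tail ih ⟨hbc.1, ?_⟩
    simp only [comp, mem_filter]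
    exact ⟨hbc.2, .tail hab hbc⟩

lemma hull_comp_disjoint (U : Finset E) (v : E) {u : E} (hu : u ∈ U)
    (huc : u ∉ comp nb U v) : u ∉ hull nb (comp nb U v) := by
  classical
  simp only [hull, Finset.mem_union, Finset.mem_biUnion, not_or, not_exists, not_and]
  refine ⟨huc, fun a ha hua => huc ?_⟩
  simp only [comp, mem_filter] at ha ⊢
  exact ⟨hu, .tail ha.2 ⟨hua, hu⟩⟩

/-- If `U` does not touch the connected set `C`, then `C` is a component of `C ∪ U`. -/
lemma IsConn.comp_union {v : E} {C U : Finset E} (hC : IsConn nb v C)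
    (hU : Disjoint U (hull nb C)) : comp nb (C ∪ U) v = C := by
  classical
  ext u
  simp only [comp, mem_filter, Finset.mem_union]
  constructor
  · rintro ⟨-, hr⟩
    induction hr with
    | refl => exact hC.1
    | tail _ hbc ih =>
      rcases Finset.mem_union.1 hbc.2 with h | h
      · exact h
      · exfalso
        refine Finset.disjoint_left.1 hU h ?_
        simp only [hull, Finset.mem_union, Finset.mem_biUnion]
        exact Or.inr ⟨_, ih, hbc.1⟩
  · intro hu
    exact ⟨Or.inl hu, (hC.2 u hu).mono Finset.subset_union_left⟩

/-- Any two points of a connected set can serve as its root. -/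
lemma IsConn.reroot (hs : ∀ a b, b ∈ nb a → a ∈ nb b) {v u : E} {C : Finset E}
    (hC : IsConn nb v C) (hu : u ∈ C) : IsConn nb u C :=
  ⟨hu, fun w hw => Relation.ReflTransGen.trans ((hC.2 u hu).symm hs hC.1) (hC.2 w hw)⟩

variable (nb)

open Classical in
/-- Summation over the sets containing `v`, organised by the component of `v`. -/
theorem sum_peel {M : Type*} [AddCommMonoid M] (W : Finset E) (v : E)
    (g : Finset E → M) :
    ∑ U ∈ W.powerset with v ∈ U, g U =
      ∑ C ∈ W.powerset with IsConn nb v C, ∑ U ∈ (W \ hull nb C).powerset, g (C ∪ U) := by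
  rw [Finset.sum_sigma']
  refine Finset.sum_bij' (fun U _ => (⟨comp nb U v, U \ comp nb U v⟩ : Sigma fun _ => Finset E))
    (fun x _ => x.1 ∪ x.2) ?_ ?_ ?_ ?_ ?_
  · intro U hU
    simp only [mem_filter, mem_powerset] at hU
    simp only [Finset.mem_sigma, mem_filter, mem_powerset]
    refine ⟨⟨(comp_subset U v).trans hU.1, isConn_comp hU.2⟩, fun u hu => ?_⟩
    rw [mem_sdiff] at hu ⊢
    exact ⟨hU.1 hu.1, hull_comp_disjoint U v hu.1 hu.2⟩
  · rintro ⟨C, U⟩ hx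
    simp only [Finset.mem_sigma, mem_filter, mem_powerset] at hx
    simp only [mem_filter, mem_powerset]
    exact ⟨Finset.union_subset hx.1.1 (hx.2.trans Finset.sdiff_subset),
      Finset.mem_union_left _ hx.1.2.1⟩
  · intro U _
    exact Finset.union_sdiff_of_subset (comp_subset U v)
  · rintro ⟨C, U⟩ hx
    simp only [Finset.mem_sigma, mem_filter, mem_powerset] at hx
    have hd : Disjoint U (hull nb C) := Finset.disjoint_of_subset_left hx.2 Finset.sdiff_disjoint
    have hd' : Disjoint U C := Finset.disjoint_of_subset_right Finset.subset_union_left hd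
    simp only [hx.1.2.comp_union hd]
    congr 1
    rw [Finset.union_sdiff_left]
    exact Finset.sdiff_eq_self_of_disjoint hd'
  · intro U _
    simp only [Finset.union_sdiff_of_subset (comp_subset U v)]

/-- The polymer partition function of a set function `φ`. -/
def polyZ {R : Type*} [AddCommMonoid R] (φ : Finset E → R) (W : Finset E) : R :=
  ∑ U ∈ W.powerset, φ U

/-- The set function factorises over sets that do not touch each other. -/
def SetSep {R : Type*} [CommSemiring R] (φ : Finset E → R) : Prop :=
  φ ∅ = 1 ∧ ∀ C U, Disjoint U (hull nb C) → φ (C ∪ U) = φ C * φ U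

variable {nb}

open Classical in
/-- The partition function, organised by the component `C` of `v`: the remaining polymers avoid `C`
and its neighbours. -/
lemma polyZ_peel {R : Type*} [CommSemiring R] {φ : Finset E → R} (hφ : SetSep nb φ)
    (W : Finset E) (v : E) :
    polyZ φ W = polyZ φ (W.erase v) +
      ∑ C ∈ W.powerset with IsConn nb v C, φ C * polyZ φ (W \ hull nb C) := by
  have h1 : polyZ φ W = ∑ U ∈ W.powerset with v ∉ U, φ U + ∑ U ∈ W.powerset with v ∈ U, φ U := by
    rw [polyZ, add_comm, Finset.sum_filter_add_sum_filter_not]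
  rw [h1, sum_peel nb W v]
  congr 1
  · rw [polyZ]
    refine sum_congr ?_ fun _ _ => rfl
    ext U
    simp only [mem_filter, mem_powerset, Finset.subset_erase]
  · refine sum_congr rfl fun C _ => ?_
    rw [polyZ, mul_sum]
    refine sum_congr rfl fun U hU => hφ.2 C U ?_
    exact Finset.disjoint_of_subset_left (mem_powerset.1 hU) Finset.sdiff_disjoint

lemma polyZ_mono {φ : Finset E → ℝ} (h0 : ∀ U, 0 ≤ φ U) {W W' : Finset E} (h : W' ⊆ W) :
    polyZ φ W' ≤ polyZ φ W :=
  Finset.sum_le_sum_of_subset_of_nonneg (Finset.powerset_mono.2 h) fun _ _ _ => h0 _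

lemma norm_polyZ_le {φ : Finset E → ℝ} {ψ : Finset E → ℂ} (h : ∀ U, ‖ψ U‖ ≤ φ U)
    (W : Finset E) : ‖polyZ ψ W‖ ≤ polyZ φ W :=
  (norm_sum_le _ _).trans (sum_le_sum fun U _ => h U)

open Classical in
/-- Two polymer models with a common majorant differ by at most the total difference of their
activities. The proof removes one site at a time. -/
theorem norm_polyZ_sub_le {φ : Finset E → ℝ} {ψ₁ ψ₂ : Finset E → ℂ} (hφ : SetSep nb φ)
    (h₁ : SetSep nb ψ₁) (h₂ : SetSep nb ψ₂) (b₁ : ∀ U, ‖ψ₁ U‖ ≤ φ U) (b₂ : ∀ U, ‖ψ₂ U‖ ≤ φ U)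
    (W : Finset E) :
    ‖polyZ ψ₁ W - polyZ ψ₂ W‖ ≤
      polyZ φ W * ∑ C ∈ W.powerset with ∃ v, IsConn nb v C, ‖ψ₁ C - ψ₂ C‖ := by
  have h0 : ∀ U, 0 ≤ φ U := fun U => (norm_nonneg _).trans (b₁ U)
  have hZ0 : ∀ W, 0 ≤ polyZ φ W := fun W => sum_nonneg fun U _ => h0 U
  induction W using Finset.strongInduction with
  | H W ih =>
    rcases W.eq_empty_or_nonempty with rfl | ⟨v, hv⟩
    · simp only [polyZ, Finset.powerset_empty, Finset.sum_singleton, h₁.1, h₂.1, sub_self,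
        norm_zero]
      exact mul_nonneg (h0 _) (sum_nonneg fun _ _ => norm_nonneg _)
    set D : Finset E → ℝ := fun W => ∑ C ∈ W.powerset with ∃ v, IsConn nb v C, ‖ψ₁ C - ψ₂ C‖
      with hD
    have hDmono : ∀ {W' : Finset E}, W' ⊆ W.erase v → D W' ≤ D (W.erase v) := by
      intro W' h
      refine Finset.sum_le_sum_of_subset_of_nonneg ?_ fun _ _ _ => norm_nonneg _
      exact Finset.filter_subset_filter _ (Finset.powerset_mono.2 h)
    have hDsplit : D (W.erase v) + ∑ C ∈ W.powerset with IsConn nb v C, ‖ψ₁ C - ψ₂ C‖ ≤ D W := by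
      rw [hD, ← Finset.sum_union]
      · refine Finset.sum_le_sum_of_subset_of_nonneg ?_ fun _ _ _ => norm_nonneg _
        intro C hC
        simp only [Finset.mem_union, mem_filter, mem_powerset] at hC ⊢
        rcases hC with ⟨h, h'⟩ | ⟨h, h'⟩
        · exact ⟨h.trans (Finset.erase_subset _ _), h'⟩
        · exact ⟨h, v, h'⟩
      · rw [Finset.disjoint_left]
        intro C hC hC'
        simp only [mem_filter, mem_powerset] at hC hC'
        exact Finset.notMem_erase v W (hC.1 hC'.2.1)
    have hsub : ∀ C, IsConn nb v C → W \ hull nb C ⊆ W.erase v := by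
      intro C hC u hu
      rw [mem_sdiff] at hu
      rw [mem_erase]
      refine ⟨?_, hu.1⟩
      rintro rfl
      exact hu.2 (Finset.mem_union_left _ hC.1)
    have hss : W.erase v ⊂ W := Finset.erase_ssubset hv
    have hD0 : 0 ≤ D (W.erase v) := sum_nonneg fun _ _ => norm_nonneg _
    -- The two sums agree up to the component `C` of `v`, where either the activity of `C` or that
    -- of the rest differs.
    rw [polyZ_peel h₁ W v, polyZ_peel h₂ W v, add_sub_add_comm, ← Finset.sum_sub_distrib]
    calc _ ≤ polyZ φ (W.erase v) * D (W.erase v) +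
          ∑ C ∈ W.powerset with IsConn nb v C,
            (‖ψ₁ C - ψ₂ C‖ * polyZ φ W + φ C * polyZ φ (W \ hull nb C) * D (W.erase v)) := by
          refine (norm_add_le _ _).trans (add_le_add (ih _ hss) ((norm_sum_le _ _).trans
            (sum_le_sum fun C hC => ?_)))
          have hC' := (mem_filter.1 hC).2
          have e : ψ₁ C * polyZ ψ₁ (W \ hull nb C) - ψ₂ C * polyZ ψ₂ (W \ hull nb C) =
            (ψ₁ C - ψ₂ C) * polyZ ψ₁ (W \ hull nb C) +
              ψ₂ C * (polyZ ψ₁ (W \ hull nb C) - polyZ ψ₂ (W \ hull nb C)) := by ring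
          rw [e]
          refine (norm_add_le _ _).trans (add_le_add ?_ ?_)
          · rw [norm_mul]
            exact mul_le_mul_of_nonneg_left ((norm_polyZ_le b₁ _).trans
              (polyZ_mono h0 Finset.sdiff_subset)) (norm_nonneg _)
          · rw [norm_mul, mul_assoc]
            refine mul_le_mul (b₂ C) ?_ (norm_nonneg _) (h0 _)
            refine (ih _ ((hsub C hC').trans_ssubset hss)).trans ?_
            exact mul_le_mul_of_nonneg_left (hDmono (hsub C hC')) (hZ0 _)
      -- The factors in front of `D (W.erase v)` are the peeled form of `polyZ φ W`.
      _ = polyZ φ W * (D (W.erase v) + ∑ C ∈ W.powerset with IsConn nb v C, ‖ψ₁ C - ψ₂ C‖) := by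
          rw [sum_add_distrib, ← sum_mul, ← sum_mul]
          have e := polyZ_peel hφ W v
          linear_combination -D (W.erase v) * e
      _ ≤ _ := mul_le_mul_of_nonneg_left hDsplit (hZ0 _)

end Polymer

section Count

variable {E : Type*} [DecidableEq E] {nb : E → Finset E}

open Classical in
/-- Connected sets containing a given point are counted by comparing with Bernoulli percolation:
the events that the open cluster of `v` is `C` are disjoint. -/
theorem sum_isConn_le (hcard : ∀ e, (nb e).card ≤ 18) {W : Finset E} {v : E} :
    ∑ C ∈ W.powerset with IsConn nb v C, (1 / 51 : ℝ) ^ C.card ≤ 1 / 19 := by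
  by_cases hv : v ∈ W
  swap
  · rw [Finset.sum_eq_zero]
    · norm_num
    · intro C hC
      simp only [mem_filter, mem_powerset] at hC
      exact absurd (hC.1 hC.2.1) hv
  -- The odds `t` of percolation with density `1/19`; the sum of `t ^ #U` over all `U` normalises
  -- it.
  set t : ℝ := 1 / 18 with ht
  have hpow : ∀ S : Finset E, ∑ U ∈ S.powerset, t ^ U.card = (1 + t) ^ S.card := by
    intro S
    have := Finset.sum_pow_mul_eq_add_pow t 1 S
    simpa [add_comm] using this
  have h1 : ∑ U ∈ W.powerset with v ∈ U, t ^ U.card = t * (1 + t) ^ (W.card - 1) := by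
    have e : (1 + t) ^ W.card = ∑ U ∈ W.powerset with v ∈ U, t ^ U.card +
        (1 + t) ^ (W.erase v).card := by
      rw [← hpow, ← hpow, ← Finset.sum_filter_add_sum_filter_not _ (fun U => v ∈ U)]
      congr 1
      refine sum_congr ?_ fun _ _ => rfl
      ext U
      simp only [mem_filter, mem_powerset, Finset.subset_erase]
    rw [Finset.card_erase_of_mem hv] at e
    have hc : W.card = W.card - 1 + 1 := by
      have := Finset.card_pos.2 ⟨v, hv⟩; omega
    rw [hc, pow_succ] at e
    rw [Nat.add_sub_cancel] at e
    linarith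
  rw [sum_peel nb W v] at h1
  have hhull : ∀ C : Finset E, (hull nb C).card ≤ 19 * C.card := by
    intro C
    refine (Finset.card_union_le _ _).trans ?_
    have : (C.biUnion nb).card ≤ C.card * 18 := Finset.card_biUnion_le_card_mul _ _ _ fun e _ =>
      hcard e
    omega
  -- The open cluster of `v` is `C` if `C` is open and the other points of `hull nb C` are closed.
  -- As `hull nb C` has at most `19 * #C` points, this has probability at least `(1/51) ^ #C`,
  -- because `(1 + t) ^ 19 / 51 ≤ t`.
  have h2 : ∀ C ∈ W.powerset.filter (IsConn nb v),
      (1 / 51 : ℝ) ^ C.card * (1 + t) ^ W.card ≤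
        ∑ U ∈ (W \ hull nb C).powerset, t ^ (C ∪ U).card := by
    intro C hC
    have hsum : ∑ U ∈ (W \ hull nb C).powerset, t ^ (C ∪ U).card =
        t ^ C.card * (1 + t) ^ (W \ hull nb C).card := by
      rw [← hpow, mul_sum]
      refine sum_congr rfl fun U hU => ?_
      rw [Finset.card_union_of_disjoint, pow_add]
      refine Finset.disjoint_of_subset_left Finset.subset_union_left
        (Finset.disjoint_of_subset_right (mem_powerset.1 hU) Finset.disjoint_sdiff)
    rw [hsum]
    have hcd : W.card ≤ 19 * C.card + (W \ hull nb C).card := by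
      have := Finset.le_card_sdiff (hull nb C) W
      have := hhull C
      omega
    calc (1 / 51 : ℝ) ^ C.card * (1 + t) ^ W.card
        ≤ (1 / 51 : ℝ) ^ C.card * (1 + t) ^ (19 * C.card + (W \ hull nb C).card) := by
          refine mul_le_mul_of_nonneg_left (pow_le_pow_right₀ (by norm_num [ht]) hcd) (by positivity)
      _ = (1 / 51 * (1 + t) ^ 19 : ℝ) ^ C.card * (1 + t) ^ (W \ hull nb C).card := by
          rw [pow_add, mul_pow, pow_mul]; ring
      _ ≤ _ := by
          refine mul_le_mul_of_nonneg_right (pow_le_pow_left₀ (by positivity) ?_ _) (by positivity)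
          rw [ht]; norm_num
  have h3 := sum_le_sum h2
  rw [h1, ← sum_mul] at h3
  have hc : W.card = W.card - 1 + 1 := by
    have := Finset.card_pos.2 ⟨v, hv⟩; omega
  rw [hc, pow_succ, Nat.add_sub_cancel, ← mul_assoc, mul_right_comm] at h3
  have hpos : 0 < (1 + t) ^ (W.card - 1) := by positivity
  -- The events are disjoint and contained in the event that `v` is open, of probability `1/19`.
  have h4 := le_of_mul_le_mul_right h3 hpos
  rw [ht] at h4
  linarith

open Classical in
/-- Exponential decay of the weight of large connected sets. -/
theorem sum_isConn_pow_le (hcard : ∀ e, (nb e).card ≤ 18) (W : Finset E) (v : E) (m : ℕ) {y : ℝ}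
    (hy : 0 ≤ y) (hy1 : 51 * y ≤ 1) :
    ∑ C ∈ W.powerset with IsConn nb v C ∧ m ≤ C.card, y ^ C.card ≤ (51 * y) ^ m / 19 := by
  calc ∑ C ∈ W.powerset with IsConn nb v C ∧ m ≤ C.card, y ^ C.card
      ≤ ∑ C ∈ W.powerset with IsConn nb v C ∧ m ≤ C.card,
          (51 * y) ^ m * (1 / 51 : ℝ) ^ C.card := by
        refine sum_le_sum fun C hC => ?_
        have hm := (mem_filter.1 hC).2.2
        have e : y = (51 * y) * (1 / 51) := by ring
        nth_rewrite 1 [e]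
        rw [mul_pow]
        exact mul_le_mul_of_nonneg_right (pow_le_pow_of_le_one (by positivity) hy1 hm)
          (by positivity)
    _ ≤ ∑ C ∈ W.powerset with IsConn nb v C, (51 * y) ^ m * (1 / 51 : ℝ) ^ C.card := by
        refine Finset.sum_le_sum_of_subset_of_nonneg ?_ fun _ _ _ => by positivity
        exact Finset.monotone_filter_right _ fun C _ h => h.1
    _ ≤ (51 * y) ^ m * (1 / 19) := by
        rw [← mul_sum]
        exact mul_le_mul_of_nonneg_left (sum_isConn_le hcard) (by positivity)
    _ = _ := by ring

end Count

/-! ### Sums over configurations with finite support -/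

section Conf

variable {E A : Type*} [DecidableEq E] [Zero A]

/-- Extension of a configuration on `W` by zero. -/
def extZ {W : Finset E} (f : W → A) (e : E) : A := if h : e ∈ W then f ⟨e, h⟩ else 0

lemma extZ_injective (W : Finset E) : Function.Injective (extZ : (W → A) → E → A) := by
  intro f g h
  funext e
  have := congrFun h e.1
  simpa [extZ, e.2] using this

/-- The configurations that vanish off `W` and take a value in `t e` at each `e ∈ W`. -/
def ConfIn (W : Finset E) (t : E → Finset A) : Finset (E → A) :=
  (Fintype.piFinset fun e : W => t e).map ⟨extZ, extZ_injective W⟩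

lemma mem_confIn {W : Finset E} {t : E → Finset A} {ω : E → A} :
    ω ∈ ConfIn W t ↔ (∀ e ∈ W, ω e ∈ t e) ∧ ∀ e ∉ W, ω e = 0 := by
  simp only [ConfIn, Finset.mem_map, Fintype.mem_piFinset, Function.Embedding.coeFn_mk]
  constructor
  · rintro ⟨f, hf, rfl⟩
    refine ⟨fun e he => ?_, fun e he => ?_⟩
    · simpa [extZ, he] using hf ⟨e, he⟩
    · simp [extZ, he]
  · rintro ⟨h1, h2⟩
    refine ⟨fun e => ω e, fun e => h1 e e.2, ?_⟩
    funext e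
    by_cases he : e ∈ W
    · simp [extZ, he]
    · simp [extZ, he, h2 e he]

lemma confIn_congr {W : Finset E} {t t' : E → Finset A} (h : ∀ e ∈ W, t e = t' e) :
    ConfIn W t = ConfIn W t' := by
  ext ω
  simp only [mem_confIn]
  refine and_congr_left fun _ => forall₂_congr fun e he => by rw [h e he]

lemma sum_confIn_prod {R : Type*} [CommSemiring R] (W : Finset E) (t : E → Finset A)
    (y : E → A → R) :
    ∑ ω ∈ ConfIn W t, ∏ e ∈ W, y e (ω e) = ∏ e ∈ W, ∑ x ∈ t e, y e x := by
  rw [ConfIn, Finset.sum_map, ← Finset.prod_coe_sort W fun e => ∑ x ∈ t e, y e x,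
    Finset.prod_univ_sum]
  refine sum_congr rfl fun f _ => ?_
  rw [← Finset.prod_coe_sort]
  refine prod_congr rfl fun e _ => ?_
  simp [extZ]

/-- A configuration on a disjoint union is a pair of configurations. -/
lemma sum_confIn_union {R : Type*} [AddCommMonoid R] {C U : Finset E} (h : Disjoint C U)
    (t : E → Finset A) (F : (E → A) → R) :
    ∑ ω ∈ ConfIn (C ∪ U) t, F ω =
      ∑ τ ∈ ConfIn C t, ∑ ω ∈ ConfIn U t, F (C.piecewise τ ω) := by
  rw [← Finset.sum_product']
  refine Finset.sum_bij' (fun ω _ => (C.piecewise ω 0, C.piecewise 0 ω))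
    (fun x _ => C.piecewise x.1 x.2) ?_ ?_ ?_ ?_ ?_
  · intro ω hω
    rw [mem_confIn] at hω
    rw [mem_product, mem_confIn, mem_confIn]
    refine ⟨⟨fun e he => ?_, fun e he => ?_⟩, fun e he => ?_, fun e he => ?_⟩
    · simpa [he] using hω.1 e (Finset.mem_union_left _ he)
    · simp [he]
    · have : e ∉ C := Finset.disjoint_right.1 h he
      simpa [this] using hω.1 e (Finset.mem_union_right _ he)
    · by_cases hC : e ∈ C
      · simp [hC]
      · simpa [hC] using hω.2 e (by simp [hC, he])
  · rintro ⟨τ, ω⟩ hx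
    rw [mem_product, mem_confIn, mem_confIn] at hx
    rw [mem_confIn]
    refine ⟨fun e he => ?_, fun e he => ?_⟩
    · by_cases hC : e ∈ C
      · simpa [hC] using hx.1.1 e hC
      · simpa [hC] using hx.2.1 e ((Finset.mem_union.1 he).resolve_left hC)
    · rw [Finset.mem_union, not_or] at he
      simpa [he.1] using hx.2.2 e he.2
  · intro ω _
    funext e
    by_cases hC : e ∈ C <;> simp [hC]
  · rintro ⟨τ, ω⟩ hx
    rw [mem_product, mem_confIn, mem_confIn] at hx
    refine Prod.ext (funext fun e => ?_) (funext fun e => ?_)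
    · by_cases hC : e ∈ C
      · simp [hC]
      · simpa [hC] using (hx.1.2 e hC).symm
    · by_cases hC : e ∈ C
      · simpa [hC] using (hx.2.2 e (Finset.disjoint_left.1 h hC)).symm
      · simp [hC]
  · intro ω _
    congr 1
    funext e
    by_cases hC : e ∈ C <;> simp [hC]

variable [Fintype A] [DecidableEq A]

/-- The configurations supported in `W`. -/
def Conf (A : Type*) [Zero A] [Fintype A] (W : Finset E) : Finset (E → A) :=
  ConfIn W fun _ => univ

/-- The configurations with support exactly `W`. -/
def ConfNZ (A : Type*) [Zero A] [Fintype A] [DecidableEq A] (W : Finset E) : Finset (E → A) :=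
  ConfIn W fun _ => univ.erase 0

/-- The configurations with support `W` or `W` without the point `v`. -/
def ConfAt (A : Type*) [Zero A] [Fintype A] [DecidableEq A] (v : E) (W : Finset E) :
    Finset (E → A) :=
  ConfIn W fun e => if e = v then univ else univ.erase 0

lemma mem_conf {W : Finset E} {ω : E → A} : ω ∈ Conf A W ↔ ∀ e ∉ W, ω e = 0 := by
  simp [Conf, mem_confIn]

lemma mem_confNZ {W : Finset E} {ω : E → A} : ω ∈ ConfNZ A W ↔ ∀ e, ω e ≠ 0 ↔ e ∈ W := by
  simp only [ConfNZ, mem_confIn, mem_erase, mem_univ, and_true]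
  constructor
  · rintro ⟨h1, h2⟩ e
    exact ⟨fun h => by_contra fun h' => h (h2 e h'), h1 e⟩
  · intro h
    exact ⟨fun e he => (h e).2 he, fun e he => by_contra fun h' => he ((h e).1 h')⟩

lemma mem_confAt {v : E} {W : Finset E} {ω : E → A} :
    ω ∈ ConfAt A v W ↔ (∀ e ∈ W, e ≠ v → ω e ≠ 0) ∧ ∀ e ∉ W, ω e = 0 := by
  simp only [ConfAt, mem_confIn]
  refine and_congr_left fun _ => forall₂_congr fun e _ => ?_
  by_cases h : e = v <;> simp [h]

lemma confNZ_empty : ConfNZ A (∅ : Finset E) = {0} := by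
  ext ω
  simp only [mem_confNZ, Finset.notMem_empty, iff_false, not_not, Finset.mem_singleton]
  exact ⟨fun h => funext h, fun h e => by rw [h]; rfl⟩

/-- Configurations are classified by their support. -/
lemma sum_conf_eq {R : Type*} [AddCommMonoid R] (W : Finset E) (F : (E → A) → R) :
    ∑ ω ∈ Conf A W, F ω = ∑ U ∈ W.powerset, ∑ ω ∈ ConfNZ A U, F ω := by
  classical
  rw [← Finset.sum_biUnion]
  · refine sum_congr ?_ fun _ _ => rfl
    ext ω
    simp only [mem_conf, Finset.mem_biUnion, mem_powerset, mem_confNZ]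
    constructor
    · intro h
      refine ⟨W.filter fun e => ω e ≠ 0, Finset.filter_subset _ _, fun e => ?_⟩
      rw [mem_filter]
      exact ⟨fun h' => ⟨by_contra fun h'' => h' (h e h''), h'⟩, fun h' => h'.2⟩
    · rintro ⟨U, hU, h⟩ e he
      by_contra h'
      exact he (hU ((h e).1 h'))
  · intro U _ U' _ hne
    rw [Function.onFun, Finset.disjoint_left]
    intro ω h h'
    rw [mem_confNZ] at h h'
    exact hne (Finset.ext fun e => (h e).symm.trans (h' e))

/-- Configurations are classified by their support together with the point `v`. -/
lemma sum_conf_eq_at {R : Type*} [AddCommMonoid R] {W : Finset E} {v : E} (hv : v ∈ W)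
    (F : (E → A) → R) :
    ∑ ω ∈ Conf A W, F ω = ∑ U ∈ W.powerset with v ∈ U, ∑ ω ∈ ConfAt A v U, F ω := by
  classical
  rw [← Finset.sum_biUnion]
  · refine sum_congr ?_ fun _ _ => rfl
    ext ω
    simp only [mem_conf, Finset.mem_biUnion, mem_filter, mem_powerset, mem_confAt]
    constructor
    · intro h
      refine ⟨W.filter fun e => ω e ≠ 0 ∨ e = v, ⟨Finset.filter_subset _ _, ?_⟩, ?_, ?_⟩
      · simp [hv]
      · intro e he hev
        exact (mem_filter.1 he).2.resolve_right hev
      · intro e he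
        by_contra h'
        exact he (mem_filter.2 ⟨by_contra fun h'' => h' (h e h''), Or.inl h'⟩)
    · rintro ⟨U, hU, h⟩ e he
      exact h.2 e fun h' => he (hU.1 h')
  · intro U hU U' hU' hne
    rw [Function.onFun, Finset.disjoint_left]
    intro ω h h'
    rw [mem_confAt] at h h'
    refine hne (Finset.ext fun e => ?_)
    simp only [Finset.coe_filter, Set.mem_ofPred_eq] at hU hU'
    by_cases hev : e = v
    · subst hev; exact ⟨fun _ => hU'.2, fun _ => hU.2⟩
    · exact ⟨fun he => by_contra fun he' => h.1 e he hev (h'.2 e he'),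
        fun he => by_contra fun he' => h'.1 e he hev (h.2 e he')⟩

/-- The activity of a set: the total weight of the configurations with this support. -/
def act {R : Type*} [AddCommMonoid R] (Φ : (E → A) → R) (U : Finset E) : R :=
  ∑ ω ∈ ConfNZ A U, Φ ω

lemma polyZ_act {R : Type*} [AddCommMonoid R] (Φ : (E → A) → R) (W : Finset E) :
    polyZ (act Φ) W = ∑ ω ∈ Conf A W, Φ ω := (sum_conf_eq W Φ).symm

/-- The set `S` cuts the support of `ω` along connected components. -/
def Cuts (nb : E → Finset E) (S : Finset E) (ω : E → A) : Prop :=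
  ∀ a ∈ S, ∀ b ∉ S, ω a ≠ 0 → ω b ≠ 0 → b ∉ nb a

/-- The function `Φ` factorises over the connected components of the support. -/
def Separable {R : Type*} [CommSemiring R] (nb : E → Finset E) (Φ : (E → A) → R) : Prop :=
  Φ 0 = 1 ∧ ∀ ω S, Cuts nb S ω → Φ ω = Φ (S.piecewise ω (0 : E → A)) * Φ (S.piecewise (0 : E → A) ω)

variable {nb : E → Finset E}

lemma Separable.mul {R : Type*} [CommSemiring R] {Φ Ψ : (E → A) → R} (h : Separable nb Φ)
    (h' : Separable nb Ψ) : Separable nb fun ω => Φ ω * Ψ ω := by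
  refine ⟨by simp [h.1, h'.1], fun ω S hS => ?_⟩
  show Φ ω * Ψ ω = _
  rw [h.2 ω S hS, h'.2 ω S hS]
  ring

lemma Separable.prod {R ι : Type*} [CommSemiring R] {T : Finset ι} {Φ : ι → (E → A) → R}
    (h : ∀ i ∈ T, Separable nb (Φ i)) : Separable nb fun ω => ∏ i ∈ T, Φ i ω := by
  refine ⟨Finset.prod_eq_one fun i hi => (h i hi).1, fun ω S hS => ?_⟩
  rw [← prod_mul_distrib]
  exact prod_congr rfl fun i hi => (h i hi).2 ω S hS

lemma Separable.map {R R' : Type*} [CommSemiring R] [CommSemiring R'] (f : R →+* R')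
    {Φ : (E → A) → R} (h : Separable nb Φ) : Separable nb fun ω => f (Φ ω) := by
  refine ⟨by simp [h.1], fun ω S hS => ?_⟩
  show f (Φ ω) = _
  rw [h.2 ω S hS, map_mul]

/-- A function of the value at a single point is separable. -/
lemma Separable.site {R : Type*} [CommSemiring R] (e : E) {y : A → R} (hy : y 0 = 1) :
    Separable nb fun ω : E → A => y (ω e) := by
  refine ⟨hy, fun ω S _ => ?_⟩
  by_cases h : e ∈ S <;> simp [h, hy]

/-- Separability is inherited by a component of a multi-component configuration. -/
lemma Separable.comp {B R : Type*} [Zero B] [CommSemiring R] {Φ : (E → A) → R}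
    (h : Separable nb Φ) (f : B → A) (hf : f 0 = 0) :
    Separable nb fun ω : E → B => Φ fun e => f (ω e) := by
  refine ⟨?_, fun ω S hS => ?_⟩
  · rw [← h.1]
    show Φ (fun e => f 0) = _
    rw [hf]; rfl
  · have hcut : Cuts nb S fun e => f (ω e) := by
      intro a ha b hb h1 h2
      refine hS a ha b hb (fun h0 => h1 ?_) (fun h0 => h2 ?_) <;> simp [h0, hf]
    show Φ (fun e => f (ω e)) = _
    rw [h.2 _ S hcut]
    congr 2 <;>
    · funext e
      by_cases he : e ∈ S <;> simp [he, hf]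

lemma cuts_piecewise {C U : Finset E} (hd : Disjoint U (hull nb C)) {τ ω : E → A}
    (hω : ∀ e ∉ U, ω e = 0) : Cuts nb C (C.piecewise τ ω) := by
  intro a ha b hb _ h2 hab
  rw [Finset.piecewise_eq_of_notMem _ _ _ hb] at h2
  have hbU : b ∈ U := by_contra fun h => h2 (hω b h)
  exact Finset.disjoint_left.1 hd hbU
    (Finset.mem_union_right _ (Finset.mem_biUnion.2 ⟨a, ha, hab⟩))

lemma piecewise_res {C : Finset E} {τ ω : E → A} (hτ : ∀ e ∉ C, τ e = 0) :
    C.piecewise (C.piecewise τ ω) (0 : E → A) = τ := by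
  funext e
  by_cases he : e ∈ C <;> simp [he, hτ]

lemma piecewise_cores {C U : Finset E} (hd : Disjoint U C) {τ ω : E → A}
    (hω : ∀ e ∉ U, ω e = 0) : C.piecewise (0 : E → A) (C.piecewise τ ω) = ω := by
  funext e
  by_cases he : e ∈ C
  · simp [he, hω e (Finset.disjoint_right.1 hd he)]
  · simp [he]

lemma setSep_act {R : Type*} [CommSemiring R] {Φ : (E → A) → R} (h : Separable nb Φ) :
    SetSep nb (act Φ) := by
  refine ⟨by simp [act, confNZ_empty, h.1], fun C U hd => ?_⟩
  have hd' : Disjoint U C := Finset.disjoint_of_subset_right Finset.subset_union_left hd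
  rw [act, ConfNZ, sum_confIn_union hd'.symm, act, act, Finset.sum_mul_sum]
  change ∑ τ ∈ ConfIn C _, ∑ ω ∈ ConfIn U _, _ = _
  refine sum_congr rfl fun τ hτ => sum_congr rfl fun ω hω => ?_
  rw [ConfNZ, mem_confIn] at hω hτ
  rw [h.2 _ C (cuts_piecewise hd hω.2), piecewise_res hτ.2, piecewise_cores hd' hω.2]

open Classical in
/-- The expectation of a function that only depends on the cluster of `v` is bounded by the sum
over the possible clusters. -/
theorem sum_conf_env_le {Φ g : (E → A) → ℝ} (hΦ : Separable nb Φ) (h0 : ∀ ω, 0 ≤ Φ ω)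
    (hg0 : ∀ ω, 0 ≤ g ω) {W : Finset E} {v : E} (hv : v ∈ W)
    (hg : ∀ (ω : E → A) (S : Finset E), v ∈ S → (∀ a ∈ S, ∀ b ∉ S, (ω a ≠ 0 ∨ a = v) → ω b ≠ 0 → b ∉ nb a) →
      g ω ≤ g (S.piecewise ω (0 : E → A))) :
    ∑ ω ∈ Conf A W, Φ ω * g ω ≤ (∑ ω ∈ Conf A W, Φ ω) *
      ∑ D ∈ W.powerset with IsConn nb v D, ∑ τ ∈ ConfAt A v D, Φ τ * g τ := by
  -- Here `C` is the component of `v` in the support with `v` added, and the weight factorises into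
  -- the part on `C` and the part away from `C`.
  rw [sum_conf_eq_at hv, sum_peel nb W v, mul_sum]
  refine sum_le_sum fun C hC => ?_
  have hvC : v ∈ C := (mem_filter.1 hC).2.1
  calc _ ≤ ∑ U ∈ (W \ hull nb C).powerset, ∑ τ ∈ ConfAt A v C, ∑ ω ∈ ConfNZ A U,
        Φ ω * (Φ τ * g τ) := by
        refine sum_le_sum fun U hU => ?_
        have hd : Disjoint U (hull nb C) := Finset.disjoint_of_subset_left
          (mem_powerset.1 hU) Finset.sdiff_disjoint
        have hd' : Disjoint U C := Finset.disjoint_of_subset_right Finset.subset_union_left hd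
        rw [ConfAt, sum_confIn_union hd'.symm]
        have hN : ConfIn U (fun e => if e = v then (univ : Finset A)
            else univ.erase 0) = ConfNZ A U := by
          refine confIn_congr fun e he => if_neg ?_
          rintro rfl
          exact Finset.disjoint_left.1 hd' he hvC
        rw [hN]
        refine sum_le_sum fun τ hτ => sum_le_sum fun ω hω => ?_
        rw [mem_confIn] at hτ
        rw [ConfNZ, mem_confIn] at hω
        have hcut := cuts_piecewise (τ := τ) hd hω.2
        rw [hΦ.2 _ C hcut, piecewise_res hτ.2, piecewise_cores hd' hω.2]
        have : g (C.piecewise τ ω) ≤ g τ := by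
          have := hg (C.piecewise τ ω) C hvC (by
            intro a ha b hb _ h2 hab
            rw [Finset.piecewise_eq_of_notMem _ _ _ hb] at h2
            have hbU : b ∈ U := by_contra fun h => h2 (hω.2 b h)
            exact Finset.disjoint_left.1 hd hbU
              (Finset.mem_union_right _ (Finset.mem_biUnion.2 ⟨a, ha, hab⟩)))
          rwa [piecewise_res hτ.2] at this
        nlinarith [mul_nonneg (h0 ω) (h0 τ)]
    _ = (∑ ω ∈ Conf A (W \ hull nb C), Φ ω) * ∑ τ ∈ ConfAt A v C, Φ τ * g τ := by
        rw [sum_conf_eq, sum_mul]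
        refine sum_congr rfl fun U _ => ?_
        rw [Finset.sum_comm, Finset.sum_mul_sum]
    _ ≤ _ := by
        refine mul_le_mul_of_nonneg_right ?_ (sum_nonneg fun τ _ =>
          mul_nonneg (h0 τ) (hg0 τ))
        refine Finset.sum_le_sum_of_subset_of_nonneg ?_ fun _ _ _ => h0 _
        intro ω hω
        rw [mem_conf] at hω ⊢
        exact fun e he => hω e fun h => he (Finset.sdiff_subset h)

/-- The value at the site `e` can be summed separately. -/
lemma sum_conf_update {R : Type*} [AddCommMonoid R] {W : Finset E} {e : E} (he : e ∈ W)
    (F : (E → A) → R) :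
    ∑ ω ∈ Conf A W, F ω = ∑ ω ∈ Conf A (W.erase e), ∑ x : A, F (update ω e x) := by
  rw [← Finset.sum_product']
  refine Finset.sum_bij' (fun ω _ => (update ω e 0, ω e))
    (fun x _ => update x.1 e x.2) ?_ ?_ ?_ ?_ ?_
  · intro ω hω
    rw [mem_conf] at hω
    simp only [mem_product, mem_conf, mem_univ, and_true, mem_erase, not_and]
    intro e' he'
    by_cases h : e' = e
    · subst h; simp
    · rw [update_of_ne h]; exact hω e' (he' h)
  · rintro ⟨ω, x⟩ hx
    simp only [mem_product, mem_conf, mem_univ, and_true, mem_erase,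
      not_and] at hx
    rw [mem_conf]
    intro e' he'
    have h : e' ≠ e := fun h => he' (h ▸ he)
    rw [update_of_ne h]
    exact hx e' fun _ => he'
  · intro ω _; simp
  · rintro ⟨ω, x⟩ hx
    simp only [mem_product, mem_conf, mem_univ, and_true, mem_erase,
      not_and] at hx
    refine Prod.ext ?_ (by simp)
    funext e'
    by_cases h : e' = e
    · subst h; simp [hx e' (by simp)]
    · simp [h]
  · intro ω _; simp

lemma sum_conf_replace_one {R : Type*} [CommSemiring R] {W : Finset E} {e : E} (he : e ∈ W)
    {G s s' : (E → A) → R} (hG : ∀ ω x, G (update ω e x) = G ω)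
    (hs : ∀ ω, ∑ x : A, s (update ω e x) = ∑ x : A, s' (update ω e x)) :
    ∑ ω ∈ Conf A W, G ω * s ω = ∑ ω ∈ Conf A W, G ω * s' ω := by
  rw [sum_conf_update he, sum_conf_update he]
  refine sum_congr rfl fun ω _ => ?_
  simp only [hG, ← mul_sum, hs]

/-- If each site `e ∈ T` carries a factor `s e` that does not depend on the other sites of `T`,
then only the sums of the factors over the values at the sites of `T` matter. -/
theorem sum_conf_replace {R : Type*} [CommSemiring R] {W T : Finset E} (hT : T ⊆ W)
    {F : (E → A) → R} {s s' : E → (E → A) → R}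
    (hF : ∀ e ∈ T, ∀ ω x, F (update ω e x) = F ω)
    (hs : ∀ e ∈ T, ∀ e' ∈ T, e' ≠ e → ∀ ω x, s e (update ω e' x) = s e ω)
    (hs' : ∀ e ∈ T, ∀ e' ∈ T, e' ≠ e → ∀ ω x, s' e (update ω e' x) = s' e ω)
    (h : ∀ e ∈ T, ∀ ω, ∑ x : A, s e (update ω e x) =
      ∑ x : A, s' e (update ω e x)) :
    ∑ ω ∈ Conf A W, F ω * ∏ e ∈ T, s e ω = ∑ ω ∈ Conf A W, F ω * ∏ e ∈ T, s' e ω := by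
  induction T using Finset.induction_on generalizing F with
  | empty => simp
  | insert e T heT ih =>
    have hmem : ∀ {e'}, e' ∈ T → e' ∈ insert e T := fun h => Finset.mem_insert_of_mem h
    have hee : e ∈ insert e T := Finset.mem_insert_self _ _
    have hne : ∀ {e'}, e' ∈ T → e' ≠ e := fun h h' => heT (h' ▸ h)
    simp only [Finset.prod_insert heT, ← mul_assoc]
    rw [ih (F := fun ω => F ω * s e ω) (fun x hx => hT (hmem hx))
      (fun e' he' ω x => by rw [hF e' (hmem he'), hs e hee e' (hmem he') (hne he')])
      (fun a ha b hb => hs a (hmem ha) b (hmem hb)) (fun a ha b hb => hs' a (hmem ha) b (hmem hb))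
      (fun a ha => h a (hmem ha))]
    have := sum_conf_replace_one (hT hee) (G := fun ω => F ω * ∏ e ∈ T, s' e ω) (s := s e)
      (s' := s' e) (fun ω x => by
        rw [hF e hee]
        congr 1
        exact prod_congr rfl fun a ha =>
          hs' a (hmem ha) e hee (hne ha).symm ω x) (h e hee)
    calc _ = ∑ ω ∈ Conf A W, F ω * (∏ e ∈ T, s' e ω) * s e ω :=
          sum_congr rfl fun ω _ => by ring
      _ = _ := this.trans (sum_congr rfl fun ω _ => by ring)

/-- Splitting a sum over configurations with values in a product. -/
lemma sum_conf_prod {B R : Type*} [Zero B] [Fintype B] [DecidableEq B]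
    [AddCommMonoid R] (W : Finset E)
    (F : (E → A) → (E → B) → R) :
    ∑ ω ∈ Conf (A × B) W, F (fun e => (ω e).1) (fun e => (ω e).2) =
      ∑ σ ∈ Conf A W, ∑ τ ∈ Conf B W, F σ τ := by
  rw [← Finset.sum_product']
  refine Finset.sum_bij' (fun ω _ => (fun e => (ω e).1, fun e => (ω e).2))
    (fun x _ => fun e => (x.1 e, x.2 e)) ?_ ?_ ?_ ?_ ?_
  · intro ω hω
    simp only [mem_conf, mem_product] at hω ⊢
    exact ⟨fun e he => by simp [hω e he], fun e he => by simp [hω e he]⟩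
  · rintro ⟨σ, τ⟩ hx
    simp only [mem_conf, mem_product] at hx ⊢
    exact fun e he => Prod.ext (hx.1 e he) (hx.2 e he)
  · intro ω _; rfl
  · intro x _; rfl
  · intro ω _; rfl

end Conf

/-! ### Edges and plaquettes of the lattice -/

section Lattice

variable {n : ℕ}

lemma unit_self (i : Fin 4) : unit i i = 1 := by simp [unit]

lemma unit_of_ne {i j : Fin 4} (h : j ≠ i) : unit i j = 0 := by simp [unit, h]

lemma unit_apply (i j : Fin 4) : unit i j = if j = i then 1 else 0 := by
  simp [unit, Pi.single_apply]

lemma unit_ne_zero (i : Fin 4) : unit i ≠ 0 := by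
  intro h
  have := congrFun h i
  rw [unit_self] at this
  exact one_ne_zero this

lemma evalChain_add {α : Type} (σ : α → ZMod n) (q q' : α →₀ ℤ) :
    evalChain σ (q + q') = evalChain σ q + evalChain σ q' :=
  Finsupp.sum_add_index' (by simp) fun a b c => by rw [add_smul]

lemma evalChain_sub {α : Type} (σ : α → ZMod n) (q q' : α →₀ ℤ) :
    evalChain σ (q - q') = evalChain σ q - evalChain σ q' :=
  Finsupp.sum_sub_index fun a b c => by rw [sub_smul]

lemma evalChain_single {α : Type} (σ : α → ZMod n) (a : α) (c : ℤ) :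
    evalChain σ (Finsupp.single a c) = c • σ a :=
  Finsupp.sum_single_index (by simp)

lemma evalChain_add_left {α : Type} (σ τ : α → ZMod n) (q : α →₀ ℤ) :
    evalChain (fun a => σ a + τ a) q = evalChain σ q + evalChain τ q := by
  simp only [evalChain, smul_add]
  exact Finsupp.sum_add

lemma evalChain_pi_single {α : Type} [DecidableEq α] (e : α) (g : ZMod n) (q : α →₀ ℤ) :
    evalChain (Pi.single e g) q = q e • g := by
  rw [evalChain, Finsupp.sum, Finset.sum_eq_single e]
  · simp
  · intro a _ ha; simp [ha]
  · intro h
    rw [Finsupp.notMem_support_iff] at h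
    simp [h]

lemma evalChain_congr {α : Type} {σ τ : α → ZMod n} {q : α →₀ ℤ}
    (h : ∀ a ∈ q.support, σ a = τ a) : evalChain σ q = evalChain τ q :=
  sum_congr rfl fun a ha => by simp only [h a ha]

lemma evalChain_eq_zero {α : Type} {σ : α → ZMod n} {q : α →₀ ℤ}
    (h : ∀ a ∈ q.support, σ a = 0) : evalChain σ q = 0 :=
  Finset.sum_eq_zero fun a ha => by simp only [h a ha, smul_zero]

lemma curl_add (σ τ : Edge → ZMod n) (p : Plaquette) :
    curl (fun e => σ e + τ e) p = curl σ p + curl τ p := evalChain_add_left _ _ _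

lemma curl_update (σ : Edge → ZMod n) (e : Edge) (x : ZMod n) (p : Plaquette) :
    curl (update σ e x) p = curl σ p + plaquetteBoundary p e • (x - σ e) := by
  have : update σ e x = fun a => σ a + (Pi.single e (x - σ e) : Edge → ZMod n) a := by
    funext a
    by_cases h : a = e
    · subst h; simp
    · simp [h]
  rw [this, curl_add]
  congr 1
  exact evalChain_pi_single _ _ _

/-- The circulation of a `1`-form around the square at `x` with directions `i` and `j`, which need
not be ordered. -/
def circ (σ : Edge → ZMod n) (x : Vertex) (i j : Fin 4) : ZMod n :=
  σ (x, i) + σ (x + unit i, j) - σ (x + unit j, i) - σ (x, j)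

lemma curl_eq_circ (σ : Edge → ZMod n) (p : Plaquette) :
    curl σ p = circ σ p.1 p.2.1.1 p.2.1.2 := by
  simp only [curl, plaquetteBoundary, evalChain_add, evalChain_sub, evalChain_single, one_smul,
    circ]

lemma circ_swap (σ : Edge → ZMod n) (x : Vertex) (i j : Fin 4) :
    circ σ x j i = -circ σ x i j := by
  simp only [circ]; ring

lemma circ_self (σ : Edge → ZMod n) (x : Vertex) (i : Fin 4) : circ σ x i i = 0 := by
  simp only [circ]; ring

/-- The exterior derivative of the circulation vanishes on every `3`-cell. -/
lemma circ_cell (σ : Edge → ZMod n) (x : Vertex) (i j k : Fin 4) :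
    circ σ (x + unit k) i j - circ σ x i j + (circ σ (x + unit i) j k - circ σ x j k) +
      (circ σ (x + unit j) k i - circ σ x k i) = 0 := by
  simp only [circ]
  rw [add_right_comm x (unit k) (unit i), add_right_comm x (unit k) (unit j),
    add_right_comm x (unit i) (unit j)]
  ring

/-- The four edges of a plaquette. -/
def plaqEdges (p : Plaquette) : Finset Edge :=
  {(p.1, p.2.1.1), (p.1 + unit p.2.1.1, p.2.1.2), (p.1 + unit p.2.1.2, p.2.1.1), (p.1, p.2.1.2)}

lemma plaquetteBoundary_apply_mem {p : Plaquette} {e : Edge} (h : e ∈ plaqEdges p) :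
    plaquetteBoundary p e = 1 ∨ plaquetteBoundary p e = -1 := by
  obtain ⟨x, ⟨⟨i, j⟩, hij⟩⟩ := p
  have hne : i ≠ j := hij.ne
  simp only [plaqEdges, Finset.mem_insert, Finset.mem_singleton] at h
  rcases h with rfl | rfl | rfl | rfl <;>
  simp [plaquetteBoundary, hne, hne.symm, unit_ne_zero]

lemma plaquetteBoundary_apply_notMem {p : Plaquette} {e : Edge} (h : e ∉ plaqEdges p) :
    plaquetteBoundary p e = 0 := by
  simp only [plaqEdges, Finset.mem_insert, Finset.mem_singleton, not_or] at h
  simp [plaquetteBoundary, Ne.symm h.1, Ne.symm h.2.1, Ne.symm h.2.2.1,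
    Ne.symm h.2.2.2]

lemma support_plaquetteBoundary (p : Plaquette) :
    (plaquetteBoundary p).support = plaqEdges p := by
  ext e
  rw [Finsupp.mem_support_iff]
  constructor
  · intro h
    by_contra h'
    exact h (plaquetteBoundary_apply_notMem h')
  · intro h h'
    rcases plaquetteBoundary_apply_mem h with h'' | h'' <;> rw [h'] at h'' <;> norm_num at h''

lemma card_plaqEdges (p : Plaquette) : (plaqEdges p).card = 4 := by
  obtain ⟨x, ⟨⟨i, j⟩, hij⟩⟩ := p
  have hne : i ≠ j := hij.ne
  rw [plaqEdges, Finset.card_insert_of_notMem, Finset.card_insert_of_notMem,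
    Finset.card_insert_of_notMem, Finset.card_singleton]
  · simp [hne]
  · simp [hne.symm, unit_ne_zero]
  · simp [hne, unit_ne_zero]

/-- The plaquette spanned by `e_i`, `e_j` at `x`, for unordered `i ≠ j`. -/
def plaqAt (x : Vertex) (i j : Fin 4) : Plaquette :=
  if h : i < j then (x, ⟨(i, j), h⟩) else if h : j < i then (x, ⟨(j, i), h⟩)
    else (x, ⟨(0, 1), by decide⟩)

lemma plaqAt_fst (x : Vertex) (i j : Fin 4) : (plaqAt x i j).1 = x := by
  unfold plaqAt; split_ifs <;> rfl

lemma plaqAt_snd {x : Vertex} {i j : Fin 4} (h : i ≠ j) (m : Fin 4) :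
    (m = (plaqAt x i j).2.1.1 ∨ m = (plaqAt x i j).2.1.2) ↔ (m = i ∨ m = j) := by
  unfold plaqAt
  rcases lt_or_gt_of_ne h with h' | h'
  · rw [dif_pos h']
  · rw [dif_neg h'.not_gt, dif_pos h']; exact or_comm

lemma mem_plaqAt {x : Vertex} {i j : Fin 4} (h : i ≠ j) (e : Edge) :
    e ∈ plaqEdges (plaqAt x i j) ↔
      e = (x, i) ∨ e = (x + unit i, j) ∨ e = (x + unit j, i) ∨ e = (x, j) := by
  unfold plaqAt
  rcases lt_or_gt_of_ne h with h' | h'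
  · rw [dif_pos h']; simp [plaqEdges]
  · rw [dif_neg h'.not_gt, dif_pos h']; simp only [plaqEdges, Finset.mem_insert,
      Finset.mem_singleton]; tauto

lemma curl_plaqAt_eq_zero {σ : Edge → ZMod n} {x : Vertex} {i j : Fin 4} (h : i ≠ j) :
    curl σ (plaqAt x i j) = 0 ↔ circ σ x i j = 0 := by
  rw [curl_eq_circ]
  unfold plaqAt
  rcases lt_or_gt_of_ne h with h' | h'
  · rw [dif_pos h']
  · rw [dif_neg h'.not_gt, dif_pos h', circ_swap, neg_eq_zero]

/-- The six plaquettes containing an edge. -/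
def star (e : Edge) : Finset Plaquette :=
  ((univ.erase e.2) ×ˢ (univ : Finset Bool)).image fun d =>
    plaqAt (if d.2 then e.1 else e.1 - unit d.1) e.2 d.1

lemma mem_star {e : Edge} {p : Plaquette} : p ∈ star e ↔ e ∈ plaqEdges p := by
  obtain ⟨x, i⟩ := e
  constructor
  · intro h
    simp only [star, Finset.mem_image, mem_product, mem_erase, mem_univ,
      and_true, Prod.exists] at h
    obtain ⟨j, s, hj, rfl⟩ := h
    rw [mem_plaqAt hj.symm]
    cases s <;> simp
  · obtain ⟨y, ⟨⟨a, b⟩, hab⟩⟩ := p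
    have hne : a ≠ b := hab.ne
    intro h
    simp only [plaqEdges, Finset.mem_insert, Finset.mem_singleton, Prod.mk.injEq] at h
    simp only [star, Finset.mem_image, mem_product, mem_erase, mem_univ,
      and_true, Prod.exists]
    have hP : plaqAt y a b = (y, ⟨(a, b), hab⟩) := by unfold plaqAt; exact dif_pos hab
    have hP' : plaqAt y b a = (y, ⟨(a, b), hab⟩) := by
      unfold plaqAt; rw [dif_neg hab.not_gt]; exact dif_pos hab
    rcases h with ⟨rfl, rfl⟩ | ⟨rfl, rfl⟩ | ⟨rfl, rfl⟩ | ⟨rfl, rfl⟩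
    · exact ⟨b, true, hne.symm, by simpa using hP⟩
    · exact ⟨a, false, hne, by simpa using hP'⟩
    · exact ⟨b, false, hne.symm, by simpa using hP⟩
    · exact ⟨a, true, hne, by simpa using hP'⟩

lemma card_star (e : Edge) : (star e).card = 6 := by
  obtain ⟨x, i⟩ := e
  rw [star, Finset.card_image_of_injOn]
  · rw [Finset.card_product, Finset.card_erase_of_mem (mem_univ _)]; rfl
  · rintro ⟨j, s⟩ hj ⟨j', s'⟩ hj' h
    simp only [Finset.coe_product, Set.mem_prod, Finset.mem_coe, mem_erase,
      mem_univ, and_true] at hj hj'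
    simp only at h
    have h1 : j = j' := by
      have h2 := plaqAt_snd (x := if s then x else x - unit j) hj.symm j'
      rw [h, plaqAt_snd hj'.symm] at h2
      exact ((h2.1 (Or.inr rfl)).resolve_left hj').symm
    subst h1
    have h3 := congrArg Prod.fst h
    rw [plaqAt_fst, plaqAt_fst] at h3
    have h4 := unit_ne_zero j
    cases s <;> cases s'
    · rfl
    · exact absurd (by simpa using h3) h4
    · exact absurd (by simpa using h3.symm) h4
    · rfl

/-- Two different edges of a plaquette determine the plaquette. -/
lemma plaq_data {p : Plaquette} {e f : Edge} (he : e ∈ plaqEdges p) (hf : f ∈ plaqEdges p)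
    (hef : e ≠ f) : (∀ m, p.1 m = min (e.1 m) (f.1 m)) ∧
      ∀ m, (m = p.2.1.1 ∨ m = p.2.1.2) ↔ (m = e.2 ∨ m = f.2 ∨ e.1 m ≠ f.1 m) := by
  obtain ⟨x, ⟨⟨i, j⟩, hij⟩⟩ := p
  have hne : i ≠ j := hij.ne
  simp only [plaqEdges, Finset.mem_insert, Finset.mem_singleton] at he hf
  rcases he with rfl | rfl | rfl | rfl <;> rcases hf with rfl | rfl | rfl | rfl <;>
    first
    | exact absurd rfl hef
    | (refine ⟨fun m => ?_, fun m => ?_⟩ <;>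
       simp only [Pi.add_apply, unit_apply] <;>
       by_cases h1 : m = i <;> by_cases h2 : m = j <;> simp_all)

lemma plaq_unique {p p' : Plaquette} {e f : Edge} (he : e ∈ plaqEdges p) (hf : f ∈ plaqEdges p)
    (he' : e ∈ plaqEdges p') (hf' : f ∈ plaqEdges p') (hef : e ≠ f) : p = p' := by
  have h := plaq_data he hf hef
  have h' := plaq_data he' hf' hef
  obtain ⟨x, ⟨⟨i, j⟩, hij⟩⟩ := p
  obtain ⟨x', ⟨⟨i', j'⟩, hij'⟩⟩ := p'
  simp only at h h' hij hij'
  have hx : x = x' := funext fun m => (h.1 m).trans (h'.1 m).symm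
  have hm : ∀ m, (m = i ∨ m = j) ↔ (m = i' ∨ m = j') := fun m => (h.2 m).trans (h'.2 m).symm
  have h1 := (hm i).1 (Or.inl rfl)
  have h2 := (hm j).1 (Or.inr rfl)
  have h3 := (hm i').2 (Or.inl rfl)
  have h4 := (hm j').2 (Or.inr rfl)
  have hii : i = i' ∧ j = j' := by omega
  obtain ⟨rfl, rfl⟩ := hii
  subst hx
  rfl

/-- The edges that share a plaquette with `e`. -/
def nbr (e : Edge) : Finset Edge := (star e).biUnion fun p => (plaqEdges p).erase e

lemma mem_nbr {e f : Edge} : f ∈ nbr e ↔ f ≠ e ∧ ∃ p, e ∈ plaqEdges p ∧ f ∈ plaqEdges p := by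
  simp only [nbr, Finset.mem_biUnion, mem_star, mem_erase]
  exact ⟨fun ⟨p, h1, h2, h3⟩ => ⟨h2, p, h1, h3⟩, fun ⟨h2, p, h1, h3⟩ => ⟨p, h1, h2, h3⟩⟩

lemma nbr_symm (e f : Edge) (h : f ∈ nbr e) : e ∈ nbr f := by
  rw [mem_nbr] at h ⊢
  exact ⟨h.1.symm, h.2.imp fun _ h => h.symm⟩

lemma card_nbr (e : Edge) : (nbr e).card ≤ 18 := by
  have h := Finset.card_biUnion_le_card_mul (star e) (fun p => (plaqEdges p).erase e) 3
    fun p hp => by rw [Finset.card_erase_of_mem (mem_star.1 hp), card_plaqEdges]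
  rw [card_star] at h
  exact h

lemma nbr_coord {e f : Edge} (h : f ∈ nbr e) (c : Fin 4) : |f.1 c - e.1 c| ≤ 1 := by
  obtain ⟨_, p, he, hf⟩ := mem_nbr.1 h
  have key : ∀ g ∈ plaqEdges p, p.1 c ≤ g.1 c ∧ g.1 c ≤ p.1 c + 1 := by
    intro g hg
    simp only [plaqEdges, Finset.mem_insert, Finset.mem_singleton] at hg
    rcases hg with rfl | rfl | rfl | rfl <;> simp only [Pi.add_apply, unit_apply] <;>
      omega
  have h1 := key e he
  have h2 := key f hf
  rw [abs_le]
  omega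

/-- A connected set of edges is at least as large as its extent in any coordinate direction. -/
lemma IsConn.extent {v u : Edge} {C : Finset Edge} (hC : IsConn nbr v C) (hu : u ∈ C)
    (c : Fin 4) : |u.1 c - v.1 c| + 1 ≤ C.card := by
  -- Neighbours differ by at most one in each coordinate, so no value between the ends is skipped.
  have key : ∀ t : ℤ, (v.1 c ≤ t ∧ t ≤ u.1 c ∨ u.1 c ≤ t ∧ t ≤ v.1 c) →
      ∃ w ∈ C, w.1 c = t := by
    have hr := hC.2 u hu
    clear hu
    induction hr with
    | refl => intro t ht; exact ⟨v, hC.1, by omega⟩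
    | @tail b b' _ hbc ih =>
      intro t ht
      have h1 := abs_le.1 (nbr_coord hbc.1 c)
      by_cases h : t = b'.1 c
      · exact ⟨b', hbc.2, h.symm⟩
      · exact ih t (by omega)
  have hsub : Finset.uIcc (v.1 c) (u.1 c) ⊆ C.image fun w => w.1 c := by
    intro t ht
    rw [Finset.mem_uIcc] at ht
    obtain ⟨w, hw, hwt⟩ := key t (by
      rcases le_total (v.1 c) (u.1 c) with h | h
      · simp only [h, inf_of_le_left, sup_of_le_right] at ht; exact Or.inl ht
      · simp only [h, inf_of_le_right, sup_of_le_left] at ht; exact Or.inr ht)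
    exact Finset.mem_image.2 ⟨w, hw, hwt⟩
  have := (Finset.card_le_card hsub).trans Finset.card_image_le
  rw [Int.card_uIcc] at this
  rw [Int.abs_eq_natAbs]
  omega

/-- A `1`-form that is closed around an edge at which it does not vanish has at least seven
edges in its support: each of the six plaquettes at the edge contains another one. -/
lemma seven_le_card {η : Edge → ZMod n} {e : Edge} (he : η e ≠ 0)
    (hc : ∀ p ∈ star e, curl η p = 0) {D : Finset Edge} (hD : ∀ f, η f ≠ 0 → f ∈ D) :
    7 ≤ D.card := by
  have key : ∀ p ∈ star e, ∃ f ∈ D.erase e, f ∈ plaqEdges p := by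
    intro p hp
    by_contra hcon
    push Not at hcon
    have h0 : ∀ f ∈ plaqEdges p, f ≠ e → η f = 0 := by
      intro f hf hfe
      by_contra h
      exact hcon f (mem_erase.2 ⟨hfe, hD f h⟩) hf
    -- Otherwise `e` is the only edge of `p` that contributes to the derivative at `p`.
    have h1 : curl η p = plaquetteBoundary p e • η e := by
      rw [← evalChain_pi_single e (η e)]
      refine evalChain_congr fun f hf => ?_
      rw [support_plaquetteBoundary] at hf
      by_cases hfe : f = e
      · subst hfe; simp
      · rw [h0 f hf hfe]; simp [hfe]
    rw [hc p hp] at h1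
    rcases plaquetteBoundary_apply_mem (mem_star.1 hp) with h | h <;> rw [h] at h1
    · exact he (by simpa using h1.symm)
    · exact he (by simpa using h1.symm)
  choose! F hF using key
  have hinj : Set.InjOn F (star e) := by
    intro p hp p' hp' h
    have h1 := hF p hp
    have h2 := hF p' hp'
    rw [← h] at h2
    exact plaq_unique (mem_star.1 hp) h1.2 (mem_star.1 hp') h2.2
      (mem_erase.1 h1.1).1.symm
  have h6 : (star e).card ≤ (D.erase e).card :=
    Finset.card_le_card_of_injOn F (fun p hp => (hF p hp).1) hinj
  rw [card_star, Finset.card_erase_of_mem (hD e he)] at h6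
  have := Finset.card_pos.2 ⟨e, hD e he⟩
  omega

end Lattice

/-! ### Forms whose exterior derivative is carried by few plaquettes -/

section Classification

variable {n : ℕ} {σ : Edge → ZMod n} {W : Finset Edge}

lemma circ_eq_zero_of_support (hσ : ∀ e ∉ W, σ e = 0) :
    ∃ N : ℤ, ∀ x i j, (∃ m, N < |x m|) → circ σ x i j = 0 := by
  obtain ⟨N, hN⟩ : ∃ N : ℤ, ∀ e ∈ W, ∀ m, |e.1 m| ≤ N := by
    refine ⟨∑ e ∈ W, ∑ m, |e.1 m|, fun e he m => ?_⟩
    refine le_trans ?_ (Finset.single_le_sum (f := fun e : Edge => ∑ m, |e.1 m|)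
      (fun e _ => sum_nonneg fun m _ => abs_nonneg _) he)
    exact Finset.single_le_sum (f := fun m => |e.1 m|) (fun m _ => abs_nonneg _)
      (mem_univ m)
  refine ⟨N + 1, fun x i j ⟨m, hm⟩ => ?_⟩
  have key : ∀ (y : Vertex) (l : Fin 4), |y m - x m| ≤ 1 → σ (y, l) = 0 := by
    intro y l hy
    refine hσ _ fun h => ?_
    have := hN _ h m
    simp only at this
    rw [abs_le] at this hy
    rw [lt_abs] at hm
    omega
  have hu : ∀ l, |(x + unit l) m - x m| ≤ 1 := by
    intro l
    rw [Pi.add_apply, unit_apply]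
    split_ifs <;> simp
  rw [circ, key x i (by simp), key _ j (hu i), key _ i (hu j), key x j (by simp)]
  simp

/-- The circulations over the squares in a plane sum to zero. -/
lemma exists_circ_ne_zero_plane (hσ : ∀ e ∉ W, σ e = 0) {x : Vertex} {i j : Fin 4} (hij : i ≠ j)
    (hx : circ σ x i j ≠ 0) :
    ∃ y, y ≠ x ∧ (∀ m, m ≠ i → m ≠ j → y m = x m) ∧ circ σ y i j ≠ 0 := by
  -- The points of the plane through `x` in the directions `i` and `j`.
  set P : ℤ × ℤ → Vertex := fun s => x + s.1 • unit i + s.2 • unit j with hP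
  have hPi : ∀ s, P s i = x i + s.1 := fun s => by
    simp [hP, unit_self, unit_of_ne hij]
  have hPj : ∀ s, P s j = x j + s.2 := fun s => by
    simp [hP, unit_self, unit_of_ne hij.symm]
  have hPm : ∀ s m, m ≠ i → m ≠ j → P s m = x m := fun s m h h' => by
    simp [hP, unit_of_ne h, unit_of_ne h']
  have hinj : Function.Injective P := by
    intro s t h
    have h1 := congrFun h i
    have h2 := congrFun h j
    rw [hPi, hPi] at h1
    rw [hPj, hPj] at h2
    exact Prod.ext (by omega) (by omega)
  have hfin : ∀ l, (Function.support fun s => σ (P s, l)).Finite := by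
    intro l
    refine (W.finite_toSet.preimage (f := fun s => (P s, l)) ?_).subset ?_
    · intro s _ t _ h
      exact hinj (Prod.ext_iff.1 h).1
    · intro s hs
      by_contra h
      exact hs (hσ _ h)
  have hs1 : ∀ s : ℤ × ℤ, P s + unit i = P (s + (1, 0)) := by
    intro s; simp only [hP, Prod.fst_add, Prod.snd_add, add_smul, one_smul, add_zero]; abel
  have hs2 : ∀ s : ℤ × ℤ, P s + unit j = P (s + (0, 1)) := by
    intro s; simp only [hP, Prod.fst_add, Prod.snd_add, add_smul, one_smul, add_zero]; abel
  have hfin' : ∀ (l) (v : ℤ × ℤ), (Function.support fun s => σ (P (s + v), l)).Finite := by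
    intro l v
    refine ((hfin l).preimage (f := fun s => s + v) (add_left_injective v).injOn).subset ?_
    intro s hs; exact hs
  -- Each edge of the plane occurs in two squares, with opposite signs.
  have hsum : ∑ᶠ s, circ σ (P s) i j = 0 := by
    have e : (fun s => circ σ (P s) i j) = fun s =>
        (σ (P s, i) + σ (P (s + (1, 0)), j)) - (σ (P (s + (0, 1)), i) + σ (P s, j)) := by
      funext s
      rw [circ, hs1, hs2]; ring
    rw [e, finsum_sub_distrib, finsum_add_distrib (hfin i) (hfin' j _),
      finsum_add_distrib (hfin' i _) (hfin j)]
    · have e1 : ∀ (l) (v : ℤ × ℤ), ∑ᶠ s, σ (P (s + v), l) = ∑ᶠ s, σ (P s, l) := fun l v =>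
        finsum_comp_equiv (Equiv.addRight v) (f := fun s => σ (P s, l))
      rw [e1, e1]; ring
    · exact ((hfin i).union (hfin' j _)).subset (Function.support_add _ _)
    · exact ((hfin' i _).union (hfin j)).subset (Function.support_add _ _)
  by_contra hcon
  push Not at hcon
  refine hx ?_
  rw [finsum_eq_single _ (0 : ℤ × ℤ)] at hsum
  · simpa [hP] using hsum
  · intro s hs
    refine hcon _ (fun h => hs (hinj ?_)) (hPm s)
    rw [h]; simp [hP]

/-- If a square in the directions `i`, `j` carries circulation, so does some square that extends
from its height or above in the direction `k`: otherwise the circulation would be constant along the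
half-line in the direction `k`, against the finiteness of the support. -/
lemma exists_circ_ne_zero_up (hσ : ∀ e ∉ W, σ e = 0) {x : Vertex} {i j k : Fin 4} (hki : k ≠ i)
    (hkj : k ≠ j) (hx : circ σ x i j ≠ 0) :
    ∃ y, x k ≤ y k ∧ (circ σ y i k ≠ 0 ∨ circ σ y j k ≠ 0) := by
  by_contra hcon
  push Not at hcon
  obtain ⟨N, hN⟩ := circ_eq_zero_of_support hσ
  have key : ∀ t : ℕ, circ σ (x + (t : ℤ) • unit k) i j = circ σ x i j := by
    intro t
    induction t with
    | zero => simp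
    | succ t ih =>
      have h := circ_cell σ (x + (t : ℤ) • unit k) i j k
      have h1 := (hcon (x + (t : ℤ) • unit k) (by simp [unit_self])).2
      have h2 := (hcon (x + (t : ℤ) • unit k) (by simp [unit_self])).1
      have h3 := (hcon (x + (t : ℤ) • unit k + unit i) (by simp [unit_self, unit_of_ne hki])).2
      have h4 := (hcon (x + (t : ℤ) • unit k + unit j) (by simp [unit_self, unit_of_ne hkj])).1
      rw [circ_swap σ _ i k, circ_swap σ _ i k, h1, h2, h3, h4] at h
      rw [Nat.cast_succ, add_smul, one_smul, ← add_assoc, ← ih]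
      linear_combination h
  refine hx ?_
  rw [← key (N - x k + 1).toNat]
  refine hN _ _ _ ⟨k, ?_⟩
  simp only [Pi.add_apply, Pi.smul_apply, unit_self, smul_eq_mul, mul_one]
  rw [lt_abs]
  omega

lemma sum_fin_four {i j k l : Fin 4} (hij : i ≠ j) (hik : i ≠ k) (hil : i ≠ l) (hjk : j ≠ k)
    (hjl : j ≠ l) (hkl : k ≠ l) (f : Fin 4 → ℕ) : ∑ m, f m = f i + f j + f k + f l := by
  have h : (univ : Finset (Fin 4)) = {i, j, k, l} := by
    symm
    rw [← Finset.card_eq_iff_eq_univ, Finset.card_insert_of_notMem, Finset.card_insert_of_notMem,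
      Finset.card_insert_of_notMem, Finset.card_singleton]
    · rfl
    · simpa using hkl
    · simp [hjk, hjl]
    · simp [hij, hik, hil]
  rw [h, Finset.sum_insert, Finset.sum_insert, Finset.sum_insert, Finset.sum_singleton]
  · ring
  · simpa using hkl
  · simp [hjk, hjl]
  · simp [hij, hik, hil]

lemma exists_other_two {i j : Fin 4} (hij : i ≠ j) :
    ∃ k l : Fin 4, i ≠ k ∧ i ≠ l ∧ j ≠ k ∧ j ≠ l ∧ k ≠ l := by
  revert i j; decide

lemma exists_other_three (c : Fin 4) : ∃ j k l : Fin 4, c ≠ j ∧ c ≠ k ∧ c ≠ l ∧ j ≠ k ∧ j ≠ l ∧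
    k ≠ l := by
  revert c; decide

/-- If only the squares containing the direction `c` carry circulation, two for each of the other
directions, then the exterior derivative is that of a form supported on a single edge. -/
lemma curl_eq_single_of_center (hσ : ∀ e ∉ W, σ e = 0) {V : Finset Vertex}
    (hVmem : ∀ x i j, i ≠ j → circ σ x i j ≠ 0 → x ∈ V) {c : Fin 4}
    (hc2 : ∀ m, m ≠ c → (V.filter fun x => circ σ x c m ≠ 0).card = 2)
    (hc0 : ∀ m m', m ≠ c → m' ≠ c → (V.filter fun x => circ σ x m m' ≠ 0).card = 0) :
    ∃ e g, ∀ p, curl σ p = curl (Pi.single e g) p := by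
  have hz : ∀ m m', m ≠ c → m' ≠ c → ∀ x, circ σ x m m' = 0 := by
    intro m m' hm hm' x
    by_cases hmm : m = m'
    · subst hmm; exact circ_self _ _ _
    by_contra h
    have : (V.filter fun x => circ σ x m m' ≠ 0).card ≠ 0 :=
      Finset.card_ne_zero_of_mem (mem_filter.2 ⟨hVmem x m m' hmm h, h⟩)
    exact this (hc0 m m' hm hm')
  -- The two squares in the directions `c`, `m` lie in one plane.
  have hpair : ∀ m, m ≠ c → ∀ x, circ σ x c m ≠ 0 → ∃ y, y ≠ x ∧ (∀ a, a ≠ c → a ≠ m → y a = x a) ∧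
      ∀ z, circ σ z c m ≠ 0 → z = x ∨ z = y := by
    intro m hm x hx
    obtain ⟨y, hyx, hya, hy⟩ := exists_circ_ne_zero_plane hσ hm.symm hx
    refine ⟨y, hyx, hya, fun z hz => ?_⟩
    have h := hc2 m hm
    by_contra hcon
    push Not at hcon
    have h4 : 2 < (V.filter fun x => circ σ x c m ≠ 0).card := Finset.two_lt_card.2 ⟨x, mem_filter.2 ⟨hVmem x c m hm.symm hx, hx⟩, y,
      mem_filter.2 ⟨hVmem y c m hm.symm hy, hy⟩, z,
      mem_filter.2 ⟨hVmem z c m hm.symm hz, hz⟩, hyx.symm, hcon.1.symm, hcon.2.symm⟩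
    have h5 : (V.filter fun x => circ σ x c m ≠ 0).card = 2 := h
    omega
  have hcoord : ∀ m, m ≠ c → ∀ x z, circ σ x c m ≠ 0 → ∀ a, a ≠ c → a ≠ m → z a ≠ x a →
      circ σ z c m = 0 := by
    intro m hm x z hx a hac ham hza
    obtain ⟨y, _, hya, hy⟩ := hpair m hm x hx
    by_contra h
    rcases hy z h with rfl | rfl
    · exact hza rfl
    · exact hza (hya a hac ham)
  -- The relation of a `3`-cell, with the circulation that does not involve `c` left out.
  have hrel : ∀ m m', m ≠ c → m' ≠ c → ∀ x,
      circ σ (x + unit m') c m - circ σ x c m = circ σ (x + unit m) c m' - circ σ x c m' := by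
    intro m m' hm hm' x
    have h := circ_cell σ x c m m'
    rw [hz m m' hm hm', hz m m' hm hm', circ_swap σ _ c m', circ_swap σ _ c m'] at h
    linear_combination h
  obtain ⟨j, k, l, hcj, hck, hcl, hjk, hjl, hkl⟩ : ∃ j k l : Fin 4, c ≠ j ∧ c ≠ k ∧ c ≠ l ∧ j ≠ k ∧
      j ≠ l ∧ k ≠ l := exists_other_three c
  -- the point of the support of the `c j` circulations with the largest `j` coordinate
  obtain ⟨p, hp, hpmax⟩ : ∃ p, circ σ p c j ≠ 0 ∧ ∀ z, p j < z j → circ σ z c j = 0 := by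
    have hne : (V.filter fun x => circ σ x c j ≠ 0).Nonempty := by
      rw [← Finset.card_pos]
      have : (V.filter fun x => circ σ x c j ≠ 0).card = 2 := hc2 j hcj.symm
      omega
    obtain ⟨p, hp, hmax⟩ := Finset.exists_max_image _ (fun x : Vertex => x j) hne
    refine ⟨p, (mem_filter.1 hp).2, fun z hz => ?_⟩
    by_contra h
    have := hmax z (mem_filter.2 ⟨hVmem z c j hcj h, h⟩)
    omega
  -- The `3`-cells at `p` and at the points below it propagate the circulation `circ σ p c j` to the
  -- other squares at the edge `(p, c)`.
  have hother : ∀ k, k ≠ c → k ≠ j → circ σ p c k = circ σ p c j ∧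
      circ σ (p - unit k) c k = -circ σ p c j ∧ circ σ (p - unit j) c j = -circ σ p c j := by
    intro k hkc hkj
    have r1 := hrel j k hcj.symm hkc p
    have z1 : circ σ (p + unit k) c j = 0 :=
      hcoord j hcj.symm p _ hp k hkc hkj (by simp [unit_self])
    have r2 := hrel j k hcj.symm hkc (p + unit j)
    have z2 : circ σ (p + unit j) c j = 0 := hpmax _ (by simp [unit_self])
    have z3 : circ σ (p + unit j + unit k) c j = 0 :=
      hpmax _ (by simp [unit_self, unit_of_ne hkj.symm])
    have z4 : circ σ (p + unit j) c k = 0 := by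
      by_contra h
      rw [z2, z3] at r2
      have := hcoord k hkc _ (p + unit j + unit j) h j hcj.symm hkj.symm (by simp [unit_self])
      rw [this] at r2
      exact h (by linear_combination r2)
    have v1 : circ σ p c k = circ σ p c j := by
      rw [z1, z4] at r1; linear_combination r1
    have hpk : circ σ p c k ≠ 0 := v1 ▸ hp
    have r3 := hrel j k hcj.symm hkc (p - unit k)
    rw [sub_add_cancel] at r3
    have z5 : circ σ (p - unit k) c j = 0 :=
      hcoord j hcj.symm p _ hp k hkc hkj (by simp [unit_self])
    have z6 : circ σ (p - unit k + unit j) c k = 0 :=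
      hcoord k hkc p _ hpk j hcj.symm hkj.symm (by simp [unit_self, unit_of_ne hkj.symm])
    have r4 := hrel j k hcj.symm hkc (p - unit j)
    rw [sub_add_cancel] at r4
    have z7 : circ σ (p - unit j) c k = 0 :=
      hcoord k hkc p _ hpk j hcj.symm hkj.symm (by simp [unit_self])
    have z8 : circ σ (p - unit j + unit k) c j = 0 :=
      hcoord j hcj.symm p _ hp k hkc hkj (by simp [unit_self, unit_of_ne hkj])
    rw [z5, z6] at r3
    rw [z7, z8] at r4
    exact ⟨v1, by linear_combination r3, by linear_combination -r4 - v1⟩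
  refine ⟨(p, c), circ σ p c j, ?_⟩
  set g := circ σ p c j with hg
  have hval : ∀ m, m ≠ c → circ σ p c m = g ∧ circ σ (p - unit m) c m = -g := by
    intro m hm
    by_cases hmj : m = j
    · subst hmj; exact ⟨rfl, (hother k hck.symm hjk.symm).2.2⟩
    · exact ⟨(hother m hm hmj).1, (hother m hm hmj).2.1⟩
  -- The squares found so far are two for each direction `m`, hence all of them.
  have hcirc : ∀ m, m ≠ c → ∀ x, circ σ x c m = circ (Pi.single (p, c) g : Edge → ZMod n) x c m := by
    intro m hm x
    have hpm : circ σ p c m ≠ 0 := by rw [(hval m hm).1]; exact hp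
    have hu := unit_ne_zero m
    simp only [circ, Pi.single_apply, Prod.mk.injEq, hm, and_false, if_false, and_true, add_zero,
      sub_zero]
    change circ σ x c m = _
    by_cases h1 : x = p
    · subst h1; simp [(hval m hm).1, hu]
    by_cases h2 : x = p - unit m
    · subst h2; simp [(hval m hm).2, hu]
    have h3 : x + unit m ≠ p := fun h => h2 (by rw [← h, add_sub_cancel_right])
    rw [if_neg h1, if_neg h3, sub_zero]
    by_contra h
    obtain ⟨y, _, _, hy⟩ := hpair m hm p hpm
    have hy1 := (hy x h).resolve_left h1
    have hgm : circ σ (p - unit m) c m ≠ 0 := by rw [(hval m hm).2]; exact neg_ne_zero.2 hp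
    rcases hy _ hgm with h4 | h4
    · exact hu (by simpa using h4)
    · exact h2 (hy1.trans h4.symm)
  intro q
  obtain ⟨x, ⟨⟨a, b⟩, hab⟩⟩ := q
  rw [curl_eq_circ, curl_eq_circ]
  simp only
  have hab' : a ≠ b := hab.ne
  by_cases ha : a = c
  · subst ha; exact hcirc b hab'.symm x
  by_cases hb : b = c
  · subst hb
    rw [circ_swap σ x b a, circ_swap _ x b a, hcirc a ha x]
  · rw [hz a b ha hb]
    simp [circ, ha, hb]

/-- The numbers `M i j` of squares in the different directions that carry circulation add up to at
least six, and in the extremal case they are concentrated on the directions containing some `c`. -/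
lemma exists_center {M : Fin 4 → Fin 4 → ℕ} {T : ℕ} (hsymm : ∀ i j, M i j = M j i)
    (hself : ∀ i, M i i = 0) (hT : 2 * T = ∑ i, ∑ j, M i j)
    (h2 : ∀ i j, i ≠ j → M i j ≠ 0 → 2 ≤ M i j)
    (h3 : ∀ i j k, i ≠ j → k ≠ i → k ≠ j → M i j ≠ 0 → 2 ≤ M i k + M j k)
    {i j : Fin 4} (hij : i ≠ j) (hMij : M i j ≠ 0) :
    6 ≤ T ∧ (T ≤ 6 → ∃ c, (∀ m, m ≠ c → M c m = 2) ∧ ∀ m m', m ≠ c → m' ≠ c → M m m' = 0) := by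
  -- The sum over the six unordered pairs of directions.
  have htot : ∀ i j k l, i ≠ j → i ≠ k → i ≠ l → j ≠ k → j ≠ l → k ≠ l →
      T =
        M i j + M i k + M i l + M j k + M j l + M k l := by
    intro i j k l hij hik hil hjk hjl hkl
    have hs := fun f => sum_fin_four hij hik hil hjk hjl hkl f
    simp only [hs, hself] at hT
    rw [hsymm j i, hsymm k i, hsymm l i, hsymm k j, hsymm l j, hsymm l k] at hT
    omega
  obtain ⟨k, l, hik, hil, hjk, hjl, hkl⟩ := exists_other_two hij
  have t := htot i j k l hij hik hil hjk hjl hkl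
  have a1 := h2 i j hij hMij
  have a2 := h3 i j k hij hik.symm hjk.symm hMij
  have a3 := h3 i j l hij hil.symm hjl.symm hMij
  refine ⟨by omega, fun hle => ?_⟩
  -- One direction occurs in all six plaquettes; it is the direction of the edge.
  have hcenter : ∃ c, (∀ m, m ≠ c → M c m = 2) ∧ ∀ m m', m ≠ c → m' ≠ c → M m m' = 0 := by
    -- If `i j` and `i k` occur, then so does `i l`, as `j l` and `k l` would cost too much.
    have aux : ∀ i j k l, i ≠ j → i ≠ k → i ≠ l → j ≠ k → j ≠ l → k ≠ l → M i j ≠ 0 → M i k ≠ 0 →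
        ∃ c, (∀ m, m ≠ c → M c m = 2) ∧ ∀ m m', m ≠ c → m' ≠ c → M m m' = 0 := by
      intro i j k l hij hik hil hjk hjl hkl h1 h1'
      have t := htot i j k l hij hik hil hjk hjl hkl
      have b1 := h2 i j hij h1
      have b2 := h2 i k hik h1'
      have b3 := h3 i j l hij hil.symm hjl.symm h1
      have b4 := h3 i k l hik hil.symm hkl.symm h1'
      have b5 := h2 k l hkl
      have b7 := h2 j l hjl
      have b6 := h2 i l hil
      have hall : ∀ m, m = i ∨ m = j ∨ m = k ∨ m = l := by
        intro m
        omega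
      rw [hsymm k l] at b4 b5
      rw [hsymm j l] at b3 b7
      rw [hsymm j l, hsymm k l] at t
      refine ⟨i, fun m hm => ?_, fun m m' hm hm' => ?_⟩
      · rcases hall m with rfl | rfl | rfl | rfl
        · exact absurd rfl hm
        all_goals omega
      · have e1 := hsymm j l
        have e2 := hsymm k l
        have e3 := hsymm k j
        rcases hall m with rfl | rfl | rfl | rfl
        · exact absurd rfl hm
        all_goals
          rcases hall m' with rfl | rfl | rfl | rfl
          · exact absurd rfl hm'
          all_goals first | exact hself _ | (clear hall; omega)
    by_cases h : M i k = 0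
    · refine aux j i k l hij.symm hjk hjl hik hil hkl (by rw [hsymm]; exact hMij) (by omega)
    · exact aux i j k l hij hik hil hjk hjl hkl hMij h
  exact hcenter

/-- A form with finite support whose exterior derivative does not vanish has non-zero derivative
on at least six plaquettes, and if there are exactly six of them they surround an edge. -/
theorem curl_support (hσ : ∀ e ∉ W, σ e = 0) {P : Finset Plaquette}
    (hP : ∀ p, curl σ p ≠ 0 → p ∈ P) (hne : ∃ p, curl σ p ≠ 0) :
    6 ≤ (P.filter fun p => curl σ p ≠ 0).card ∧
      ((P.filter fun p => curl σ p ≠ 0).card ≤ 6 →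
        ∃ e g, ∀ p, curl σ p = curl (Pi.single e g) p) := by
  classical
  set V := P.image Prod.fst with hV
  -- `M i j` is the number of squares with circulation in the directions `i`, `j`.
  set M : Fin 4 → Fin 4 → ℕ := fun i j => (V.filter fun x => circ σ x i j ≠ 0).card with hM
  have hVmem : ∀ x i j, i ≠ j → circ σ x i j ≠ 0 → x ∈ V := by
    intro x i j hij h
    refine Finset.mem_image.2 ⟨plaqAt x i j, hP _ ?_, plaqAt_fst x i j⟩
    rwa [Ne, curl_plaqAt_eq_zero hij]
  have hsymm : ∀ i j, M i j = M j i := by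
    intro i j
    simp only [hM]
    congr 1
    refine Finset.filter_congr fun x _ => ?_
    rw [circ_swap σ x i j, neg_ne_zero]
  have hself : ∀ i, M i i = 0 := by
    intro i
    simp [hM, circ_self]
  have hT : 2 * (P.filter fun p => curl σ p ≠ 0).card = ∑ i, ∑ j, M i j := by
    have e1 : P.filter (fun p => curl σ p ≠ 0) =
        (V ×ˢ univ).filter fun p => curl σ p ≠ 0 := by
      ext p
      simp only [mem_filter, mem_product, mem_univ, and_true]
      exact ⟨fun h => ⟨Finset.mem_image_of_mem _ h.1, h.2⟩, fun h => ⟨hP p h.2, h.2⟩⟩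
    have e2 : (P.filter fun p => curl σ p ≠ 0).card =
        ∑ d : {d : Fin 4 × Fin 4 // d.1 < d.2}, M d.1.1 d.1.2 := by
      rw [e1, Finset.card_filter, Finset.sum_product_right]
      refine sum_congr rfl fun d _ => ?_
      simp only [hM]
      rw [Finset.card_filter]
      refine sum_congr rfl fun x _ => ?_
      rw [curl_eq_circ]
    rw [e2, ← Finset.sum_subtype (univ.filter fun d : Fin 4 × Fin 4 => d.1 < d.2)
      (by simp) (fun d => M d.1 d.2), Finset.sum_filter, Fintype.sum_prod_type]
    have h10 := hsymm 1 0
    have h20 := hsymm 2 0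
    have h30 := hsymm 3 0
    have h21 := hsymm 2 1
    have h31 := hsymm 3 1
    have h32 := hsymm 3 2
    simp only [Fin.sum_univ_four, hself, h10, h20, h30, h21, h31, h32]
    simp
    omega
  have h2 : ∀ i j, i ≠ j → M i j ≠ 0 → 2 ≤ M i j := by
    intro i j hij h
    obtain ⟨x, hx⟩ := Finset.card_pos.1 (Nat.pos_of_ne_zero h)
    have hx' := (mem_filter.1 hx).2
    obtain ⟨y, hy, _, hy'⟩ := exists_circ_ne_zero_plane hσ hij hx'
    have := Finset.one_lt_card.2 ⟨x, hx, y, mem_filter.2 ⟨hVmem y i j hij hy', hy'⟩, hy.symm⟩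
    exact this
  -- A square with circulation in the directions `i`, `j` forces one in the directions `i`, `k` or
  -- `j`, `k`, and these come in pairs.
  have h3 : ∀ i j k, i ≠ j → k ≠ i → k ≠ j → M i j ≠ 0 → 2 ≤ M i k + M j k := by
    intro i j k hij hki hkj h
    obtain ⟨x, hx⟩ := Finset.card_pos.1 (Nat.pos_of_ne_zero h)
    have hx' := (mem_filter.1 hx).2
    obtain ⟨y, _, hy⟩ := exists_circ_ne_zero_up hσ hki hkj hx'
    have h1 : M i k ≠ 0 ∨ M j k ≠ 0 := by
      rcases hy with hy | hy
      · exact Or.inl (Finset.card_ne_zero_of_mem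
          (mem_filter.2 ⟨hVmem y i k hki.symm hy, hy⟩))
      · exact Or.inr (Finset.card_ne_zero_of_mem
          (mem_filter.2 ⟨hVmem y j k hkj.symm hy, hy⟩))
    rcases h1 with h1 | h1
    · have := h2 _ _ hki.symm h1; omega
    · have := h2 _ _ hkj.symm h1; omega
  obtain ⟨p, hp⟩ := hne
  have hstart : ∃ i j, i ≠ j ∧ M i j ≠ 0 := by
    refine ⟨p.2.1.1, p.2.1.2, p.2.2.ne, ?_⟩
    rw [curl_eq_circ] at hp
    exact Finset.card_ne_zero_of_mem (mem_filter.2 ⟨hVmem _ _ _ p.2.2.ne hp, hp⟩)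
  obtain ⟨i, j, hij, hMij⟩ := hstart
  obtain ⟨h6, hcen⟩ := exists_center hsymm hself hT h2 h3 hij hMij
  refine ⟨h6, fun hle => ?_⟩
  obtain ⟨c, hc2, hc0⟩ := hcen hle
  exact curl_eq_single_of_center hσ hVmem hc2 hc0

end Classification

/-! ### Closed forms and the endpoints of a path -/

section Rays

variable {n : ℕ}

lemma evalChain_zsmul {α : Type} (σ : α → ZMod n) (c : ℤ) (q : α →₀ ℤ) :
    evalChain σ (c • q) = c • evalChain σ q := by
  rw [evalChain, Finsupp.sum_smul_index (by simp), evalChain, Finsupp.smul_sum]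
  simp [mul_assoc]

lemma boundary_add (q q' : Edge →₀ ℤ) : boundary (q + q') = boundary q + boundary q' :=
  Finsupp.sum_add_index' (by simp) fun a b c => by rw [add_smul]

lemma evalChain_edgeBoundary (ψ : Vertex → ZMod n) (e : Edge) :
    evalChain ψ (edgeBoundary e) = ψ (e.1 + unit e.2) - ψ e.1 := by
  simp [edgeBoundary, evalChain_sub, evalChain_single]

/-- Stokes' theorem for a path. -/
lemma evalChain_boundary (ψ : Vertex → ZMod n) (q : Edge →₀ ℤ) :
    evalChain ψ (boundary q) = evalChain (fun e => evalChain ψ (edgeBoundary e)) q := by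
  induction q using Finsupp.induction_linear with
  | zero => simp [boundary, evalChain]
  | add q q' h h' => rw [boundary_add, evalChain_add, evalChain_add, h, h']
  | single e c =>
    rw [evalChain_single, boundary, Finsupp.sum_single_index (by simp), evalChain_zsmul]

lemma curl_grad (ψ : Vertex → ZMod n) (p : Plaquette) :
    curl (fun e => evalChain ψ (edgeBoundary e)) p = 0 := by
  rw [curl_eq_circ, circ]
  simp only [evalChain_edgeBoundary]
  rw [add_right_comm p.1 (unit p.2.1.2) (unit p.2.1.1)]
  ring

lemma IsPath.card_support_boundary {γ : Edge →₀ ℤ} (h : IsPath γ) :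
    (boundary γ).support.card ≤ 2 := by
  rcases h with h | ⟨x, y, h⟩
  · simp [h.2]
  · rw [h.2]
    calc _ ≤ ({y, x} : Finset Vertex).card := by
          refine Finset.card_le_card fun z hz => ?_
          rw [Finsupp.mem_support_iff] at hz
          rw [Finset.mem_insert, Finset.mem_singleton]
          by_contra hcon
          push Not at hcon
          refine hz ?_
          rw [Finsupp.sub_apply, Finsupp.single_eq_of_ne hcon.1, Finsupp.single_eq_of_ne hcon.2,
            sub_zero]
      _ ≤ 2 := Finset.card_le_two

/-- The `t`-th edge on the line through `x` in the direction `0`. -/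
def ray (x : Vertex) (t : ℤ) : Edge := (x + t • unit 0, 0)

/-- If a closed form with finite support does not vanish on a path, its support surrounds one of
the endpoints of the path: it meets the line through the endpoint on both sides. The reason is that
the form is the gradient of a function with finite support, which is the sum of the form along a
half-line. -/
theorem exists_ray {W : Finset Edge} {η : Edge → ZMod n} (hη : ∀ e ∉ W, η e = 0)
    (hc : ∀ p, curl η p = 0) {γ : Edge →₀ ℤ} (h : evalChain η γ ≠ 0) :
    ∃ x ∈ (boundary γ).support, ∃ k l : ℕ, η (ray x k) ≠ 0 ∧ η (ray x (-(l + 1))) ≠ 0 := by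
  obtain ⟨R, hR⟩ : ∃ R : ℤ, ∀ e ∈ W, ∀ m, |e.1 m| ≤ R := by
    refine ⟨∑ e ∈ W, ∑ m, |e.1 m|, fun e he m => ?_⟩
    refine le_trans ?_ (Finset.single_le_sum (f := fun e : Edge => ∑ m, |e.1 m|)
      (fun e _ => sum_nonneg fun m _ => abs_nonneg _) he)
    exact Finset.single_le_sum (f := fun m => |e.1 m|) (fun m _ => abs_nonneg _)
      (mem_univ m)
  -- Far away in any coordinate the form vanishes.
  have hR0 : ∀ (y : Vertex) (j m : Fin 4), R < |y m| → η (y, j) = 0 := by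
    intro y j m hy
    exact hη _ fun hmem => absurd (hR _ hmem m) (not_le.2 hy)
  have hcirc : ∀ x i j, circ η x i j = 0 := by
    intro x i j
    by_cases hij : i = j
    · subst hij; exact circ_self _ _ _
    · rw [← curl_plaqAt_eq_zero hij]; exact hc _
  -- The potential that vanishes for large coordinates in the direction `0`.
  set ψ : Vertex → ZMod n := fun x =>
    -∑ k ∈ range (R + 1 - x 0).toNat, η (ray x k) with hψ
  have hstep : ∀ x, ψ (x + unit 0) - ψ x = η (x, 0) := by
    intro x
    simp only [hψ, Pi.add_apply, unit_self]
    rcases lt_or_ge (x 0) (R + 1) with hx | hx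
    · have e : (R + 1 - x 0).toNat = (R + 1 - (x 0 + 1)).toNat + 1 := by omega
      rw [e, Finset.sum_range_succ']
      have e2 : ∀ k : ℕ, ray x ((k + 1 : ℕ) : ℤ) = ray (x + unit 0) k := by
        intro k; simp only [ray, Nat.cast_succ, add_smul, one_smul]; congr 1; abel
      simp only [e2]
      simp [ray]
    · have e1 : (R + 1 - x 0).toNat = 0 := by omega
      have e2 : (R + 1 - (x 0 + 1)).toNat = 0 := by omega
      rw [e1, e2, hR0 x 0 0 (by rw [lt_abs]; omega)]
      simp
  have hgrad : ∀ e : Edge, evalChain ψ (edgeBoundary e) = η e := by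
    rintro ⟨x, j⟩
    rw [evalChain_edgeBoundary]
    simp only
    by_cases hj : j = 0
    · subst hj; exact hstep x
    -- For another direction `j`, induction from the far end of the half-line, using that the form
    -- is closed.
    have key : ∀ (t : ℕ) (x : Vertex), R + 1 - x 0 ≤ t → ψ (x + unit j) - ψ x = η (x, j) := by
      intro t
      induction t with
      | zero =>
        intro x hx
        have e1 : (R + 1 - x 0).toNat = 0 := by omega
        simp only [hψ, Pi.add_apply, unit_of_ne (Ne.symm hj), add_zero, e1]
        rw [hR0 x j 0 (by rw [lt_abs]; omega)]
        simp
      | succ t ih =>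
        intro x hx
        have h1 := ih (x + unit 0) (by rw [Pi.add_apply, unit_self]; push_cast at hx; omega)
        have h2 := hstep x
        have h3 := hstep (x + unit j)
        have h4 := hcirc x 0 j
        rw [circ] at h4
        rw [add_right_comm] at h1
        linear_combination h1 + h2 - h3 + h4
    exact key (R + 1 - x 0).toNat x (by omega)
  have hne : evalChain ψ (boundary γ) ≠ 0 := by
    rw [evalChain_boundary, funext hgrad]
    exact h
  obtain ⟨x, hx, hψx⟩ : ∃ x ∈ (boundary γ).support, ψ x ≠ 0 := by
    by_contra hcon
    push Not at hcon
    exact hne (evalChain_eq_zero hcon)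
  refine ⟨x, hx, ?_⟩
  obtain ⟨k, -, hk⟩ : ∃ k ∈ range (R + 1 - x 0).toNat, η (ray x k) ≠ 0 :=
    Finset.exists_ne_zero_of_sum_ne_zero fun h0 => hψx (by simp only [hψ, h0, neg_zero])
  suffices hl : ∃ l : ℕ, η (ray x (-(l + 1))) ≠ 0 from
    hl.elim fun l hl => ⟨k, l, hk, hl⟩
  by_contra hcon
  push Not at hcon
  -- If the form vanished on the other side of `x`, the potential would be constant there, although
  -- it vanishes far away: far to the left it is constant in the direction `1`.
  have hleft : ∀ t : ℕ, ψ (x - (t : ℤ) • unit 0) = ψ x := by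
    intro t
    induction t with
    | zero => simp
    | succ t ih =>
      have h1 := hstep (x - ((t + 1 : ℕ) : ℤ) • unit 0)
      have h2 := hcon t
      have e : x - ((t + 1 : ℕ) : ℤ) • unit 0 + unit 0 = x - (t : ℤ) • unit 0 := by
        rw [Nat.cast_succ, add_smul, one_smul]; abel
      have e' : (x - ((t + 1 : ℕ) : ℤ) • unit 0, (0 : Fin 4)) = ray x (-(t + 1)) := by
        simp only [ray, Nat.cast_succ, neg_smul]; rw [sub_eq_add_neg]
      rw [e, e', h2] at h1
      rw [← ih]
      linear_combination -h1
  set y : Vertex := x - ((R + x 0 + 1).toNat : ℤ) • unit 0 with hy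
  have hy0 : R < |y 0| ∨ R < 0 := by
    rw [hy]
    simp only [Pi.sub_apply, Pi.smul_apply, unit_self, smul_eq_mul, mul_one]
    rw [lt_abs]
    omega
  have hzero : ∀ t : ℕ, ψ (y + (t : ℤ) • unit 1) = ψ y := by
    intro t
    induction t with
    | zero => simp
    | succ t ih =>
      have h1 := hgrad (y + (t : ℤ) • unit 1, 1)
      rw [evalChain_edgeBoundary] at h1
      have h2 : η (y + (t : ℤ) • unit 1, 1) = 0 := by
        rcases hy0 with h0 | h0
        · refine hR0 _ _ 0 ?_
          simpa [unit_of_ne (show (0 : Fin 4) ≠ 1 by decide)] using h0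
        · exact hR0 _ _ 0 (lt_of_lt_of_le h0 (abs_nonneg _))
      rw [h2] at h1
      simp only at h1
      rw [Nat.cast_succ, add_smul, one_smul, ← add_assoc, ← ih]
      linear_combination h1
  have hfar : ψ (y + ((R - y 1 + 1).toNat : ℤ) • unit 1) = 0 := by
    simp only [hψ]
    rw [Finset.sum_eq_zero, neg_zero]
    intro k _
    refine hR0 _ _ 1 ?_
    simp only [Pi.add_apply, Pi.smul_apply, unit_self, smul_eq_mul, mul_one,
      unit_of_ne (show (1 : Fin 4) ≠ 0 by decide), mul_zero, add_zero]
    rw [lt_abs]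
    omega
  rw [hzero, hy, hleft] at hfar
  exact hψx hfar

end Rays

/-! ### Separability of the weights, and fluctuating edges -/

section Separability

variable {n : ℕ}

lemma curl_congr {σ τ : Edge → ZMod n} {p : Plaquette} (h : ∀ e ∈ plaqEdges p, σ e = τ e) :
    curl σ p = curl τ p :=
  evalChain_congr fun e he => h e (by rwa [support_plaquetteBoundary] at he)

lemma curl_eq_zero {σ : Edge → ZMod n} {p : Plaquette} (h : ∀ e ∈ plaqEdges p, σ e = 0) :
    curl σ p = 0 :=
  evalChain_eq_zero fun e he => h e (by rwa [support_plaquetteBoundary] at he)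

lemma curl_zero (p : Plaquette) : curl (0 : Edge → ZMod n) p = 0 := curl_eq_zero fun _ _ => rfl

/-- The part of `ω` on `S`. -/
def res (S : Finset Edge) (ω : Edge → ZMod n) : Edge → ZMod n := S.piecewise ω 0

/-- The part of `ω` off `S`. -/
def cores (S : Finset Edge) (ω : Edge → ZMod n) : Edge → ZMod n := S.piecewise 0 ω

lemma res_mem {S : Finset Edge} {e : Edge} (h : e ∈ S) (ω : Edge → ZMod n) : res S ω e = ω e := by
  simp [res, h]

lemma res_notMem {S : Finset Edge} {e : Edge} (h : e ∉ S) (ω : Edge → ZMod n) :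
    res S ω e = 0 := by simp [res, h]

lemma cores_mem {S : Finset Edge} {e : Edge} (h : e ∈ S) (ω : Edge → ZMod n) :
    cores S ω e = 0 := by simp [cores, h]

lemma cores_notMem {S : Finset Edge} {e : Edge} (h : e ∉ S) (ω : Edge → ZMod n) :
    cores S ω e = ω e := by simp [cores, h]

/-- All non-zero edges of a plaquette lie on the same side of a cut. -/
lemma Cuts.plaquette {S : Finset Edge} {ω : Edge → ZMod n} (h : Cuts nbr S ω) (p : Plaquette) :
    ((∀ f ∈ plaqEdges p, res S ω f = ω f) ∧ ∀ f ∈ plaqEdges p, cores S ω f = 0) ∨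
      ((∀ f ∈ plaqEdges p, res S ω f = 0) ∧ ∀ f ∈ plaqEdges p, cores S ω f = ω f) := by
  by_cases hp : ∃ f ∈ plaqEdges p, f ∈ S ∧ ω f ≠ 0
  · obtain ⟨f, hf, hfS, hf0⟩ := hp
    have key : ∀ f' ∈ plaqEdges p, f' ∉ S → ω f' = 0 := by
      intro f' hf' hf'S
      by_contra h0
      exact h f hfS f' hf'S hf0 h0 (mem_nbr.2 ⟨fun h' => hf'S (h' ▸ hfS), p, hf, hf'⟩)
    left
    refine ⟨fun f' hf' => ?_, fun f' hf' => ?_⟩ <;> by_cases hS : f' ∈ S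
    · exact res_mem hS ω
    · rw [res_notMem hS, key f' hf' hS]
    · exact cores_mem hS ω
    · rw [cores_notMem hS, key f' hf' hS]
  · push Not at hp
    right
    refine ⟨fun f' hf' => ?_, fun f' hf' => ?_⟩ <;> by_cases hS : f' ∈ S
    · rw [res_mem hS, hp f' hf' hS]
    · exact res_notMem hS ω
    · rw [cores_mem hS, hp f' hf' hS]
    · exact cores_notMem hS ω

lemma Cuts.curl {S : Finset Edge} {ω : Edge → ZMod n} (h : Cuts nbr S ω) (p : Plaquette) :
    (LatticeHiggs.curl (res S ω) p = LatticeHiggs.curl ω p ∧ LatticeHiggs.curl (cores S ω) p = 0) ∨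
      (LatticeHiggs.curl (res S ω) p = 0 ∧
        LatticeHiggs.curl (cores S ω) p = LatticeHiggs.curl ω p) :=
  (h.plaquette p).imp (fun h => ⟨curl_congr h.1, curl_eq_zero h.2⟩)
    fun h => ⟨curl_eq_zero h.1, curl_congr h.2⟩

/-- The edges next to a non-zero edge lie on the same side of a cut. -/
lemma Cuts.res_nbr {S : Finset Edge} {ω : Edge → ZMod n} (h : Cuts nbr S ω) {e : Edge}
    (he : e ∈ S) (h0 : ω e ≠ 0) : ∀ f ∈ nbr e, res S ω f = ω f := by
  intro f hf
  by_cases hS : f ∈ S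
  · exact res_mem hS ω
  · rw [res_notMem hS]
    by_contra h1
    exact h e he f hS h0 (Ne.symm h1) hf

lemma Cuts.cores_nbr {S : Finset Edge} {ω : Edge → ZMod n} (h : Cuts nbr S ω) {e : Edge}
    (he : e ∉ S) (h0 : ω e ≠ 0) : ∀ f ∈ nbr e, cores S ω f = ω f := by
  intro f hf
  by_cases hS : f ∈ S
  · rw [cores_mem hS]
    by_contra h1
    exact h f hS e he (Ne.symm h1) h0 (nbr_symm _ _ hf)
  · exact cores_notMem hS ω

lemma separable_plaquette {R : Type*} [CommSemiring R] {b : ZMod n → R} (hb : b 0 = 1)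
    (p : Plaquette) : Separable nbr fun ω : Edge → ZMod n => b (curl ω p) := by
  refine ⟨(congrArg b (curl_zero p)).trans hb, fun ω S hS => ?_⟩
  show b (curl ω p) = b (curl (res S ω) p) * b (curl (cores S ω) p)
  rcases hS.curl p with h | h <;> rw [h.1, h.2, hb] <;> simp

/-! ### Edges with a preferred value -/

/-- All plaquettes at `e` are flat. -/
def ClosedAround (e : Edge) (ω : Edge → ZMod n) : Prop := ∀ p ∈ star e, curl ω p = 0

lemma curl_update_congr {e : Edge} {ω ω' : Edge → ZMod n} (h : ∀ f ∈ nbr e, ω f = ω' f)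
    (x : ZMod n) {p : Plaquette} (hp : p ∈ star e) :
    curl (update ω e x) p = curl (update ω' e x) p := by
  refine curl_congr fun f hf => ?_
  by_cases hfe : f = e
  · subst hfe; simp
  · rw [update_of_ne hfe, update_of_ne hfe]
    exact h f (mem_nbr.2 ⟨hfe, p, mem_star.1 hp, hf⟩)

lemma closedAround_update_congr {e : Edge} {ω ω' : Edge → ZMod n} (h : ∀ f ∈ nbr e, ω f = ω' f)
    (x : ZMod n) :
    ClosedAround e (update ω e x) ↔ ClosedAround e (update ω' e x) :=
  forall₂_congr fun p hp => by rw [curl_update_congr h x hp]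

lemma star_nonempty (e : Edge) : (star e).Nonempty := by
  rw [← Finset.card_pos, card_star]; norm_num

/-- The values of the plaquettes at `e` after giving `e` the value `x`, relative to a value `h` at
which they are all flat. -/
lemma curl_update_of_closedAround {e : Edge} {ω : Edge → ZMod n} {h : ZMod n}
    (hc : ClosedAround e (update ω e h)) (x : ZMod n) {p : Plaquette} (hp : p ∈ star e) :
    curl (update ω e x) p = plaquetteBoundary p e • (x - h) := by
  have h1 := hc p hp
  rw [curl_update] at h1 ⊢
  have : curl ω p = -(plaquetteBoundary p e • (h - ω e)) := eq_neg_of_add_eq_zero_left h1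
  rw [this, smul_sub, smul_sub, smul_sub]
  abel

lemma closedAround_unique {e : Edge} {ω : Edge → ZMod n} {h h' : ZMod n}
    (hc : ClosedAround e (update ω e h)) (hc' : ClosedAround e (update ω e h')) :
    h = h' := by
  obtain ⟨p, hp⟩ := star_nonempty e
  have h1 := curl_update_of_closedAround hc h' hp
  rw [hc' p hp] at h1
  rcases plaquetteBoundary_apply_mem (mem_star.1 hp) with h2 | h2 <;> rw [h2] at h1
  · rw [one_smul] at h1; exact (sub_eq_zero.1 h1.symm).symm
  · rw [neg_smul, one_smul] at h1; exact (sub_eq_zero.1 (neg_eq_zero.1 h1.symm)).symm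

lemma curl_ne_zero_of_closedAround {e : Edge} {ω : Edge → ZMod n} {h : ZMod n}
    (hc : ClosedAround e (update ω e h)) (hne : ω e ≠ h) {p : Plaquette}
    (hp : p ∈ star e) : curl ω p ≠ 0 := by
  have h1 := curl_update_of_closedAround hc (ω e) hp
  rw [Function.update_eq_self] at h1
  rw [h1]
  rcases plaquetteBoundary_apply_mem (mem_star.1 hp) with h2 | h2 <;> rw [h2]
  · rw [one_smul]; exact sub_ne_zero.2 hne
  · rw [neg_smul, one_smul]; exact neg_ne_zero.2 (sub_ne_zero.2 hne)

variable (H : ZMod n → Prop)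

/-- The edges around `e` single out a value `h` of the edge `e` for which all plaquettes at `e` are
flat, and this value is admissible. -/
def Pinned (e : Edge) (ω : Edge → ZMod n) : Prop :=
  ∃ h, H h ∧ ClosedAround e (update ω e h)

/-- If the edges around `e` single out an admissible value, then `ω` takes this value at `e`. -/
def RedAt (e : Edge) (ω : Edge → ZMod n) : Prop :=
  ∀ h, H h → ClosedAround e (update ω e h) → ω e = h

/-- The configuration takes the pinned value at every edge of `T`. -/
def Red (T : Finset Edge) (ω : Edge → ZMod n) : Prop := ∀ e ∈ T, RedAt H e ω

/-- Every connected component of `ω` takes the pinned value at every edge of `T`. -/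
def LocRed (T : Finset Edge) (ω : Edge → ZMod n) : Prop :=
  ∀ C v, IsConn nbr v C → (∀ e ∈ C, ω e ≠ 0) → Cuts nbr C ω → Red H T (res C ω)

variable {H} {T : Finset Edge} {ω : Edge → ZMod n}

lemma pinned_congr {e : Edge} {ω' : Edge → ZMod n} (h : ∀ f ∈ nbr e, ω f = ω' f) :
    Pinned H e ω ↔ Pinned H e ω' :=
  exists_congr fun x => and_congr_right fun _ => closedAround_update_congr h x

lemma redAt_congr {e : Edge} {ω' : Edge → ZMod n} (h : ∀ f ∈ nbr e, ω f = ω' f)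
    (he : ω e = ω' e) : RedAt H e ω ↔ RedAt H e ω' :=
  forall₂_congr fun x _ => by rw [closedAround_update_congr h x, he]

lemma pinned_update (e : Edge) (x : ZMod n) : Pinned H e (update ω e x) ↔ Pinned H e ω :=
  pinned_congr fun _ hf => update_of_ne (mem_nbr.1 hf).1 _ _

lemma redAt_of_closedAround {e : Edge} (hc : ClosedAround e ω) : RedAt H e ω := by
  intro h _ hch
  refine closedAround_unique ?_ hch
  rwa [Function.update_eq_self]

/-- The component of a non-zero edge. -/
lemma exists_component {W : Finset Edge} (hW : ∀ f ∉ W, ω f = 0) {e : Edge} (he : ω e ≠ 0) :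
    ∃ C ⊆ W, IsConn nbr e C ∧ (∀ f ∈ C, ω f ≠ 0) ∧ Cuts nbr C ω := by
  classical
  set U := W.filter fun f => ω f ≠ 0 with hU
  have hmem : ∀ f, ω f ≠ 0 → f ∈ U := fun f hf =>
    mem_filter.2 ⟨by_contra fun h => hf (hW f h), hf⟩
  refine ⟨comp nbr U e, (comp_subset U e).trans (Finset.filter_subset _ _),
    isConn_comp (hmem e he), fun f hf => (mem_filter.1 (comp_subset U e hf)).2, ?_⟩
  intro a ha b hb _ h2 hab
  exact hull_comp_disjoint U e (hmem b h2) hb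
    (Finset.mem_union_right _ (Finset.mem_biUnion.2 ⟨a, ha, hab⟩))

lemma LocRed.redAt {W : Finset Edge} (hW : ∀ f ∉ W, ω f = 0) (h : LocRed H T ω) {e : Edge}
    (he : e ∈ T) (h0 : ω e ≠ 0) : RedAt H e ω := by
  obtain ⟨C, -, hC, hC0, hcut⟩ := exists_component hW h0
  refine (redAt_congr (fun f hf => ?_) ?_).1 (h C e hC hC0 hcut e he)
  · exact hcut.res_nbr hC.1 h0 f hf
  · exact res_mem hC.1 ω

lemma Cuts.closed {S : Finset Edge} (h : Cuts nbr S ω) (hc : ∀ p, LatticeHiggs.curl ω p = 0)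
    (p : Plaquette) : LatticeHiggs.curl (res S ω) p = 0 := by
  rcases h.curl p with h | h
  · rw [h.1, hc]
  · exact h.1

lemma locRed_of_closed (hc : ∀ p, curl ω p = 0) : LocRed H T ω :=
  fun _ _ _ _ hcut _ _ => redAt_of_closedAround fun p _ => hcut.closed hc p

/-- Pinned values restrict to components: an edge whose plaquettes are flattened by changing a
component alone is surrounded by that component. -/
lemma Red.locRed (h : Red H T ω) : LocRed H T ω := by
  intro C v hC hC0 hcut e he x hx hcl
  by_cases hω : ω e = 0
  · have hr : res C ω e = 0 := by
      by_cases heC : e ∈ C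
      · exact absurd hω (hC0 e heC)
      · exact res_notMem heC ω
    rw [hr]
    by_contra hx0
    -- every plaquette at `e` contains a non-zero edge of the component, hence none outside it
    have hag : ∀ f ∈ nbr e, res C ω f = ω f := by
      intro f hf
      obtain ⟨hfe, p, hep, hfp⟩ := mem_nbr.1 hf
      have hne : curl (res C ω) p ≠ 0 :=
        curl_ne_zero_of_closedAround hcl (by rw [hr]; exact hx0) (mem_star.2 hep)
      rcases hcut.plaquette p with h1 | h1
      · exact h1.1 f hfp
      · exact absurd (curl_eq_zero h1.1) hne
    have := h e he x hx ((closedAround_update_congr hag x).1 hcl)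
    exact hx0 (hω.symm.trans this)
  · by_cases heC : e ∈ C
    · rw [res_mem heC]
      exact h e he x hx ((closedAround_update_congr (hcut.res_nbr heC hω) x).1 hcl)
    · rw [res_notMem heC]
      have hz : ∀ f ∈ nbr e, res C ω f = (0 : Edge → ZMod n) f := by
        intro f hf
        by_cases hfC : f ∈ C
        · exact absurd (nbr_symm _ _ hf) (hcut f hfC e heC (hC0 f hfC) hω)
        · exact res_notMem hfC ω
      have h1 := (closedAround_update_congr hz x).1 hcl
      refine closedAround_unique (e := e) (ω := 0) ?_ h1
      intro p _
      have h2 : update (0 : Edge → ZMod n) e 0 = 0 := Function.update_eq_self e 0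
      rw [h2]
      exact curl_zero p

/-- A configuration with few non-flat plaquettes takes its pinned values as soon as its components
do: the non-flat plaquettes are too few to be shared by two components. -/
lemma LocRed.redAt_of_card_le {W : Finset Edge} (hW : ∀ f ∉ W, ω f = 0) (h : LocRed H T ω)
    {P : Finset Plaquette} (hP : ∀ p, curl ω p ≠ 0 → p ∈ P)
    (hcard : (P.filter fun p => curl ω p ≠ 0).card ≤ 6) {e : Edge} (he : e ∈ T) :
    RedAt H e ω := by
  intro x hx hcl
  by_contra hne
  have h0 : ω e = 0 := by
    by_contra h0
    exact hne (h.redAt hW he h0 x hx hcl)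
  -- If the value at `e` is not the pinned one, then `e` is zero and its six plaquettes are the non-
  -- flat ones. The component `C` of an edge next to `e` has six non-flat plaquettes by itself, so
  -- it agrees with `ω` around `e`.
  have hstar : star e ⊆ P.filter fun p => curl ω p ≠ 0 := by
    intro p hp
    have := curl_ne_zero_of_closedAround hcl hne hp
    exact mem_filter.2 ⟨hP p this, this⟩
  obtain ⟨p₀, hp₀⟩ := star_nonempty e
  have hp₀' := (mem_filter.1 (hstar hp₀)).2
  obtain ⟨f, hf, hf0⟩ : ∃ f ∈ plaqEdges p₀, ω f ≠ 0 := by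
    by_contra hcon
    push Not at hcon
    exact hp₀' (curl_eq_zero hcon)
  obtain ⟨C, hCW, hC, hC0, hcut⟩ := exists_component hW hf0
  have hres : ∀ p, curl (res C ω) p ≠ 0 → curl (res C ω) p = curl ω p := by
    intro p hp
    rcases hcut.curl p with h1 | h1
    · exact h1.1
    · exact absurd h1.1 hp
  have hp₀C : curl (res C ω) p₀ ≠ 0 := by
    rcases hcut.plaquette p₀ with h1 | h1
    · rw [curl_congr h1.1]; exact hp₀'
    · have := h1.1 f hf
      rw [res_mem hC.1] at this
      exact absurd this hf0
  have h6 := (curl_support (σ := res C ω) (W := C) (fun f hf => res_notMem hf ω) (P := P)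
    (fun p hp => hP p (by rwa [hres p hp] at hp)) ⟨p₀, hp₀C⟩).1
  have hsub : (P.filter fun p => curl (res C ω) p ≠ 0) ⊆ P.filter fun p => curl ω p ≠ 0 := by
    intro p hp
    rw [mem_filter] at hp ⊢
    exact ⟨hp.1, by rw [← hres p hp.2]; exact hp.2⟩
  have heq := Finset.eq_of_subset_of_card_le hsub (hcard.trans h6)
  have hr : res C ω e = 0 := by
    by_cases heC : e ∈ C
    · rw [res_mem heC, h0]
    · exact res_notMem heC ω
  have hcl' : ClosedAround e (update (res C ω) e x) := by
    intro p hp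
    have h1 := hcl p hp
    have h2 := hstar hp
    rw [← heq] at h2
    rw [curl_update] at h1 ⊢
    rw [hres p (mem_filter.1 h2).2, hr]
    rwa [h0] at h1
  have := h C f hC hC0 hcut e he x hx hcl'
  rw [hr] at this
  exact hne (h0.trans this)

/-- A factor for every non-zero edge with a pinned value is separable. -/
lemma separable_pinned {R : Type*} [CommSemiring R] (e : Edge) (v : ZMod n → R) :
    open Classical in Separable nbr fun ω : Edge → ZMod n =>
      if ω e ≠ 0 ∧ Pinned H e ω then v (ω e) else 1 := by
  classical
  refine ⟨by simp, fun ω S hS => ?_⟩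
  show (if ω e ≠ 0 ∧ Pinned H e ω then v (ω e) else 1) =
    (if res S ω e ≠ 0 ∧ Pinned H e (res S ω) then v (res S ω e) else 1) *
    (if cores S ω e ≠ 0 ∧ Pinned H e (cores S ω) then v (cores S ω e) else 1)
  by_cases h0 : ω e = 0
  · have h1 : res S ω e = 0 := by by_cases he : e ∈ S <;> simp [res, he, h0]
    have h2 : cores S ω e = 0 := by by_cases he : e ∈ S <;> simp [cores, he, h0]
    simp [h0, h1, h2]
  · by_cases he : e ∈ S
    · rw [res_mem he, cores_mem he, pinned_congr (hS.res_nbr he h0)]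
      simp
    · rw [res_notMem he, cores_notMem he, pinned_congr (hS.cores_nbr he h0)]
      simp

/-- The components of a configuration are those of its two parts. -/
lemma locRed_cut {S : Finset Edge} (hS : Cuts nbr S ω) :
    LocRed H T ω ↔ LocRed H T (res S ω) ∧ LocRed H T (cores S ω) := by
  constructor
  · intro h
    refine ⟨fun C v hC hC0 hcut => ?_, fun C v hC hC0 hcut => ?_⟩
    · have hCS : C ⊆ S := fun f hf => by_contra fun h' => hC0 f hf (res_notMem h' ω)
      have hC0' : ∀ f ∈ C, ω f ≠ 0 := fun f hf => by
        have := hC0 f hf; rwa [res_mem (hCS hf)] at this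
      have hcut' : Cuts nbr C ω := by
        intro a ha b hb h1 h2
        by_cases hbS : b ∈ S
        · exact hcut a ha b hb (hC0 a ha) (by rwa [res_mem hbS])
        · exact hS a (hCS ha) b hbS h1 h2
      have e : res C (res S ω) = res C ω := by
        funext f
        by_cases hf : f ∈ C
        · rw [res_mem hf, res_mem hf, res_mem (hCS hf)]
        · rw [res_notMem hf, res_notMem hf]
      rw [e]
      exact h C v hC hC0' hcut'
    · have hCS : ∀ f ∈ C, f ∉ S := fun f hf h' => hC0 f hf (cores_mem h' ω)
      have hC0' : ∀ f ∈ C, ω f ≠ 0 := fun f hf => by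
        have := hC0 f hf; rwa [cores_notMem (hCS f hf)] at this
      have hcut' : Cuts nbr C ω := by
        intro a ha b hb h1 h2
        by_cases hbS : b ∈ S
        · intro hab
          exact hS b hbS a (hCS a ha) h2 h1 (nbr_symm _ _ hab)
        · exact hcut a ha b hb (hC0 a ha) (by rwa [cores_notMem hbS])
      have e : res C (cores S ω) = res C ω := by
        funext f
        by_cases hf : f ∈ C
        · rw [res_mem hf, res_mem hf, cores_notMem (hCS f hf)]
        · rw [res_notMem hf, res_notMem hf]
      rw [e]
      exact h C v hC hC0' hcut'
  · rintro ⟨h1, h2⟩ C v hC hC0 hcut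
    -- a connected set of non-zero edges lies on one side of the cut
    have hside : ∀ u ∈ C, (u ∈ S ↔ v ∈ S) := by
      intro u hu
      have hr := hC.2 u hu
      clear hu
      suffices h : u ∈ C ∧ (u ∈ S ↔ v ∈ S) from h.2
      induction hr with
      | refl => exact ⟨hC.1, Iff.rfl⟩
      | @tail b c _ hbc ih =>
        refine ⟨hbc.2, Iff.trans ?_ ih.2⟩
        constructor
        · intro hc
          by_contra hb
          exact hS c hc b hb (hC0 c hbc.2) (hC0 b ih.1) (nbr_symm _ _ hbc.1)
        · intro hb
          by_contra hc
          exact hS b hb c hc (hC0 b ih.1) (hC0 c hbc.2) hbc.1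
    by_cases hv : v ∈ S
    · have hCS : ∀ f ∈ C, f ∈ S := fun f hf => (hside f hf).2 hv
      have e : res C (res S ω) = res C ω := by
        funext f
        by_cases hf : f ∈ C
        · rw [res_mem hf, res_mem hf, res_mem (hCS f hf)]
        · rw [res_notMem hf, res_notMem hf]
      rw [← e]
      refine h1 C v hC (fun f hf => by rw [res_mem (hCS f hf)]; exact hC0 f hf) ?_
      intro a ha b hb h3 h4
      have hbS : b ∈ S := by_contra fun h' => h4 (res_notMem h' ω)
      exact hcut a ha b hb (hC0 a ha) (by rwa [res_mem hbS] at h4)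
    · have hCS : ∀ f ∈ C, f ∉ S := fun f hf h' => hv ((hside f hf).1 h')
      have e : res C (cores S ω) = res C ω := by
        funext f
        by_cases hf : f ∈ C
        · rw [res_mem hf, res_mem hf, cores_notMem (hCS f hf)]
        · rw [res_notMem hf, res_notMem hf]
      rw [← e]
      refine h2 C v hC (fun f hf => by rw [cores_notMem (hCS f hf)]; exact hC0 f hf) ?_
      intro a ha b hb h3 h4
      have hbS : b ∉ S := fun h' => h4 (cores_mem h' ω)
      exact hcut a ha b hb (hC0 a ha) (by rwa [cores_notMem hbS] at h4)

lemma separable_locRed : open Classical in Separable nbr fun ω : Edge → ZMod n =>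
    if LocRed H T ω then (1 : ℝ) else 0 := by
  classical
  refine ⟨if_pos (locRed_of_closed curl_zero), fun ω S hS => ?_⟩
  show (if LocRed H T ω then (1 : ℝ) else 0) =
    (if LocRed H T (res S ω) then (1 : ℝ) else 0) * (if LocRed H T (cores S ω) then (1 : ℝ) else 0)
  by_cases h1 : LocRed H T (res S ω) <;> by_cases h2 : LocRed H T (cores S ω) <;>
    simp [locRed_cut hS, h1, h2]

end Separability

/-! ### Comparison of two weights -/

section Compare

variable {E A : Type*} [DecidableEq E] [Zero A] [Fintype A] [DecidableEq A] {nb : E → Finset E}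

open Classical in
/-- The expectation of `f` under the weight `w` on the configurations supported in `W`. -/
def avg (w : (E → A) → ℝ) (W : Finset E) (f : (E → A) → ℂ) : ℂ :=
  (∑ ω ∈ Conf A W, (w ω : ℂ) * f ω) / ((∑ ω ∈ Conf A W, w ω : ℝ) : ℂ)

lemma sum_weight_pos {w : (E → A) → ℝ} (h0 : ∀ ω, 0 ≤ w ω) (h1 : w 0 = 1) (W : Finset E) :
    0 < ∑ ω ∈ Conf A W, w ω :=
  Finset.sum_pos' (fun ω _ => h0 ω) ⟨0, mem_conf.2 fun _ _ => rfl, by rw [h1]; norm_num⟩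

lemma norm_avg_le {w : (E → A) → ℝ} (h0 : ∀ ω, 0 ≤ w ω) (h1 : w 0 = 1) {W : Finset E}
    {f : (E → A) → ℂ} {c : ℝ} (hf : ∀ ω, ‖f ω‖ ≤ c) : ‖avg w W f‖ ≤ c := by
  have hp := sum_weight_pos h0 h1 W
  rw [avg, norm_div, Complex.norm_real, Real.norm_of_nonneg hp.le, div_le_iff₀ hp]
  refine (norm_sum_le _ _).trans ?_
  rw [mul_sum]
  refine sum_le_sum fun ω _ => ?_
  rw [norm_mul, Complex.norm_real, Real.norm_of_nonneg (h0 ω), mul_comm]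
  exact mul_le_mul_of_nonneg_right (hf ω) (h0 ω)

open Classical in
/-- Two observables with the same weight have expectations that differ by the sum over connected
sets `C` of the differences restricted to configurations with support `C`. -/
theorem norm_sum_sub_le {Φ M : (E → A) → ℝ} {F₁ F₂ : (E → A) → ℂ} (hΦ : Separable nb Φ)
    (hM : Separable nb M) (h₁ : Separable nb F₁) (h₂ : Separable nb F₂) (h0 : ∀ ω, 0 ≤ Φ ω)
    (b₁ : ∀ ω, ‖F₁ ω‖ ≤ M ω) (b₂ : ∀ ω, ‖F₂ ω‖ ≤ M ω) {c : ℝ} (hc : 0 ≤ c)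
    (hcM : ∀ ω, c * M ω ≤ 1) (W : Finset E) :
    c * ‖∑ ω ∈ Conf A W, (Φ ω : ℂ) * F₁ ω - ∑ ω ∈ Conf A W, (Φ ω : ℂ) * F₂ ω‖ ≤
      (∑ ω ∈ Conf A W, Φ ω) * ∑ C ∈ W.powerset with ∃ v, IsConn nb v C,
        ‖∑ ω ∈ ConfNZ A C, (Φ ω : ℂ) * (F₁ ω - F₂ ω)‖ := by
  have hΦc : Separable nb fun ω => (Φ ω : ℂ) := hΦ.map Complex.ofRealHom
  have key := norm_polyZ_sub_le (setSep_act (hΦ.mul hM)) (setSep_act (hΦc.mul h₁))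
    (setSep_act (hΦc.mul h₂)) (fun U => ?_) (fun U => ?_) W
  · rw [polyZ_act, polyZ_act, polyZ_act] at key
    have hD : ∀ C, act (fun ω => (Φ ω : ℂ) * F₁ ω) C - act (fun ω => (Φ ω : ℂ) * F₂ ω) C =
        ∑ ω ∈ ConfNZ A C, (Φ ω : ℂ) * (F₁ ω - F₂ ω) := by
      intro C
      simp only [act, mul_sub, Finset.sum_sub_distrib]
    simp only [hD] at key
    refine (mul_le_mul_of_nonneg_left key hc).trans ?_
    rw [← mul_assoc]
    refine mul_le_mul_of_nonneg_right ?_ (sum_nonneg fun _ _ => norm_nonneg _)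
    rw [mul_sum]
    refine sum_le_sum fun ω _ => ?_
    calc c * (Φ ω * M ω) = Φ ω * (c * M ω) := by ring
      _ ≤ Φ ω * 1 := mul_le_mul_of_nonneg_left (hcM ω) (h0 ω)
      _ = Φ ω := mul_one _
  all_goals
    refine (norm_sum_le _ _).trans (sum_le_sum fun ω _ => ?_)
    rw [norm_mul, Complex.norm_real, Real.norm_of_nonneg (h0 ω)]
    first
    | exact mul_le_mul_of_nonneg_left (b₁ ω) (h0 ω)
    | exact mul_le_mul_of_nonneg_left (b₂ ω) (h0 ω)

/-- An independent pair is a configuration with values in a product. -/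
lemma sum_pair (w w' : (E → A) → ℝ) (f g : (E → A) → ℂ) (W : Finset E) :
    ∑ ω ∈ Conf (A × A) W, ((w (fun e => (ω e).1) * w' (fun e => (ω e).2) : ℝ) : ℂ) *
      (f (fun e => (ω e).1) * g (fun e => (ω e).2)) =
    (∑ ω ∈ Conf A W, (w ω : ℂ) * f ω) * ∑ ω ∈ Conf A W, (w' ω : ℂ) * g ω := by
  rw [sum_conf_prod W fun σ τ => ((w σ * w' τ : ℝ) : ℂ) * (f σ * g τ), Finset.sum_mul_sum]
  refine sum_congr rfl fun σ _ => sum_congr rfl fun τ _ => ?_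
  push_cast; ring

open Classical in
/-- Comparison of the expectation of a product `f * g` under `w` with the product of the
expectations of `f` under `w` and of `g` under `w'`, or, for `f = 1`, of two expectations of the
same observable. -/
theorem norm_avg_sub_le {w w' : (E → A) → ℝ} {f g : (E → A) → ℂ} {M : (E → A × A) → ℝ}
    (hw : Separable nb w) (hw' : Separable nb w') (hM : Separable nb M) (hf : Separable nb f)
    (hg : Separable nb g) (h0 : ∀ ω, 0 ≤ w ω) (h0' : ∀ ω, 0 ≤ w' ω)
    (b₁ : ∀ ω, ‖f (fun e => (ω e).1) * g (fun e => (ω e).1)‖ ≤ M ω)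
    (b₂ : ∀ ω, ‖f (fun e => (ω e).1) * g (fun e => (ω e).2)‖ ≤ M ω) {c : ℝ} (hc : 0 ≤ c)
    (hcM : ∀ ω, c * M ω ≤ 1) (W : Finset E) :
    c * ‖avg w W (fun ω => f ω * g ω) - avg w W f * avg w' W g‖ ≤
      ∑ C ∈ W.powerset with ∃ v, IsConn nb v C,
        ‖∑ ω ∈ ConfNZ (A × A) C,
          ((w (fun e => (ω e).1) * w' (fun e => (ω e).2) : ℝ) : ℂ) *
            (f (fun e => (ω e).1) * g (fun e => (ω e).1) -
              f (fun e => (ω e).1) * g (fun e => (ω e).2))‖ := by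
  have s1 : ∀ {R : Type} [CommSemiring R] {Φ : (E → A) → R}, Separable nb Φ →
      Separable nb fun ω : E → A × A => Φ fun e => (ω e).1 := fun h => h.comp Prod.fst rfl
  have s2 : ∀ {R : Type} [CommSemiring R] {Φ : (E → A) → R}, Separable nb Φ →
      Separable nb fun ω : E → A × A => Φ fun e => (ω e).2 := fun h => h.comp Prod.snd rfl
  have key := norm_sum_sub_le (Φ := fun ω : E → A × A => w (fun e => (ω e).1) * w' (fun e => (ω e).2))
    ((s1 hw).mul (s2 hw')) hM ((s1 hf).mul (s1 hg)) ((s1 hf).mul (s2 hg))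
    (fun ω => mul_nonneg (h0 _) (h0' _)) b₁ b₂ hc hcM W
  have hZ := sum_weight_pos h0 hw.1 W
  have hZ' := sum_weight_pos h0' hw'.1 W
  have e1 := sum_pair w w' (fun ω => f ω * g ω) 1 W
  have e2 := sum_pair w w' f g W
  have e3 := sum_pair w w' 1 1 W
  simp only [Pi.one_apply, mul_one] at e1 e3
  rw [e1, e2] at key
  have e4 : (∑ ω ∈ Conf (A × A) W, w (fun e => (ω e).1) * w' (fun e => (ω e).2) : ℝ) =
      (∑ ω ∈ Conf A W, w ω) * ∑ ω ∈ Conf A W, w' ω := by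
    have h := e3
    exact_mod_cast h
  rw [e4] at key
  set Z := ∑ ω ∈ Conf A W, w ω
  set Z' := ∑ ω ∈ Conf A W, w' ω with hZ'e
  have e5 : (∑ ω ∈ Conf A W, (w ω : ℂ) * (f ω * g ω)) * ∑ ω ∈ Conf A W, (w' ω : ℂ) -
      (∑ ω ∈ Conf A W, (w ω : ℂ) * f ω) * ∑ ω ∈ Conf A W, (w' ω : ℂ) * g ω =
      (Z * Z' : ℝ) * (avg w W (fun ω => f ω * g ω) - avg w W f * avg w' W g) := by
    have hz : (Z : ℂ) ≠ 0 := by exact_mod_cast hZ.ne'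
    have hz' : (Z' : ℂ) ≠ 0 := by exact_mod_cast hZ'.ne'
    have hs : ∑ ω ∈ Conf A W, (w' ω : ℂ) = (Z' : ℂ) := by rw [hZ'e]; push_cast; rfl
    rw [hs]
    simp only [avg]
    change _ = ((Z * Z' : ℝ) : ℂ) * (_ / (Z : ℂ) - _ / (Z : ℂ) * (_ / (Z' : ℂ)))
    push_cast
    field_simp
  rw [e5, norm_mul, Complex.norm_real, Real.norm_of_nonneg (by positivity)] at key
  have hp : 0 < Z * Z' := mul_pos hZ hZ'
  refine le_of_mul_le_mul_left ?_ hp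
  linarith

open Classical in
/-- Sums over connected sets, if the summand decays with the size of the set and is supported on
sets that contain one of the given points and are not too small. -/
theorem sum_conn_le (hs : ∀ a b, b ∈ nb a → a ∈ nb b) (hcard : ∀ e, (nb e).card ≤ 18)
    {ι : Type*} (S : Finset ι) (pt : ι → E) (m : ι → ℕ) {c : ι → ℝ} (hc : ∀ i, 0 ≤ c i) {y : ℝ}
    (hy : 0 ≤ y) (hy1 : 51 * y ≤ 1) {W : Finset E} {G : Finset E → ℝ}
    (hG : ∀ C v, IsConn nb v C → C ⊆ W →
      G C ≤ ∑ i ∈ S, if pt i ∈ C ∧ m i ≤ C.card then c i * y ^ C.card else 0) :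
    ∑ C ∈ W.powerset with ∃ v, IsConn nb v C, G C ≤ ∑ i ∈ S, c i * ((51 * y) ^ m i / 19) := by
  calc ∑ C ∈ W.powerset with ∃ v, IsConn nb v C, G C
      ≤ ∑ C ∈ W.powerset with ∃ v, IsConn nb v C, ∑ i ∈ S,
          if pt i ∈ C ∧ m i ≤ C.card then c i * y ^ C.card else 0 := by
        refine sum_le_sum fun C hC => ?_
        rw [mem_filter, mem_powerset] at hC
        obtain ⟨hCW, v, hv⟩ := hC
        exact hG C v hv hCW
    _ = ∑ i ∈ S, c i * ∑ C ∈ W.powerset with (∃ v, IsConn nb v C) ∧ (pt i ∈ C ∧ m i ≤ C.card),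
          y ^ C.card := by
        rw [Finset.sum_comm]
        refine sum_congr rfl fun i _ => ?_
        rw [← Finset.sum_filter, Finset.filter_filter, mul_sum]
    _ ≤ _ := by
        refine sum_le_sum fun i _ => mul_le_mul_of_nonneg_left ?_ (hc i)
        refine le_trans ?_ (sum_isConn_pow_le hcard W (pt i) (m i) hy hy1)
        refine Finset.sum_le_sum_of_subset_of_nonneg ?_ fun _ _ _ => by positivity
        refine Finset.monotone_filter_right _ ?_
        rintro C - ⟨⟨v, hv⟩, h1, h2⟩
        exact ⟨hv.reroot hs h1, h2⟩

lemma sum_confNZ_prod {R : Type*} [CommSemiring R] (C : Finset E) (y : A → R) :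
    ∑ ω ∈ ConfNZ A C, ∏ e ∈ C, y (ω e) = (∑ t ∈ univ.erase 0, y t) ^ C.card := by
  rw [ConfNZ, sum_confIn_prod C _ fun _ => y, prod_const]

lemma sum_confAt_prod {R : Type*} [CommSemiring R] {v : E} {D : Finset E} (hv : v ∈ D)
    (u y : A → R) :
    ∑ ω ∈ ConfAt A v D, u (ω v) * ∏ e ∈ D.erase v, y (ω e) =
      (∑ t, u t) * (∑ t ∈ univ.erase 0, y t) ^ (D.card - 1) := by
  have h := sum_confIn_prod D (fun e => if e = v then (univ : Finset A)
    else univ.erase 0) fun e => if e = v then u else y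
  rw [← Finset.mul_prod_erase D _ hv] at h
  rw [ConfAt, ← Finset.card_erase_of_mem hv, ← prod_const]
  rw [if_pos rfl, if_pos rfl] at h
  convert h using 2
  · rename_i ω _
    rw [← Finset.mul_prod_erase D _ hv, if_pos rfl]
    congr 1
    refine prod_congr rfl fun e he => ?_
    rw [if_neg (mem_erase.1 he).1]
  · refine prod_congr rfl fun e he => ?_
    rw [if_neg (mem_erase.1 he).1, if_neg (mem_erase.1 he).1]

lemma sum_pair_erase (y y' : A → ℝ) (hy : y 0 = 1) (hy' : y' 0 = 1) :
    ∑ t ∈ (univ : Finset (A × A)).erase 0, y t.1 * y' t.2 =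
      (1 + ∑ t ∈ univ.erase 0, y t) * (1 + ∑ t ∈ univ.erase 0, y' t) - 1 := by
  have h1 : ∑ t ∈ (univ : Finset (A × A)).erase 0, y t.1 * y' t.2 =
      ∑ t : A × A, y t.1 * y' t.2 - 1 := by
    rw [← Finset.add_sum_erase univ (fun t : A × A => y t.1 * y' t.2)
      (mem_univ (0 : A × A))]
    simp [hy, hy']
  have h2 : ∀ z : A → ℝ, z 0 = 1 → 1 + ∑ t ∈ univ.erase 0, z t = ∑ t, z t := by
    intro z hz
    rw [← Finset.add_sum_erase univ z (mem_univ (0 : A)), hz]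
  rw [h1, h2 y hy, h2 y' hy', Finset.sum_mul_sum, Fintype.sum_prod_type]

end Compare

/-! ### The model in unitary gauge -/

section Gauge

variable {n : ℕ} [NeZero n]

/-- The weight of a `1`-form in unitary gauge, with a factor `k` for every edge of `W` and a factor
`b` for every plaquette of `P`. -/
def wt (k b : ZMod n → ℝ) (W : Finset Edge) (P : Finset Plaquette) (σ : Edge → ZMod n) : ℝ :=
  (∏ e ∈ W, k (σ e)) * ∏ p ∈ P, b (curl σ p)

lemma separable_wt {k b : ZMod n → ℝ} (hk : k 0 = 1) (hb : b 0 = 1) (W : Finset Edge)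
    (P : Finset Plaquette) : Separable nbr (wt k b W P) :=
  (Separable.prod fun e _ => Separable.site e hk).mul
    (Separable.prod fun p _ => separable_plaquette hb p)

lemma wt_nonneg {k b : ZMod n → ℝ} (hk : ∀ g, 0 ≤ k g) (hb : ∀ g, 0 ≤ b g) (W : Finset Edge)
    (P : Finset Plaquette) (σ : Edge → ZMod n) : 0 ≤ wt k b W P σ :=
  mul_nonneg (prod_nonneg fun _ _ => hk _) (prod_nonneg fun _ _ => hb _)

/-- The Kronecker function at `0`, the limit of the plaquette weights as `β → ∞`. -/
def delta (g : ZMod n) : ℝ := if g = 0 then 1 else 0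

lemma delta_zero : delta (0 : ZMod n) = 1 := if_pos rfl

lemma delta_nonneg (g : ZMod n) : 0 ≤ delta g := by unfold delta; split_ifs <;> norm_num

lemma delta_le_one (g : ZMod n) : delta g ≤ 1 := by unfold delta; split_ifs <;> norm_num

lemma prod_delta {P : Finset Plaquette} {σ : Edge → ZMod n} :
    ∏ p ∈ P, delta (curl σ p) = 1 ↔ ∀ p ∈ P, curl σ p = 0 := by
  constructor
  · intro h p hp
    by_contra h0
    rw [Finset.prod_eq_zero hp (by rw [delta, if_neg h0])] at h
    exact zero_ne_one h
  · intro h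
    exact Finset.prod_eq_one fun p hp => by rw [h p hp, delta_zero]

variable (ρ : AddChar (ZMod n) Circle)

/-- The squares of the functions `φ_r`; since every edge and every plaquette occurs with both
orientations, these are the weights of single edges and plaquettes. -/
def phi2 (r : ℝ) (g : ZMod n) : ℝ := varphi ρ r g ^ 2

lemma phi2_pos (r : ℝ) (g : ZMod n) : 0 < phi2 ρ r g := pow_pos (Real.exp_pos _) 2

lemma phi2_zero (r : ℝ) : phi2 ρ r 0 = 1 := by simp [phi2, varphi]

lemma rho_neg_re (g : ZMod n) : ((ρ (-g) : Circle) : ℂ).re = ((ρ g : Circle) : ℂ).re := by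
  rw [AddChar.map_neg_eq_inv, Circle.coe_inv_eq_conj, Complex.conj_re]

lemma phi2_neg (r : ℝ) (g : ZMod n) : phi2 ρ r (-g) = phi2 ρ r g := by
  simp only [phi2, varphi, Complex.sub_re, rho_neg_re]

lemma rho_re_le_one (g : ZMod n) : ((ρ g : Circle) : ℂ).re ≤ 1 := by
  refine (Complex.re_le_norm _).trans ?_
  rw [Circle.norm_coe]

lemma phi2_le_one {r : ℝ} (hr : 0 ≤ r) (g : ZMod n) : phi2 ρ r g ≤ 1 := by
  refine pow_le_one₀ (Real.exp_pos _).le (Real.exp_le_one_iff.2 ?_)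
  refine mul_nonpos_of_nonneg_of_nonpos hr ?_
  have := rho_re_le_one ρ g
  simp only [AddChar.map_zero_eq_one, Circle.coe_one, Complex.sub_re, Complex.one_re]
  linarith

lemma phi2_eq (r : ℝ) (g : ZMod n) :
    phi2 ρ r g = Real.exp (2 * r * (((ρ g : Circle) : ℂ).re - 1)) := by
  rw [phi2, varphi, ← Real.exp_nat_mul]
  congr 1
  simp
  ring

/-- The gradient of a Higgs field. -/
def grad (φ : Vertex → ZMod n) (e : Edge) : ZMod n := evalChain φ (edgeBoundary e)

lemma exp_action (N : ℕ) (β κ : ℝ) (σ : Edge → ZMod n) (φ : Vertex → ZMod n) :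
    Real.exp (-(action ρ N β κ σ φ).re) =
      Real.exp (2 * β * (boxPlaquettes N).card + 2 * κ * (boxEdges N).card) *
        ((∏ e ∈ boxEdges N, phi2 ρ κ (σ e - grad φ e)) *
          ∏ p ∈ boxPlaquettes N, phi2 ρ β (curl σ p)) := by
  simp only [phi2_eq]
  rw [← Real.exp_sum, ← Real.exp_sum, ← Real.exp_add, ← Real.exp_add]
  congr 1
  have h2 : ∀ g : ZMod n, (((ρ g : Circle) : ℂ) + ((ρ (-g) : Circle) : ℂ)).re =
      2 * ((ρ g : Circle) : ℂ).re := by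
    intro g; rw [Complex.add_re, rho_neg_re]; ring
  rw [action, Complex.sub_re, neg_mul, Complex.neg_re, Complex.re_ofReal_mul,
    Complex.re_ofReal_mul, Complex.re_sum, Complex.re_sum]
  simp only [h2, mul_sub, Finset.sum_sub_distrib, Finset.sum_const, nsmul_eq_mul, ← mul_sum,
    grad]
  ring

lemma plaqEdges_subset_boxEdges {N : ℕ} {p : Plaquette} (hp : p ∈ boxPlaquettes N) :
    plaqEdges p ⊆ boxEdges N := by
  simp only [boxPlaquettes, mem_filter, mem_product, mem_univ, and_true] at hp
  obtain ⟨h0, h1, h2, h3⟩ := hp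
  intro e he
  simp only [plaqEdges, Finset.mem_insert, Finset.mem_singleton] at he
  simp only [boxEdges, mem_filter, mem_product, mem_univ, and_true]
  rcases he with rfl | rfl | rfl | rfl
  · exact ⟨h0, h1⟩
  · exact ⟨h1, h3⟩
  · refine ⟨h2, ?_⟩
    simp only
    rwa [add_right_comm]
  · exact ⟨h0, h2⟩

lemma curl_add_grad (σ : Edge → ZMod n) (φ : Vertex → ZMod n) (p : Plaquette) :
    curl (fun e => σ e + grad φ e) p = curl σ p := by
  rw [curl_add]
  have : curl (grad φ) p = 0 := curl_grad φ p
  rw [this, add_zero]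

lemma sum_extend (W : Finset Edge) (F : (Edge → ZMod n) → ℂ) :
    ∑ σ : W → ZMod n, F (extend σ) = ∑ σ ∈ Conf (ZMod n) W, F σ := by
  rw [Conf, ConfIn, Finset.sum_map, Fintype.piFinset_univ]
  rfl

/-- A gauge transformation removes the Higgs field: the expectation of a gauge invariant observable
is an expectation over the gauge field alone. -/
theorem expectation_eq_avg {N : ℕ} {w : (Edge → ZMod n) → (Vertex → ZMod n) → ℝ}
    {f : (Edge → ZMod n) → (Vertex → ZMod n) → ℂ} {w' : (Edge → ZMod n) → ℝ}
    {F : (Edge → ZMod n) → ℂ} {c : ℝ} (hc : c ≠ 0)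
    (hw : ∀ σ τ φ, (∀ e ∈ boxEdges N, τ e = σ e + grad φ e) → w τ φ = c * w' σ)
    (hf : ∀ σ τ φ, (∀ e ∈ boxEdges N, τ e = σ e + grad φ e) → f τ φ = F σ) :
    expectation N w f = avg w' (boxEdges N) F := by
  -- The substitution `σ ↦ σ + grad φ` makes the sum over the gauge field independent of `φ`; both
  -- the numerator and the normalisation acquire the same factor.
  have key : ∀ (g : (Edge → ZMod n) → (Vertex → ZMod n) → ℂ) (G : (Edge → ZMod n) → ℂ),
      (∀ σ τ φ, (∀ e ∈ boxEdges N, τ e = σ e + grad φ e) → g τ φ = G σ) →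
      ∑ ω : (boxEdges N → ZMod n) × (boxVertices N → ZMod n),
        (w (extend ω.1) (extend ω.2) : ℂ) * g (extend ω.1) (extend ω.2) =
      (Fintype.card (boxVertices N → ZMod n) * c : ℂ) *
        ∑ σ ∈ Conf (ZMod n) (boxEdges N), (w' σ : ℂ) * G σ := by
    intro g G hg
    rw [Fintype.sum_prod_type_right]
    have h1 : ∀ φ : boxVertices N → ZMod n,
        ∑ σ : boxEdges N → ZMod n, (w (extend σ) (extend φ) : ℂ) * g (extend σ) (extend φ) =
        c * ∑ σ ∈ Conf (ZMod n) (boxEdges N), (w' σ : ℂ) * G σ := by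
      intro φ
      rw [← sum_extend (boxEdges N) fun σ => (w' σ : ℂ) * G σ, mul_sum,
        ← Equiv.sum_comp (Equiv.addRight fun e : boxEdges N => grad (extend φ) e.1)]
      refine sum_congr rfl fun σ _ => ?_
      have h2 : ∀ e ∈ boxEdges N,
          extend (Equiv.addRight (fun e : boxEdges N => grad (extend φ) e.1) σ) e =
            extend σ e + grad (extend φ) e := by
        intro e he
        simp [extend, he]
      rw [hw _ _ _ h2, hg _ _ _ h2]
      push_cast; ring
    simp only [h1]
    rw [Finset.sum_const, nsmul_eq_mul, Finset.card_univ]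
    ring
  have k1 := key f F hf
  have k2 := key (fun _ _ => 1) (fun _ => 1) fun _ _ _ _ => rfl
  simp only [mul_one] at k2
  rw [expectation, k1, k2, avg]
  push_cast
  rw [mul_div_mul_left]
  exact mul_ne_zero (by exact_mod_cast Fintype.card_ne_zero) (by exact_mod_cast hc)

lemma weight_eq (N : ℕ) (β κ : ℝ) {σ τ : Edge → ZMod n} {φ : Vertex → ZMod n}
    (h : ∀ e ∈ boxEdges N, τ e = σ e + grad φ e) :
    weight ρ N β κ τ φ =
      Real.exp (2 * β * (boxPlaquettes N).card + 2 * κ * (boxEdges N).card) *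
        wt (phi2 ρ κ) (phi2 ρ β) (boxEdges N) (boxPlaquettes N) σ := by
  rw [weight, exp_action, wt]
  congr 2
  · exact prod_congr rfl fun e he => by rw [h e he, add_sub_cancel_right]
  · refine prod_congr rfl fun p hp => ?_
    rw [curl_congr fun e he => h e (plaqEdges_subset_boxEdges hp he), curl_add_grad]

lemma weightInfty_eq (N : ℕ) (κ : ℝ) {σ τ : Edge → ZMod n} {φ : Vertex → ZMod n}
    (h : ∀ e ∈ boxEdges N, τ e = σ e + grad φ e) :
    weightInfty ρ N κ τ φ = Real.exp (2 * κ * (boxEdges N).card) *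
        wt (phi2 ρ κ) delta (boxEdges N) (boxPlaquettes N) σ := by
  have hcurl : ∀ p ∈ boxPlaquettes N, curl τ p = curl σ p := fun p hp => by
    rw [curl_congr fun e he => h e (plaqEdges_subset_boxEdges hp he), curl_add_grad]
  have hcl : IsClosedOn N τ ↔ ∀ p ∈ boxPlaquettes N, curl σ p = 0 :=
    forall₂_congr fun p hp => by rw [hcurl p hp]
  rw [weightInfty, wt]
  split_ifs with hc
  · rw [prod_delta.2 (hcl.1 hc), mul_one, exp_action]
    have h0 : ∏ p ∈ boxPlaquettes N, phi2 ρ 0 (curl τ p) = 1 :=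
      Finset.prod_eq_one fun p _ => by simp [phi2_eq]
    rw [h0, mul_one]
    simp only [mul_zero, zero_mul, zero_add]
    congr 1
    exact prod_congr rfl fun e he => by rw [h e he, add_sub_cancel_right]
  · have : ∃ p ∈ boxPlaquettes N, curl σ p ≠ 0 := by
      by_contra hcon
      push Not at hcon
      exact hc (hcl.2 hcon)
    obtain ⟨p, hp, hp0⟩ := this
    rw [Finset.prod_eq_zero hp (by rw [delta, if_neg hp0])]
    simp

lemma rho_evalChain (σ : Edge → ZMod n) (γ : Edge →₀ ℤ) :
    ((ρ (evalChain σ γ) : Circle) : ℂ) = ∏ e ∈ γ.support, ((ρ (γ e • σ e) : Circle) : ℂ) := by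
  rw [evalChain, Finsupp.sum]
  generalize γ.support = S
  induction S using Finset.induction_on with
  | empty => simp
  | insert e S he ih =>
    rw [Finset.sum_insert he, Finset.prod_insert he, AddChar.map_add_eq_mul, Circle.coe_mul, ih]

end Gauge

/-! ### Existence of the infinite volume limits -/

section Limits

variable {n : ℕ} [NeZero n]

/-- The plaquettes that contain an edge of `W`. -/
def stars (W : Finset Edge) : Finset Plaquette := W.biUnion star

lemma mem_stars_of_curl {W : Finset Edge} {σ : Edge → ZMod n} (hσ : ∀ e ∉ W, σ e = 0)
    {p : Plaquette} (hp : curl σ p ≠ 0) : p ∈ stars W := by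
  by_contra h
  refine hp (curl_eq_zero fun e he => hσ e fun heW => h ?_)
  exact Finset.mem_biUnion.2 ⟨e, heW, mem_star.2 he⟩

/-- All edges and plaquettes near `e` belong to `B_N`. -/
def Inner (N : ℕ) (e : Edge) : Prop := ∀ m, |e.1 m| + 2 ≤ (N : ℤ)

lemma mem_boxVertices {N : ℕ} {x : Vertex} : x ∈ boxVertices N ↔ ∀ m, |x m| ≤ (N : ℤ) := by
  simp only [boxVertices, Finset.mem_Icc, Pi.le_def, abs_le, forall_and]

lemma plaq_coord {p : Plaquette} {e : Edge} (h : e ∈ plaqEdges p) (m : Fin 4) :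
    p.1 m ≤ e.1 m ∧ e.1 m ≤ p.1 m + 1 := by
  simp only [plaqEdges, Finset.mem_insert, Finset.mem_singleton] at h
  rcases h with rfl | rfl | rfl | rfl <;> simp only [Pi.add_apply, unit_apply] <;> omega

lemma Inner.mem_boxEdges {N : ℕ} {e : Edge} (h : Inner N e) : e ∈ boxEdges N := by
  simp only [boxEdges, mem_filter, mem_product, mem_univ, and_true,
    mem_boxVertices]
  refine ⟨fun m => ?_, fun m => ?_⟩
  · have := h m; omega
  · have := h m
    rw [Pi.add_apply, unit_apply]
    rw [abs_le]
    have h2 := abs_le.1 (le_refl |e.1 m|)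
    split_ifs <;> omega

lemma Inner.star_subset {N : ℕ} {e : Edge} (h : Inner N e) : star e ⊆ boxPlaquettes N := by
  intro p hp
  rw [mem_star] at hp
  simp only [boxPlaquettes, mem_filter, mem_product, mem_univ, and_true,
    mem_boxVertices, Pi.add_apply, unit_apply]
  have key : ∀ m (t : ℤ), 0 ≤ t → t ≤ 2 → |p.1 m + t| ≤ N := by
    intro m t ht ht2
    have h1 := plaq_coord hp m
    have h2 := h m
    have h3 := abs_le.1 (le_refl |e.1 m|)
    rw [abs_le]
    omega
  refine ⟨fun m => ?_, fun m => ?_, fun m => ?_, fun m => ?_⟩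
  · simpa using key m 0 le_rfl (by norm_num)
  · exact key m _ (by split_ifs <;> norm_num) (by split_ifs <;> norm_num)
  · exact key m _ (by split_ifs <;> norm_num) (by split_ifs <;> norm_num)
  · rw [add_assoc]
    exact key m _ (by split_ifs <;> norm_num) (by split_ifs <;> norm_num)

lemma exists_coord_le (S : Finset Edge) : ∃ R : ℕ, ∀ e ∈ S, ∀ m, |e.1 m| ≤ (R : ℤ) := by
  refine ⟨∑ e ∈ S, ∑ m, (e.1 m).natAbs, fun e he m => ?_⟩
  rw [Int.abs_eq_natAbs]
  have h1 := Finset.single_le_sum (f := fun e : Edge => ∑ m, (e.1 m).natAbs)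
    (fun e _ => Nat.zero_le _) he
  have h2 := Finset.single_le_sum (f := fun m => (e.1 m).natAbs) (fun m _ => Nat.zero_le _)
    (mem_univ m)
  exact_mod_cast h2.trans h1

lemma eventually_subset_boxEdges (S : Finset Edge) :
    ∀ᶠ N in Filter.atTop, S ⊆ boxEdges N := by
  obtain ⟨R, hR⟩ := exists_coord_le S
  filter_upwards [Filter.eventually_ge_atTop (R + 2)] with N hN e he
  exact Inner.mem_boxEdges fun m => by have := hR e he m; omega

lemma boxEdges_mono {N M : ℕ} (h : N ≤ M) : boxEdges N ⊆ boxEdges M := by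
  intro e he
  have h' : (N : ℤ) ≤ M := by exact_mod_cast h
  simp only [boxEdges, mem_filter, mem_product, mem_univ, and_true,
    mem_boxVertices] at he ⊢
  exact ⟨fun m => (he.1 m).trans h', fun m => (he.2 m).trans h'⟩

variable {k b : ZMod n → ℝ}

lemma prod_curl_eq (hb : b 0 = 1) {P P' : Finset Plaquette} (hPP : P ⊆ P') {σ : Edge → ZMod n}
    (h : ∀ p, curl σ p ≠ 0 → p ∈ P) : ∏ p ∈ P', b (curl σ p) = ∏ p ∈ P, b (curl σ p) := by
  symm
  refine Finset.prod_subset hPP fun p _ hp => ?_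
  rw [not_not.1 fun h0 => hp (h p h0), hb]

lemma prod_edges_eq (hk : k 0 = 1) {W C : Finset Edge} (hCW : C ⊆ W) {σ : Edge → ZMod n}
    (hσ : ∀ e ∉ C, σ e = 0) : ∏ e ∈ W, k (σ e) = ∏ e ∈ C, k (σ e) := by
  symm
  refine Finset.prod_subset hCW fun e _ he => ?_
  rw [hσ e he, hk]

/-- The weight of `B_N` on configurations on a larger box. -/
def wtFree (k b : ZMod n → ℝ) (N M : ℕ) (σ : Edge → ZMod n) : ℝ :=
  wt k b (boxEdges N) (boxPlaquettes N) σ * ∏ e ∈ boxEdges M \ boxEdges N, delta (σ e)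

lemma sum_wtFree {N M : ℕ} (h : N ≤ M) (F : (Edge → ZMod n) → ℂ) :
    ∑ σ ∈ Conf (ZMod n) (boxEdges M), (wtFree k b N M σ : ℂ) * F σ =
      ∑ σ ∈ Conf (ZMod n) (boxEdges N),
        (wt k b (boxEdges N) (boxPlaquettes N) σ : ℂ) * F σ := by
  symm
  have hsub : Conf (ZMod n) (boxEdges N) ⊆ Conf (ZMod n) (boxEdges M) := by
    intro σ hσ
    rw [mem_conf] at hσ ⊢
    exact fun e he => hσ e fun h' => he (boxEdges_mono h h')
  rw [← Finset.sum_subset hsub]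
  · refine sum_congr rfl fun σ hσ => ?_
    rw [mem_conf] at hσ
    rw [wtFree, Finset.prod_eq_one, mul_one]
    intro e he
    rw [hσ e (mem_sdiff.1 he).2, delta_zero]
  · intro σ hσ hσ'
    rw [mem_conf] at hσ hσ'
    push Not at hσ'
    obtain ⟨e, he, he0⟩ := hσ'
    have heM : e ∈ boxEdges M := by_contra fun h' => he0 (hσ e h')
    rw [wtFree, Finset.prod_eq_zero (mem_sdiff.2 ⟨heM, he⟩) (by rw [delta, if_neg he0])]
    simp

lemma avg_wtFree {N M : ℕ} (h : N ≤ M) (F : (Edge → ZMod n) → ℂ) :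
    avg (wtFree k b N M) (boxEdges M) F =
      avg (wt k b (boxEdges N) (boxPlaquettes N)) (boxEdges N) F := by
  have h1 := sum_wtFree (k := k) (b := b) h F
  have h2 := sum_wtFree (k := k) (b := b) h fun _ => 1
  simp only [mul_one] at h2
  rw [avg, avg, h1]
  push_cast
  rw [h2]

lemma separable_wtFree (hk : k 0 = 1) (hb : b 0 = 1) (N M : ℕ) :
    Separable nbr (wtFree k b N M) :=
  (separable_wt hk hb _ _).mul (Separable.prod fun e _ => Separable.site e delta_zero)

lemma wtFree_nonneg (hk : ∀ g, 0 ≤ k g) (hb : ∀ g, 0 ≤ b g) (N M : ℕ) (σ : Edge → ZMod n) :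
    0 ≤ wtFree k b N M σ :=
  mul_nonneg (wt_nonneg hk hb _ _ _) (prod_nonneg fun _ _ => delta_nonneg _)

lemma prod_le_one' {ι : Type*} {s : Finset ι} {f : ι → ℝ} (h0 : ∀ i, 0 ≤ f i)
    (h1 : ∀ i, f i ≤ 1) : ∏ i ∈ s, f i ≤ 1 :=
  Finset.prod_le_one (fun i _ => h0 i) fun i _ => h1 i

lemma wt_le (hk0 : k 0 = 1) (hk : ∀ g, 0 ≤ k g) (hb : ∀ g, 0 ≤ b g) (hb1 : ∀ g, b g ≤ 1)
    {W C : Finset Edge} (hCW : C ⊆ W) (P : Finset Plaquette) {σ : Edge → ZMod n}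
    (hσ : ∀ e ∉ C, σ e = 0) : wt k b W P σ ≤ ∏ e ∈ C, k (σ e) := by
  rw [wt, prod_edges_eq hk0 hCW hσ]
  exact mul_le_of_le_one_right (prod_nonneg fun _ _ => hk _)
    (prod_le_one' (fun _ => hb _) fun _ => hb1 _)

lemma wtFree_le (hk0 : k 0 = 1) (hk : ∀ g, 0 ≤ k g) (hb : ∀ g, 0 ≤ b g) (hb1 : ∀ g, b g ≤ 1)
    {N M : ℕ} {C : Finset Edge} (hCM : C ⊆ boxEdges M) {σ : Edge → ZMod n}
    (hσ : ∀ e, σ e ≠ 0 ↔ e ∈ C) : wtFree k b N M σ ≤ ∏ e ∈ C, k (σ e) := by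
  have hσ' : ∀ e ∉ C, σ e = 0 := fun e he => not_not.1 fun h => he ((hσ e).1 h)
  by_cases hCN : C ⊆ boxEdges N
  · refine (mul_le_of_le_one_right (wt_nonneg hk hb _ _ _)
      (prod_le_one' (fun _ => delta_nonneg _) fun _ => delta_le_one _)).trans ?_
    exact wt_le hk0 hk hb hb1 hCN _ hσ'
  · obtain ⟨e, heC, heN⟩ := Finset.not_subset.1 hCN
    rw [wtFree, Finset.prod_eq_zero (mem_sdiff.2 ⟨hCM heC, heN⟩)
      (by rw [delta, if_neg ((hσ e).2 heC)]), mul_zero]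
    exact prod_nonneg fun _ _ => hk _

/-- Well inside `B_N` the boundary conditions have no influence on the weight. -/
lemma wtFree_eq (hk0 : k 0 = 1) (hb0 : b 0 = 1) {N M : ℕ} (hNM : N ≤ M) {C : Finset Edge}
    (hC : ∀ e ∈ C, Inner N e) {σ : Edge → ZMod n} (hσ : ∀ e ∉ C, σ e = 0) :
    wtFree k b N M σ = wt k b (boxEdges M) (stars (boxEdges M)) σ := by
  have hCN : C ⊆ boxEdges N := fun e he => (hC e he).mem_boxEdges
  have hs : ∀ p, curl σ p ≠ 0 → p ∈ stars C := fun p hp => mem_stars_of_curl hσ hp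
  have h1 : stars C ⊆ boxPlaquettes N := Finset.biUnion_subset.2 fun e he => (hC e he).star_subset
  have h2 : stars C ⊆ stars (boxEdges M) :=
    Finset.biUnion_subset_biUnion_of_subset_left _ (hCN.trans (boxEdges_mono hNM))
  rw [wtFree, wt, wt, prod_edges_eq hk0 hCN hσ,
    prod_edges_eq hk0 (hCN.trans (boxEdges_mono hNM)) hσ, prod_curl_eq hb0 h1 hs,
    prod_curl_eq hb0 h2 hs]
  have h3 : ∏ e ∈ boxEdges M \ boxEdges N, delta (σ e) = 1 := Finset.prod_eq_one fun e he => by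
    rw [hσ e fun h => (mem_sdiff.1 he).2 (hCN h), delta_zero]
  rw [h3, mul_one]

/-- Exchanging the two components of a pair of configurations. -/
lemma sum_confNZ_swap {A R : Type*} [Zero A] [Fintype A] [DecidableEq A] [AddCommMonoid R]
    (C : Finset Edge) (F : (Edge → A) → (Edge → A) → R) :
    ∑ ω ∈ ConfNZ (A × A) C, F (fun e => (ω e).1) (fun e => (ω e).2) =
      ∑ ω ∈ ConfNZ (A × A) C, F (fun e => (ω e).2) (fun e => (ω e).1) := by
  refine Finset.sum_bij' (fun ω _ e => (ω e).swap) (fun ω _ e => (ω e).swap) ?_ ?_ ?_ ?_ ?_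
  · intro ω hω
    rw [mem_confNZ] at hω ⊢
    intro e
    rw [← hω e, Ne, Ne, Prod.swap_eq_iff_eq_swap]
    rfl
  · intro ω hω
    rw [mem_confNZ] at hω ⊢
    intro e
    rw [← hω e, Ne, Ne, Prod.swap_eq_iff_eq_swap]
    rfl
  · intro ω _; rfl
  · intro ω _; rfl
  · intro ω _; rfl

/-- An observable that is a product over the edges of `S`. -/
def siteProd (S : Finset Edge) (y : Edge → ZMod n → ℂ) (σ : Edge → ZMod n) : ℂ :=
  ∏ e ∈ S, y e (σ e)

lemma separable_siteProd {S : Finset Edge} {y : Edge → ZMod n → ℂ} (hy : ∀ e, y e 0 = 1) :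
    Separable nbr (siteProd S y) := Separable.prod fun e _ => Separable.site e (hy e)

/-- The total weight `(1 + a)² - 1` of the non-zero pairs of group elements. -/
lemma sum_pair_weight (hk0 : k 0 = 1) {a : ℝ} (ha : ∑ g ∈ univ.erase 0, k g = a) :
    ∑ t ∈ (univ : Finset (ZMod n × ZMod n)).erase 0, k t.1 * k t.2 = (1 + a) * (1 + a) - 1 := by
  rw [sum_pair_erase k k hk0 hk0, ha]

lemma inner_or_far {S : Finset Edge} {R : ℕ} (hR : ∀ e ∈ S, ∀ m, |e.1 m| ≤ (R : ℤ)) {C : Finset Edge}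
    {v e : Edge} (hC : IsConn nbr v C) (he : e ∈ S) (heC : e ∈ C) {N : ℕ}
    (h : C.card < N - (R + 2)) : ∀ f ∈ C, Inner N f := by
  intro f hf m
  have h1 := (hC.reroot nbr_symm heC).extent hf m
  have h2 := hR e he m
  have h3 := abs_sub_abs_le_abs_sub (f.1 m) (e.1 m)
  omega

/-- Different boundary conditions on large boxes lead to nearly the same expectations. -/
lemma norm_avg_free_sub_le (hk0 : k 0 = 1) (hk : ∀ g, 0 ≤ k g) (hb0 : b 0 = 1) (hb : ∀ g, 0 ≤ b g)
    (hb1 : ∀ g, b g ≤ 1) {a D : ℝ} (ha : ∑ g ∈ univ.erase 0, k g = a) (hD : 1 ≤ D)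
    (hX : 51 * (((1 + a) * (1 + a) - 1) * D) ≤ 1 / 2) {S : Finset Edge} {y : Edge → ZMod n → ℂ}
    (hy0 : ∀ e, y e 0 = 1) (hy : ∀ e g, ‖y e g‖ ≤ D) {R : ℕ}
    (hR : ∀ e ∈ S, ∀ m, |e.1 m| ≤ (R : ℤ)) {N M : ℕ} (hNM : N ≤ M) :
    (D ^ S.card)⁻¹ * ‖avg (wt k b (boxEdges N) (boxPlaquettes N)) (boxEdges N) (siteProd S y) -
      avg (wt k b (boxEdges M) (stars (boxEdges M))) (boxEdges M) (siteProd S y)‖ ≤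
      S.card * (2 * ((1 / 2) ^ (N - (R + 2)) / 19)) := by
  classical
  have ha0 : 0 ≤ a := by rw [← ha]; exact sum_nonneg fun _ _ => hk _
  set X := ((1 + a) * (1 + a) - 1) * D with hXdef
  have hX0 : 0 ≤ X := mul_nonneg (by nlinarith) (by linarith)
  set w := wtFree k b N M
  set w' := wt k b (boxEdges M) (stars (boxEdges M))
  set f := siteProd S y
  set Mj : (Edge → ZMod n × ZMod n) → ℝ := fun ω => ∏ e ∈ S, if ω e = 0 then 1 else D with hMj
  have hMsep : Separable nbr Mj := Separable.prod fun e _ =>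
    Separable.site e (y := fun t : ZMod n × ZMod n => if t = 0 then (1 : ℝ) else D) (if_pos rfl)
  have hfM : ∀ (ω : Edge → ZMod n × ZMod n) (π : ZMod n × ZMod n → ZMod n), π 0 = 0 →
      ‖f fun e => π (ω e)‖ ≤ Mj ω := by
    intro ω π hπ
    simp only [f, siteProd, norm_prod, hMj]
    refine Finset.prod_le_prod (fun _ _ => norm_nonneg _) fun e _ => ?_
    split_ifs with h
    · rw [h, hπ, hy0, norm_one]
    · exact hy _ _
  have hw1 : avg w (boxEdges M) (fun _ => 1) = 1 := by
    have hp := sum_weight_pos (wtFree_nonneg hk hb N M) (separable_wtFree hk0 hb0 N M).1 (boxEdges M)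
    rw [avg]
    simp only [mul_one]
    rw [← Complex.ofReal_sum, div_self]
    exact_mod_cast hp.ne'
  have hone : Separable nbr (fun _ : Edge → ZMod n => (1 : ℂ)) := ⟨rfl, fun _ _ _ => (mul_one _).symm⟩
  -- The pair consists of a configuration with free and one with zero boundary conditions.
  have key := norm_avg_sub_le (f := fun _ => 1) (g := f) (separable_wtFree (k := k) hk0 hb0 N M)
    (separable_wt hk0 hb0 (boxEdges M) (stars (boxEdges M))) hMsep hone (separable_siteProd hy0)
    (wtFree_nonneg hk hb N M) (wt_nonneg hk hb _ _)
    (fun ω => by simpa using hfM ω Prod.fst rfl) (fun ω => by simpa using hfM ω Prod.snd rfl)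
    (c := (D ^ S.card)⁻¹) (by positivity) (fun ω => by
      rw [inv_mul_le_iff₀ (by positivity), mul_one, ← prod_const]
      refine Finset.prod_le_prod (fun e _ => ?_) fun e _ => ?_ <;> split_ifs <;> linarith)
    (boxEdges M)
  simp only [one_mul] at key
  rw [hw1, one_mul, avg_wtFree hNM] at key
  refine key.trans ?_
  refine (sum_conn_le nbr_symm card_nbr S id (fun _ => N - (R + 2)) (c := fun _ => 2)
    (fun _ => by norm_num) hX0 (by linarith) ?_).trans ?_
  · intro C v hC hCW
    -- A set that misses `S` does not contribute, as the observable is one on both configurations.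
    by_cases hS : ∃ e ∈ S, e ∈ C
    swap
    · push Not at hS
      have hz : ∀ ω ∈ ConfNZ (ZMod n × ZMod n) C, ((w (fun e => (ω e).1) * w' (fun e => (ω e).2) : ℝ) : ℂ) *
          (f (fun e => (ω e).1) - f (fun e => (ω e).2)) = 0 := by
        intro ω hω
        rw [mem_confNZ] at hω
        have h0 : ∀ e ∈ S, ω e = 0 := fun e he => not_not.1 fun h => hS e he ((hω e).1 h)
        have : ∀ π : ZMod n × ZMod n → ZMod n, π 0 = 0 → f (fun e => π (ω e)) = 1 := fun π hπ =>
          Finset.prod_eq_one fun e he => by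
            show y e (π (ω e)) = 1
            rw [h0 e he, hπ, hy0]
        rw [this Prod.fst rfl, this Prod.snd rfl, sub_self, mul_zero]
      rw [Finset.sum_eq_zero hz, norm_zero]
      exact sum_nonneg fun _ _ => by split_ifs <;> positivity
    · obtain ⟨e, heS, heC⟩ := hS
      by_cases hcard : N - (R + 2) ≤ C.card
      -- A large set has a small weight.
      · refine le_trans ?_ (Finset.single_le_sum (fun i _ => by split_ifs <;> positivity) heS)
        rw [if_pos ⟨heC, hcard⟩]
        refine (norm_sum_le _ _).trans ?_
        calc _ ≤ ∑ ω ∈ ConfNZ (ZMod n × ZMod n) C, 2 * ∏ e ∈ C, (k (ω e).1 * k (ω e).2 * D) := by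
              refine sum_le_sum fun ω hω => ?_
              have hω' := mem_confNZ.1 hω
              have hz : ∀ e ∉ C, ω e = 0 := fun e he => not_not.1 fun h => he ((hω' e).1 h)
              have hm : Mj ω ≤ D ^ C.card := by
                calc Mj ω = ∏ e ∈ S.filter (· ∈ C), if ω e = 0 then 1 else D := by
                      rw [hMj, Finset.prod_filter]
                      refine prod_congr rfl fun e _ => ?_
                      by_cases he : e ∈ C
                      · rw [if_pos he]
                      · rw [if_neg he, if_pos (hz e he)]
                  _ ≤ ∏ e ∈ S.filter (· ∈ C), D := by
                      refine Finset.prod_le_prod (fun e _ => ?_) fun e _ => ?_ <;> split_ifs <;>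
                        linarith
                  _ ≤ D ^ C.card := by
                      rw [prod_const]
                      refine pow_le_pow_right₀ hD (Finset.card_le_card fun e he => ?_)
                      exact (mem_filter.1 he).2
              have hwle : w (fun e => (ω e).1) ≤ ∏ e ∈ C, k (ω e).1 := by
                have hC1 : wtFree k b N M (fun e => (ω e).1) ≤
                    ∏ e ∈ C.filter (fun e => (ω e).1 ≠ 0), k (ω e).1 := by
                  refine wtFree_le hk0 hk hb hb1 ((Finset.filter_subset _ _).trans hCW) fun e => ?_
                  rw [mem_filter]
                  exact ⟨fun h => ⟨(hω' e).1 fun h' => h (by rw [h']; rfl), h⟩, fun h => h.2⟩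
                refine hC1.trans_eq (Finset.prod_subset (Finset.filter_subset _ _) fun e he he' => ?_)
                have : (ω e).1 = 0 := by
                  by_contra h; exact he' (mem_filter.2 ⟨he, h⟩)
                rw [this, hk0]
              have hwle' : w' (fun e => (ω e).2) ≤ ∏ e ∈ C, k (ω e).2 :=
                wt_le hk0 hk hb hb1 hCW _ fun e he => by rw [hz e he]; rfl
              have hf2 : ‖f (fun e => (ω e).1) - f (fun e => (ω e).2)‖ ≤ 2 * D ^ C.card := by
                refine (norm_sub_le _ _).trans ?_
                have h1 := hfM ω Prod.fst rfl
                have h2 := hfM ω Prod.snd rfl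
                linarith
              rw [norm_mul, Complex.norm_real, Real.norm_of_nonneg
                (mul_nonneg (wtFree_nonneg hk hb _ _ _) (wt_nonneg hk hb _ _ _)),
                prod_mul_distrib, prod_mul_distrib, prod_const]
              calc _ ≤ ((∏ e ∈ C, k (ω e).1) * ∏ e ∈ C, k (ω e).2) * (2 * D ^ C.card) :=
                    mul_le_mul (mul_le_mul hwle hwle' (wt_nonneg hk hb _ _ _)
                      (prod_nonneg fun _ _ => hk _)) hf2 (norm_nonneg _)
                      (mul_nonneg (prod_nonneg fun _ _ => hk _)
                        (prod_nonneg fun _ _ => hk _))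
                _ = _ := by ring
          _ = 2 * X ^ C.card := by
              rw [← mul_sum, sum_confNZ_prod C fun t : ZMod n × ZMod n => k t.1 * k t.2 * D,
                ← sum_mul, sum_pair_weight hk0 ha]
      -- A small set that meets `S` lies well inside the box, where the two weights agree; the
      -- exchange of the two configurations then shows that the contribution is zero.
      · have hin := inner_or_far hR hC heS heC (not_le.1 hcard)
        have hz : ∑ ω ∈ ConfNZ (ZMod n × ZMod n) C,
            ((w (fun e => (ω e).1) * w' (fun e => (ω e).2) : ℝ) : ℂ) *
              (f (fun e => (ω e).1) - f (fun e => (ω e).2)) = 0 := by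
          have e1 : ∀ ω ∈ ConfNZ (ZMod n × ZMod n) C,
              ((w (fun e => (ω e).1) * w' (fun e => (ω e).2) : ℝ) : ℂ) *
              (f (fun e => (ω e).1) - f (fun e => (ω e).2)) =
              ((w' (fun e => (ω e).1) * w' (fun e => (ω e).2) : ℝ) : ℂ) * f (fun e => (ω e).1) -
              ((w' (fun e => (ω e).1) * w' (fun e => (ω e).2) : ℝ) : ℂ) * f (fun e => (ω e).2) := by
            intro ω hω
            rw [mem_confNZ] at hω
            have : w (fun e => (ω e).1) = w' (fun e => (ω e).1) :=
              wtFree_eq hk0 hb0 hNM hin fun e he => by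
                rw [not_not.1 fun h => he ((hω e).1 h)]; rfl
            rw [this, mul_sub]
          rw [sum_congr rfl e1, Finset.sum_sub_distrib,
            sum_confNZ_swap C fun σ τ => ((w' σ * w' τ : ℝ) : ℂ) * f σ, sub_eq_zero]
          exact sum_congr rfl fun ω _ => by rw [mul_comm (w' _)]
        rw [hz, norm_zero]
        exact sum_nonneg fun _ _ => by split_ifs <;> positivity
  · rw [Finset.sum_const, nsmul_eq_mul]
    have h51 : 0 ≤ 51 * X := by positivity
    have : (51 * X) ^ (N - (R + 2)) ≤ (1 / 2) ^ (N - (R + 2)) := pow_le_pow_left₀ h51 hX _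
    gcongr

/-- Product observables have infinite volume limits, which do not depend on the boundary
conditions. -/
theorem exists_limit (hk0 : k 0 = 1) (hk : ∀ g, 0 ≤ k g) (hb0 : b 0 = 1) (hb : ∀ g, 0 ≤ b g)
    (hb1 : ∀ g, b g ≤ 1) {a D : ℝ} (ha : ∑ g ∈ univ.erase 0, k g = a) (hD : 1 ≤ D)
    (hX : 51 * (((1 + a) * (1 + a) - 1) * D) ≤ 1 / 2) (S : Finset Edge) {y : Edge → ZMod n → ℂ}
    (hy0 : ∀ e, y e 0 = 1) (hy : ∀ e g, ‖y e g‖ ≤ D) :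
    ∃ L : ℂ, Filter.Tendsto (fun N =>
        avg (wt k b (boxEdges N) (boxPlaquettes N)) (boxEdges N) (siteProd S y)) Filter.atTop (𝓝 L) ∧
      Filter.Tendsto (fun N =>
        avg (wt k b (boxEdges N) (stars (boxEdges N))) (boxEdges N) (siteProd S y))
        Filter.atTop (𝓝 L) := by
  obtain ⟨R, hR⟩ := exists_coord_le S
  set F := fun N => avg (wt k b (boxEdges N) (boxPlaquettes N)) (boxEdges N) (siteProd S y) with hF
  set Z := fun N => avg (wt k b (boxEdges N) (stars (boxEdges N))) (boxEdges N) (siteProd S y)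
    with hZ
  set ε : ℕ → ℝ := fun N => D ^ S.card * (S.card * (2 * ((1 / 2) ^ (N - (R + 2)) / 19))) with hε
  have hFZ : ∀ N M, N ≤ M → ‖F N - Z M‖ ≤ ε N := by
    intro N M hNM
    have h := norm_avg_free_sub_le hk0 hk hb0 hb hb1 ha hD hX hy0 hy hR hNM
    rwa [inv_mul_le_iff₀ (by positivity)] at h
  have hε0 : Filter.Tendsto ε Filter.atTop (𝓝 0) := by
    have h1 : Filter.Tendsto (fun N : ℕ => ((1 : ℝ) / 2) ^ (N - (R + 2))) Filter.atTop (𝓝 0) :=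
      (tendsto_pow_atTop_nhds_zero_of_lt_one (by norm_num) (by norm_num)).comp
        (Filter.tendsto_sub_atTop_nat _)
    have h2 := (((h1.div_const 19).const_mul 2).const_mul (S.card : ℝ)).const_mul (D ^ S.card)
    simpa [hε] using h2
  have hcauchy : CauchySeq Z := by
    refine Metric.cauchySeq_iff'.2 fun δ hδ => ?_
    obtain ⟨N, hN⟩ := (hε0.eventually (gt_mem_nhds (half_pos hδ))).exists
    refine ⟨N, fun M hM => ?_⟩
    rw [dist_eq_norm]
    calc ‖Z M - Z N‖ = ‖(F N - Z N) - (F N - Z M)‖ := by congr 1; ring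
      _ ≤ ‖F N - Z N‖ + ‖F N - Z M‖ := norm_sub_le _ _
      _ < δ := by have := hFZ N N le_rfl; have := hFZ N M hM; linarith
  obtain ⟨L, hL⟩ := cauchySeq_tendsto_of_complete hcauchy
  refine ⟨L, ?_, hL⟩
  have hdiff : Filter.Tendsto (fun N => F N - Z N) Filter.atTop (𝓝 0) :=
    squeeze_zero_norm (fun N => hFZ N N le_rfl) hε0
  have := hdiff.add hL
  simpa using this

end Limits

/-! ### The weights of a single edge -/

/-- Weights `k` of an edge and `b` of a plaquette. They are even since orientations do not matter,
and normalised at `0`. -/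
structure Weights (n : ℕ) where
  /-- the weight of an edge -/
  k : ZMod n → ℝ
  /-- the weight of a plaquette -/
  b : ZMod n → ℝ
  k_zero : k 0 = 1
  b_zero : b 0 = 1
  k_pos : ∀ g, 0 < k g
  b_pos : ∀ g, 0 < b g
  k_neg : ∀ g, k (-g) = k g
  b_neg : ∀ g, b (-g) = b g
  b_le_one : ∀ g, b g ≤ 1

namespace Weights

variable {n : ℕ} [NeZero n] (w : Weights n) (ρ : AddChar (ZMod n) Circle)

lemma k_nonneg (g : ZMod n) : 0 ≤ w.k g := (w.k_pos g).le

lemma b_nonneg (g : ZMod n) : 0 ≤ w.b g := (w.b_pos g).le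

/-- The total weight of the non-zero values of an edge. -/
def a : ℝ := ∑ g ∈ univ.erase 0, w.k g

/-- The total weight of the fluctuations of an edge around the value at which its six plaquettes
are flat, apart from the weight of the edge itself. -/
def q : ℝ := ∑ g ∈ univ.erase 0, w.b g ^ 6

/-- The weight of all values of an edge whose six plaquettes are flat at the value `h`. -/
def mass (h : ZMod n) : ℝ := ∑ g, w.b g ^ 6 * w.k (g + h)

/-- The ratio of `mass h` to the weight of the single value `h`. -/
def gain (h : ZMod n) : ℝ := w.mass h / w.k h

/-- The mean of the relative phase of an edge whose six plaquettes are flat at the value `h`. -/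
def mean (h : ZMod n) : ℂ :=
  (∑ g, ((ρ g : Circle) : ℂ) * ((w.b g ^ 6 * w.k (g + h) : ℝ) : ℂ)) / (w.mass h : ℂ)

lemma a_nonneg : 0 ≤ w.a := sum_nonneg fun _ _ => w.k_nonneg _

lemma q_nonneg : 0 ≤ w.q := sum_nonneg fun _ _ => pow_nonneg (w.b_nonneg _) _

lemma mass_eq (h : ZMod n) :
    w.mass h = w.k h + ∑ g ∈ univ.erase 0, w.b g ^ 6 * w.k (g + h) := by
  rw [mass, ← Finset.add_sum_erase univ _ (mem_univ (0 : ZMod n)), w.b_zero, one_pow,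
    one_mul, zero_add]

lemma k_le_mass (h : ZMod n) : w.k h ≤ w.mass h := by
  rw [mass_eq]
  have : 0 ≤ ∑ g ∈ univ.erase 0, w.b g ^ 6 * w.k (g + h) := sum_nonneg fun g _ =>
    mul_nonneg (pow_nonneg (w.b_nonneg g) 6) (w.k_nonneg _)
  linarith

lemma mass_pos (h : ZMod n) : 0 < w.mass h := (w.k_pos h).trans_le (w.k_le_mass h)

lemma gain_pos (h : ZMod n) : 0 < w.gain h := div_pos (w.mass_pos h) (w.k_pos h)

lemma one_le_gain (h : ZMod n) : 1 ≤ w.gain h :=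
  (one_le_div (w.k_pos h)).2 (w.k_le_mass h)

lemma k_mul_gain (h : ZMod n) : w.k h * w.gain h = w.mass h :=
  mul_div_cancel₀ _ (w.k_pos h).ne'

lemma mass_neg (h : ZMod n) : w.mass (-h) = w.mass h := by
  rw [mass, mass, ← Equiv.sum_comp (Equiv.neg _)]
  refine sum_congr rfl fun g _ => ?_
  rw [Equiv.neg_apply, w.b_neg, ← neg_add, w.k_neg]

/-- Only the fluctuations move the mean phase away from one; `mass h` is bounded below by the weight
of the value `h` itself. -/
lemma norm_sub_one_le (h : ZMod n) :
    w.k h * ‖w.mean ρ h - 1‖ ≤ 2 * ∑ g ∈ univ.erase 0, w.b g ^ 6 * w.k (g + h) := by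
  have hm := w.mass_pos h
  have e : w.mean ρ h - 1 = (∑ g ∈ univ.erase 0,
      (((ρ g : Circle) : ℂ) - 1) * ((w.b g ^ 6 * w.k (g + h) : ℝ) : ℂ)) / (w.mass h : ℂ) := by
    have hm' : (w.mass h : ℂ) ≠ 0 := by exact_mod_cast hm.ne'
    rw [mean, eq_div_iff hm', sub_mul, div_mul_cancel₀ _ hm', one_mul, mass, Complex.ofReal_sum,
      ← Finset.sum_sub_distrib, ← Finset.add_sum_erase univ _ (mem_univ (0 : ZMod n))]
    simp only [AddChar.map_zero_eq_one, Circle.coe_one, one_mul, sub_self, zero_add, sub_mul]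
  have h2 : ∀ g : ZMod n, ‖((ρ g : Circle) : ℂ) - 1‖ ≤ 2 := by
    intro g
    refine (norm_sub_le _ _).trans ?_
    rw [Circle.norm_coe, norm_one]; norm_num
  have hS : 0 ≤ 2 * ∑ g ∈ univ.erase 0, w.b g ^ 6 * w.k (g + h) :=
    mul_nonneg (by norm_num) (sum_nonneg fun g _ =>
      mul_nonneg (pow_nonneg (w.b_nonneg g) 6) (w.k_nonneg _))
  have h3 : ‖∑ g ∈ univ.erase 0,
      (((ρ g : Circle) : ℂ) - 1) * ((w.b g ^ 6 * w.k (g + h) : ℝ) : ℂ)‖ ≤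
      2 * ∑ g ∈ univ.erase 0, w.b g ^ 6 * w.k (g + h) := by
    refine (norm_sum_le _ _).trans ?_
    rw [mul_sum]
    refine sum_le_sum fun g _ => ?_
    have hn : 0 ≤ w.b g ^ 6 * w.k (g + h) :=
      mul_nonneg (pow_nonneg (w.b_nonneg g) 6) (w.k_nonneg _)
    rw [norm_mul, Complex.norm_real, Real.norm_of_nonneg hn]
    exact mul_le_mul_of_nonneg_right (h2 g) hn
  rw [e, norm_div, Complex.norm_real, Real.norm_of_nonneg hm.le, mul_div_assoc', div_le_iff₀ hm]
  calc _ ≤ w.mass h * (2 * ∑ g ∈ univ.erase 0, w.b g ^ 6 * w.k (g + h)) :=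
        mul_le_mul (w.k_le_mass h) h3 (norm_nonneg _) hm.le
    _ = _ := mul_comm _ _

/-- The total weight of the fluctuations around non-zero values. -/
lemma sum_fluct_le : ∑ h ∈ univ.erase 0, ∑ g ∈ univ.erase 0,
    w.b g ^ 6 * w.k (g + h) ≤ w.q * (1 + w.a) := by
  rw [Finset.sum_comm, q, sum_mul]
  refine sum_le_sum fun g _ => ?_
  rw [← mul_sum]
  refine mul_le_mul_of_nonneg_left ?_ (pow_nonneg (w.b_nonneg g) 6)
  calc ∑ h ∈ univ.erase 0, w.k (g + h) ≤ ∑ h, w.k (g + h) :=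
        Finset.sum_le_sum_of_subset_of_nonneg (Finset.subset_univ _) fun _ _ _ => w.k_nonneg _
    _ = ∑ h, w.k h := Equiv.sum_comp (Equiv.addLeft g) w.k
    _ = 1 + w.a := by
        rw [a, ← Finset.add_sum_erase univ _ (mem_univ (0 : ZMod n)), w.k_zero]

lemma sum_mean_sub_one_le :
    ∑ h ∈ univ.erase 0, w.k h * ‖w.mean ρ h - 1‖ ≤ 2 * (w.q * (1 + w.a)) := by
  calc _ ≤ ∑ h ∈ univ.erase 0, 2 * ∑ g ∈ univ.erase 0, w.b g ^ 6 * w.k (g + h) :=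
        sum_le_sum fun h _ => w.norm_sub_one_le ρ h
    _ ≤ _ := by
        rw [← mul_sum]
        exact mul_le_mul_of_nonneg_left w.sum_fluct_le (by norm_num)

lemma fluct_zero_le {α : ℝ} (hα : ∀ g ≠ 0, w.b g ≤ α) :
    ∑ g ∈ univ.erase 0, w.b g ^ 6 * w.k (g + 0) ≤ α ^ 6 * w.a := by
  rw [a, mul_sum]
  refine sum_le_sum fun g hg => ?_
  rw [add_zero]
  exact mul_le_mul_of_nonneg_right (pow_le_pow_left₀ (w.b_nonneg g)
    (hα g (mem_erase.1 hg).1) 6) (w.k_nonneg g)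

lemma gain_zero_le {α : ℝ} (hα : ∀ g ≠ 0, w.b g ≤ α) : w.gain 0 ≤ 1 + α ^ 6 * w.a := by
  rw [gain, w.k_zero, div_one, mass_eq, w.k_zero]
  linarith [w.fluct_zero_le hα]

lemma norm_mean_zero_sub_one_le {α : ℝ} (hα : ∀ g ≠ 0, w.b g ≤ α) :
    ‖w.mean ρ 0 - 1‖ ≤ 2 * (α ^ 6 * w.a) := by
  have h := w.norm_sub_one_le ρ 0
  rw [w.k_zero, one_mul] at h
  linarith [w.fluct_zero_le hα]

/-- The deviation of the normalised `gain` from one. -/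
lemma sum_gain_sub_one_le {α : ℝ} (hα : ∀ g ≠ 0, w.b g ≤ α) :
    ∑ h ∈ univ.erase 0, w.k h * |w.gain h / w.gain 0 - 1| ≤
    w.q * (1 + w.a) + α ^ 6 * w.a * w.a := by
  have hz := w.one_le_gain 0
  have hz' := w.gain_zero_le hα
  have key : ∀ h, w.k h * |w.gain h / w.gain 0 - 1| ≤
      ∑ g ∈ univ.erase 0, w.b g ^ 6 * w.k (g + h) + w.k h * (α ^ 6 * w.a) := by
    intro h
    have h1 : |w.gain h / w.gain 0 - 1| ≤ (w.gain h - 1) + α ^ 6 * w.a := by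
      have hg := w.one_le_gain h
      have e : w.gain h / w.gain 0 - 1 = ((w.gain h - 1) - (w.gain 0 - 1)) / w.gain 0 := by
        field_simp; ring
      rw [e, abs_div, abs_of_pos (w.gain_pos 0), div_le_iff₀ (w.gain_pos 0)]
      have h2 : |(w.gain h - 1) - (w.gain 0 - 1)| ≤ (w.gain h - 1) + (w.gain 0 - 1) := by
        rw [abs_le]; constructor <;> linarith
      nlinarith
    have h3 : w.k h * (w.gain h - 1) = ∑ g ∈ univ.erase 0, w.b g ^ 6 * w.k (g + h) := by
      rw [mul_sub, k_mul_gain, mass_eq]; ring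
    calc w.k h * |w.gain h / w.gain 0 - 1| ≤ w.k h * ((w.gain h - 1) + α ^ 6 * w.a) :=
          mul_le_mul_of_nonneg_left h1 (w.k_nonneg h)
      _ = _ := by rw [mul_add, h3]
  calc _ ≤ ∑ h ∈ univ.erase 0, (∑ g ∈ univ.erase 0, w.b g ^ 6 * w.k (g + h) +
        w.k h * (α ^ 6 * w.a)) := sum_le_sum fun h _ => key h
    _ ≤ _ := by
        rw [sum_add_distrib, ← sum_mul]
        have := w.sum_fluct_le
        change _ + w.a * _ ≤ _
        linarith

/-- The sum over the values of an edge, taken with either orientation, whose six plaquettes are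
flat at the value `h`. -/
lemma sum_edge (h : ZMod n) {c : ℤ} (hc : c = 1 ∨ c = -1) :
    ∑ x, ((w.k x * w.b (x - h) ^ 6 : ℝ) : ℂ) * ((ρ (c • x) : Circle) : ℂ) =
      ((ρ (c • h) : Circle) : ℂ) * (w.mass h : ℂ) * w.mean ρ (c • h) := by
  have hm' : ∀ h, (w.mass h : ℂ) ≠ 0 := fun h => by exact_mod_cast (w.mass_pos h).ne'
  rcases hc with rfl | rfl
  · simp only [one_smul]
    rw [mean, mul_assoc, mul_div_cancel₀ _ (hm' h), mul_sum,
      ← Equiv.sum_comp (Equiv.addRight h)]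
    refine sum_congr rfl fun g _ => ?_
    rw [Equiv.coe_addRight, add_sub_cancel_right, AddChar.map_add_eq_mul, Circle.coe_mul]
    push_cast; ring
  · simp only [neg_smul, one_smul]
    rw [mean, w.mass_neg, mul_assoc, mul_div_cancel₀ _ (hm' h), mul_sum,
      ← Equiv.sum_comp (Equiv.subLeft h)]
    refine sum_congr rfl fun g _ => ?_
    rw [Equiv.subLeft_apply, neg_sub, sub_eq_add_neg g h, AddChar.map_add_eq_mul, Circle.coe_mul,
      sub_right_comm, sub_self, zero_sub, w.b_neg, ← w.k_neg (h - g), neg_sub, sub_eq_add_neg g h]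
    push_cast; ring

lemma sum_edge_one (h : ZMod n) : ∑ x, w.k x * w.b (x - h) ^ 6 = w.mass h := by
  rw [mass, ← Equiv.sum_comp (Equiv.addRight h)]
  refine sum_congr rfl fun g _ => ?_
  rw [Equiv.coe_addRight, add_sub_cancel_right, mul_comm]

end Weights

/-! ### Conditioning on everything but a family of separated edges -/

section Fibre

variable {n : ℕ} [NeZero n] (w : Weights n)

/-- No two edges of `T` lie in a common plaquette. -/
def Separated (T : Finset Edge) : Prop := ∀ e ∈ T, ∀ e' ∈ T, e' ≠ e → e' ∉ nbr e

/-- The product of the plaquette weights at `e`. -/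
def starProd (e : Edge) (σ : Edge → ZMod n) : ℝ := ∏ p ∈ star e, w.b (curl σ p)

/-- The part of the weight that does not involve the edges of `T`. -/
def restWt (W T : Finset Edge) (σ : Edge → ZMod n) : ℝ :=
  (∏ e ∈ W \ T, w.k (σ e)) * ∏ p ∈ stars W \ stars T, w.b (curl σ p)

variable {w} {W T : Finset Edge}

lemma starProd_pos (e : Edge) (σ : Edge → ZMod n) : 0 < starProd w e σ :=
  Finset.prod_pos fun _ _ => w.b_pos _

lemma stars_mono (h : T ⊆ W) : stars T ⊆ stars W :=
  Finset.biUnion_subset_biUnion_of_subset_left _ h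

/-- As no plaquette contains two edges of `T`, the weight is a product over the edges of `T`, apart
from a factor that does not involve them. -/
lemma wt_split (hTW : T ⊆ W) (hT : Separated T) (σ : Edge → ZMod n) :
    wt w.k w.b W (stars W) σ =
      restWt w W T σ * ∏ e ∈ T, (w.k (σ e) * starProd w e σ) := by
  have hd : ∏ p ∈ stars T, w.b (curl σ p) = ∏ e ∈ T, starProd w e σ := by
    refine Finset.prod_biUnion fun e he e' he' hne => ?_
    rw [Function.onFun, Finset.disjoint_left]
    intro p hp hp'
    exact hT e he e' he' hne.symm (mem_nbr.2 ⟨hne.symm, p, mem_star.1 hp, mem_star.1 hp'⟩)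
  rw [wt, restWt, ← Finset.prod_sdiff hTW, ← Finset.prod_sdiff (stars_mono hTW), hd,
    prod_mul_distrib]
  ring

lemma curl_update_notMem {e : Edge} {p : Plaquette} (h : e ∉ plaqEdges p) (σ : Edge → ZMod n)
    (x : ZMod n) : curl (update σ e x) p = curl σ p :=
  curl_congr fun f hf => update_of_ne (by rintro rfl; exact h hf) _ _

lemma restWt_update {e : Edge} (he : e ∈ T) (σ : Edge → ZMod n) (x : ZMod n) :
    restWt w W T (update σ e x) = restWt w W T σ := by
  rw [restWt, restWt]
  congr 1
  · refine prod_congr rfl fun f hf => ?_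
    rw [update_of_ne]
    rintro rfl
    exact (mem_sdiff.1 hf).2 he
  · refine prod_congr rfl fun p hp => ?_
    rw [curl_update_notMem]
    intro hep
    exact (mem_sdiff.1 hp).2 (Finset.mem_biUnion.2 ⟨e, he, mem_star.2 hep⟩)

lemma starProd_update_of_notMem {e e' : Edge} (hne : e' ≠ e) (h : e' ∉ nbr e)
    (σ : Edge → ZMod n) (x : ZMod n) :
    starProd w e (update σ e' x) = starProd w e σ := by
  refine prod_congr rfl fun p hp => ?_
  rw [curl_update_notMem]
  intro hp'
  exact h (mem_nbr.2 ⟨hne, p, mem_star.1 hp, hp'⟩)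

lemma starProd_update_of_closedAround {e : Edge} {σ : Edge → ZMod n} {h : ZMod n}
    (hc : ClosedAround e (update σ e h)) (x : ZMod n) :
    starProd w e (update σ e x) = w.b (x - h) ^ 6 := by
  rw [starProd, ← card_star e, ← prod_const]
  refine prod_congr rfl fun p hp => ?_
  rw [curl_update_of_closedAround hc x hp]
  rcases plaquetteBoundary_apply_mem (mem_star.1 hp) with h2 | h2 <;> rw [h2]
  · rw [one_smul]
  · rw [neg_smul, one_smul, w.b_neg]

/-- The total weight of a function `u` of the value of an edge with pinned value `h`, relative to
the weight of `h`. -/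
def fibre (w : Weights n) (u : ZMod n → ℂ) (h : ZMod n) : ℂ :=
  (∑ x, ((w.k x * w.b (x - h) ^ 6 : ℝ) : ℂ) * u x) / (w.k h : ℂ)

variable (H : ZMod n → Prop)

open Classical in
/-- Summation over the values of the edges of `T` that have a pinned value. Only the pinned value
is kept, with the total weight of all values. -/
theorem sum_wt_fibre (hTW : T ⊆ W) (hT : Separated T) (u : Edge → ZMod n → ℂ)
    {G : (Edge → ZMod n) → ℂ}
    (hG : ∀ e ∈ T, ∀ σ x, G (update σ e x) = G σ) :
    ∑ σ ∈ Conf (ZMod n) W, (wt w.k w.b W (stars W) σ : ℂ) * (G σ * ∏ e ∈ T, u e (σ e)) =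
      ∑ σ ∈ Conf (ZMod n) W, if Red H T σ then (wt w.k w.b W (stars W) σ : ℂ) *
        (G σ * ∏ e ∈ T, if Pinned H e σ then fibre w (u e) (σ e) else u e (σ e)) else 0 := by
  have key := sum_conf_replace (A := ZMod n) (R := ℂ) hTW (F := fun σ => (restWt w W T σ : ℂ) * G σ)
    (s := fun e σ => ((w.k (σ e) * starProd w e σ : ℝ) : ℂ) * u e (σ e))
    (s' := fun e σ => ((w.k (σ e) * starProd w e σ : ℝ) : ℂ) *
      if RedAt H e σ then (if Pinned H e σ then fibre w (u e) (σ e) else u e (σ e)) else 0)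
    (fun e he σ x => by rw [restWt_update he, hG e he])
    (fun e he e' he' hne σ x => by
      rw [starProd_update_of_notMem hne (hT e he e' he' hne), update_of_ne hne.symm])
    (fun e he e' he' hne σ x => by
      have hag : ∀ f ∈ nbr e, update σ e' x f = σ f := fun f hf =>
        update_of_ne (by rintro rfl; exact hT e he _ he' hne hf) _ _
      have he1 : update σ e' x e = σ e := update_of_ne hne.symm _ _
      rw [starProd_update_of_notMem hne (hT e he e' he' hne), he1, pinned_congr hag,
        redAt_congr hag he1])
    (fun e he σ => by
      simp only [Function.update_self, pinned_update]
      by_cases hp : Pinned H e σ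
      -- At an edge with pinned value `h` the condition `RedAt` selects `h`, and `fibre` is the sum
      -- over all values.
      · obtain ⟨h, hh, hc⟩ := id hp
        have hred : ∀ x, RedAt H e (update σ e x) ↔ x = h := by
          intro x
          constructor
          · intro hr
            have := hr h hh (by rwa [Function.update_idem])
            rwa [Function.update_self] at this
          · rintro rfl y hy hcy
            rw [Function.update_idem] at hcy
            rw [Function.update_self]
            exact closedAround_unique hc hcy
        simp only [hred, hp, if_true, starProd_update_of_closedAround hc]
        refine Eq.symm ((Finset.sum_eq_single h (fun x _ hx => by rw [if_neg hx, mul_zero])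
          (fun h' => absurd (mem_univ h) h')).trans ?_)
        rw [if_pos rfl, sub_self, w.b_zero, one_pow, mul_one, fibre, mul_div_cancel₀]
        exact_mod_cast (w.k_pos h).ne'
      · have hred : ∀ x, RedAt H e (update σ e x) := fun x y hy hcy =>
          absurd ⟨y, hy, by rwa [Function.update_idem] at hcy⟩ hp
        simp only [hred, hp, if_true, if_false])
  refine Eq.trans (Eq.trans ?_ key) ?_
  · refine sum_congr rfl fun σ _ => ?_
    rw [wt_split hTW hT]
    simp only [prod_mul_distrib, Complex.ofReal_mul, Complex.ofReal_prod]
    ring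
  · refine sum_congr rfl fun σ _ => ?_
    split_ifs with hr
    · rw [wt_split hTW hT]
      have e1 : ∀ e ∈ T, (if RedAt H e σ then
          (if Pinned H e σ then fibre w (u e) (σ e) else u e (σ e)) else 0) =
          if Pinned H e σ then fibre w (u e) (σ e) else u e (σ e) := fun e he => if_pos (hr e he)
      rw [prod_mul_distrib, prod_congr rfl e1]
      simp only [prod_mul_distrib, Complex.ofReal_mul, Complex.ofReal_prod]
      ring
    · rw [Red] at hr
      push Not at hr
      obtain ⟨e, he, hre⟩ := hr
      rw [Finset.prod_eq_zero he (by rw [if_neg hre, mul_zero]), mul_zero]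

/-- The bound on the mean phase of an edge for arbitrary values of the plaquettes around it. -/
def PhaseBound (w : Weights n) (ρ : AddChar (ZMod n) Circle) (δ : ℝ) : Prop :=
  ∀ v : Fin 6 → ZMod n, ‖∑ g, ((ρ g : Circle) : ℂ) * (((∏ i, w.b (g + v i)) * w.k g : ℝ) : ℂ)‖ ≤
    (1 - δ) * ∑ g, (∏ i, w.b (g + v i)) * w.k g

/-- The bound on the conditional mean phase of the edge `e`, given all other edges. -/
lemma PhaseBound.norm_sum_le {ρ : AddChar (ZMod n) Circle} {δ : ℝ} (hδ : PhaseBound w ρ δ) (e : Edge)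
    (σ : Edge → ZMod n) {c : ℤ} (hc : c = 1 ∨ c = -1) :
    ‖∑ x, ((w.k x * starProd w e (update σ e x) : ℝ) : ℂ) * ((ρ (c • x) : Circle) : ℂ)‖ ≤
      (1 - δ) * ∑ x, w.k x * starProd w e (update σ e x) := by
  have h6 : Fintype.card (star e) = 6 := by rw [Fintype.card_coe, card_star]
  set ψ : Fin 6 ≃ star e := (Fintype.equivFinOfCardEq h6).symm with hψ
  have hprod : ∀ F : Plaquette → ℝ, ∏ p ∈ star e, F p = ∏ i, F (ψ i) := by
    intro F
    rw [← Finset.prod_coe_sort, ← Equiv.prod_comp ψ]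
  -- the value of each plaquette is an affine function of the value of the edge
  obtain ⟨v, hv⟩ : ∃ v : Fin 6 → ZMod n, ∀ x i,
      w.b (curl (update σ e x) (ψ i)) = w.b (c • x + v i) := by
    have hi : ∀ i, ∃ v : ZMod n, ∀ x, w.b (curl (update σ e x) (ψ i)) = w.b (c • x + v) := by
      intro i
      have hb : ∀ x, curl (update σ e x) (ψ i) =
          plaquetteBoundary (ψ i) e • x + curl (update σ e 0) (ψ i) := by
        intro x
        rw [curl_update, curl_update, smul_sub, smul_sub, smul_zero]; ring
      rcases plaquetteBoundary_apply_mem (mem_star.1 (ψ i).2) with h2 | h2 <;> rcases hc with rfl | rfl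
      · exact ⟨_, fun x => by rw [hb, h2]⟩
      · refine ⟨-curl (update σ e 0) (ψ i), fun x => ?_⟩
        rw [hb, h2, ← w.b_neg, neg_add, one_smul, neg_smul, one_smul]
      · refine ⟨-curl (update σ e 0) (ψ i), fun x => ?_⟩
        rw [hb, h2, ← w.b_neg, neg_add, one_smul, neg_smul, one_smul, neg_neg]
      · exact ⟨_, fun x => by rw [hb, h2]⟩
    choose v hv using hi
    exact ⟨v, fun x i => hv i x⟩
  have hs : ∀ x, starProd w e (update σ e x) = ∏ i, w.b (c • x + v i) := by
    intro x
    rw [starProd, hprod fun p => w.b (curl (update σ e x) p)]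
    exact prod_congr rfl fun i _ => hv x i
  have hk : ∀ x, w.k x = w.k (c • x) := by
    intro x
    rcases hc with rfl | rfl
    · rw [one_smul]
    · rw [neg_smul, one_smul, w.k_neg]
  have hbij : Function.Bijective fun x : ZMod n => c • x := by
    rcases hc with rfl | rfl
    · simp only [one_smul]; exact Function.bijective_id
    · simp only [neg_smul, one_smul]; exact (Equiv.neg (ZMod n)).bijective
  have h1 := hδ v
  rw [← hbij.sum_comp, ← hbij.sum_comp (fun g => (∏ i, w.b (g + v i)) * w.k g)] at h1
  refine le_trans (le_of_eq ?_) (h1.trans (le_of_eq ?_))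
  · congr 1
    refine sum_congr rfl fun x _ => ?_
    rw [hs, hk x, mul_comm, mul_comm (w.k _)]
  · congr 1
    refine sum_congr rfl fun x _ => ?_
    rw [hs, hk x, mul_comm]

/-- Given the other edges, the phases of separated edges are independent, and each of them has
small mean. -/
theorem norm_sum_wt_le {ρ : AddChar (ZMod n) Circle} {δ : ℝ} (hδ : PhaseBound w ρ δ)
    (hTW : T ⊆ W) (hT : Separated T) {c : Edge → ℤ} (hc : ∀ e ∈ T, c e = 1 ∨ c e = -1)
    {G : (Edge → ZMod n) → ℂ} (hG : ∀ e ∈ T, ∀ σ x, G (update σ e x) = G σ)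
    (hG1 : ∀ σ, ‖G σ‖ ≤ 1) :
    ‖∑ σ ∈ Conf (ZMod n) W, (wt w.k w.b W (stars W) σ : ℂ) *
      (G σ * ∏ e ∈ T, ((ρ (c e • σ e) : Circle) : ℂ))‖ ≤
      (1 - δ) ^ T.card * ∑ σ ∈ Conf (ZMod n) W, wt w.k w.b W (stars W) σ := by
  -- `S0 e` is the total conditional weight of the values of `e`, and `S1 e` the same with the
  -- phases.
  set S0 : Edge → (Edge → ZMod n) → ℝ := fun e σ =>
    ∑ x, w.k x * starProd w e (update σ e x) with hS0
  have hS0pos : ∀ e σ, 0 < S0 e σ := fun e σ => Finset.sum_pos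
    (fun x _ => mul_pos (w.k_pos x) (starProd_pos e _)) Finset.univ_nonempty
  set S1 : Edge → (Edge → ZMod n) → ℂ := fun e σ =>
    ∑ x, ((w.k x * starProd w e (update σ e x) : ℝ) : ℂ) * ((ρ (c e • x) : Circle) : ℂ)
    with hS1
  have hS0u : ∀ e σ y, S0 e (update σ e y) = S0 e σ := fun e σ y => by
    simp only [hS0, Function.update_idem]
  have hS1u : ∀ e σ y, S1 e (update σ e y) = S1 e σ := fun e σ y => by
    simp only [hS1, Function.update_idem]
  have hS0n : ∀ e ∈ T, ∀ e' ∈ T, e' ≠ e → ∀ σ y, S0 e (update σ e' y) = S0 e σ := by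
    intro e he e' he' hne σ y
    simp only [hS0]
    refine sum_congr rfl fun x _ => ?_
    rw [Function.update_comm hne, starProd_update_of_notMem hne (hT e he e' he' hne)]
  have hS1n : ∀ e ∈ T, ∀ e' ∈ T, e' ≠ e → ∀ σ y, S1 e (update σ e' y) = S1 e σ := by
    intro e he e' he' hne σ y
    simp only [hS1]
    refine sum_congr rfl fun x _ => ?_
    rw [Function.update_comm hne, starProd_update_of_notMem hne (hT e he e' he' hne)]
  -- The phase of each edge of `T` is replaced by its conditional mean `S1 e / S0 e`.
  have key := sum_conf_replace (A := ZMod n) (R := ℂ) hTW (F := fun σ => (restWt w W T σ : ℂ) * G σ)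
    (s := fun e σ => ((w.k (σ e) * starProd w e σ : ℝ) : ℂ) * ((ρ (c e • σ e) : Circle) : ℂ))
    (s' := fun e σ => ((w.k (σ e) * starProd w e σ : ℝ) : ℂ) * (S1 e σ / (S0 e σ : ℂ)))
    (fun e he σ x => by rw [restWt_update he, hG e he])
    (fun e he e' he' hne σ x => by
      rw [starProd_update_of_notMem hne (hT e he e' he' hne), update_of_ne hne.symm])
    (fun e he e' he' hne σ x => by
      rw [starProd_update_of_notMem hne (hT e he e' he' hne), update_of_ne hne.symm,
        hS0n e he e' he' hne, hS1n e he e' he' hne])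
    (fun e he σ => by
      simp only [Function.update_self, hS0u, hS1u]
      rw [← sum_mul, ← Complex.ofReal_sum]
      change _ = (S0 e σ : ℂ) * _
      rw [mul_div_cancel₀]
      exact_mod_cast (hS0pos e σ).ne')
  have e1 : ∑ σ ∈ Conf (ZMod n) W, (wt w.k w.b W (stars W) σ : ℂ) *
      (G σ * ∏ e ∈ T, ((ρ (c e • σ e) : Circle) : ℂ)) =
      ∑ σ ∈ Conf (ZMod n) W, (wt w.k w.b W (stars W) σ : ℂ) *
        (G σ * ∏ e ∈ T, (S1 e σ / (S0 e σ : ℂ))) := by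
    refine Eq.trans (Eq.trans ?_ key) ?_ <;>
    · refine sum_congr rfl fun σ _ => ?_
      rw [wt_split hTW hT]
      simp only [prod_mul_distrib, Complex.ofReal_mul, Complex.ofReal_prod]
      ring
  rw [e1, mul_sum]
  refine (norm_sum_le _ _).trans (sum_le_sum fun σ _ => ?_)
  have hw0 : 0 ≤ wt w.k w.b W (stars W) σ := wt_nonneg w.k_nonneg w.b_nonneg _ _ _
  rw [norm_mul, Complex.norm_real, Real.norm_of_nonneg hw0, mul_comm, norm_mul, norm_prod]
  refine mul_le_mul_of_nonneg_right ?_ hw0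
  have h2 : ∏ e ∈ T, ‖S1 e σ / (S0 e σ : ℂ)‖ ≤ (1 - δ) ^ T.card := by
    rw [← prod_const]
    refine Finset.prod_le_prod (fun _ _ => norm_nonneg _) fun e he => ?_
    rw [norm_div, Complex.norm_real, Real.norm_of_nonneg (hS0pos e σ).le, div_le_iff₀ (hS0pos e σ)]
    exact hδ.norm_sum_le e σ (hc e he)
  calc _ ≤ 1 * ∏ e ∈ T, ‖S1 e σ / (S0 e σ : ℂ)‖ :=
        mul_le_mul_of_nonneg_right (hG1 σ) (prod_nonneg fun _ _ => norm_nonneg _)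
    _ ≤ _ := by rw [one_mul]; exact h2

/-- The case in which all six plaquettes are flat at the same value. -/
lemma PhaseBound.norm_mean_le {ρ : AddChar (ZMod n) Circle} {δ : ℝ} (hδ : PhaseBound w ρ δ)
    (h : ZMod n) : ‖w.mean ρ h‖ ≤ 1 - δ := by
  have h1 := hδ fun _ => -h
  simp only [prod_const, Finset.card_univ, Fintype.card_fin] at h1
  rw [← Equiv.sum_comp (Equiv.addRight h),
    ← Equiv.sum_comp (Equiv.addRight h) (fun g => w.b (g + -h) ^ 6 * w.k g)] at h1
  simp only [Equiv.coe_addRight, add_neg_cancel_right] at h1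
  change _ ≤ (1 - δ) * w.mass h at h1
  have hm := w.mass_pos h
  rw [Weights.mean, norm_div, Complex.norm_real, Real.norm_of_nonneg hm.le, div_le_iff₀ hm]
  refine le_trans (le_of_eq ?_) h1
  have e1 : ∑ x, ((ρ (x + h) : Circle) : ℂ) * ((w.b x ^ 6 * w.k (x + h) : ℝ) : ℂ) =
      ((ρ h : Circle) : ℂ) * ∑ x, ((ρ x : Circle) : ℂ) * ((w.b x ^ 6 * w.k (x + h) : ℝ) : ℂ) := by
    rw [mul_sum]
    refine sum_congr rfl fun x _ => ?_
    rw [AddChar.map_add_eq_mul, Circle.coe_mul]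
    ring
  rw [e1, norm_mul, Circle.norm_coe, one_mul]

end Fibre

/-! ### The tilted weight -/

section Tilt

open Classical in
/-- Exponential decay, with one site of the connected set left out. -/
theorem sum_isConn_pow_pred_le {E : Type*} [DecidableEq E] {nb : E → Finset E}
    (hcard : ∀ e, (nb e).card ≤ 18) (W : Finset E) (v : E) (m : ℕ) {y : ℝ}
    (hy : 0 ≤ y) (hy1 : 51 * y ≤ 1) :
    ∑ C ∈ W.powerset with IsConn nb v C ∧ m + 1 ≤ C.card, y ^ (C.card - 1) ≤
      51 * (51 * y) ^ m / 19 := by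
  calc ∑ C ∈ W.powerset with IsConn nb v C ∧ m + 1 ≤ C.card, y ^ (C.card - 1)
      ≤ ∑ C ∈ W.powerset with IsConn nb v C ∧ m + 1 ≤ C.card,
          51 * (51 * y) ^ m * (1 / 51 : ℝ) ^ C.card := by
        refine sum_le_sum fun C hC => ?_
        have hm := (mem_filter.1 hC).2.2
        obtain ⟨c, hc⟩ : ∃ c, C.card = c + 1 := ⟨C.card - 1, by omega⟩
        rw [hc, Nat.add_sub_cancel]
        have e : y = (51 * y) * (1 / 51) := by ring
        calc y ^ c = (51 * y) ^ c * (1 / 51 : ℝ) ^ c := by rw [← mul_pow, ← e]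
          _ ≤ (51 * y) ^ m * (1 / 51 : ℝ) ^ c :=
              mul_le_mul_of_nonneg_right (pow_le_pow_of_le_one (by positivity) hy1 (by omega))
                (by positivity)
          _ = _ := by rw [pow_succ]; ring
    _ ≤ ∑ C ∈ W.powerset with IsConn nb v C, 51 * (51 * y) ^ m * (1 / 51 : ℝ) ^ C.card := by
        refine Finset.sum_le_sum_of_subset_of_nonneg ?_ fun _ _ _ => by positivity
        exact Finset.monotone_filter_right _ fun C _ h => h.1
    _ ≤ 51 * (51 * y) ^ m * (1 / 19) := by
        rw [← mul_sum]
        exact mul_le_mul_of_nonneg_left (sum_isConn_le hcard) (by positivity)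
    _ = _ := by ring

variable {n : ℕ} [NeZero n] (w : Weights n) (H : ZMod n → Prop) (T W : Finset Edge)

open Classical in
/-- The tilted weight. The configuration takes its pinned values at the edges of `T`, in every
component, and the weight of such an edge takes the fluctuations into account. -/
def tilt (σ : Edge → ZMod n) : ℝ :=
  ((if LocRed H T σ then 1 else 0) * wt w.k w.b W (stars W) σ) *
    ∏ e ∈ T, if σ e ≠ 0 ∧ Pinned H e σ then w.gain (σ e) / w.gain 0 else 1

open Classical in
/-- The product of the normalised mean phases of the pinned edges of `T`. -/
def pinMean (ρ : AddChar (ZMod n) Circle) (c : Edge → ℤ) (σ : Edge → ZMod n) : ℂ :=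
  ∏ e ∈ T, if σ e ≠ 0 ∧ Pinned H e σ then w.mean ρ (c e • σ e) / w.mean ρ 0 else 1

/-- The phase of a configuration along a path with coefficients `c` on `S`. -/
def phase (ρ : AddChar (ZMod n) Circle) (S : Finset Edge) (c : Edge → ℤ) (σ : Edge → ZMod n) : ℂ :=
  ∏ e ∈ S, ((ρ (c e • σ e) : Circle) : ℂ)

lemma separable_tilt : Separable nbr (tilt w H T W) :=
  (separable_locRed.mul (separable_wt w.k_zero w.b_zero _ _)).mul
    (Separable.prod fun e _ => separable_pinned e fun h => w.gain h / w.gain 0)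

lemma separable_pinMean (ρ : AddChar (ZMod n) Circle) (c : Edge → ℤ) :
    Separable nbr (pinMean w H T ρ c) :=
  Separable.prod fun e _ => separable_pinned e fun h => w.mean ρ (c e • h) / w.mean ρ 0

lemma separable_phase (ρ : AddChar (ZMod n) Circle) (S : Finset Edge) (c : Edge → ℤ) :
    Separable nbr (phase ρ S c) :=
  Separable.prod fun e _ => Separable.site e (y := fun x => ((ρ (c e • x) : Circle) : ℂ)) (by simp)

lemma norm_phase (ρ : AddChar (ZMod n) Circle) (S : Finset Edge) (c : Edge → ℤ)
    (σ : Edge → ZMod n) : ‖phase ρ S c σ‖ = 1 := by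
  rw [phase, norm_prod]
  exact Finset.prod_eq_one fun e _ => Circle.norm_coe _

lemma tilt_nonneg (σ : Edge → ZMod n) : 0 ≤ tilt w H T W σ := by
  refine mul_nonneg (mul_nonneg (by split_ifs <;> norm_num)
    (wt_nonneg w.k_nonneg w.b_nonneg _ _ _)) (prod_nonneg fun e _ => ?_)
  split_ifs
  · exact (div_pos (w.gain_pos _) (w.gain_pos _)).le
  · norm_num

open Classical in
/-- The possible excess of the weight of an admissible value of an edge. -/
def excess (h : ZMod n) : ℝ := if H h ∧ h ≠ 0 then |w.gain h / w.gain 0 - 1| else 0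

lemma excess_nonneg (h : ZMod n) : 0 ≤ excess w H h := by
  unfold excess; split_ifs
  · exact abs_nonneg _
  · exact le_rfl

lemma excess_zero : excess w H 0 = 0 := if_neg fun h => h.2 rfl

/-- An upper bound for the weight of a single edge under the tilted weight. -/
def edgeWt (h : ZMod n) : ℝ := w.k h * (1 + excess w H h)

lemma edgeWt_zero : edgeWt w H 0 = 1 := by simp [edgeWt, excess_zero, w.k_zero]

lemma edgeWt_nonneg (h : ZMod n) : 0 ≤ edgeWt w H h :=
  mul_nonneg (w.k_nonneg h) (by linarith [excess_nonneg w H h])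

/-- The total tilted weight of the non-zero values of an edge. -/
def edgeSum : ℝ := ∑ h ∈ univ.erase 0, edgeWt w H h

lemma edgeSum_nonneg : 0 ≤ edgeSum w H := sum_nonneg fun _ _ => edgeWt_nonneg w H _

variable {w H T W}

lemma tilt_eq_zero {σ : Edge → ZMod n} (h : ¬ LocRed H T σ) : tilt w H T W σ = 0 := by
  simp [tilt, h]

lemma tilt_le {C : Finset Edge} (hCW : C ⊆ W) {σ : Edge → ZMod n} (hσ : ∀ e ∉ C, σ e = 0) :
    tilt w H T W σ ≤ (∏ e ∈ C, edgeWt w H (σ e)) * ∏ p ∈ stars W, w.b (curl σ p) := by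
  classical
  have hb0 : 0 ≤ ∏ p ∈ stars W, w.b (curl σ p) := prod_nonneg fun _ _ => w.b_nonneg _
  by_cases hl : LocRed H T σ
  swap
  · rw [tilt_eq_zero hl]
    exact mul_nonneg (prod_nonneg fun _ _ => edgeWt_nonneg w H _) hb0
  have h1 : ∏ e ∈ T, (if σ e ≠ 0 ∧ Pinned H e σ then w.gain (σ e) / w.gain 0 else 1) ≤
      ∏ e ∈ C, (1 + excess w H (σ e)) := by
    have hex : ∀ e, 1 ≤ 1 + excess w H (σ e) := fun e => by linarith [excess_nonneg w H (σ e)]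
    have hpos : ∀ e, 0 ≤ (if σ e ≠ 0 ∧ Pinned H e σ then w.gain (σ e) / w.gain 0 else 1) := by
      intro e
      split_ifs
      · exact (div_pos (w.gain_pos _) (w.gain_pos _)).le
      · norm_num
    calc ∏ e ∈ T, (if σ e ≠ 0 ∧ Pinned H e σ then w.gain (σ e) / w.gain 0 else 1)
        = ∏ e ∈ T.filter (· ∈ C),
            (if σ e ≠ 0 ∧ Pinned H e σ then w.gain (σ e) / w.gain 0 else 1) := by
          rw [Finset.prod_filter]
          refine prod_congr rfl fun e _ => ?_
          by_cases he : e ∈ C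
          · rw [if_pos he]
          · rw [if_neg he, if_neg fun h => h.1 (hσ e he)]
      _ ≤ ∏ e ∈ T.filter (· ∈ C), (1 + excess w H (σ e)) := by
          refine Finset.prod_le_prod (fun e _ => hpos e) fun e he => ?_
          split_ifs with h
          · have hr := hl.redAt hσ (mem_filter.1 he).1 h.1
            obtain ⟨x, hx, hcl⟩ := h.2
            have hex' := hr x hx hcl
            rw [excess, if_pos ⟨hex' ▸ hx, h.1⟩]
            linarith [le_abs_self (w.gain (σ e) / w.gain 0 - 1)]
          · exact hex e
      _ ≤ ∏ e ∈ C, (1 + excess w H (σ e)) := by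
          refine Finset.prod_le_prod_of_subset_of_one_le (fun e he => (mem_filter.1 he).2)
            (fun e _ => zero_le_one.trans (hex e)) fun e _ _ => hex e
  rw [tilt, if_pos hl, one_mul, wt, prod_edges_eq w.k_zero hCW hσ]
  simp only [edgeWt, prod_mul_distrib]
  have hk0 : 0 ≤ ∏ e ∈ C, w.k (σ e) := prod_nonneg fun _ _ => w.k_nonneg _
  calc _ ≤ ((∏ e ∈ C, w.k (σ e)) * ∏ p ∈ stars W, w.b (curl σ p)) *
        ∏ e ∈ C, (1 + excess w H (σ e)) := mul_le_mul_of_nonneg_left h1 (mul_nonneg hk0 hb0)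
    _ = _ := by ring

/-- Every non-flat plaquette costs a factor. -/
lemma prod_plaq_le {α : ℝ} (hα : ∀ g ≠ 0, w.b g ≤ α) (hα1 : α ≤ 1) {P : Finset Plaquette}
    {σ : Edge → ZMod n} {m : ℕ} (hm : m ≤ (P.filter fun p => curl σ p ≠ 0).card) :
    ∏ p ∈ P, w.b (curl σ p) ≤ α ^ m := by
  classical
  rcases Nat.eq_zero_or_pos m with rfl | hm0
  · rw [pow_zero]; exact prod_le_one' (fun p => w.b_nonneg _) fun p => w.b_le_one _
  have hα0 : 0 ≤ α := by
    obtain ⟨p, hp⟩ := Finset.card_pos.1 (hm0.trans_le hm)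
    exact (w.b_nonneg _).trans (hα _ (mem_filter.1 hp).2)
  calc ∏ p ∈ P, w.b (curl σ p)
      ≤ ∏ p ∈ P, if curl σ p ≠ 0 then α else 1 := by
        refine Finset.prod_le_prod (fun p _ => w.b_nonneg _) fun p _ => ?_
        split_ifs with h
        · exact hα _ h
        · exact w.b_le_one _
    _ = α ^ (P.filter fun p => curl σ p ≠ 0).card := by
        rw [← Finset.prod_filter, prod_const]
    _ ≤ α ^ m := pow_le_pow_of_le_one hα0 hα1 hm

lemma six_le_card {C : Finset Edge} (hCW : C ⊆ W) {σ : Edge → ZMod n} (hσ : ∀ e ∉ C, σ e = 0)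
    (hne : ∃ p, curl σ p ≠ 0) : 6 ≤ ((stars W).filter fun p => curl σ p ≠ 0).card :=
  (curl_support hσ (fun _ hp => stars_mono hCW (mem_stars_of_curl hσ hp)) hne).1

end Tilt

/-! ### Replacement of the weight by the tilted weight -/

section Replace

variable {n : ℕ} [NeZero n] (w : Weights n) (H : ZMod n → Prop) (T W : Finset Edge)

lemma norm_prod_sub_prod_le {ι : Type*} (T : Finset ι) {a b : ι → ℂ} (ha : ∀ i ∈ T, ‖a i‖ ≤ 1)
    (hb : ∀ i ∈ T, ‖b i‖ ≤ 1) : ‖∏ i ∈ T, a i - ∏ i ∈ T, b i‖ ≤ ∑ i ∈ T, ‖a i - b i‖ := by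
  classical
  induction T using Finset.induction_on with
  | empty => simp
  | insert i T hi ih =>
    have ih' := ih (fun j hj => ha j (Finset.mem_insert_of_mem hj))
      fun j hj => hb j (Finset.mem_insert_of_mem hj)
    rw [Finset.prod_insert hi, Finset.prod_insert hi, Finset.sum_insert hi]
    have e : a i * ∏ j ∈ T, a j - b i * ∏ j ∈ T, b j =
        (a i - b i) * ∏ j ∈ T, a j + b i * (∏ j ∈ T, a j - ∏ j ∈ T, b j) := by ring
    have h1 : ‖∏ j ∈ T, a j‖ ≤ 1 := by
      rw [norm_prod]
      exact Finset.prod_le_one (fun _ _ => norm_nonneg _)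
        fun j hj => ha j (Finset.mem_insert_of_mem hj)
    have h2 := hb i (Finset.mem_insert_self i T)
    rw [e]
    refine (norm_add_le _ _).trans ?_
    rw [norm_mul, norm_mul]
    have := mul_le_mul_of_nonneg_left h1 (norm_nonneg (a i - b i))
    have := mul_le_mul h2 ih' (norm_nonneg _) zero_le_one
    linarith

open Classical in
/-- The error made at the edge `e` when the weight is replaced by the tilted weight. -/
def defect (ε : ℝ) (e : Edge) (σ : Edge → ZMod n) : ℝ :=
  (if RedAt H e σ then 0 else 1) + 3 * ε * if Pinned H e σ then 0 else 1

lemma defect_nonneg {ε : ℝ} (hε : 0 ≤ ε) (e : Edge) (σ : Edge → ZMod n) : 0 ≤ defect H ε e σ := by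
  unfold defect
  refine add_nonneg ?_ (mul_nonneg (by linarith) ?_) <;> split_ifs <;> norm_num

variable {w H T W}

lemma tilt_zero : tilt w H T W 0 = 1 := (separable_tilt w H T W).1

open Classical in
/-- Summation over the values of the pinned edges of `T`, compared with the tilted weight. -/
lemma norm_sum_wt_sub_tilt_le (hTW : T ⊆ W) (hT : Separated T) {u m : Edge → ZMod n → ℂ}
    (hfib : ∀ e ∈ T, ∀ h, fibre w (u e) h = u e h * (w.gain h * m e h))
    (hm : ∀ e ∈ T, ∀ h, ‖m e h‖ ≤ 1) {ε : ℝ} (hε : 0 ≤ ε) (hm0 : ∀ e ∈ T, ‖m e 0 - 1‖ ≤ 2 * ε)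
    (hz : w.gain 0 ≤ 1 + ε) {G : (Edge → ZMod n) → ℂ}
    (hG : ∀ e ∈ T, ∀ σ x, G (update σ e x) = G σ)
    (hR : ∀ σ, ‖G σ * ∏ e ∈ T, u e (σ e)‖ ≤ 1) :
    ‖(∑ σ ∈ Conf (ZMod n) W, (wt w.k w.b W (stars W) σ : ℂ) * (G σ * ∏ e ∈ T, u e (σ e))) /
        ((w.gain 0 : ℂ) ^ T.card) -
      ∑ σ ∈ Conf (ZMod n) W, (tilt w H T W σ : ℂ) * ((G σ * ∏ e ∈ T, u e (σ e)) *
        ∏ e ∈ T, if σ e ≠ 0 ∧ Pinned H e σ then m e (σ e) else m e 0)‖ ≤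
      ∑ σ ∈ Conf (ZMod n) W, tilt w H T W σ * ∑ e ∈ T, defect H ε e σ := by
  have hz1 := w.one_le_gain 0
  have hz0 : (w.gain 0 : ℂ) ≠ 0 := by exact_mod_cast (w.gain_pos 0).ne'
  rw [sum_wt_fibre H hTW hT u hG, Finset.sum_div, ← Finset.sum_sub_distrib]
  refine (norm_sum_le _ _).trans (sum_le_sum fun σ _ => ?_)
  have ht := tilt_nonneg w H T W σ
  -- After division by `gain 0` for every edge, `a e` is the factor at `e` in the first sum and `b
  -- e` the one in the second. They differ only if `e` has no pinned value.
  set R := G σ * ∏ e ∈ T, u e (σ e) with hRdef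
  set a : Edge → ℂ := fun e => if Pinned H e σ then m e (σ e) else 1 / (w.gain 0 : ℂ) with ha
  set b : Edge → ℂ := fun e => if σ e ≠ 0 ∧ Pinned H e σ then m e (σ e) else m e 0 with hb
  have hb1 : ∀ e ∈ T, ‖b e‖ ≤ 1 := fun e he => by
    simp only [hb]; split_ifs <;> exact hm e he _
  have hi1 : ‖1 / (w.gain 0 : ℂ)‖ ≤ 1 := by
    rw [norm_div, norm_one, Complex.norm_real, Real.norm_of_nonneg (w.gain_pos 0).le]
    exact (div_le_one (w.gain_pos 0)).2 hz1
  have ha1 : ∀ e ∈ T, ‖a e‖ ≤ 1 := fun e he => by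
    simp only [ha]; split_ifs
    · exact hm e he _
    · exact hi1
  have hdef0 : 0 ≤ ∑ e ∈ T, defect H ε e σ := sum_nonneg fun e _ => defect_nonneg H hε e σ
  by_cases hred : Red H T σ
  · rw [if_pos hred]
    have e1 : (wt w.k w.b W (stars W) σ : ℂ) * (G σ * ∏ e ∈ T, if Pinned H e σ then
        fibre w (u e) (σ e) else u e (σ e)) / (w.gain 0 : ℂ) ^ T.card =
        (tilt w H T W σ : ℂ) * (R * ∏ e ∈ T, a e) := by
      have h1 : ∀ e ∈ T, (if Pinned H e σ then fibre w (u e) (σ e) else u e (σ e)) =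
          u e (σ e) * (a e * ((w.gain 0 : ℂ) *
            ((if σ e ≠ 0 ∧ Pinned H e σ then w.gain (σ e) / w.gain 0 else 1 : ℝ) : ℂ))) := by
        intro e he
        simp only [ha]
        by_cases hp : Pinned H e σ
        · rw [if_pos hp, if_pos hp, hfib e he]
          by_cases h0 : σ e = 0
          · rw [if_neg (by simp [h0]), h0]; push_cast; ring
          · rw [if_pos ⟨h0, hp⟩]; push_cast; field_simp
        · rw [if_neg hp, if_neg hp, if_neg fun h => hp h.2]
          push_cast; field_simp
      rw [prod_congr rfl h1, prod_mul_distrib, prod_mul_distrib,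
        prod_mul_distrib, prod_const, tilt, if_pos hred.locRed, one_mul]
      push_cast
      field_simp
      rw [hRdef]; ring
    rw [e1, ← mul_sub, ← mul_sub, norm_mul, norm_mul, Complex.norm_real, Real.norm_of_nonneg ht]
    refine mul_le_mul_of_nonneg_left ?_ ht
    calc ‖R‖ * ‖∏ e ∈ T, a e - ∏ e ∈ T, b e‖ ≤ 1 * ∑ e ∈ T, ‖a e - b e‖ :=
          mul_le_mul (hR σ) (norm_prod_sub_prod_le T ha1 hb1) (norm_nonneg _) zero_le_one
      _ ≤ _ := by
          rw [one_mul]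
          refine sum_le_sum fun e he => ?_
          simp only [ha, hb, defect]
          by_cases hp : Pinned H e σ
          · have : m e (σ e) = if σ e ≠ 0 ∧ Pinned H e σ then m e (σ e) else m e 0 := by
              by_cases h0 : σ e = 0
              · rw [if_neg (by simp [h0]), h0]
              · rw [if_pos ⟨h0, hp⟩]
            rw [if_pos hp, ← this, sub_self, norm_zero, if_pos hp, mul_zero, add_zero]
            split_ifs <;> norm_num
          · rw [if_neg hp, if_neg (fun h => hp h.2), if_neg hp, mul_one]
            have h1 : ‖1 / (w.gain 0 : ℂ) - 1‖ ≤ ε := by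
              have : 1 / (w.gain 0 : ℂ) - 1 = ((-((w.gain 0 - 1) / w.gain 0) : ℝ) : ℂ) := by
                push_cast; field_simp; ring
              rw [this, Complex.norm_real, norm_neg,
                Real.norm_of_nonneg (div_nonneg (by linarith) (w.gain_pos 0).le),
                div_le_iff₀ (w.gain_pos 0)]
              nlinarith
            have h2 : ‖1 / (w.gain 0 : ℂ) - m e 0‖ ≤ 3 * ε := by
              calc ‖1 / (w.gain 0 : ℂ) - m e 0‖ = ‖(1 / (w.gain 0 : ℂ) - 1) - (m e 0 - 1)‖ := by
                    congr 1; ring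
                _ ≤ _ := (norm_sub_le _ _).trans (by linarith [hm0 e he])
            split_ifs <;> linarith
  -- A configuration that occurs in the second sum only: an edge misses its pinned value, although
  -- each component of the configuration respects it.
  · rw [if_neg hred, zero_div, zero_sub, norm_neg, norm_mul, norm_mul, Complex.norm_real,
      Real.norm_of_nonneg ht]
    refine mul_le_mul_of_nonneg_left ?_ ht
    have hbn : ‖∏ e ∈ T, b e‖ ≤ 1 := by
      rw [norm_prod]; exact Finset.prod_le_one (fun _ _ => norm_nonneg _) hb1
    have h1 : ‖R‖ * ‖∏ e ∈ T, b e‖ ≤ 1 := mul_le_one₀ (hR σ) (norm_nonneg _) hbn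
    refine h1.trans ?_
    rw [Red] at hred
    push Not at hred
    obtain ⟨e, he, hre⟩ := hred
    refine le_trans ?_ (Finset.single_le_sum (fun e _ => defect_nonneg H hε e σ) he)
    rw [defect, if_neg hre]
    have : 0 ≤ 3 * ε * if Pinned H e σ then (0 : ℝ) else 1 :=
      mul_nonneg (by linarith) (by split_ifs <;> norm_num)
    linarith

open Classical in
/-- The bound on the expected error at one edge. -/
def defectBound (w : Weights n) (H : ZMod n → Prop) (α : ℝ) : ℝ :=
  51 / 19 * (1 + edgeSum w H) * (α ^ 7 * (51 * edgeSum w H) ^ 6 +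
    3 * (α ^ 6 * w.a) * (α ^ 6 * (51 * edgeSum w H) +
      (if ∀ h, H h then 0 else 1) * (51 * edgeSum w H) ^ 6))

open Classical in
/-- The expected error at one edge. An edge that misses its pinned value costs a seventh non-flat
plaquette, as well as a cluster of seven edges. An edge without a pinned value costs six non-flat
plaquettes, or, for a flat configuration with non-admissible value, a cluster of seven edges. -/
lemma sum_tilt_defect_le (hTW : T ⊆ W) (H0 : H 0) {α : ℝ} (hα : ∀ g ≠ 0, w.b g ≤ α) (hα0 : 0 ≤ α)
    (hα1 : α ≤ 1) (hP : 51 * edgeSum w H ≤ 1) {e : Edge} (he : e ∈ T) :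
    ∑ σ ∈ Conf (ZMod n) W, tilt w H T W σ * defect H (α ^ 6 * w.a) e σ ≤
      (∑ σ ∈ Conf (ZMod n) W, tilt w H T W σ) * defectBound w H α := by
  set ε := α ^ 6 * w.a with hεdef
  have hε : 0 ≤ ε := mul_nonneg (pow_nonneg hα0 6) w.a_nonneg
  set P := edgeSum w H with hPdef
  have hP0 : 0 ≤ P := edgeSum_nonneg w H
  -- Whether there is a defect at `e` can be read off from the component of `e`, with `e` itself
  -- included.
  refine (sum_conf_env_le (separable_tilt w H T W) (tilt_nonneg w H T W)
    (defect_nonneg H hε e) (hTW he) ?_).trans ?_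
  · intro ω S heS hS
    refine le_of_eq ?_
    have hag : ∀ f ∈ nbr e, ω f = S.piecewise ω (0 : Edge → ZMod n) f := by
      intro f hf
      by_cases hfS : f ∈ S
      · rw [Finset.piecewise_eq_of_mem _ _ _ hfS]
      · rw [Finset.piecewise_eq_of_notMem _ _ _ hfS]
        by_contra h0
        exact hS e heS f hfS (Or.inr rfl) h0 hf
    simp only [defect, pinned_congr (H := H) hag,
      redAt_congr (H := H) hag (Finset.piecewise_eq_of_mem _ _ _ heS).symm]
  refine mul_le_mul_of_nonneg_left ?_ (sum_nonneg fun σ _ => tilt_nonneg w H T W σ)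
  -- The indicator of the event that some value is not admissible.
  set κ : ℝ := if ∀ h, H h then 0 else 1 with hκ
  have hκ0 : 0 ≤ κ := by rw [hκ]; split_ifs <;> norm_num
  set A : Finset Edge → ℝ := fun D => (if 6 + 1 ≤ D.card then α ^ 7 + 3 * ε * κ else 0) +
    if 1 + 1 ≤ D.card then 3 * ε * α ^ 6 else 0 with hA
  have hpt : ∀ D ⊆ W, IsConn nbr e D → ∀ τ ∈ ConfAt (ZMod n) e D,
      tilt w H T W τ * defect H ε e τ ≤ A D * ∏ f ∈ D, edgeWt w H (τ f) := by
    intro D hDW hD τ hτ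
    rw [mem_confAt] at hτ
    have heD : e ∈ D := hD.1
    have hY : 0 ≤ ∏ f ∈ D, edgeWt w H (τ f) := prod_nonneg fun _ _ => edgeWt_nonneg w H _
    have hA0 : 0 ≤ A D := by
      simp only [hA]
      refine add_nonneg ?_ ?_ <;> split_ifs <;> positivity
    by_cases hl : LocRed H T τ
    swap
    · rw [tilt_eq_zero hl, zero_mul]; exact mul_nonneg hA0 hY
    set B := ∏ p ∈ stars W, w.b (curl τ p) with hB
    have htl : tilt w H T W τ ≤ (∏ f ∈ D, edgeWt w H (τ f)) * B := tilt_le hDW hτ.2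
    have hB0 : 0 ≤ B := prod_nonneg fun _ _ => w.b_nonneg _
    have hB1 : B ≤ 1 := prod_le_one' (fun _ => w.b_nonneg _) fun _ => w.b_le_one _
    -- an edge that misses its pinned value
    have h1 : B * (if RedAt H e τ then 0 else 1) ≤ if 6 + 1 ≤ D.card then α ^ 7 else 0 := by
      by_cases hr : RedAt H e τ
      · rw [if_pos hr, mul_zero]; split_ifs <;> positivity
      rw [if_neg hr, mul_one]
      -- With at most six non-flat plaquettes `LocRed` would give the pinned value at `e`.
      have h7 : B ≤ α ^ 7 := by
        refine prod_plaq_le hα hα1 ?_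
        by_contra hc
        exact hr (hl.redAt_of_card_le hτ.2
          (fun p hp => stars_mono hDW (mem_stars_of_curl hτ.2 hp)) (by omega) he)
      have hcard : 7 ≤ D.card := by
        rw [RedAt] at hr
        push Not at hr
        obtain ⟨h, hh, hcl, hne⟩ := hr
        have h0 : τ e = 0 := by
          by_contra h0
          exact hne (hl.redAt hτ.2 he h0 h hh hcl)
        refine seven_le_card (η := update τ e h) (e := e) ?_ hcl ?_
        · rw [Function.update_self]; rw [h0] at hne; exact hne.symm
        · intro f hf
          by_contra hfD
          have hfe : f ≠ e := by rintro rfl; exact hfD heD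
          rw [update_of_ne hfe] at hf
          exact hf (hτ.2 f hfD)
      rw [if_pos hcard]; exact h7
    -- an edge without pinned value
    have h2 : B * (if Pinned H e τ then 0 else 1) ≤
        (if 6 + 1 ≤ D.card then κ else 0) + if 1 + 1 ≤ D.card then α ^ 6 else 0 := by
      have hn1 : (0 : ℝ) ≤ if 6 + 1 ≤ D.card then κ else 0 := by split_ifs <;> positivity
      have hn2 : (0 : ℝ) ≤ if 1 + 1 ≤ D.card then α ^ 6 else 0 := by split_ifs <;> positivity
      by_cases hp : Pinned H e τ
      · rw [if_pos hp, mul_zero]; exact add_nonneg hn1 hn2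
      rw [if_neg hp, mul_one]
      by_cases hcl : ∀ p, curl τ p = 0
      · have hnH : ¬ H (τ e) := fun hH => hp ⟨τ e, hH, by
          rw [Function.update_eq_self]; exact fun p _ => hcl p⟩
        have h0 : τ e ≠ 0 := fun h0 => hnH (h0 ▸ H0)
        have hcard : 7 ≤ D.card := seven_le_card h0 (fun p _ => hcl p)
          fun f hf => by_contra fun hfD => hf (hτ.2 f hfD)
        have hκ1 : κ = 1 := by rw [hκ, if_neg fun h => hnH (h _)]
        rw [if_pos hcard, hκ1]
        linarith
      · push Not at hcl
        have h6 : B ≤ α ^ 6 := prod_plaq_le hα hα1 (six_le_card hDW hτ.2 hcl)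
        have hcard : 1 + 1 ≤ D.card := by
          by_contra hc
          have hD1 : D = {e} := by
            refine (Finset.eq_of_subset_of_card_le (Finset.singleton_subset_iff.2 heD) ?_).symm
            rw [Finset.card_singleton]; omega
          refine hp ⟨0, H0, fun p _ => ?_⟩
          refine curl_eq_zero fun f _ => ?_
          by_cases hfe : f = e
          · rw [hfe, Function.update_self]
          · rw [update_of_ne hfe]
            exact hτ.2 f (by rw [hD1, Finset.mem_singleton]; exact hfe)
        rw [if_pos hcard]
        linarith
    have h3 : B * defect H ε e τ ≤ A D := by
      have : B * defect H ε e τ = B * (if RedAt H e τ then 0 else 1) +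
          3 * ε * (B * (if Pinned H e τ then 0 else 1)) := by rw [defect]; ring
      rw [this]
      have := mul_le_mul_of_nonneg_left h2 (by positivity : 0 ≤ 3 * ε)
      simp only [hA]
      split_ifs at * <;> linarith
    calc tilt w H T W τ * defect H ε e τ
        ≤ ((∏ f ∈ D, edgeWt w H (τ f)) * B) * defect H ε e τ :=
          mul_le_mul_of_nonneg_right htl (defect_nonneg H hε e τ)
      _ = (∏ f ∈ D, edgeWt w H (τ f)) * (B * defect H ε e τ) := mul_assoc _ _ _
      _ ≤ (∏ f ∈ D, edgeWt w H (τ f)) * A D := mul_le_mul_of_nonneg_left h3 hY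
      _ = _ := mul_comm _ _
  have hsum : ∀ D ⊆ W, IsConn nbr e D → ∑ τ ∈ ConfAt (ZMod n) e D,
      tilt w H T W τ * defect H ε e τ ≤ A D * ((1 + P) * P ^ (D.card - 1)) := by
    intro D hDW hD
    refine (sum_le_sum (hpt D hDW hD)).trans (le_of_eq ?_)
    rw [← mul_sum]
    congr 1
    have := sum_confAt_prod hD.1 (edgeWt w H) (edgeWt w H)
    have hP1 : ∑ t, edgeWt w H t = 1 + P := by
      rw [← Finset.add_sum_erase univ _ (mem_univ (0 : ZMod n)), edgeWt_zero]; rfl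
    rw [hP1] at this
    refine Eq.trans ?_ this
    exact sum_congr rfl fun τ _ => (Finset.mul_prod_erase D _ hD.1).symm
  calc ∑ D ∈ W.powerset with IsConn nbr e D, ∑ τ ∈ ConfAt (ZMod n) e D,
        tilt w H T W τ * defect H ε e τ
      ≤ ∑ D ∈ W.powerset with IsConn nbr e D, A D * ((1 + P) * P ^ (D.card - 1)) := by
        refine sum_le_sum fun D hD => ?_
        rw [mem_filter, mem_powerset] at hD
        exact hsum D hD.1 hD.2
    _ = (1 + P) * ((α ^ 7 + 3 * ε * κ) *
          (∑ D ∈ W.powerset with IsConn nbr e D ∧ 6 + 1 ≤ D.card, P ^ (D.card - 1)) +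
        3 * ε * α ^ 6 *
          ∑ D ∈ W.powerset with IsConn nbr e D ∧ 1 + 1 ≤ D.card, P ^ (D.card - 1)) := by
        have hf : ∀ m : ℕ, ∑ D ∈ W.powerset with IsConn nbr e D ∧ m + 1 ≤ D.card, P ^ (D.card - 1) =
            ∑ D ∈ W.powerset with IsConn nbr e D,
              if m + 1 ≤ D.card then P ^ (D.card - 1) else 0 := fun m => by
          rw [← Finset.filter_filter, ← Finset.sum_filter]
        rw [hf 6, hf 1, mul_sum, mul_sum, ← sum_add_distrib, mul_sum]
        refine sum_congr rfl fun D _ => ?_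
        simp only [hA]
        split_ifs <;> ring
    _ ≤ (1 + P) * ((α ^ 7 + 3 * ε * κ) * (51 * (51 * P) ^ 6 / 19) +
          3 * ε * α ^ 6 * (51 * (51 * P) ^ 1 / 19)) := by
        refine mul_le_mul_of_nonneg_left (add_le_add
          (mul_le_mul_of_nonneg_left ?_ (by positivity))
          (mul_le_mul_of_nonneg_left ?_ (by positivity))) (by positivity)
        · exact sum_isConn_pow_pred_le card_nbr W e 6 hP0 hP
        · exact sum_isConn_pow_pred_le card_nbr W e 1 hP0 hP
    _ = defectBound w H α := by rw [defectBound]; ring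

open Classical in
/-- The expectation of the phase under the original weight is close to an expectation under the
tilted weight, with a factor `mean 0` for every edge of `T`. -/
theorem norm_avg_wt_sub_tilt_le (ρ : AddChar (ZMod n) Circle) {S : Finset Edge} (hTS : T ⊆ S)
    (hTW : T ⊆ W) (hT : Separated T) {c : Edge → ℤ} (hc : ∀ e ∈ T, c e = 1 ∨ c e = -1) (H0 : H 0)
    {α : ℝ} (hα : ∀ g ≠ 0, w.b g ≤ α) (hα0 : 0 ≤ α) (hα1 : α ≤ 1) (hP : 51 * edgeSum w H ≤ 1)
    (hθ : w.mean ρ 0 ≠ 0) (hmean : ∀ h, ‖w.mean ρ h‖ ≤ 1) :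
    ‖avg (wt w.k w.b W (stars W)) W (phase ρ S c) - w.mean ρ 0 ^ T.card *
      avg (tilt w H T W) W (fun σ => phase ρ S c σ * pinMean w H T ρ c σ)‖ ≤
      2 * T.card * defectBound w H α := by
  set ε := α ^ 6 * w.a with hεdef
  have hε : 0 ≤ ε := mul_nonneg (pow_nonneg hα0 6) w.a_nonneg
  set Z := ∑ σ ∈ Conf (ZMod n) W, tilt w H T W σ with hZdef
  have hZ : 0 < Z := sum_weight_pos (tilt_nonneg w H T W) tilt_zero W
  set D := ∑ σ ∈ Conf (ZMod n) W, tilt w H T W σ * ∑ e ∈ T, defect H ε e σ with hDdef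
  have hD : D ≤ Z * (T.card * defectBound w H α) := by
    rw [hDdef]
    simp only [mul_sum]
    rw [Finset.sum_comm]
    calc _ ≤ ∑ e ∈ T, Z * defectBound w H α := sum_le_sum fun e he =>
          sum_tilt_defect_le hTW H0 hα hα0 hα1 hP he
      _ = _ := by rw [Finset.sum_const, nsmul_eq_mul]; ring
  have hsplit : ∀ σ, phase ρ S c σ = phase ρ (S \ T) c σ * phase ρ T c σ := fun σ => by
    rw [phase, phase, phase, Finset.prod_sdiff hTS]
  have hz := w.gain_zero_le hα
  have hm0 := w.norm_mean_zero_sub_one_le ρ hα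
  have hkC : ∀ h, (w.k h : ℂ) ≠ 0 := fun h => by exact_mod_cast (w.k_pos h).ne'
  -- The numerator of the expectation, and below its denominator, for which the phases are replaced
  -- by one.
  have num := norm_sum_wt_sub_tilt_le (w := w) (H := H) hTW hT
    (u := fun e x => ((ρ (c e • x) : Circle) : ℂ)) (m := fun e h => w.mean ρ (c e • h))
    (fun e he h => by
      rw [fibre, w.sum_edge ρ h (hc e he), Weights.gain]
      push_cast; ring)
    (fun e _ h => hmean _) hε (fun e _ => by rw [smul_zero]; exact hm0) hz
    (G := phase ρ (S \ T) c)
    (fun e he σ x => prod_congr rfl fun f hf => by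
      rw [update_of_ne]
      rintro rfl
      exact (mem_sdiff.1 hf).2 he)
    (fun σ => by
      change ‖phase ρ (S \ T) c σ * phase ρ T c σ‖ ≤ 1
      rw [norm_mul, norm_phase, norm_phase, one_mul])
  have den := norm_sum_wt_sub_tilt_le (w := w) (H := H) hTW hT
    (u := fun _ _ => 1) (m := fun _ _ => 1)
    (fun e he h => by
      rw [fibre, one_mul, mul_one]
      simp only [mul_one]
      rw [← Complex.ofReal_sum, w.sum_edge_one, Weights.gain]
      push_cast; rfl)
    (fun e _ h => by simp) hε (fun e _ => by simpa using hε) hz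
    (G := fun _ => 1) (fun e he σ x => rfl) (fun σ => by simp)
  simp only [ite_self, Finset.prod_const_one, mul_one] at den
  rw [← hDdef] at num den
  set N1 := ∑ σ ∈ Conf (ZMod n) W, (wt w.k w.b W (stars W) σ : ℂ) * phase ρ S c σ with hN1
  set Z1 := ∑ σ ∈ Conf (ZMod n) W, (wt w.k w.b W (stars W) σ : ℂ) with hZ1
  set N2 := ∑ σ ∈ Conf (ZMod n) W, (tilt w H T W σ : ℂ) *
    (phase ρ S c σ * pinMean w H T ρ c σ) with hN2
  have hZ1r : Z1 = ((∑ σ ∈ Conf (ZMod n) W, wt w.k w.b W (stars W) σ : ℝ) : ℂ) := by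
    rw [hZ1]; push_cast; rfl
  have hZ1p : 0 < ∑ σ ∈ Conf (ZMod n) W, wt w.k w.b W (stars W) σ :=
    sum_weight_pos (wt_nonneg w.k_nonneg w.b_nonneg _ _) (separable_wt w.k_zero w.b_zero _ _).1 W
  have hZ1n : Z1 ≠ 0 := by rw [hZ1r]; exact_mod_cast hZ1p.ne'
  have hgn : (w.gain 0 : ℂ) ^ T.card ≠ 0 := pow_ne_zero _ (by exact_mod_cast (w.gain_pos 0).ne')
  have hZc : ∑ σ ∈ Conf (ZMod n) W, (tilt w H T W σ : ℂ) = (Z : ℂ) := by rw [hZdef]; push_cast; rfl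
  rw [hZc] at den
  have hnum : ‖N1 / (w.gain 0 : ℂ) ^ T.card - w.mean ρ 0 ^ T.card * N2‖ ≤ D := by
    refine le_trans (le_of_eq ?_) num
    congr 2
    · congr 1
      exact sum_congr rfl fun σ _ => by rw [hsplit]; rfl
    · rw [hN2, mul_sum]
      refine sum_congr rfl fun σ _ => ?_
      rw [hsplit]
      change _ = (tilt w H T W σ : ℂ) * ((phase ρ (S \ T) c σ * phase ρ T c σ) * _)
      have : ∏ e ∈ T, (if σ e ≠ 0 ∧ Pinned H e σ then w.mean ρ (c e • σ e)
          else w.mean ρ (c e • (0 : ZMod n))) = w.mean ρ 0 ^ T.card * pinMean w H T ρ c σ := by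
        rw [pinMean, ← prod_const, ← prod_mul_distrib]
        refine prod_congr rfl fun e _ => ?_
        split_ifs
        · field_simp
        · rw [smul_zero, mul_one]
      rw [this]; ring
  have hL : ‖N1 / Z1‖ ≤ 1 := by
    have := norm_avg_le (wt_nonneg w.k_nonneg w.b_nonneg W (stars W))
      (separable_wt w.k_zero w.b_zero W (stars W)).1 (W := W) (f := phase ρ S c)
      (fun σ => (norm_phase ρ S c σ).le)
    rw [avg, ← hZ1r] at this
    exact this
  have hZC : (Z : ℂ) ≠ 0 := by exact_mod_cast hZ.ne'
  have e1 : avg (wt w.k w.b W (stars W)) W (phase ρ S c) = N1 / Z1 := by rw [avg, ← hZ1r]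
  have e2 : avg (tilt w H T W) W (fun σ => phase ρ S c σ * pinMean w H T ρ c σ) = N2 / Z := by
    rw [avg]
  rw [e1, e2]
  have e3 : (N1 / Z1 - w.mean ρ 0 ^ T.card * (N2 / Z)) * Z =
      (N1 / (w.gain 0 : ℂ) ^ T.card - w.mean ρ 0 ^ T.card * N2) -
        (N1 / Z1) * (Z1 / (w.gain 0 : ℂ) ^ T.card - Z) := by
    field_simp; ring
  have h4 : ‖N1 / Z1 - w.mean ρ 0 ^ T.card * (N2 / Z)‖ * Z ≤ 2 * D := by
    calc _ = ‖(N1 / Z1 - w.mean ρ 0 ^ T.card * (N2 / Z)) * Z‖ := by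
          rw [norm_mul, Complex.norm_real, Real.norm_of_nonneg hZ.le]
      _ ≤ D + 1 * D := by
          rw [e3]
          refine (norm_sub_le _ _).trans (add_le_add hnum ?_)
          rw [norm_mul]
          exact mul_le_mul hL den (norm_nonneg _) zero_le_one
      _ = 2 * D := by ring
  refine le_of_mul_le_mul_right ?_ hZ
  calc _ ≤ 2 * D := h4
    _ ≤ _ := by nlinarith

end Replace

/-! ### Configurations with non-flat plaquettes -/

section NonFlat

variable {n : ℕ} [NeZero n]

/-- A plaquette that contains the given edge. -/
def plaqOf (e : Edge) : Plaquette := (star_nonempty e).choose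

lemma mem_plaqOf (e : Edge) : e ∈ plaqEdges (plaqOf e) := mem_star.1 (star_nonempty e).choose_spec

lemma phase_eq (ρ : AddChar (ZMod n) Circle) (γ : Edge →₀ ℤ) (σ : Edge → ZMod n) :
    phase ρ γ.support γ σ = ((ρ (evalChain σ γ) : Circle) : ℂ) := (rho_evalChain ρ σ γ).symm

lemma evalChain_eq_of_eqOn {σ τ : Edge → ZMod n} {γ : Edge →₀ ℤ}
    (h : ∀ e ∈ γ.support, σ e = τ e) : evalChain σ γ = evalChain τ γ :=
  evalChain_congr h

lemma curl_single (e : Edge) (g : ZMod n) (p : Plaquette) :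
    curl (Pi.single e g) p = plaquetteBoundary p e • g := by
  have h := curl_update (0 : Edge → ZMod n) e g p
  rw [curl_zero, zero_add, Pi.zero_apply, sub_zero] at h
  exact h

variable {w : Weights n} {H : ZMod n → Prop} {T : Finset Edge} {ρ : AddChar (ZMod n) Circle}

lemma pinMean_eq_one {c : Edge → ℤ} {σ : Edge → ZMod n} (h : ∀ e ∈ T, σ e = 0) :
    pinMean w H T ρ c σ = 1 :=
  Finset.prod_eq_one fun e he => if_neg fun h' => h'.1 (h e he)

lemma norm_prod_sub_one_le_card {ι : Type*} (S : Finset ι) {x : ι → ℂ} {A μ : ℝ} (hμ : 1 ≤ μ)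
    (h1 : ∀ i ∈ S, ‖x i‖ ≤ μ) (hA : ∀ i ∈ S, ‖x i - 1‖ ≤ A) :
    ‖∏ i ∈ S, x i - 1‖ ≤ S.card * A * μ ^ S.card := by
  classical
  induction S using Finset.induction_on with
  | empty => simp
  | insert i S hi ih =>
    have ih' := ih (fun j hj => h1 j (Finset.mem_insert_of_mem hj))
      fun j hj => hA j (Finset.mem_insert_of_mem hj)
    have hi1 := h1 i (Finset.mem_insert_self i S)
    have hiA := hA i (Finset.mem_insert_self i S)
    have hA0 : 0 ≤ A := (norm_nonneg _).trans hiA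
    rw [Finset.prod_insert hi, Finset.card_insert_of_notMem hi]
    have e : x i * ∏ j ∈ S, x j - 1 = x i * (∏ j ∈ S, x j - 1) + (x i - 1) := by ring
    rw [e]
    refine (norm_add_le _ _).trans ?_
    rw [norm_mul]
    have h2 := mul_le_mul hi1 ih' (norm_nonneg _) (by linarith)
    have h3 : 1 ≤ μ ^ (S.card + 1) := one_le_pow₀ hμ
    have h4 : A ≤ A * μ ^ (S.card + 1) := le_mul_of_one_le_right hA0 h3
    push_cast
    rw [pow_succ] at h4 ⊢
    nlinarith

/-- Only the edges of `T` in the support contribute. -/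
lemma norm_pinMean_sub_one_le {μ A : ℝ} (hμ : ∀ h, ‖w.mean ρ h / w.mean ρ 0‖ ≤ μ) (hμ1 : 1 ≤ μ)
    (hA : ∀ h, ‖w.mean ρ h / w.mean ρ 0 - 1‖ ≤ A) (c : Edge → ℤ) {C : Finset Edge}
    {σ : Edge → ZMod n} (hσC : ∀ e ∉ C, σ e = 0) :
    ‖pinMean w H T ρ c σ - 1‖ ≤ C.card * A * μ ^ C.card := by
  classical
  have hA0 : 0 ≤ A := (norm_nonneg _).trans (hA 0)
  have e1 : pinMean w H T ρ c σ = ∏ e ∈ T.filter (· ∈ C),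
      if σ e ≠ 0 ∧ Pinned H e σ then w.mean ρ (c e • σ e) / w.mean ρ 0 else 1 := by
    rw [pinMean, Finset.prod_filter]
    refine prod_congr rfl fun e _ => ?_
    by_cases heC : e ∈ C
    · rw [if_pos heC]
    · rw [if_neg heC, if_neg fun h => h.1 (hσC e heC)]
  rw [e1]
  have hc : (T.filter (· ∈ C)).card ≤ C.card :=
    Finset.card_le_card fun e he => (mem_filter.1 he).2
  refine (norm_prod_sub_one_le_card _ hμ1 (A := A) (fun e _ => ?_) fun e _ => ?_).trans ?_
  · split_ifs
    · exact hμ _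
    · rw [norm_one]; exact hμ1
  · split_ifs
    · exact hA _
    · rw [sub_self, norm_zero]; exact hA0
  · exact mul_le_mul (mul_le_mul_of_nonneg_right (by exact_mod_cast hc) hA0)
      (pow_le_pow_right₀ hμ1 hc) (by positivity) (by positivity)

lemma norm_pinMean_sub_le {μ A : ℝ} (hμ : ∀ h, ‖w.mean ρ h / w.mean ρ 0‖ ≤ μ) (hμ1 : 1 ≤ μ)
    (hA : ∀ h, ‖w.mean ρ h / w.mean ρ 0 - 1‖ ≤ A) (c : Edge → ℤ) {C : Finset Edge}
    {σ τ : Edge → ZMod n} (hσC : ∀ e ∉ C, σ e = 0) (hτC : ∀ e ∉ C, τ e = 0) :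
    ‖pinMean w H T ρ c σ - pinMean w H T ρ c τ‖ ≤ 2 * A * C.card * μ ^ C.card := by
  have e2 : pinMean w H T ρ c σ - pinMean w H T ρ c τ =
      (pinMean w H T ρ c σ - 1) - (pinMean w H T ρ c τ - 1) := by ring
  rw [e2]
  refine (norm_sub_le _ _).trans ((add_le_add (norm_pinMean_sub_one_le hμ hμ1 hA c hσC)
    (norm_pinMean_sub_one_le hμ hμ1 hA c hτC)).trans (le_of_eq ?_))
  ring

lemma phase_eq_one {S : Finset Edge} {c : Edge → ℤ} {σ : Edge → ZMod n} (h : ∀ e ∈ S, σ e = 0) :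
    phase ρ S c σ = 1 :=
  Finset.prod_eq_one fun e he => by rw [h e he]; simp

/-- If two configurations on a connected set `C`, the first of which is not flat while the second
is, give different values to the observable, then the first one has many non-flat plaquettes, or
`C` is large and close to the path, or `C` is close to a corner of the path, or `C` surrounds an
endpoint of the path. -/
lemma nonflat_cases {γ : Edge →₀ ℤ} (hTS : T ⊆ γ.support) (H0 : H 0) {C : Finset Edge} {v : Edge}
    (hC : IsConn nbr v C) {σ τ : Edge → ZMod n} (hσ : ∀ e ∉ C, σ e = 0) (hτ : ∀ e ∉ C, τ e = 0)
    (hl : LocRed H T σ) (hne : ∃ p, curl σ p ≠ 0) (hcl : ∀ p, curl τ p = 0)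
    (hd : phase ρ γ.support γ σ * pinMean w H T ρ γ σ ≠
      phase ρ γ.support γ τ * pinMean w H T ρ γ τ)
    {P : Finset Plaquette} (hP : ∀ p, curl σ p ≠ 0 → p ∈ P) :
    (∃ e ∈ γ.support, e ∈ C ∧ 2 ≤ C.card ∧ 7 ≤ (P.filter fun p => curl σ p ≠ 0).card) ∨
      (∃ e ∈ γ.support \ T, ∃ f ∈ plaqEdges (plaqOf e), f ∈ C) ∨
      ((¬ ∀ h, H h) ∧ ∃ e ∈ T, ∃ f ∈ plaqEdges (plaqOf e), f ∈ C ∧ 6 ≤ C.card) ∨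
      (phase ρ γ.support γ σ = phase ρ γ.support γ τ ∧ ∃ e ∈ T, e ∈ C ∧ 6 ≤ C.card) ∨
      ∃ x ∈ (boundary γ).support, ∃ k : ℕ, ∃ f ∈ plaqEdges (plaqOf (ray x k)),
        f ∈ C ∧ k + 1 ≤ C.card := by
  classical
  -- A configuration that is not flat has at least six non-flat plaquettes.
  obtain ⟨h6, h6'⟩ := curl_support hσ hP hne
  obtain ⟨e₀, he₀, he₀C⟩ : ∃ e ∈ γ.support, e ∈ C := by
    by_contra hcon
    push Not at hcon
    apply hd
    rw [phase_eq_one fun e he => hσ e (hcon e he), phase_eq_one fun e he => hτ e (hcon e he),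
      pinMean_eq_one fun e he => hσ e (hcon e (hTS he)),
      pinMean_eq_one fun e he => hτ e (hcon e (hTS he))]
  by_cases h7 : 7 ≤ (P.filter fun p => curl σ p ≠ 0).card
  · left
    refine ⟨e₀, he₀, he₀C, ?_, h7⟩
    by_contra hc
    have hC1 : C = {e₀} := by
      refine (Finset.eq_of_subset_of_card_le (Finset.singleton_subset_iff.2 he₀C) ?_).symm
      rw [Finset.card_singleton]; omega
    have : (P.filter fun p => curl σ p ≠ 0) ⊆ star e₀ := by
      intro p hp
      have hp0 := (mem_filter.1 hp).2
      by_contra hps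
      refine hp0 (curl_eq_zero fun f hf => hσ f ?_)
      rw [hC1, Finset.mem_singleton]
      rintro rfl
      exact hps (mem_star.2 hf)
    have := Finset.card_le_card this
    rw [card_star] at this
    omega
  right
  -- In the case of exactly six plaquettes, they surround an edge `e'`, and changing the value of
  -- `e'` turns `σ` into a closed form `η`. The cases depend on the position of `e'`.
  obtain ⟨e', g, hg⟩ := h6' (by omega)
  have hg0 : g ≠ 0 := by
    rintro rfl
    obtain ⟨p, hp⟩ := hne
    rw [hg, curl_single, smul_zero] at hp
    exact hp rfl
  have hit : ∃ f ∈ plaqEdges (plaqOf e'), f ∈ C := by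
    by_contra hcon
    push Not at hcon
    have h0 : curl σ (plaqOf e') = 0 := curl_eq_zero fun f hf => hσ f (hcon f hf)
    rw [hg, curl_single] at h0
    rcases plaquetteBoundary_apply_mem (mem_plaqOf e') with h | h <;> rw [h] at h0 <;>
      simp [hg0] at h0
  set η : Edge → ZMod n := update σ e' (σ e' - g) with hη
  have hηcl : ∀ p, curl η p = 0 := fun p => by
    rw [hη, curl_update, hg, curl_single, ← smul_add]
    simp
  have hηC : ∀ f, η f ≠ 0 → f ∈ insert e' C := by
    intro f hf
    by_contra hcon
    rw [Finset.mem_insert, not_or] at hcon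
    rw [hη, update_of_ne hcon.1] at hf
    exact hf (hσ f hcon.2)
  have hη6 : ∀ f, η f ≠ 0 → 6 ≤ C.card := by
    intro f hf
    have h7 := seven_le_card hf (fun p _ => hηcl p) hηC
    have := Finset.card_insert_le e' C
    omega
  by_cases he'S : e' ∈ γ.support
  -- If `e'` belongs to `T`, then `η e'` is not admissible, as `σ` does not take this value; in
  -- particular `η` does not vanish at `e'`.
  · by_cases he'T : e' ∈ T
    · right; left
      obtain ⟨f, hf, hfC⟩ := hit
      have hr := hl.redAt_of_card_le hσ hP (by omega) he'T
      refine ⟨fun hall => hg0 ?_, e', he'T, f, hf, hfC, hη6 e' ?_⟩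
      · exact sub_eq_self.1 (hr (σ e' - g) (hall _) fun p _ => hηcl p).symm
      intro h0
      have hx : σ e' - g = 0 := by rw [hη, Function.update_self] at h0; exact h0
      have := hr (σ e' - g) (hx ▸ H0) fun p _ => hηcl p
      exact hg0 (by rw [hx] at this; rw [this, zero_sub] at hx; exact neg_eq_zero.1 hx)
    · left
      exact ⟨e', mem_sdiff.2 ⟨he'S, he'T⟩, hit⟩
  right
  -- Off the path, `e'` is irrelevant for the phase, so `η` may replace `σ`.
  have hση : ∀ e ∈ γ.support, η e = σ e := fun e he =>
    update_of_ne (by rintro rfl; exact he'S he) _ _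
  -- a point of `C` next to a given point of the support of `η`
  have near : ∀ u, η u ≠ 0 → ∃ u' ∈ C, u' ∈ plaqEdges (plaqOf u) ∧ |u'.1 0 - u.1 0| ≤ 1 ∧
      (u ≠ e' → u' = u) := by
    intro u hu
    by_cases hue : u = e'
    · subst hue
      obtain ⟨f, hf, hfC⟩ := hit
      refine ⟨f, hfC, hf, ?_, fun h => absurd rfl h⟩
      by_cases hfu : f = u
      · subst hfu; simp
      · exact nbr_coord (mem_nbr.2 ⟨hfu, _, mem_plaqOf u, hf⟩) 0
    · have huC : u ∈ C := (Finset.mem_insert.1 (hηC u hu)).resolve_left hue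
      exact ⟨u, huC, mem_plaqOf u, by simp, fun _ => rfl⟩
  right
  by_cases hph : phase ρ γ.support γ σ = phase ρ γ.support γ τ
  · left
    refine ⟨hph, ?_⟩
    have hpm : pinMean w H T ρ γ σ ≠ pinMean w H T ρ γ τ := fun h => hd (by rw [hph, h])
    by_cases h1 : ∀ e ∈ T, σ e = 0
    · by_cases h2 : ∀ e ∈ T, τ e = 0
      · exact absurd (by rw [pinMean_eq_one h1, pinMean_eq_one h2]) hpm
      · push Not at h2
        obtain ⟨e, he, he0⟩ := h2
        have heC : e ∈ C := by_contra fun h => he0 (hτ e h)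
        have := seven_le_card he0 (fun p _ => hcl p) fun f hf => by_contra fun h => hf (hτ f h)
        exact ⟨e, he, heC, by omega⟩
    · push Not at h1
      obtain ⟨e, he, he0⟩ := h1
      have heC : e ∈ C := by_contra fun h => he0 (hσ e h)
      exact ⟨e, he, heC, hη6 e (by rw [hση e (hTS he)]; exact he0)⟩
  · right
    rw [phase_eq, phase_eq, ← evalChain_eq_of_eqOn hση] at hph
    have hev : evalChain η γ ≠ 0 ∨ evalChain τ γ ≠ 0 := by
      by_contra hcon
      push Not at hcon
      exact hph (by rw [hcon.1, hcon.2])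
    rcases hev with hev | hev
    · obtain ⟨x, hx, k, l, h1, h2⟩ :=
        exists_ray (W := insert e' C) (fun e he => by_contra fun h => he (hηC e h)) hηcl hev
      obtain ⟨u, huC, hup, hud, hue⟩ := near _ h1
      obtain ⟨u', huC', -, hud', hue'⟩ := near _ h2
      refine ⟨x, hx, k, u, hup, huC, ?_⟩
      have hext := (hC.reroot nbr_symm huC).extent huC' 0
      have c1 : (ray x k).1 0 = x 0 + k := by simp [ray, unit]
      have c2 : (ray x (-(l + 1))).1 0 = x 0 - (l + 1) := by simp [ray, unit]; ring
      rw [c1] at hud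
      rw [c2] at hud'
      by_cases hk : ray x k = e'
      · have hl' : ray x (-(l + 1)) ≠ e' := by
          intro h
          rw [← hk] at h
          have := congrArg (fun e : Edge => e.1 0) h
          simp only [c1, c2] at this
          omega
        have := hue' hl'
        rw [this, c2] at hext
        rw [abs_le] at hud
        have h3 := neg_abs_le (x 0 - (l + 1) - u.1 0)
        omega
      · have := hue hk
        rw [this, c1] at hext
        rw [abs_le] at hud'
        have h3 := neg_abs_le (u'.1 0 - (x 0 + k))
        omega
    · obtain ⟨x, hx, k, l, h1, h2⟩ := exists_ray hτ hcl hev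
      have hu : ray x k ∈ C := by_contra fun h => h1 (hτ _ h)
      have hu' : ray x (-(l + 1)) ∈ C := by_contra fun h => h2 (hτ _ h)
      refine ⟨x, hx, k, _, mem_plaqOf _, hu, ?_⟩
      have hext := (hC.reroot nbr_symm hu).extent hu' 0
      have c1 : (ray x k).1 0 = x 0 + k := by simp [ray, unit]
      have c2 : (ray x (-(l + 1))).1 0 = x 0 - (l + 1) := by simp [ray, unit]; ring
      rw [c1, c2] at hext
      have h3 := neg_abs_le (x 0 - (l + 1) - (x 0 + k))
      omega

end NonFlat

section NonFlatSum

variable {n : ℕ} [NeZero n] (w : Weights n) (H : ZMod n → Prop)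

/-- The weight of a pair of values of an edge, for a pair of configurations of which the first one
has the tilted weight; the factor `μ` bounds the effect of the observable. -/
def pairWt (μ : ℝ) (t : ZMod n × ZMod n) : ℝ := edgeWt w H t.1 * w.k t.2 * μ

/-- The total weight of the non-zero pairs. -/
def pairSum (μ : ℝ) : ℝ := ((1 + edgeSum w H) * (1 + w.a) - 1) * μ

variable {w H}

lemma sum_pairWt (μ : ℝ) :
    ∑ t ∈ (univ : Finset (ZMod n × ZMod n)).erase 0, pairWt w H μ t = pairSum w H μ := by
  simp only [pairWt, pairSum]
  rw [← sum_mul, sum_pair_erase _ _ (edgeWt_zero w H) w.k_zero]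
  rfl

lemma pairWt_nonneg {μ : ℝ} (hμ : 0 ≤ μ) (t : ZMod n × ZMod n) : 0 ≤ pairWt w H μ t :=
  mul_nonneg (mul_nonneg (edgeWt_nonneg w H _) (w.k_nonneg _)) hμ

lemma pairSum_nonneg {μ : ℝ} (hμ : 0 ≤ μ) : 0 ≤ pairSum w H μ := by
  rw [← sum_pairWt]; exact sum_nonneg fun t _ => pairWt_nonneg hμ t

/-- The common majorant of the normalised mean phases of a pair of configurations. -/
def majorant (T : Finset Edge) (μ : ℝ) (ω : Edge → ZMod n × ZMod n) : ℝ :=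
  ∏ e ∈ T, if ω e = 0 then 1 else μ

lemma separable_majorant (T : Finset Edge) (μ : ℝ) : Separable nbr (majorant (n := n) T μ) :=
  Separable.prod fun e _ =>
    Separable.site e (y := fun t : ZMod n × ZMod n => if t = 0 then (1 : ℝ) else μ) (if_pos rfl)

lemma majorant_le {T C : Finset Edge} {μ : ℝ} (hμ : 1 ≤ μ) {ω : Edge → ZMod n × ZMod n}
    (hω : ∀ e ∉ C, ω e = 0) : majorant T μ ω ≤ μ ^ C.card := by
  classical
  have h1 : ∀ e, (1 : ℝ) ≤ if ω e = 0 then 1 else μ := fun e => by split_ifs <;> linarith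
  calc majorant T μ ω ≤ ∏ e ∈ T ∪ C, if ω e = 0 then 1 else μ :=
        Finset.prod_le_prod_of_subset_of_one_le Finset.subset_union_left
          (fun e _ => zero_le_one.trans (h1 e)) fun e _ _ => h1 e
    _ = ∏ e ∈ C, if ω e = 0 then 1 else μ := by
        refine (Finset.prod_subset Finset.subset_union_right fun e _ he => ?_).symm
        rw [if_pos (hω e he)]
    _ ≤ ∏ e ∈ C, μ := by
        refine Finset.prod_le_prod (fun e _ => zero_le_one.trans (h1 e)) fun e _ => ?_
        split_ifs <;> linarith
    _ = _ := prod_const _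

variable {T : Finset Edge} {ρ : AddChar (ZMod n) Circle}

lemma norm_pinMean_le {μ : ℝ} (hμ : ∀ h, ‖w.mean ρ h / w.mean ρ 0‖ ≤ μ) (hμ1 : 1 ≤ μ) (c : Edge → ℤ)
    (ω : Edge → ZMod n × ZMod n) (π : ZMod n × ZMod n → ZMod n) (hπ : π 0 = 0) :
    ‖pinMean w H T ρ c fun e => π (ω e)‖ ≤ majorant T μ ω := by
  rw [pinMean, norm_prod]
  refine Finset.prod_le_prod (fun _ _ => norm_nonneg _) fun e _ => ?_
  by_cases h : ω e = 0
  · rw [if_pos h, h, hπ, if_neg (by simp), norm_one]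
  · rw [if_neg h]
    split_ifs
    · exact hμ _
    · rw [norm_one]; exact hμ1

/-- The number of the given points in `C`, counted with weight `c`, if `C` is not too small. -/
def touch {ι : Type*} (S : Finset ι) (pt : ι → Edge) (m : ι → ℕ) (c : ℝ) (C : Finset Edge) : ℝ :=
  ∑ i ∈ S, if pt i ∈ C ∧ m i ≤ C.card then c else 0

lemma touch_nonneg {ι : Type*} (S : Finset ι) (pt : ι → Edge) (m : ι → ℕ) {c : ℝ} (hc : 0 ≤ c)
    (C : Finset Edge) : 0 ≤ touch S pt m c C :=
  sum_nonneg fun i _ => by split_ifs <;> positivity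

lemma le_touch {ι : Type*} {S : Finset ι} {pt : ι → Edge} {m : ι → ℕ} {c : ℝ} (hc : 0 ≤ c)
    {C : Finset Edge} {i : ι} (hi : i ∈ S) (h1 : pt i ∈ C) (h2 : m i ≤ C.card) :
    c ≤ touch S pt m c C := by
  refine le_trans ?_ (Finset.single_le_sum (f := fun i => if pt i ∈ C ∧ m i ≤ C.card then
    c else 0) (fun i _ => by split_ifs <;> positivity) hi)
  simp [h1, h2]

open Classical in
lemma sum_touch_le {ι : Type*} (S : Finset ι) (pt : ι → Edge) (m : ι → ℕ) {c y : ℝ} (hc : 0 ≤ c)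
    (hy : 0 ≤ y) (hy1 : 51 * y ≤ 1) (W : Finset Edge) :
    ∑ C ∈ W.powerset with ∃ v, IsConn nbr v C, touch S pt m c C * y ^ C.card ≤
      ∑ i ∈ S, c * ((51 * y) ^ m i / 19) :=
  sum_conn_le nbr_symm card_nbr S pt m (fun _ => hc) hy hy1 fun C _ _ _ => by
    rw [touch, sum_mul]
    exact sum_le_sum fun i _ => by split_ifs <;> simp

/-- A finite geometric sum over the distances from the endpoints of a path. -/
lemma sum_ray_le {V : Finset Vertex} (hV : V.card ≤ 2) (K : ℕ) {z c : ℝ} (hz : 0 ≤ z)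
    (hz1 : z ≤ 1 / 2) (hc : 0 ≤ c) :
    ∑ i ∈ (V ×ˢ range K).sigma (fun j => plaqEdges (plaqOf (ray j.1 j.2))),
      c * (z ^ (i.1.2 + 1) / 19) ≤ 16 * c * z / 19 := by
  have hgeo : ∑ k ∈ range K, z ^ k ≤ 2 := by
    have h := geom_sum_mul z K
    have hp := pow_nonneg hz K
    have hs : 0 ≤ ∑ k ∈ range K, z ^ k := sum_nonneg fun k _ => pow_nonneg hz k
    nlinarith
  rw [Finset.sum_sigma, Finset.sum_product]
  simp only [Finset.sum_const, card_plaqEdges, nsmul_eq_mul]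
  have e1 : ∑ k ∈ range K, ((4 : ℕ) : ℝ) * (c * (z ^ (k + 1) / 19)) =
      4 * c * z / 19 * ∑ k ∈ range K, z ^ k := by
    rw [mul_sum]
    refine sum_congr rfl fun k _ => ?_
    rw [pow_succ]; push_cast; ring
  rw [e1]
  have hV' : (V.card : ℝ) ≤ 2 := by exact_mod_cast hV
  have h4 : 0 ≤ 4 * c * z / 19 := by positivity
  calc (V.card : ℝ) * (4 * c * z / 19 * ∑ k ∈ range K, z ^ k)
      ≤ 2 * (4 * c * z / 19 * 2) := by
        refine mul_le_mul hV' (mul_le_mul_of_nonneg_left hgeo h4) (by positivity) (by norm_num)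
    _ = _ := by ring

open Classical in
/-- The contribution of the configurations with non-flat plaquettes to the comparison between the
tilted weight and the weight of flat configurations. -/
theorem sum_nonflat_le {γ : Edge →₀ ℤ} (hγ : IsPath γ) (hTS : T ⊆ γ.support) (H0 : H 0)
    {W : Finset Edge} {α : ℝ} (hα : ∀ g ≠ 0, w.b g ≤ α) (hα0 : 0 ≤ α) (hα1 : α ≤ 1) {μ A : ℝ}
    (hμ : ∀ h, ‖w.mean ρ h / w.mean ρ 0‖ ≤ μ) (hμ1 : 1 ≤ μ)
    (hA : ∀ h, ‖w.mean ρ h / w.mean ρ 0 - 1‖ ≤ A)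
    (hX : 51 * pairSum w H μ ≤ 1 / 2) :
    ∑ C ∈ W.powerset with ∃ v, IsConn nbr v C, ∑ ω ∈ ConfNZ (ZMod n × ZMod n) C,
      (if ∀ p, curl (fun e => (ω e).1) p = 0 then 0 else
        tilt w H T W (fun e => (ω e).1) * wt w.k delta W (stars W) (fun e => (ω e).2) *
        ‖phase ρ γ.support γ (fun e => (ω e).1) * pinMean w H T ρ γ (fun e => (ω e).1) -
          phase ρ γ.support γ (fun e => (ω e).2) * pinMean w H T ρ γ (fun e => (ω e).2)‖) ≤
      2 / 19 * (γ.support.card * (α ^ 7 * (51 * pairSum w H μ) ^ 2) +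
        4 * (γ.support \ T).card * (α ^ 6 * (51 * pairSum w H μ)) +
        4 * T.card * ((if ∀ h, H h then 0 else 1) * (α ^ 6 * (51 * pairSum w H μ) ^ 6)) +
        T.card * (A * (α ^ 6 * (102 * pairSum w H μ) ^ 6)) +
        16 * (α ^ 6 * (51 * pairSum w H μ))) := by
  have hA0 : 0 ≤ A := (norm_nonneg _).trans (hA 0)
  set ι : ℝ := if ∀ h, H h then 0 else 1 with hι
  have hι0 : 0 ≤ ι := by rw [hι]; split_ifs <;> norm_num
  set X := pairSum w H μ with hXdef
  have hX0 : 0 ≤ X := pairSum_nonneg (by linarith)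
  have hz0 : 0 ≤ 51 * X := by positivity
  -- The contributions of the cases in `nonflat_cases`; the bound for `t5` carries another factor
  -- `C.card` from the number of edges in the observable.
  set t1 := touch γ.support id (fun _ => 2) (2 * α ^ 7) with ht1
  set t2 := touch ((γ.support \ T).sigma fun e => plaqEdges (plaqOf e)) (fun i => i.2) (fun _ => 1)
    (2 * α ^ 6) with ht2
  set t3 := touch (T.sigma fun e => plaqEdges (plaqOf e)) (fun i => i.2) (fun _ => 6)
    (2 * (ι * α ^ 6)) with ht3
  set t5 := touch T id (fun _ => 6) (2 * (A * α ^ 6)) with ht5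
  set t4 := touch (((boundary γ).support ×ˢ range (W.card + 1)).sigma
    fun j => plaqEdges (plaqOf (ray j.1 j.2))) (fun i => i.2) (fun i => i.1.2 + 1)
    (2 * α ^ 6) with ht4
  have hn1 : ∀ C, 0 ≤ t1 C := touch_nonneg _ _ _ (by positivity)
  have hn2 : ∀ C, 0 ≤ t2 C := touch_nonneg _ _ _ (by positivity)
  have hn3 : ∀ C, 0 ≤ t3 C := touch_nonneg _ _ _ (by positivity)
  have hn5 : ∀ C, 0 ≤ t5 C := touch_nonneg _ _ _ (by positivity)
  have hn4 : ∀ C, 0 ≤ t4 C := touch_nonneg _ _ _ (by positivity)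
  have hmain : ∀ C ∈ W.powerset.filter (fun C => ∃ v, IsConn nbr v C),
      ∑ ω ∈ ConfNZ (ZMod n × ZMod n) C, (if ∀ p, curl (fun e => (ω e).1) p = 0 then 0 else
        tilt w H T W (fun e => (ω e).1) * wt w.k delta W (stars W) (fun e => (ω e).2) *
        ‖phase ρ γ.support γ (fun e => (ω e).1) * pinMean w H T ρ γ (fun e => (ω e).1) -
          phase ρ γ.support γ (fun e => (ω e).2) * pinMean w H T ρ γ (fun e => (ω e).2)‖) ≤
      (t1 C + t2 C + t3 C + t5 C * C.card + t4 C) * X ^ C.card := by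
    intro C hC
    rw [mem_filter, mem_powerset] at hC
    obtain ⟨hCW, v, hv⟩ := hC
    have hT0 : 0 ≤ t1 C + t2 C + t3 C + t5 C * C.card + t4 C := by linarith [hn1 C, hn2 C, hn3 C, hn4 C, mul_nonneg (hn5 C) (Nat.cast_nonneg C.card)]
    rw [hXdef, ← sum_pairWt, ← sum_confNZ_prod C (pairWt w H μ), mul_sum]
    refine sum_le_sum fun ω hω => ?_
    rw [mem_confNZ] at hω
    have hωC : ∀ e ∉ C, ω e = 0 := fun e he => by_contra fun h => he ((hω e).1 h)
    have hY0 : 0 ≤ ∏ e ∈ C, pairWt w H μ (ω e) :=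
      prod_nonneg fun e _ => pairWt_nonneg (by linarith) _
    set σ : Edge → ZMod n := fun e => (ω e).1 with hσ
    set τ : Edge → ZMod n := fun e => (ω e).2 with hτ
    have hσC : ∀ e ∉ C, σ e = 0 := fun e he => by simp only [hσ, hωC e he]; rfl
    have hτC : ∀ e ∉ C, τ e = 0 := fun e he => by simp only [hτ, hωC e he]; rfl
    by_cases hcl : ∀ p, curl σ p = 0
    · rw [if_pos hcl]; exact mul_nonneg hT0 hY0
    rw [if_neg hcl]
    by_cases hl : LocRed H T σ
    swap
    · rw [tilt_eq_zero hl, zero_mul, zero_mul]; exact mul_nonneg hT0 hY0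
    by_cases hcl2 : ∀ p, curl τ p = 0
    swap
    · push Not at hcl2
      obtain ⟨p, hp⟩ := hcl2
      have : wt w.k delta W (stars W) τ = 0 := by
        rw [wt, Finset.prod_eq_zero (stars_mono hCW (mem_stars_of_curl hτC hp))
          (by rw [delta, if_neg hp]), mul_zero]
      rw [this, mul_zero, zero_mul]; exact mul_nonneg hT0 hY0
    by_cases hd : phase ρ γ.support γ σ * pinMean w H T ρ γ σ =
        phase ρ γ.support γ τ * pinMean w H T ρ γ τ
    · rw [hd, sub_self, norm_zero, mul_zero]; exact mul_nonneg hT0 hY0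
    push Not at hcl
    set B := ∏ p ∈ stars W, w.b (curl σ p) with hB
    have hB0 : 0 ≤ B := prod_nonneg fun _ _ => w.b_nonneg _
    have hP : ∀ p, curl σ p ≠ 0 → p ∈ stars W := fun p hp =>
      stars_mono hCW (mem_stars_of_curl hσC hp)
    have hm0 : 0 ≤ μ ^ C.card := by positivity
    have hq5 : 0 ≤ t5 C * C.card := mul_nonneg (hn5 C) (Nat.cast_nonneg _)
    have h6 : B ≤ α ^ 6 := prod_plaq_le hα hα1 (curl_support hσC hP hcl).1
    have hnorm : ‖phase ρ γ.support γ σ * pinMean w H T ρ γ σ -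
        phase ρ γ.support γ τ * pinMean w H T ρ γ τ‖ ≤ 2 * μ ^ C.card := by
      refine (norm_sub_le _ _).trans ?_
      rw [norm_mul, norm_mul, norm_phase, norm_phase, one_mul, one_mul]
      have h1 := norm_pinMean_le (H := H) (T := T) hμ hμ1 γ ω Prod.fst rfl
      have h2 := norm_pinMean_le (H := H) (T := T) hμ hμ1 γ ω Prod.snd rfl
      have h3 := majorant_le (T := T) hμ1 hωC
      linarith
    have hcoef : B * ‖phase ρ γ.support γ σ * pinMean w H T ρ γ σ -
        phase ρ γ.support γ τ * pinMean w H T ρ γ τ‖ ≤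
        (t1 C + t2 C + t3 C + t5 C * C.card + t4 C) * μ ^ C.card := by
      have := hn1 C; have := hn2 C; have := hn3 C; have := hn4 C
      have hfin : 2 * B ≤ t1 C + t2 C + t3 C + t5 C * C.card + t4 C →
          B * ‖phase ρ γ.support γ σ * pinMean w H T ρ γ σ -
            phase ρ γ.support γ τ * pinMean w H T ρ γ τ‖ ≤
          (t1 C + t2 C + t3 C + t5 C * C.card + t4 C) * μ ^ C.card := fun h =>
        calc _ ≤ B * (2 * μ ^ C.card) := mul_le_mul_of_nonneg_left hnorm hB0
          _ = 2 * B * μ ^ C.card := by ring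
          _ ≤ _ := mul_le_mul_of_nonneg_right h hm0
      rcases nonflat_cases hTS H0 hv hσC hτC hl hcl hcl2 hd hP with
        ⟨e, he, heC, h2, h7⟩ | ⟨e, he, f, hf, hfC⟩ | ⟨hnH, e, he, f, hf, hfC, hc⟩ |
        ⟨hph, e, he, heC, hc⟩ | ⟨x, hx, k, f, hf, hfC, hk⟩
      · have h7' : B ≤ α ^ 7 := prod_plaq_le hα hα1 h7
        have : 2 * α ^ 7 ≤ t1 C := le_touch (by positivity) he heC h2
        exact hfin (by linarith)
      · have : 2 * α ^ 6 ≤ t2 C := le_touch (by positivity) (i := ⟨e, f⟩)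
          (Finset.mem_sigma.2 ⟨he, hf⟩) hfC (Finset.card_pos.2 ⟨f, hfC⟩)
        exact hfin (by linarith)
      · have : 2 * (ι * α ^ 6) ≤ t3 C := le_touch (by positivity) (i := ⟨e, f⟩)
          (Finset.mem_sigma.2 ⟨he, hf⟩) hfC hc
        rw [hι, if_neg hnH, one_mul] at this
        exact hfin (by linarith)
      · have h5 : 2 * (A * α ^ 6) ≤ t5 C := le_touch (by positivity) (i := e) he heC hc
        rw [hph, ← mul_sub, norm_mul, norm_phase, one_mul]
        have h8 := norm_pinMean_sub_le (H := H) (T := T) hμ hμ1 hA γ hσC hτC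
        calc _ ≤ α ^ 6 * (2 * A * C.card * μ ^ C.card) :=
              mul_le_mul h6 h8 (norm_nonneg _) (by positivity)
          _ = 2 * (A * α ^ 6) * C.card * μ ^ C.card := by ring
          _ ≤ t5 C * C.card * μ ^ C.card :=
              mul_le_mul_of_nonneg_right (mul_le_mul_of_nonneg_right h5 (Nat.cast_nonneg _)) hm0
          _ ≤ _ := mul_le_mul_of_nonneg_right (by linarith) hm0
      · have hkW : k < W.card + 1 := by have := Finset.card_le_card hCW; omega
        have : 2 * α ^ 6 ≤ t4 C := le_touch (by positivity) (i := ⟨(x, k), f⟩)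
          (Finset.mem_sigma.2 ⟨mem_product.2 ⟨hx, Finset.mem_range.2 hkW⟩, hf⟩) hfC hk
        exact hfin (by linarith)
    have hK0 : 0 ≤ ∏ e ∈ C, edgeWt w H (σ e) := prod_nonneg fun _ _ => edgeWt_nonneg w H _
    have hK1 : 0 ≤ ∏ e ∈ C, w.k (τ e) := prod_nonneg fun _ _ => w.k_nonneg _
    have hwτ : wt w.k delta W (stars W) τ ≤ ∏ e ∈ C, w.k (τ e) :=
      wt_le w.k_zero w.k_nonneg delta_nonneg delta_le_one hCW _ hτC
    calc _ ≤ ((∏ e ∈ C, edgeWt w H (σ e)) * B * ∏ e ∈ C, w.k (τ e)) *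
          ‖phase ρ γ.support γ σ * pinMean w H T ρ γ σ -
            phase ρ γ.support γ τ * pinMean w H T ρ γ τ‖ :=
          mul_le_mul_of_nonneg_right (mul_le_mul (tilt_le hCW hσC) hwτ
            (wt_nonneg w.k_nonneg delta_nonneg _ _ _) (by positivity)) (norm_nonneg _)
      _ = ((∏ e ∈ C, edgeWt w H (σ e)) * ∏ e ∈ C, w.k (τ e)) *
          (B * ‖phase ρ γ.support γ σ * pinMean w H T ρ γ σ -
            phase ρ γ.support γ τ * pinMean w H T ρ γ τ‖) := by ring
      _ ≤ _ := mul_le_mul_of_nonneg_left hcoef (by positivity)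
      _ = (t1 C + t2 C + t3 C + t5 C * C.card + t4 C) * ∏ e ∈ C, pairWt w H μ (ω e) := by
          simp only [pairWt, prod_mul_distrib, prod_const]
          ring
  -- The factor `C.card ≤ 2 ^ C.card` is absorbed by the exponential decay.
  have h2 : ∀ C : Finset Edge, t5 C * C.card * X ^ C.card ≤ t5 C * (2 * X) ^ C.card := fun C => by
    rw [mul_pow, mul_assoc]
    refine mul_le_mul_of_nonneg_left (mul_le_mul_of_nonneg_right ?_ (by positivity)) (hn5 C)
    exact_mod_cast Nat.lt_two_pow_self.le
  calc _ ≤ ∑ C ∈ W.powerset with ∃ v, IsConn nbr v C,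
        (t1 C * X ^ C.card + t2 C * X ^ C.card + t3 C * X ^ C.card + t5 C * (2 * X) ^ C.card +
          t4 C * X ^ C.card) :=
        sum_le_sum fun C hC => (hmain C hC).trans (by linarith [h2 C])
    _ ≤ ∑ i ∈ γ.support, 2 * α ^ 7 * ((51 * X) ^ 2 / 19) +
        ∑ i ∈ (γ.support \ T).sigma fun e => plaqEdges (plaqOf e), 2 * α ^ 6 * ((51 * X) ^ 1 / 19) +
        ∑ i ∈ T.sigma fun e => plaqEdges (plaqOf e), 2 * (ι * α ^ 6) * ((51 * X) ^ 6 / 19) +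
        ∑ i ∈ T, 2 * (A * α ^ 6) * ((51 * (2 * X)) ^ 6 / 19) +
        16 * (2 * α ^ 6) * (51 * X) / 19 := by
        simp only [sum_add_distrib]
        refine add_le_add (add_le_add (add_le_add (add_le_add ?_ ?_) ?_) ?_) ?_
        · exact sum_touch_le _ _ _ (by positivity) hX0 (by linarith) W
        · exact sum_touch_le _ _ _ (by positivity) hX0 (by linarith) W
        · exact sum_touch_le _ _ _ (by positivity) hX0 (by linarith) W
        · exact sum_touch_le _ _ _ (by positivity) (by linarith) (by linarith) W
        · exact (sum_touch_le _ _ _ (by positivity) hX0 (by linarith) W).trans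
            (sum_ray_le hγ.card_support_boundary _ hz0 hX (by positivity))
    _ = _ := by
        simp only [Finset.sum_const, Finset.card_sigma, card_plaqEdges, nsmul_eq_mul]
        push_cast; ring

end NonFlatSum

/-! ### Pairs of flat configurations -/

section Flat

variable {n : ℕ} [NeZero n]

lemma norm_prod_sub_one_le {ι 𝕜 : Type*} [NormedField 𝕜] (S : Finset ι) (x : ι → 𝕜) :
    ‖∏ i ∈ S, x i - 1‖ ≤ ∏ i ∈ S, (1 + ‖x i - 1‖) - 1 := by
  classical
  induction S using Finset.induction_on with
  | empty => simp
  | insert i S hi ih =>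
    rw [Finset.prod_insert hi, Finset.prod_insert hi]
    have e : x i * ∏ j ∈ S, x j - 1 = x i * (∏ j ∈ S, x j - 1) + (x i - 1) := by ring
    have h1 : ‖x i‖ ≤ 1 + ‖x i - 1‖ := by
      calc ‖x i‖ = ‖1 + (x i - 1)‖ := by congr 1; ring
        _ ≤ _ := (norm_add_le _ _).trans (by rw [norm_one])
    rw [e]
    refine (norm_add_le _ _).trans ?_
    rw [norm_mul]
    have h2 := mul_le_mul h1 ih (norm_nonneg _) (by positivity)
    linarith

variable {k : ZMod n → ℝ}

/-- An upper bound for the weight of the pairs of configurations on `m` edges of which at least one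
edge is marked, if the marks of an edge have total weight `u`. -/
def markedSum (a u : ℝ) (m : ℕ) : ℝ :=
  m * (u * (2 + 2 * a + u)) * ((1 + a + u) * (1 + a + u) - 1) ^ (m - 1)

lemma pow_sub_pow_le {x y : ℝ} (hy : 0 ≤ y) (h : y ≤ x) (m : ℕ) :
    x ^ m - y ^ m ≤ m * (x - y) * x ^ (m - 1) := by
  induction m with
  | zero => simp
  | succ m ih =>
    rcases Nat.eq_zero_or_pos m with rfl | hm
    · simp
    obtain ⟨l, rfl⟩ : ∃ l, m = l + 1 := ⟨m - 1, by omega⟩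
    rw [Nat.add_sub_cancel] at ih ⊢
    have h1 : y ^ (l + 1) ≤ x ^ (l + 1) := pow_le_pow_left₀ hy h _
    have h2 : (x - y) * y ^ (l + 1) ≤ (x - y) * x ^ (l + 1) :=
      mul_le_mul_of_nonneg_left h1 (by linarith)
    have hx : 0 ≤ x := hy.trans h
    have h3 := mul_le_mul_of_nonneg_left ih hx
    push_cast at h3 ⊢
    rw [pow_succ x l] at *
    rw [pow_succ x (l + 1), pow_succ y (l + 1), pow_succ x l]
    nlinarith

/-- The weight of the pairs with support `C` and at least one mark. With the marks the single
weights have sum `a + u`, so the weight is a difference of two powers. -/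
lemma sum_marked_le (hk0 : k 0 = 1) (hk : ∀ g, 0 ≤ k g) {y : ZMod n → ℝ} (hy0 : y 0 = 0)
    (hy : ∀ g, 0 ≤ y g) {a u : ℝ} (ha : ∑ g ∈ univ.erase 0, k g = a)
    (hu : ∑ g ∈ univ.erase 0, k g * y g = u) (C : Finset Edge) :
    ∑ ω ∈ ConfNZ (ZMod n × ZMod n) C, (∏ e ∈ C, k (ω e).1 * k (ω e).2) *
      (∏ e ∈ C, (1 + y (ω e).1) * (1 + y (ω e).2) - 1) ≤ markedSum a u C.card := by
  have ha0 : 0 ≤ a := by rw [← ha]; exact sum_nonneg fun g _ => hk g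
  have hu0 : 0 ≤ u := by rw [← hu]; exact sum_nonneg fun g _ => mul_nonneg (hk g) (hy g)
  have h1 : ∑ ω ∈ ConfNZ (ZMod n × ZMod n) C, ∏ e ∈ C, k (ω e).1 * k (ω e).2 =
      ((1 + a) * (1 + a) - 1) ^ C.card := by
    rw [← sum_pair_weight hk0 ha, ← sum_confNZ_prod C fun t : ZMod n × ZMod n => k t.1 * k t.2]
  have h2 : ∑ ω ∈ ConfNZ (ZMod n × ZMod n) C, ∏ e ∈ C,
      (k (ω e).1 * (1 + y (ω e).1)) * (k (ω e).2 * (1 + y (ω e).2)) =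
      ((1 + a + u) * (1 + a + u) - 1) ^ C.card := by
    have h3 : ∑ g ∈ univ.erase 0, k g * (1 + y g) = a + u := by
      simp only [mul_add, mul_one, sum_add_distrib, ha, hu]
    have h4 := sum_pair_weight (k := fun g => k g * (1 + y g)) (by simp [hk0, hy0]) h3
    rw [add_assoc, ← h4, ← sum_confNZ_prod C fun t : ZMod n × ZMod n =>
      (k t.1 * (1 + y t.1)) * (k t.2 * (1 + y t.2))]
  have h5 : ∑ ω ∈ ConfNZ (ZMod n × ZMod n) C, (∏ e ∈ C, k (ω e).1 * k (ω e).2) *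
      (∏ e ∈ C, (1 + y (ω e).1) * (1 + y (ω e).2) - 1) =
      ((1 + a + u) * (1 + a + u) - 1) ^ C.card - ((1 + a) * (1 + a) - 1) ^ C.card := by
    rw [← h1, ← h2, ← Finset.sum_sub_distrib]
    refine sum_congr rfl fun ω _ => ?_
    simp only [prod_mul_distrib]
    ring
  rw [h5]
  refine (pow_sub_pow_le (by nlinarith) (by nlinarith) _).trans (le_of_eq ?_)
  rw [markedSum]; ring

/-- Edges where the configuration vanishes carry no mark. -/
lemma prod_marks_le {y : ZMod n → ℝ} (hy0 : y 0 = 0) (hy : ∀ g, 0 ≤ y g) {T C : Finset Edge}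
    {σ : Edge → ZMod n} (hσ : ∀ e ∉ C, σ e = 0) :
    ∏ e ∈ T, (1 + y (σ e)) ≤ ∏ e ∈ C, (1 + y (σ e)) := by
  classical
  have h1 : ∀ e, (1 : ℝ) ≤ 1 + y (σ e) := fun e => by linarith [hy (σ e)]
  calc ∏ e ∈ T, (1 + y (σ e)) ≤ ∏ e ∈ T ∪ C, (1 + y (σ e)) :=
        Finset.prod_le_prod_of_subset_of_one_le Finset.subset_union_left
          (fun e _ => zero_le_one.trans (h1 e)) fun e _ _ => h1 e
    _ = ∏ e ∈ C, (1 + y (σ e)) := by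
        refine (Finset.prod_subset Finset.subset_union_right fun e _ he => ?_).symm
        rw [hσ e he, hy0, add_zero]

/-- Two products over the edges of `T` differ from each other at most by the marks. -/
lemma norm_prod_sub_prod_le_marks {𝕜 : Type*} [NormedField 𝕜] {y : ZMod n → ℝ} (hy0 : y 0 = 0)
    (hy : ∀ g, 0 ≤ y g) {T C : Finset Edge} {σ τ : Edge → ZMod n} (hσ : ∀ e ∉ C, σ e = 0)
    (hτ : ∀ e ∉ C, τ e = 0) {v : Edge → ZMod n → 𝕜} (hv : ∀ e ∈ T, ∀ g, ‖v e g - 1‖ ≤ y g) :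
    ‖∏ e ∈ T, v e (σ e) - ∏ e ∈ T, v e (τ e)‖ ≤
      2 * (∏ e ∈ C, (1 + y (σ e)) * (1 + y (τ e)) - 1) := by
  have key : ∀ σ : Edge → ZMod n, (∀ e ∉ C, σ e = 0) →
      ‖∏ e ∈ T, v e (σ e) - 1‖ ≤ ∏ e ∈ C, (1 + y (σ e)) - 1 := by
    intro σ hσ
    refine (norm_prod_sub_one_le T _).trans (sub_le_sub_right ?_ 1)
    refine le_trans ?_ (prod_marks_le (T := T) hy0 hy hσ)
    exact Finset.prod_le_prod (fun e _ => by positivity) fun e he => by linarith [hv e he (σ e)]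
  have h1 : ∀ σ : Edge → ZMod n, 1 ≤ ∏ e ∈ C, (1 + y (σ e)) := fun σ =>
    Finset.one_le_prod fun e _ => by linarith [hy (σ e)]
  have h2 := key σ hσ
  have h3 := key τ hτ
  have e : ∏ e ∈ T, v e (σ e) - ∏ e ∈ T, v e (τ e) =
      (∏ e ∈ T, v e (σ e) - 1) - (∏ e ∈ T, v e (τ e) - 1) := by ring
  rw [e, prod_mul_distrib]
  refine (norm_sub_le _ _).trans ?_
  have h4 := h1 σ
  have h5 := h1 τ
  nlinarith

open Classical in
lemma sum_touch_pred_le {ι : Type*} (S : Finset ι) (pt : ι → Edge) (m : ι → ℕ) {c y : ℝ} (hc : 0 ≤ c)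
    (hy : 0 ≤ y) (hy1 : 51 * y ≤ 1) (W : Finset Edge) :
    ∑ C ∈ W.powerset with ∃ v, IsConn nbr v C, touch S pt (fun i => m i + 1) c C * y ^ (C.card - 1) ≤
      ∑ i ∈ S, c * (51 * (51 * y) ^ m i / 19) := by
  simp only [touch, sum_mul]
  rw [Finset.sum_comm]
  refine sum_le_sum fun i _ => ?_
  refine le_trans (le_of_eq ?_) (mul_le_mul_of_nonneg_left
    (sum_isConn_pow_pred_le card_nbr W (pt i) (m i) hy hy1) hc)
  rw [mul_sum, Finset.sum_filter, Finset.sum_filter]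
  refine sum_congr rfl fun C _ => ?_
  by_cases h1 : pt i ∈ C
  · by_cases h2 : m i + 1 ≤ C.card
    · have : (∃ v, IsConn nbr v C) ↔ IsConn nbr (pt i) C :=
        ⟨fun ⟨v, hv⟩ => hv.reroot nbr_symm h1, fun h => ⟨_, h⟩⟩
      simp only [this, h1, h2, and_self, and_true, if_true]
    · simp [h2]
  · have h3 : ¬ IsConn nbr (pt i) C := fun h => h1 h.1
    simp [h1, h3]

lemma sum_ray_pred_le {V : Finset Vertex} (hV : V.card ≤ 2) (K : ℕ) {z c : ℝ} (hz : 0 ≤ z)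
    (hz1 : z ≤ 1 / 2) (hc : 0 ≤ c) :
    ∑ i ∈ V ×ˢ range K, c * (51 * z ^ (i.2 + 1) / 19) ≤ 204 * c * z / 19 := by
  have h := sum_ray_le hV K hz hz1 hc
  rw [Finset.sum_sigma] at h
  simp only [Finset.sum_const, card_plaqEdges, nsmul_eq_mul] at h
  rw [← mul_sum] at h
  have e : ∑ i ∈ V ×ˢ range K, c * (51 * z ^ (i.2 + 1) / 19) =
      51 * ∑ i ∈ V ×ˢ range K, c * (z ^ (i.2 + 1) / 19) := by
    rw [mul_sum]
    exact sum_congr rfl fun i _ => by ring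
  rw [e]
  push_cast at h
  linarith

variable {w : Weights n} {H : ZMod n → Prop} {T : Finset Edge} {ρ : AddChar (ZMod n) Circle}

/-- A flat configuration that changes the phase of the path surrounds one of the endpoints. -/
lemma exists_ray_of_flat {γ : Edge →₀ ℤ} {C : Finset Edge} {v : Edge} (hC : IsConn nbr v C)
    {σ : Edge → ZMod n} (hσ : ∀ e ∉ C, σ e = 0) (hcl : ∀ p, curl σ p = 0)
    (h : phase ρ γ.support γ σ ≠ 1) :
    ∃ x ∈ (boundary γ).support, ∃ k : ℕ, ray x k ∈ C ∧ k + 2 ≤ C.card := by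
  rw [phase_eq] at h
  have hev : evalChain σ γ ≠ 0 := fun h0 => h (by rw [h0]; simp)
  obtain ⟨x, hx, k, l, h1, h2⟩ := exists_ray hσ hcl hev
  have hu : ray x k ∈ C := by_contra fun h => h1 (hσ _ h)
  have hu' : ray x (-(l + 1)) ∈ C := by_contra fun h => h2 (hσ _ h)
  refine ⟨x, hx, k, hu, ?_⟩
  have hext := (hC.reroot nbr_symm hu).extent hu' 0
  have c1 : (ray x k).1 0 = x 0 + k := by simp [ray, unit]
  have c2 : (ray x (-(l + 1))).1 0 = x 0 - (l + 1) := by simp [ray, unit]; ring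
  rw [c1, c2] at hext
  have h3 := neg_abs_le (x 0 - (l + 1) - (x 0 + k))
  omega

variable (w H) in
open Classical in
/-- The normalised gain of an edge of a flat configuration. -/
def flatGain (h : ZMod n) : ℝ := if h ≠ 0 ∧ H h then w.gain h / w.gain 0 else 1

variable (w H ρ) in
open Classical in
/-- The normalised mean phase of an edge of a flat configuration. -/
def flatMean (c : ℤ) (h : ZMod n) : ℂ := if h ≠ 0 ∧ H h then w.mean ρ (c • h) / w.mean ρ 0 else 1

lemma abs_flatGain_sub_one (h : ZMod n) : ‖flatGain w H h - 1‖ = excess w H h := by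
  unfold flatGain excess
  by_cases h1 : H h ∧ h ≠ 0
  · rw [if_pos h1, if_pos ⟨h1.2, h1.1⟩, Real.norm_eq_abs]
  · rw [if_neg h1, if_neg fun h' => h1 ⟨h'.2, h'.1⟩, sub_self, norm_zero]

/-- In a flat configuration every edge is surrounded by plaquettes that are flat at its own value.
-/
lemma pinned_iff_of_flat {σ : Edge → ZMod n} (hcl : ∀ p, curl σ p = 0) (e : Edge) :
    Pinned H e σ ↔ H (σ e) := by
  have hc : ClosedAround e (update σ e (σ e)) := by
    rw [Function.update_eq_self]; exact fun p _ => hcl p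
  constructor
  · rintro ⟨h, hh, hc'⟩
    rwa [closedAround_unique hc hc']
  · exact fun h => ⟨_, h, hc⟩

lemma pinMean_eq_of_flat {c : Edge → ℤ} {σ : Edge → ZMod n} (hcl : ∀ p, curl σ p = 0) :
    pinMean w H T ρ c σ = ∏ e ∈ T, flatMean w H ρ (c e) (σ e) := by
  refine prod_congr rfl fun e _ => ?_
  rw [flatMean]
  by_cases h : σ e ≠ 0 ∧ H (σ e)
  · rw [if_pos h, if_pos ⟨h.1, (pinned_iff_of_flat hcl e).2 h.2⟩]
  · rw [if_neg h, if_neg fun h' => h ⟨h'.1, (pinned_iff_of_flat hcl e).1 h'.2⟩]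

lemma wt_delta_eq {W C : Finset Edge} (hCW : C ⊆ W) {σ : Edge → ZMod n} (hσ : ∀ e ∉ C, σ e = 0)
    (hcl : ∀ p, curl σ p = 0) : wt w.k delta W (stars W) σ = ∏ e ∈ C, w.k (σ e) := by
  rw [wt, prod_delta.2 fun p _ => hcl p, mul_one, prod_edges_eq w.k_zero hCW hσ]

lemma wt_delta_eq_zero {W C : Finset Edge} (hCW : C ⊆ W) {σ : Edge → ZMod n}
    (hσ : ∀ e ∉ C, σ e = 0) (hcl : ¬ ∀ p, curl σ p = 0) : wt w.k delta W (stars W) σ = 0 := by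
  push Not at hcl
  obtain ⟨p, hp⟩ := hcl
  rw [wt, Finset.prod_eq_zero (stars_mono hCW (mem_stars_of_curl hσ hp))
    (by rw [delta, if_neg hp]), mul_zero]

lemma tilt_eq_of_flat {W C : Finset Edge} (hCW : C ⊆ W) {σ : Edge → ZMod n}
    (hσ : ∀ e ∉ C, σ e = 0) (hcl : ∀ p, curl σ p = 0) :
    tilt w H T W σ = (∏ e ∈ C, w.k (σ e)) * ∏ e ∈ T, flatGain w H (σ e) := by
  have h1 : ∏ p ∈ stars W, w.b (curl σ p) = 1 :=
    Finset.prod_eq_one fun p _ => by rw [hcl p, w.b_zero]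
  rw [tilt, if_pos (locRed_of_closed hcl), one_mul, wt, prod_edges_eq w.k_zero hCW hσ, h1, mul_one]
  congr 1
  refine prod_congr rfl fun e _ => ?_
  rw [flatGain]
  by_cases h : σ e ≠ 0 ∧ H (σ e)
  · rw [if_pos h, if_pos ⟨h.1, (pinned_iff_of_flat hcl e).2 h.2⟩]
  · rw [if_neg h, if_neg fun h' => h ⟨h'.1, (pinned_iff_of_flat hcl e).1 h'.2⟩]

/-- The difference of the observable on two flat configurations. -/
lemma norm_flat_sub_le {γ : Edge →₀ ℤ} {C : Finset Edge} {v : Edge} (hC : IsConn nbr v C)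
    {W : Finset Edge} (hCW : C ⊆ W) {ω : Edge → ZMod n × ZMod n} (hω : ∀ e ∉ C, ω e = 0)
    (h1 : ∀ p, curl (fun e => (ω e).1) p = 0) (h2 : ∀ p, curl (fun e => (ω e).2) p = 0) {μ A : ℝ}
    (hμ : ∀ h, ‖w.mean ρ h / w.mean ρ 0‖ ≤ μ) (hμ1 : 1 ≤ μ)
    (hA : ∀ h, ‖w.mean ρ h / w.mean ρ 0 - 1‖ ≤ A) :
    ‖phase ρ γ.support γ (fun e => (ω e).1) * pinMean w H T ρ γ (fun e => (ω e).1) -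
      phase ρ γ.support γ (fun e => (ω e).2) * pinMean w H T ρ γ (fun e => (ω e).2)‖ ≤
    (touch ((boundary γ).support ×ˢ range (W.card + 1)) (fun i => ray i.1 i.2)
      (fun i => i.2 + 1 + 1) 2 C + touch T id (fun _ => 6 + 1) (2 * A) C * C.card) * μ ^ C.card := by
  classical
  set σ : Edge → ZMod n := fun e => (ω e).1 with hσ
  set τ : Edge → ZMod n := fun e => (ω e).2 with hτ
  have hσC : ∀ e ∉ C, σ e = 0 := fun e he => by simp only [hσ, hω e he]; rfl
  have hτC : ∀ e ∉ C, τ e = 0 := fun e he => by simp only [hτ, hω e he]; rfl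
  have hA0 : 0 ≤ A := (norm_nonneg _).trans (hA 0)
  have ht1 : 0 ≤ touch ((boundary γ).support ×ˢ range (W.card + 1)) (fun i => ray i.1 i.2)
      (fun i => i.2 + 1 + 1) 2 C := touch_nonneg _ _ _ (by norm_num) _
  have ht2 : 0 ≤ touch T id (fun _ => 6 + 1) (2 * A) C := touch_nonneg _ _ _ (by positivity) _
  have hμm : 0 ≤ μ ^ C.card := by positivity
  have hVle : ‖pinMean w H T ρ γ σ‖ ≤ μ ^ C.card ∧ ‖pinMean w H T ρ γ τ‖ ≤ μ ^ C.card := by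
    have h3 := majorant_le (T := T) hμ1 hω
    exact ⟨(norm_pinMean_le (H := H) (T := T) hμ hμ1 γ ω Prod.fst rfl).trans h3,
      (norm_pinMean_le (H := H) (T := T) hμ hμ1 γ ω Prod.snd rfl).trans h3⟩
  by_cases hph : phase ρ γ.support γ σ = 1 ∧ phase ρ γ.support γ τ = 1
  · rw [hph.1, hph.2, one_mul, one_mul]
    by_cases hT : ∃ e ∈ T, σ e ≠ 0 ∨ τ e ≠ 0
    -- If the phases agree, some edge of `T` is non-zero in a closed form on `C`, which needs seven
    -- edges.
    · obtain ⟨e, he, he0⟩ := hT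
      have hmem : e ∈ C ∧ 6 + 1 ≤ C.card := by
        rcases he0 with h0 | h0
        · exact ⟨by_contra fun h => h0 (hσC e h),
            seven_le_card h0 (fun p _ => h1 p) fun f hf => by_contra fun h => hf (hσC f h)⟩
        · exact ⟨by_contra fun h => h0 (hτC e h),
            seven_le_card h0 (fun p _ => h2 p) fun f hf => by_contra fun h => hf (hτC f h)⟩
      have hle : 2 * A ≤ touch T id (fun _ => 6 + 1) (2 * A) C :=
        le_touch (by positivity) he hmem.1 hmem.2
      have h5 : 2 * A * C.card ≤ touch T id (fun _ => 6 + 1) (2 * A) C * C.card :=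
        mul_le_mul_of_nonneg_right hle (Nat.cast_nonneg _)
      calc _ ≤ 2 * A * C.card * μ ^ C.card := norm_pinMean_sub_le hμ hμ1 hA γ hσC hτC
        _ ≤ _ := mul_le_mul_of_nonneg_right (by linarith) hμm
    · push Not at hT
      rw [pinMean_eq_one fun e he => (hT e he).1, pinMean_eq_one fun e he => (hT e he).2, sub_self,
        norm_zero]
      positivity
  -- Otherwise one of the configurations surrounds an endpoint of the path.
  · have hex : ∃ x ∈ (boundary γ).support, ∃ k : ℕ, ray x k ∈ C ∧ k + 2 ≤ C.card := by
      by_cases h3 : phase ρ γ.support γ σ = 1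
      · exact exists_ray_of_flat hC hτC h2 fun h4 => hph ⟨h3, h4⟩
      · exact exists_ray_of_flat hC hσC h1 h3
    obtain ⟨x, hx, k, hk, hkC⟩ := hex
    have hkW : k < W.card + 1 := by have := Finset.card_le_card hCW; omega
    have hle : 2 ≤ touch ((boundary γ).support ×ˢ range (W.card + 1)) (fun i => ray i.1 i.2)
        (fun i => i.2 + 1 + 1) 2 C :=
      le_touch (by norm_num) (i := (x, k))
        (mem_product.2 ⟨hx, Finset.mem_range.2 hkW⟩) hk (by omega)
    refine (norm_sub_le _ _).trans ?_
    rw [norm_mul, norm_mul, norm_phase, norm_phase, one_mul, one_mul]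
    have h6 : 0 ≤ touch T id (fun _ => 6 + 1) (2 * A) C * C.card := by positivity
    calc _ ≤ 2 * μ ^ C.card := by linarith [hVle.1, hVle.2]
      _ ≤ _ := mul_le_mul_of_nonneg_right (by linarith) hμm

end Flat

/-! ### Comparison with the model of flat configurations -/

section FlatCompare

variable {n : ℕ} [NeZero n] {w : Weights n} {H : ZMod n → Prop} {T : Finset Edge}
  {ρ : AddChar (ZMod n) Circle}

lemma card_sq_le {m : ℕ} (hm : 7 ≤ m) : (m : ℝ) * m ≤ 2 ^ (m - 1) := by
  obtain ⟨l, rfl⟩ : ∃ l, m = l + 7 := ⟨m - 7, by omega⟩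
  have : (l + 7) * (l + 7) ≤ 2 ^ (l + 7 - 1) := by
    induction l with
    | zero => norm_num
    | succ l ih =>
      have ih' := ih (by omega)
      have e1 : l + 7 - 1 = l + 6 := rfl
      have e2 : l + 1 + 7 - 1 = l + 6 + 1 := rfl
      rw [e1] at ih'
      rw [e2, pow_succ]
      nlinarith
  exact_mod_cast this

lemma card_le_two_pow (m : ℕ) : (m : ℝ) ≤ 2 ^ (m - 1) := by
  rcases Nat.eq_zero_or_pos m with rfl | hm
  · norm_num
  · obtain ⟨l, rfl⟩ : ∃ l, m = l + 1 := ⟨m - 1, by omega⟩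
    have : l + 1 ≤ 2 ^ (l + 1 - 1) := by
      rw [Nat.add_sub_cancel]
      exact Nat.lt_two_pow_self
    exact_mod_cast this

lemma edgeSum_eq : edgeSum w H = w.a + ∑ h ∈ univ.erase 0, w.k h * excess w H h := by
  simp only [edgeSum, edgeWt, mul_add, mul_one, sum_add_distrib, Weights.a]

open Classical in
/-- The flat configurations in the comparison between the tilted weight and the weight of flat
configurations. By symmetry, the difference of the observable on two configurations is multiplied
by the difference of their gains. -/
lemma norm_sum_flat_le {γ : Edge →₀ ℤ} {C : Finset Edge} {v : Edge} (hC : IsConn nbr v C)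
    {W : Finset Edge} (hCW : C ⊆ W) {μ A u : ℝ}
    (hμ : ∀ h, ‖w.mean ρ h / w.mean ρ 0‖ ≤ μ) (hμ1 : 1 ≤ μ)
    (hA : ∀ h, ‖w.mean ρ h / w.mean ρ 0 - 1‖ ≤ A)
    (hu : ∑ h ∈ univ.erase 0, w.k h * excess w H h = u) :
    ‖∑ ω ∈ ConfNZ (ZMod n × ZMod n) C, (if ∀ p, curl (fun e => (ω e).1) p = 0 then
        ((tilt w H T W (fun e => (ω e).1) * wt w.k delta W (stars W) (fun e => (ω e).2) : ℝ) : ℂ) *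
        (phase ρ γ.support γ (fun e => (ω e).1) * pinMean w H T ρ γ (fun e => (ω e).1) -
          phase ρ γ.support γ (fun e => (ω e).2) * pinMean w H T ρ γ (fun e => (ω e).2)) else 0)‖ ≤
    (touch ((boundary γ).support ×ˢ range (W.card + 1)) (fun i => ray i.1 i.2)
      (fun i => i.2 + 1 + 1) 2 C + touch T id (fun _ => 6 + 1) (2 * A) C * C.card) * μ ^ C.card *
      markedSum w.a u C.card := by
  set f : (Edge → ZMod n) → ℂ := fun σ => phase ρ γ.support γ σ * pinMean w H T ρ γ σ with hf
  set κ : (Edge → ZMod n) → ℝ := fun σ => if ∀ p, curl σ p = 0 then ∏ e ∈ C, w.k (σ e) else 0 with hκ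
  set z : (Edge → ZMod n) → ℝ := fun σ => ∏ e ∈ T, flatGain w H (σ e) with hz
  set F : (Edge → ZMod n) → (Edge → ZMod n) → ℂ := fun σ τ =>
    ((κ σ * κ τ * z σ : ℝ) : ℂ) * (f σ - f τ) with hF
  have hmem : ∀ ω ∈ ConfNZ (ZMod n × ZMod n) C, ∀ e ∉ C, ω e = 0 := fun ω hω e he =>
    by_contra fun h => he ((mem_confNZ.1 hω e).1 h)
  have e1 : ∑ ω ∈ ConfNZ (ZMod n × ZMod n) C, (if ∀ p, curl (fun e => (ω e).1) p = 0 then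
        ((tilt w H T W (fun e => (ω e).1) * wt w.k delta W (stars W) (fun e => (ω e).2) : ℝ) : ℂ) *
        (f (fun e => (ω e).1) - f (fun e => (ω e).2)) else 0) =
      ∑ ω ∈ ConfNZ (ZMod n × ZMod n) C, F (fun e => (ω e).1) (fun e => (ω e).2) := by
    refine sum_congr rfl fun ω hω => ?_
    have hσC : ∀ e ∉ C, (ω e).1 = 0 := fun e he => by rw [hmem ω hω e he]; rfl
    have hτC : ∀ e ∉ C, (ω e).2 = 0 := fun e he => by rw [hmem ω hω e he]; rfl
    simp only [hF, hκ, hz]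
    by_cases h1 : ∀ p, curl (fun e => (ω e).1) p = 0
    · rw [if_pos h1, if_pos h1, tilt_eq_of_flat hCW hσC h1]
      by_cases h2 : ∀ p, curl (fun e => (ω e).2) p = 0
      · rw [if_pos h2, wt_delta_eq hCW hτC h2]
        push_cast; ring
      · rw [if_neg h2, wt_delta_eq_zero hCW hτC h2]
        simp
    · rw [if_neg h1, if_neg h1]; simp
  -- Adding the sum with `σ` and `τ` exchanged turns the factor `z σ` into `z σ - z τ`.
  have e2 : (2 : ℂ) * ∑ ω ∈ ConfNZ (ZMod n × ZMod n) C, F (fun e => (ω e).1) (fun e => (ω e).2) =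
      ∑ ω ∈ ConfNZ (ZMod n × ZMod n) C, ((κ (fun e => (ω e).1) * κ (fun e => (ω e).2) *
        (z (fun e => (ω e).1) - z (fun e => (ω e).2)) : ℝ) : ℂ) *
        (f (fun e => (ω e).1) - f (fun e => (ω e).2)) := by
    rw [two_mul]
    nth_rewrite 2 [sum_confNZ_swap C F]
    rw [← sum_add_distrib]
    refine sum_congr rfl fun ω _ => ?_
    simp only [hF]
    push_cast; ring
  set c := touch ((boundary γ).support ×ˢ range (W.card + 1)) (fun i => ray i.1 i.2)
      (fun i => i.2 + 1 + 1) 2 C + touch T id (fun _ => 6 + 1) (2 * A) C * C.card with hc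
  have hA0 : 0 ≤ A := (norm_nonneg _).trans (hA 0)
  have hc0 : 0 ≤ c := add_nonneg (touch_nonneg _ _ _ (by norm_num) _)
    (mul_nonneg (touch_nonneg _ _ _ (by positivity) _) (Nat.cast_nonneg _))
  have hcμ : 0 ≤ c * μ ^ C.card := by positivity
  have e3 : ‖(2 : ℂ) * ∑ ω ∈ ConfNZ (ZMod n × ZMod n) C, F (fun e => (ω e).1) (fun e => (ω e).2)‖ ≤
      2 * (c * μ ^ C.card * markedSum w.a u C.card) := by
    rw [e2]
    refine (norm_sum_le _ _).trans ?_
    refine le_trans ?_ (mul_le_mul_of_nonneg_left (mul_le_mul_of_nonneg_left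
      (sum_marked_le w.k_zero w.k_nonneg (excess_zero w H) (excess_nonneg w H) (a := w.a) rfl hu C)
      hcμ) (by norm_num : (0 : ℝ) ≤ 2))
    rw [mul_sum, mul_sum]
    refine sum_le_sum fun ω hω => ?_
    have hσC : ∀ e ∉ C, (ω e).1 = 0 := fun e he => by rw [hmem ω hω e he]; rfl
    have hτC : ∀ e ∉ C, (ω e).2 = 0 := fun e he => by rw [hmem ω hω e he]; rfl
    have hm := norm_prod_sub_prod_le_marks (T := T) (excess_zero w H) (excess_nonneg w H) hσC hτC
      (v := fun _ => flatGain w H) fun e _ g => (abs_flatGain_sub_one (w := w) (H := H) g).le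
    have hM0 : 0 ≤ ∏ e ∈ C, (1 + excess w H (ω e).1) * (1 + excess w H (ω e).2) - 1 := by
      have := norm_nonneg (∏ e ∈ T, flatGain w H (ω e).1 - ∏ e ∈ T, flatGain w H (ω e).2)
      linarith
    have hK0 : 0 ≤ ∏ e ∈ C, w.k (ω e).1 * w.k (ω e).2 :=
      prod_nonneg fun e _ => mul_nonneg (w.k_nonneg _) (w.k_nonneg _)
    have hpos : 0 ≤ 2 * (c * μ ^ C.card * ((∏ e ∈ C, w.k (ω e).1 * w.k (ω e).2) *
        (∏ e ∈ C, (1 + excess w H (ω e).1) * (1 + excess w H (ω e).2) - 1))) := by positivity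
    by_cases h1 : ∀ p, curl (fun e => (ω e).1) p = 0
    swap
    · simp only [hκ]; rw [if_neg h1]; simpa using hpos
    by_cases h2 : ∀ p, curl (fun e => (ω e).2) p = 0
    swap
    · simp only [hκ]; rw [if_neg h2]; simpa using hpos
    have hd := norm_flat_sub_le (γ := γ) (H := H) (T := T) hC hCW (hmem ω hω) h1 h2 hμ hμ1 hA
    simp only [hκ]
    rw [if_pos h1, if_pos h2, norm_mul, Complex.norm_real, norm_mul, ← prod_mul_distrib,
      Real.norm_of_nonneg hK0]
    calc _ ≤ ((∏ e ∈ C, w.k (ω e).1 * w.k (ω e).2) *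
          (2 * (∏ e ∈ C, (1 + excess w H (ω e).1) * (1 + excess w H (ω e).2) - 1))) *
          (c * μ ^ C.card) :=
          mul_le_mul (mul_le_mul_of_nonneg_left hm hK0) hd (norm_nonneg _) (by positivity)
      _ = _ := by ring
  rw [norm_mul, Complex.norm_ofNat] at e3
  change ‖∑ ω ∈ ConfNZ (ZMod n × ZMod n) C, (if ∀ p, curl (fun e => (ω e).1) p = 0 then
        ((tilt w H T W (fun e => (ω e).1) * wt w.k delta W (stars W) (fun e => (ω e).2) : ℝ) : ℂ) *
        (f (fun e => (ω e).1) - f (fun e => (ω e).2)) else 0)‖ ≤ _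
  rw [e1]
  linarith

/-- The bound on the total contribution of flat configurations. -/
def flatBound (a u μ A t : ℝ) : ℝ :=
  u * (2 + 2 * a + u) * μ * 51 / 19 * (8 * (102 * (μ * ((1 + a + u) * (1 + a + u) - 1))) +
    2 * A * t * (102 * (μ * ((1 + a + u) * (1 + a + u) - 1))) ^ 6)

open Classical in
/-- A mark at one of the edges of `C` contributes a factor `C.card`, and the observable another one;
both are absorbed by doubling the weight of each edge. -/
lemma sum_flat_le {γ : Edge →₀ ℤ} (hγ : IsPath γ) {W : Finset Edge} {μ A u a : ℝ} (hμ1 : 1 ≤ μ)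
    (hA0 : 0 ≤ A) (ha0 : 0 ≤ a) (hu0 : 0 ≤ u)
    (hX : 102 * (μ * ((1 + a + u) * (1 + a + u) - 1)) ≤ 1 / 2) :
    ∑ C ∈ W.powerset with ∃ v, IsConn nbr v C,
      (touch ((boundary γ).support ×ˢ range (W.card + 1)) (fun i => ray i.1 i.2)
      (fun i => i.2 + 1 + 1) 2 C + touch T id (fun _ => 6 + 1) (2 * A) C * C.card) * μ ^ C.card *
      markedSum a u C.card ≤ flatBound a u μ A T.card := by
  set Xp := (1 + a + u) * (1 + a + u) - 1 with hXp
  have hXp0 : 0 ≤ Xp := by rw [hXp]; nlinarith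
  set y := 2 * (μ * Xp) with hy
  have hy0 : 0 ≤ y := by positivity
  have hy51 : 51 * y = 102 * (μ * Xp) := by rw [hy]; ring
  set B := u * (2 + 2 * a + u) * μ with hB
  have hB0 : 0 ≤ B := by positivity
  set t1 := touch ((boundary γ).support ×ˢ range (W.card + 1)) (fun i => ray i.1 i.2)
      (fun i => i.2 + 1 + 1) 2 with ht1
  set t2 := touch T id (fun _ => 6 + 1) (2 * A) with ht2
  have ht10 : ∀ C, 0 ≤ t1 C := touch_nonneg _ _ _ (by norm_num)
  have ht20 : ∀ C, 0 ≤ t2 C := touch_nonneg _ _ _ (by positivity)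
  have hpt : ∀ C ∈ W.powerset.filter (fun C => ∃ v, IsConn nbr v C),
      (t1 C + t2 C * C.card) * μ ^ C.card * markedSum a u C.card ≤
        B * (t1 C * y ^ (C.card - 1) + t2 C * y ^ (C.card - 1)) := by
    intro C hC
    rw [mem_filter] at hC
    obtain ⟨-, v, hv⟩ := hC
    obtain ⟨m, hm⟩ : ∃ m, C.card = m + 1 :=
      ⟨C.card - 1, by have := Finset.card_pos.2 ⟨v, hv.1⟩; omega⟩
    have h2 := card_le_two_pow C.card
    have hq : 0 ≤ (μ * Xp) ^ m := by positivity
    have key1 : C.card * (μ * Xp) ^ m ≤ y ^ m := by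
      rw [hy, mul_pow 2]
      rw [hm, Nat.add_sub_cancel] at h2
      rw [hm]
      exact mul_le_mul_of_nonneg_right h2 hq
    have key2 : t2 C * (C.card * C.card * (μ * Xp) ^ m) ≤ t2 C * y ^ m := by
      by_cases h7 : 7 ≤ C.card
      · refine mul_le_mul_of_nonneg_left ?_ (ht20 C)
        have h3 := card_sq_le h7
        rw [hy, mul_pow 2]
        rw [hm, Nat.add_sub_cancel] at h3
        rw [hm]
        exact mul_le_mul_of_nonneg_right h3 hq
      · have : t2 C = 0 := Finset.sum_eq_zero fun i _ => if_neg fun h => h7 h.2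
        rw [this, zero_mul, zero_mul]
    have e : (t1 C + t2 C * C.card) * μ ^ C.card * markedSum a u C.card =
        B * (t1 C * (C.card * (μ * Xp) ^ m) + t2 C * (C.card * C.card * (μ * Xp) ^ m)) := by
      rw [markedSum, hm, Nat.add_sub_cancel, mul_pow, pow_succ μ m]
      ring
    rw [e]
    have hm1 : C.card - 1 = m := by omega
    rw [hm1]
    exact mul_le_mul_of_nonneg_left (add_le_add (mul_le_mul_of_nonneg_left key1 (ht10 C)) key2) hB0
  refine (sum_le_sum hpt).trans ?_
  rw [← mul_sum, sum_add_distrib]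
  have s1 := (sum_touch_pred_le ((boundary γ).support ×ˢ range (W.card + 1))
    (fun i => ray i.1 i.2) (fun i => i.2 + 1) (c := 2) (by norm_num) hy0 (by linarith) W).trans
    (sum_ray_pred_le hγ.card_support_boundary _ (z := 51 * y) (by positivity) (by linarith)
      (by norm_num))
  have s2 := sum_touch_pred_le T id (fun _ => 6) (c := 2 * A) (by positivity) hy0 (by linarith) W
  rw [Finset.sum_const, nsmul_eq_mul] at s2
  calc _ ≤ B * (204 * 2 * (51 * y) / 19 + T.card * (2 * A * (51 * (51 * y) ^ 6 / 19))) :=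
        mul_le_mul_of_nonneg_left (add_le_add s1 s2) hB0
    _ = _ := by rw [flatBound, hy51, hB]; ring

lemma avg_one {w : (Edge → ZMod n) → ℝ} (h0 : ∀ ω, 0 ≤ w ω) (h1 : w 0 = 1) (W : Finset Edge) :
    avg w W (fun _ => 1) = 1 := by
  have hp := sum_weight_pos h0 h1 W
  rw [avg]
  simp only [mul_one]
  rw [← Complex.ofReal_sum, div_self]
  exact_mod_cast hp.ne'

lemma majorant_le_pow {μ : ℝ} (hμ1 : 1 ≤ μ) (ω : Edge → ZMod n × ZMod n) :
    majorant T μ ω ≤ μ ^ T.card := by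
  rw [majorant, ← prod_const]
  exact Finset.prod_le_prod (fun e _ => by split_ifs <;> linarith) fun e _ => by
    split_ifs <;> linarith

open Classical in
/-- The expectation of the observable under the tilted weight is close to its expectation in the
model of flat configurations. -/
theorem norm_avg_tilt_sub_le {γ : Edge →₀ ℤ} (hγ : IsPath γ) (hTS : T ⊆ γ.support) (H0 : H 0)
    (W : Finset Edge) {α : ℝ} (hα : ∀ g ≠ 0, w.b g ≤ α) (hα0 : 0 ≤ α) (hα1 : α ≤ 1) {μ A u : ℝ}
    (hμ : ∀ h, ‖w.mean ρ h / w.mean ρ 0‖ ≤ μ) (hμ1 : 1 ≤ μ)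
    (hA : ∀ h, ‖w.mean ρ h / w.mean ρ 0 - 1‖ ≤ A)
    (hu : ∑ h ∈ univ.erase 0, w.k h * excess w H h = u)
    (hX : 102 * (μ * ((1 + w.a + u) * (1 + w.a + u) - 1)) ≤ 1 / 2) :
    (μ ^ T.card)⁻¹ *
      ‖avg (tilt w H T W) W (fun σ => phase ρ γ.support γ σ * pinMean w H T ρ γ σ) -
        avg (wt w.k delta W (stars W)) W (fun σ => phase ρ γ.support γ σ * pinMean w H T ρ γ σ)‖ ≤
      flatBound w.a u μ A T.card +
      2 / 19 * (γ.support.card * (α ^ 7 * (51 * pairSum w H μ) ^ 2) +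
        4 * (γ.support \ T).card * (α ^ 6 * (51 * pairSum w H μ)) +
        4 * T.card * ((if ∀ h, H h then 0 else 1) * (α ^ 6 * (51 * pairSum w H μ) ^ 6)) +
        T.card * (A * (α ^ 6 * (102 * pairSum w H μ) ^ 6)) +
        16 * (α ^ 6 * (51 * pairSum w H μ))) := by
  have hu0 : 0 ≤ u := by
    rw [← hu]
    exact sum_nonneg fun g _ => mul_nonneg (w.k_nonneg g) (excess_nonneg w H g)
  have ha0 := w.a_nonneg
  have hA0 : 0 ≤ A := (norm_nonneg _).trans (hA 0)
  have hXp : 51 * pairSum w H μ ≤ 1 / 2 := by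
    rw [pairSum, edgeSum_eq, hu]
    have h1 : 0 ≤ (1 + w.a + u) * (1 + w.a + u) - 1 := by nlinarith
    have h2 : (1 + (w.a + u)) * (1 + w.a) - 1 ≤ (1 + w.a + u) * (1 + w.a + u) - 1 := by nlinarith
    have h3 := mul_le_mul_of_nonneg_right h2 (by linarith : (0 : ℝ) ≤ μ)
    have h4 : 0 ≤ μ * ((1 + w.a + u) * (1 + w.a + u) - 1) := by positivity
    nlinarith
  set f : (Edge → ZMod n) → ℂ := fun σ => phase ρ γ.support γ σ * pinMean w H T ρ γ σ with hf
  have hfsep : Separable nbr f := (separable_phase ρ _ _).mul (separable_pinMean w H T ρ γ)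
  have hbd : ∀ (ω : Edge → ZMod n × ZMod n) (π : ZMod n × ZMod n → ZMod n), π 0 = 0 →
      ‖f fun e => π (ω e)‖ ≤ majorant T μ ω := by
    intro ω π hπ
    simp only [hf]
    rw [norm_mul, norm_phase, one_mul]
    exact norm_pinMean_le hμ hμ1 γ ω π hπ
  have hone : Separable nbr (fun _ : Edge → ZMod n => (1 : ℂ)) :=
    ⟨rfl, fun _ _ _ => (mul_one _).symm⟩
  have key := norm_avg_sub_le (f := fun _ => 1) (g := f) (separable_tilt w H T W)
    (separable_wt w.k_zero delta_zero W (stars W)) (separable_majorant T μ) hone hfsep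
    (tilt_nonneg w H T W) (wt_nonneg w.k_nonneg delta_nonneg _ _)
    (fun ω => by simpa using hbd ω Prod.fst rfl) (fun ω => by simpa using hbd ω Prod.snd rfl)
    (c := (μ ^ T.card)⁻¹) (by positivity) (fun ω => by
      rw [inv_mul_le_iff₀ (by positivity), mul_one]
      exact majorant_le_pow hμ1 ω) W
  simp only [one_mul] at key
  rw [avg_one (tilt_nonneg w H T W) tilt_zero, one_mul] at key
  refine key.trans ?_
  -- The pairs are split according to whether the first configuration is flat.
  have hsplit : ∀ C ∈ W.powerset.filter (fun C => ∃ v, IsConn nbr v C),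
      ‖∑ ω ∈ ConfNZ (ZMod n × ZMod n) C, ((tilt w H T W (fun e => (ω e).1) *
        wt w.k delta W (stars W) (fun e => (ω e).2) : ℝ) : ℂ) *
          (f (fun e => (ω e).1) - f (fun e => (ω e).2))‖ ≤
      (touch ((boundary γ).support ×ˢ range (W.card + 1)) (fun i => ray i.1 i.2)
        (fun i => i.2 + 1 + 1) 2 C + touch T id (fun _ => 6 + 1) (2 * A) C * C.card) * μ ^ C.card *
        markedSum w.a u C.card + ∑ ω ∈ ConfNZ (ZMod n × ZMod n) C,
      (if ∀ p, curl (fun e => (ω e).1) p = 0 then 0 else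
        tilt w H T W (fun e => (ω e).1) * wt w.k delta W (stars W) (fun e => (ω e).2) *
        ‖f (fun e => (ω e).1) - f (fun e => (ω e).2)‖) := by
    intro C hC
    rw [mem_filter, mem_powerset] at hC
    obtain ⟨hCW, v, hv⟩ := hC
    have e : ∑ ω ∈ ConfNZ (ZMod n × ZMod n) C, ((tilt w H T W (fun e => (ω e).1) *
        wt w.k delta W (stars W) (fun e => (ω e).2) : ℝ) : ℂ) *
          (f (fun e => (ω e).1) - f (fun e => (ω e).2)) =
        ∑ ω ∈ ConfNZ (ZMod n × ZMod n) C, (if ∀ p, curl (fun e => (ω e).1) p = 0 then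
          ((tilt w H T W (fun e => (ω e).1) * wt w.k delta W (stars W) (fun e => (ω e).2) : ℝ) : ℂ) *
          (f (fun e => (ω e).1) - f (fun e => (ω e).2)) else 0) +
        ∑ ω ∈ ConfNZ (ZMod n × ZMod n) C, (if ∀ p, curl (fun e => (ω e).1) p = 0 then 0 else
          ((tilt w H T W (fun e => (ω e).1) * wt w.k delta W (stars W) (fun e => (ω e).2) : ℝ) : ℂ) *
          (f (fun e => (ω e).1) - f (fun e => (ω e).2))) := by
      rw [← sum_add_distrib]
      refine sum_congr rfl fun ω _ => ?_
      split_ifs <;> simp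
    rw [e]
    refine (norm_add_le _ _).trans (add_le_add
      (norm_sum_flat_le hv hCW hμ hμ1 hA hu) ((norm_sum_le _ _).trans ?_))
    refine sum_le_sum fun ω _ => ?_
    split_ifs
    · rw [norm_zero]
    · rw [norm_mul, Complex.norm_real, Real.norm_of_nonneg (mul_nonneg (tilt_nonneg w H T W _)
        (wt_nonneg w.k_nonneg delta_nonneg _ _ _))]
  refine (sum_le_sum hsplit).trans ?_
  rw [sum_add_distrib]
  exact add_le_add (sum_flat_le hγ hμ1 hA0 ha0 hu0 hX)
    (sum_nonflat_le hγ hTS H0 hα hα0 hα1 hμ hμ1 hA hXp)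

end FlatCompare

/-! ### The mean phases in the model of flat configurations -/

section MeanPhase

variable {n : ℕ} [NeZero n] {w : Weights n} {H : ZMod n → Prop} {T : Finset Edge}
  {ρ : AddChar (ZMod n) Circle}

variable (w H ρ) in
open Classical in
/-- A bound for the deviation of the normalised mean phase of an edge from one. -/
def meanMark (h : ZMod n) : ℝ :=
  if h ≠ 0 ∧ H h then ‖w.mean ρ h / w.mean ρ 0 - 1‖ + ‖w.mean ρ (-h) / w.mean ρ 0 - 1‖ else 0

lemma meanMark_zero : meanMark w H ρ 0 = 0 := if_neg fun h => h.1 rfl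

lemma meanMark_nonneg (h : ZMod n) : 0 ≤ meanMark w H ρ h := by
  unfold meanMark; split_ifs <;> positivity

lemma norm_flatMean_sub_one_le {c : ℤ} (hc : c = 1 ∨ c = -1) (h : ZMod n) :
    ‖flatMean w H ρ c h - 1‖ ≤ meanMark w H ρ h := by
  unfold flatMean meanMark
  split_ifs
  · rcases hc with rfl | rfl
    · rw [one_smul]; exact le_add_of_nonneg_right (norm_nonneg _)
    · rw [neg_smul, one_smul]; exact le_add_of_nonneg_left (norm_nonneg _)
  · simp

open Classical in
/-- The contribution of the pairs of flat configurations on `C`. Exchanging the configurations turns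
it into a product of the difference of the phases and the difference of the mean phases, so that `C`
surrounds an endpoint of the path and carries a mark. -/
lemma norm_sum_phase_mean_le {γ : Edge →₀ ℤ} {C : Finset Edge} {v : Edge} (hC : IsConn nbr v C)
    (hc : ∀ e ∈ T, γ e = 1 ∨ γ e = -1) {W : Finset Edge} (hCW : C ⊆ W) {x : ℝ}
    (hx : ∑ h ∈ univ.erase 0, w.k h * meanMark w H ρ h = x) :
    ‖∑ ω ∈ ConfNZ (ZMod n × ZMod n) C, ((wt w.k delta W (stars W) (fun e => (ω e).1) *
        wt w.k delta W (stars W) (fun e => (ω e).2) : ℝ) : ℂ) *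
        (phase ρ γ.support γ (fun e => (ω e).1) * pinMean w H T ρ γ (fun e => (ω e).1) -
          phase ρ γ.support γ (fun e => (ω e).1) * pinMean w H T ρ γ (fun e => (ω e).2))‖ ≤
    touch ((boundary γ).support ×ˢ range (W.card + 1)) (fun i => ray i.1 i.2)
      (fun i => i.2 + 1 + 1) 2 C * markedSum w.a x C.card := by
  set R : (Edge → ZMod n) → ℂ := phase ρ γ.support γ with hR
  set κ : (Edge → ZMod n) → ℝ := fun σ => if ∀ p, curl σ p = 0 then ∏ e ∈ C, w.k (σ e) else 0 with hκ
  set V : (Edge → ZMod n) → ℂ := fun σ => ∏ e ∈ T, flatMean w H ρ (γ e) (σ e) with hV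
  set F : (Edge → ZMod n) → (Edge → ZMod n) → ℂ := fun σ τ =>
    ((κ σ * κ τ : ℝ) : ℂ) * (R σ * V σ - R σ * V τ) with hF
  have hmem : ∀ ω ∈ ConfNZ (ZMod n × ZMod n) C, ∀ e ∉ C, ω e = 0 := fun ω hω e he =>
    by_contra fun h => he ((mem_confNZ.1 hω e).1 h)
  have e1 : ∑ ω ∈ ConfNZ (ZMod n × ZMod n) C, ((wt w.k delta W (stars W) (fun e => (ω e).1) *
        wt w.k delta W (stars W) (fun e => (ω e).2) : ℝ) : ℂ) *
        (R (fun e => (ω e).1) * pinMean w H T ρ γ (fun e => (ω e).1) -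
          R (fun e => (ω e).1) * pinMean w H T ρ γ (fun e => (ω e).2)) =
      ∑ ω ∈ ConfNZ (ZMod n × ZMod n) C, F (fun e => (ω e).1) (fun e => (ω e).2) := by
    refine sum_congr rfl fun ω hω => ?_
    have hσC : ∀ e ∉ C, (ω e).1 = 0 := fun e he => by rw [hmem ω hω e he]; rfl
    have hτC : ∀ e ∉ C, (ω e).2 = 0 := fun e he => by rw [hmem ω hω e he]; rfl
    simp only [hF, hκ, hV]
    by_cases h1 : ∀ p, curl (fun e => (ω e).1) p = 0
    · by_cases h2 : ∀ p, curl (fun e => (ω e).2) p = 0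
      · rw [if_pos h1, if_pos h2, wt_delta_eq hCW hσC h1, wt_delta_eq hCW hτC h2,
          pinMean_eq_of_flat h1, pinMean_eq_of_flat h2]
      · rw [if_neg h2, wt_delta_eq_zero hCW hτC h2]; simp
    · rw [if_neg h1, wt_delta_eq_zero hCW hσC h1]; simp
  have e2 : (2 : ℂ) * ∑ ω ∈ ConfNZ (ZMod n × ZMod n) C, F (fun e => (ω e).1) (fun e => (ω e).2) =
      ∑ ω ∈ ConfNZ (ZMod n × ZMod n) C, ((κ (fun e => (ω e).1) * κ (fun e => (ω e).2) : ℝ) : ℂ) *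
        ((R (fun e => (ω e).1) - R (fun e => (ω e).2)) *
          (V (fun e => (ω e).1) - V (fun e => (ω e).2))) := by
    rw [two_mul]
    nth_rewrite 2 [sum_confNZ_swap C F]
    rw [← sum_add_distrib]
    refine sum_congr rfl fun ω _ => ?_
    simp only [hF]
    push_cast; ring
  set c := touch ((boundary γ).support ×ˢ range (W.card + 1)) (fun i => ray i.1 i.2)
      (fun i => i.2 + 1 + 1) 2 C with hcdef
  have hc0 : 0 ≤ c := touch_nonneg _ _ _ (by norm_num) _
  have e3 : ‖(2 : ℂ) * ∑ ω ∈ ConfNZ (ZMod n × ZMod n) C, F (fun e => (ω e).1) (fun e => (ω e).2)‖ ≤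
      2 * (c * markedSum w.a x C.card) := by
    rw [e2]
    refine (norm_sum_le _ _).trans ?_
    refine le_trans ?_ (mul_le_mul_of_nonneg_left (mul_le_mul_of_nonneg_left
      (sum_marked_le w.k_zero w.k_nonneg meanMark_zero meanMark_nonneg (a := w.a) rfl hx C)
      hc0) (by norm_num : (0 : ℝ) ≤ 2))
    rw [mul_sum, mul_sum]
    refine sum_le_sum fun ω hω => ?_
    have hσC : ∀ e ∉ C, (ω e).1 = 0 := fun e he => by rw [hmem ω hω e he]; rfl
    have hτC : ∀ e ∉ C, (ω e).2 = 0 := fun e he => by rw [hmem ω hω e he]; rfl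
    have hm := norm_prod_sub_prod_le_marks (T := T) meanMark_zero meanMark_nonneg hσC hτC
      (v := fun e => flatMean w H ρ (γ e)) fun e he g =>
        norm_flatMean_sub_one_le (w := w) (H := H) (ρ := ρ) (hc e he) g
    have hM0 : 0 ≤ ∏ e ∈ C, (1 + meanMark w H ρ (ω e).1) * (1 + meanMark w H ρ (ω e).2) - 1 := by
      have := norm_nonneg (∏ e ∈ T, flatMean w H ρ (γ e) (ω e).1 -
        ∏ e ∈ T, flatMean w H ρ (γ e) (ω e).2)
      linarith
    have hK0 : 0 ≤ ∏ e ∈ C, w.k (ω e).1 * w.k (ω e).2 :=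
      prod_nonneg fun e _ => mul_nonneg (w.k_nonneg _) (w.k_nonneg _)
    have hpos : 0 ≤ 2 * (c * ((∏ e ∈ C, w.k (ω e).1 * w.k (ω e).2) *
        (∏ e ∈ C, (1 + meanMark w H ρ (ω e).1) * (1 + meanMark w H ρ (ω e).2) - 1))) := by
      positivity
    by_cases h1 : ∀ p, curl (fun e => (ω e).1) p = 0
    swap
    · simp only [hκ]; rw [if_neg h1]; simpa using hpos
    by_cases h2 : ∀ p, curl (fun e => (ω e).2) p = 0
    swap
    · simp only [hκ]; rw [if_neg h2]; simpa using hpos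
    have hd : ‖R (fun e => (ω e).1) - R (fun e => (ω e).2)‖ ≤ c := by
      by_cases hph : R (fun e => (ω e).1) = 1 ∧ R (fun e => (ω e).2) = 1
      · rw [hph.1, hph.2, sub_self, norm_zero]; exact hc0
      · have hex : ∃ x ∈ (boundary γ).support, ∃ k : ℕ, ray x k ∈ C ∧ k + 2 ≤ C.card := by
          by_cases h3 : R (fun e => (ω e).1) = 1
          · exact exists_ray_of_flat hC hτC h2 fun h4 => hph ⟨h3, h4⟩
          · exact exists_ray_of_flat hC hσC h1 h3
        obtain ⟨x, hx, k, hk, hkC⟩ := hex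
        have hkW : k < W.card + 1 := by have := Finset.card_le_card hCW; omega
        have hle : 2 ≤ c := le_touch (by norm_num) (i := (x, k))
          (mem_product.2 ⟨hx, Finset.mem_range.2 hkW⟩) hk (by omega)
        refine (norm_sub_le _ _).trans ?_
        rw [hR, norm_phase, norm_phase]
        linarith
    simp only [hκ]
    rw [if_pos h1, if_pos h2, norm_mul, norm_mul, Complex.norm_real, ← prod_mul_distrib,
      Real.norm_of_nonneg hK0]
    calc _ ≤ (∏ e ∈ C, w.k (ω e).1 * w.k (ω e).2) * (c *
          (2 * (∏ e ∈ C, (1 + meanMark w H ρ (ω e).1) * (1 + meanMark w H ρ (ω e).2) - 1))) :=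
          mul_le_mul_of_nonneg_left (mul_le_mul hd hm (norm_nonneg _) hc0) hK0
      _ = _ := by ring
  rw [norm_mul, Complex.norm_ofNat] at e3
  rw [e1]
  linarith

open Classical in
/-- In the model of flat configurations, the phase of a path and the mean phases along the path are
nearly uncorrelated. -/
theorem norm_avg_phase_mean_sub_le {γ : Edge →₀ ℤ} (hγ : IsPath γ)
    (hc : ∀ e ∈ T, γ e = 1 ∨ γ e = -1) (W : Finset Edge) {μ x : ℝ}
    (hμ : ∀ h, ‖w.mean ρ h / w.mean ρ 0‖ ≤ μ) (hμ1 : 1 ≤ μ)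
    (hx : ∑ h ∈ univ.erase 0, w.k h * meanMark w H ρ h = x)
    (hX : 102 * ((1 + w.a + x) * (1 + w.a + x) - 1) ≤ 1 / 2) :
    (μ ^ T.card)⁻¹ *
      ‖avg (wt w.k delta W (stars W)) W (fun σ => phase ρ γ.support γ σ * pinMean w H T ρ γ σ) -
        avg (wt w.k delta W (stars W)) W (phase ρ γ.support γ) *
          avg (wt w.k delta W (stars W)) W (pinMean w H T ρ γ)‖ ≤
      flatBound w.a x 1 0 T.card := by
  have hx0 : 0 ≤ x := by
    rw [← hx]
    exact sum_nonneg fun g _ => mul_nonneg (w.k_nonneg g) (meanMark_nonneg g)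
  have h0 := wt_nonneg w.k_nonneg delta_nonneg W (stars W)
  have hsep := separable_wt w.k_zero delta_zero W (stars W)
  have hV : ∀ (ω : Edge → ZMod n × ZMod n) (π : ZMod n × ZMod n → ZMod n), π 0 = 0 →
      ‖pinMean w H T ρ γ fun e => π (ω e)‖ ≤ majorant T μ ω := fun ω π hπ =>
    norm_pinMean_le hμ hμ1 γ ω π hπ
  refine (norm_avg_sub_le hsep hsep (separable_majorant T μ) (separable_phase ρ _ _)
    (separable_pinMean w H T ρ γ) h0 h0
    (fun ω => by rw [norm_mul, norm_phase, one_mul]; exact hV ω Prod.fst rfl)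
    (fun ω => by rw [norm_mul, norm_phase, one_mul]; exact hV ω Prod.snd rfl)
    (c := (μ ^ T.card)⁻¹) (by positivity) (fun ω => by
      rw [inv_mul_le_iff₀ (by positivity), mul_one]
      exact majorant_le_pow hμ1 ω) W).trans ?_
  refine le_trans ?_ (sum_flat_le (T := T) hγ (W := W) le_rfl le_rfl w.a_nonneg hx0
    (by rwa [one_mul]))
  refine sum_le_sum fun C hC => ?_
  rw [mem_filter, mem_powerset] at hC
  obtain ⟨hCW, v, hv⟩ := hC
  refine (norm_sum_phase_mean_le hv hc hCW hx).trans (le_of_eq ?_)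
  have : touch T id (fun _ => 6 + 1) (2 * (0 : ℝ)) C = 0 := by simp [touch]
  rw [this, zero_mul, add_zero, one_pow, mul_one]

/-- In the model of flat configurations, an edge rarely has a non-zero value. -/
lemma sum_flat_site_le {W : Finset Edge} {e : Edge} (he : e ∈ W) {r : ZMod n → ℝ} (hr0 : r 0 = 0)
    (hr : ∀ h, 0 ≤ r h) (ha : 51 * w.a ≤ 1) :
    ∑ σ ∈ Conf (ZMod n) W, wt w.k delta W (stars W) σ * r (σ e) ≤
      (∑ σ ∈ Conf (ZMod n) W, wt w.k delta W (stars W) σ) *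
        ((∑ h ∈ univ.erase 0, w.k h * r h) * (51 * (51 * w.a) ^ 6 / 19)) := by
  classical
  have h0 := wt_nonneg w.k_nonneg delta_nonneg W (stars W)
  refine (sum_conf_env_le (separable_wt w.k_zero delta_zero W (stars W)) h0
    (fun σ => hr (σ e)) he fun ω S heS _ => by simp [heS]).trans ?_
  refine mul_le_mul_of_nonneg_left ?_ (sum_nonneg fun σ _ => h0 σ)
  set s := ∑ h ∈ univ.erase 0, w.k h * r h with hs
  have hs0 : 0 ≤ s := sum_nonneg fun h _ => mul_nonneg (w.k_nonneg h) (hr h)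
  have hpt : ∀ D ⊆ W, IsConn nbr e D →
      ∑ τ ∈ ConfAt (ZMod n) e D, wt w.k delta W (stars W) τ * r (τ e) ≤
        if 6 + 1 ≤ D.card then s * w.a ^ (D.card - 1) else 0 := by
    intro D hDW hD
    have hz : ∀ τ ∈ ConfAt (ZMod n) e D, wt w.k delta W (stars W) τ * r (τ e) ≤
        if 6 + 1 ≤ D.card then (w.k (τ e) * r (τ e)) * ∏ f ∈ D.erase e, w.k (τ f) else 0 := by
      intro τ hτ
      rw [mem_confAt] at hτ
      have hn : 0 ≤ if 6 + 1 ≤ D.card then (w.k (τ e) * r (τ e)) * ∏ f ∈ D.erase e, w.k (τ f)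
          else 0 := by
        split_ifs
        · exact mul_nonneg (mul_nonneg (w.k_nonneg _) (hr _))
            (prod_nonneg fun f _ => w.k_nonneg _)
        · exact le_rfl
      by_cases hcl : ∀ p, curl τ p = 0
      swap
      · rw [wt_delta_eq_zero hDW hτ.2 hcl, zero_mul]; exact hn
      by_cases hτe : τ e = 0
      · rw [hτe, hr0, mul_zero]; rw [hτe, hr0] at hn; exact hn
      -- A closed form that does not vanish at `e` has at least seven non-zero edges.
      have h7 : 6 + 1 ≤ D.card := seven_le_card hτe (fun p _ => hcl p) fun f hf =>
        by_contra fun h => hf (hτ.2 f h)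
      rw [if_pos h7, wt_delta_eq hDW hτ.2 hcl, ← Finset.mul_prod_erase D _ hD.1]
      exact le_of_eq (by ring)
    refine (sum_le_sum hz).trans ?_
    split_ifs with h7
    · have := sum_confAt_prod hD.1 (fun h => w.k h * r h) w.k
      rw [this]
      have e1 : ∑ t, w.k t * r t = s := by
        rw [← Finset.add_sum_erase univ _ (mem_univ (0 : ZMod n)), hr0, mul_zero,
          zero_add]
      rw [e1]; rfl
    · simp
  calc _ ≤ ∑ D ∈ W.powerset with IsConn nbr e D,
        if 6 + 1 ≤ D.card then s * w.a ^ (D.card - 1) else 0 := by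
        refine sum_le_sum fun D hD => ?_
        rw [mem_filter, mem_powerset] at hD
        exact hpt D hD.1 hD.2
    _ = s * ∑ D ∈ W.powerset with IsConn nbr e D ∧ 6 + 1 ≤ D.card, w.a ^ (D.card - 1) := by
        rw [← Finset.filter_filter, ← Finset.sum_filter, mul_sum]
    _ ≤ _ := mul_le_mul_of_nonneg_left
        (sum_isConn_pow_pred_le card_nbr W e 6 w.a_nonneg ha) hs0

open Classical in
/-- In the model of flat configurations, the mean phases at the edges outside `T` are close to one,
and so are the mean phases at non-admissible values. -/
theorem norm_avg_mean_sub_le {S : Finset Edge} (hTS : T ⊆ S) {W : Finset Edge} (hSW : S ⊆ W)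
    {c : Edge → ℤ} (hc : ∀ e ∈ S, c e = 1 ∨ c e = -1) {ε m : ℝ} (hε : 0 ≤ ε)
    (hmean : ∀ h, ‖w.mean ρ h‖ ≤ 1) (hθ : w.mean ρ 0 ≠ 0) (hθε : ‖w.mean ρ 0 - 1‖ ≤ 2 * ε)
    (hm : ∑ h ∈ univ.erase 0, w.k h * (‖w.mean ρ h - 1‖ + ‖w.mean ρ (-h) - 1‖) ≤ m)
    (ha : 51 * w.a ≤ 1) :
    ‖w.mean ρ 0 ^ T.card * avg (wt w.k delta W (stars W)) W (pinMean w H T ρ c) -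
      avg (wt w.k delta W (stars W)) W (fun σ => ∏ e ∈ S, w.mean ρ (c e • σ e))‖ ≤
      (S \ T).card * (2 * ε + m * (51 * (51 * w.a) ^ 6 / 19)) +
        T.card * ((if ∀ h, H h then 0 else 1) *
          ((m + 2 * ε * w.a) * (51 * (51 * w.a) ^ 6 / 19))) := by
  set W0 := wt w.k delta W (stars W) with hW0
  have h0 : ∀ σ, 0 ≤ W0 σ := wt_nonneg w.k_nonneg delta_nonneg W (stars W)
  have hZ : 0 < ∑ σ ∈ Conf (ZMod n) W, W0 σ :=
    sum_weight_pos h0 (separable_wt w.k_zero delta_zero W (stars W)).1 W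
  set Z := ∑ σ ∈ Conf (ZMod n) W, W0 σ with hZdef
  set E := 51 * (51 * w.a) ^ 6 / 19 with hE
  have hE0 : 0 ≤ E := by have := w.a_nonneg; positivity
  set κ : ℝ := if ∀ h, H h then 0 else 1 with hκ
  -- the deviations at the edges outside `T` and in `T`
  set r : ZMod n → ℝ := fun h => if h = 0 then 0 else ‖w.mean ρ h - 1‖ + ‖w.mean ρ (-h) - 1‖ with hr
  set r' : ZMod n → ℝ := fun h => if h = 0 then 0 else
    κ * (‖w.mean ρ h - 1‖ + ‖w.mean ρ (-h) - 1‖ + 2 * ε) with hr'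
  have hκ0 : 0 ≤ κ := by rw [hκ]; split_ifs <;> norm_num
  have hrn : ∀ h, 0 ≤ r h := fun h => by simp only [hr]; split_ifs <;> positivity
  have hrn' : ∀ h, 0 ≤ r' h := fun h => by simp only [hr']; split_ifs <;> positivity
  have hcm : ∀ e ∈ S, ∀ h, ‖w.mean ρ (c e • h) - 1‖ ≤ ‖w.mean ρ h - 1‖ + ‖w.mean ρ (-h) - 1‖ := by
    intro e he h
    rcases hc e he with h1 | h1 <;> rw [h1]
    · rw [one_smul]; exact le_add_of_nonneg_right (norm_nonneg _)
    · rw [neg_smul, one_smul]; exact le_add_of_nonneg_left (norm_nonneg _)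
  -- Edge by edge, the factor of an edge in `T` is replaced only where its value is not admissible,
  -- and an edge outside `T` has factor one in the first product.
  have hpt : ∀ σ, (∀ p, curl σ p = 0) → ‖w.mean ρ 0 ^ T.card * pinMean w H T ρ c σ -
      ∏ e ∈ S, w.mean ρ (c e • σ e)‖ ≤ ∑ e ∈ S, if e ∈ T then r' (σ e) else 2 * ε + r (σ e) := by
    intro σ hcl
    have e1 : w.mean ρ 0 ^ T.card * pinMean w H T ρ c σ =
        ∏ e ∈ S, if e ∈ T then w.mean ρ 0 * flatMean w H ρ (c e) (σ e) else 1 := by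
      rw [pinMean_eq_of_flat hcl, ← prod_const, ← prod_mul_distrib,
        ← Finset.prod_filter, Finset.filter_mem_eq_inter, Finset.inter_eq_right.2 hTS]
    have hfm : ∀ e h, w.mean ρ 0 * flatMean w H ρ (c e) h =
        if h ≠ 0 ∧ H h then w.mean ρ (c e • h) else w.mean ρ 0 := by
      intro e h
      unfold flatMean
      split_ifs
      · rw [mul_div_cancel₀ _ hθ]
      · rw [mul_one]
    rw [e1]
    refine (norm_prod_sub_prod_le S (fun e _ => ?_) fun e _ => hmean _).trans
      (sum_le_sum fun e he => ?_)
    · split_ifs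
      · rw [hfm]; split_ifs <;> exact hmean _
      · rw [norm_one]
    · split_ifs with heT
      · rw [hfm]
        by_cases h1 : σ e = 0
        · rw [if_neg fun h => h.1 h1, h1, smul_zero, sub_self, norm_zero]; exact hrn' _
        by_cases h2 : H (σ e)
        · rw [if_pos ⟨h1, h2⟩, sub_self, norm_zero]; exact hrn' _
        · have hκ1 : κ = 1 := if_neg fun h => h2 (h _)
          rw [if_neg fun h => h2 h.2]
          simp only [hr']
          rw [if_neg h1, hκ1, one_mul]
          have e2 : w.mean ρ 0 - w.mean ρ (c e • σ e) =
              (w.mean ρ 0 - 1) - (w.mean ρ (c e • σ e) - 1) := by ring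
          rw [e2]
          refine (norm_sub_le _ _).trans ?_
          linarith [hcm e he (σ e)]
      · rw [norm_sub_rev]
        by_cases h1 : σ e = 0
        · rw [h1, smul_zero]; linarith [hrn 0]
        · simp only [hr]; rw [if_neg h1]; linarith [hcm e he (σ e)]
  have e3 : w.mean ρ 0 ^ T.card * avg W0 W (pinMean w H T ρ c) -
      avg W0 W (fun σ => ∏ e ∈ S, w.mean ρ (c e • σ e)) =
      (∑ σ ∈ Conf (ZMod n) W, (W0 σ : ℂ) * (w.mean ρ 0 ^ T.card * pinMean w H T ρ c σ -
        ∏ e ∈ S, w.mean ρ (c e • σ e))) / (Z : ℂ) := by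
    rw [avg, avg, mul_div_assoc', ← sub_div, mul_sum, ← Finset.sum_sub_distrib]
    congr 1
    exact sum_congr rfl fun σ _ => by ring
  rw [e3, norm_div, Complex.norm_real, Real.norm_of_nonneg hZ.le, div_le_iff₀ hZ]
  have hsr : ∑ h ∈ univ.erase 0, w.k h * r h ≤ m := by
    refine le_trans (le_of_eq (sum_congr rfl fun h hh => ?_)) hm
    simp only [hr]
    rw [if_neg (mem_erase.1 hh).1]
  have hsr' : ∑ h ∈ univ.erase 0, w.k h * r' h ≤ κ * (m + 2 * ε * w.a) := by
    have : ∑ h ∈ univ.erase 0, w.k h * r' h =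
        κ * (∑ h ∈ univ.erase 0, w.k h * (‖w.mean ρ h - 1‖ + ‖w.mean ρ (-h) - 1‖) +
          2 * ε * w.a) := by
      rw [Weights.a, mul_sum, ← sum_add_distrib, mul_sum]
      refine sum_congr rfl fun h hh => ?_
      simp only [hr']
      rw [if_neg (mem_erase.1 hh).1]
      ring
    rw [this]
    exact mul_le_mul_of_nonneg_left (by linarith) hκ0
  calc _ ≤ ∑ σ ∈ Conf (ZMod n) W, W0 σ * ∑ e ∈ S, (if e ∈ T then r' (σ e) else 2 * ε + r (σ e)) := by
        refine (norm_sum_le _ _).trans (sum_le_sum fun σ hσ => ?_)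
        rw [norm_mul, Complex.norm_real, Real.norm_of_nonneg (h0 σ)]
        by_cases hcl : ∀ p, curl σ p = 0
        · exact mul_le_mul_of_nonneg_left (hpt σ hcl) (h0 σ)
        · have : W0 σ = 0 := wt_delta_eq_zero Finset.Subset.rfl (mem_conf.1 hσ) hcl
          rw [this, zero_mul, zero_mul]
    _ = ∑ e ∈ S, if e ∈ T then ∑ σ ∈ Conf (ZMod n) W, W0 σ * r' (σ e)
          else Z * (2 * ε) + ∑ σ ∈ Conf (ZMod n) W, W0 σ * r (σ e) := by
        simp only [mul_sum]
        rw [Finset.sum_comm]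
        refine sum_congr rfl fun e _ => ?_
        split_ifs
        · rfl
        · rw [hZdef, sum_mul, ← sum_add_distrib]
          exact sum_congr rfl fun σ _ => by ring
    _ ≤ ∑ e ∈ S, if e ∈ T then Z * (κ * ((m + 2 * ε * w.a) * E)) else Z * (2 * ε + m * E) := by
        refine sum_le_sum fun e he => ?_
        split_ifs
        · refine (sum_flat_site_le (hSW he) (by simp [hr']) hrn' ha).trans
            (mul_le_mul_of_nonneg_left ?_ hZ.le)
          have := mul_le_mul_of_nonneg_right hsr' hE0
          rw [← hE]
          linarith
        · have h1 := sum_flat_site_le (hSW he) (by simp [hr]) hrn ha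
          have h2 := mul_le_mul_of_nonneg_left (mul_le_mul_of_nonneg_right hsr hE0) hZ.le
          rw [← hZdef, ← hW0, ← hE] at h1
          linarith
    _ = _ := by
        rw [← Finset.sum_sdiff hTS, sum_congr rfl fun e he => if_neg
          (mem_sdiff.1 he).2, sum_congr rfl fun e (he : e ∈ T) => if_pos he,
          Finset.sum_const, Finset.sum_const, nsmul_eq_mul, nsmul_eq_mul]
        ring

end MeanPhase

/-! ### The weights of the lattice Higgs model -/

section Scalars

variable {n : ℕ} [NeZero n] (ρ : AddChar (ZMod n) Circle)

/-- The edge and plaquette weights of the lattice Higgs model. -/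
def higgs {β : ℝ} (hβ : 0 ≤ β) (κ : ℝ) : Weights n where
  k := phi2 ρ κ
  b := phi2 ρ β
  k_zero := phi2_zero ρ κ
  b_zero := phi2_zero ρ β
  k_pos := phi2_pos ρ κ
  b_pos := phi2_pos ρ β
  k_neg := phi2_neg ρ κ
  b_neg := phi2_neg ρ β
  b_le_one := phi2_le_one ρ hβ

variable {β : ℝ} (hβ : 0 ≤ β) (κ : ℝ)

lemma theta_eq_mean (h : ZMod n) : theta ρ β κ h = (higgs ρ hβ κ).mean ρ h := by
  simp only [theta, Weights.mean, Weights.mass, higgs, phi2, ← pow_mul, Complex.ofReal_sum]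

lemma higgs_a : (higgs ρ hβ κ).a = alpha0 ρ κ := rfl

lemma exists_ne_zero (hn : 2 ≤ n) : ∃ g : ZMod n, g ≠ 0 := by
  have : Nontrivial (ZMod n) := ZMod.nontrivial_iff.2 (by omega)
  exact exists_ne 0

lemma alpha0_pos (hn : 2 ≤ n) (r : ℝ) : 0 < alpha0 ρ r := by
  obtain ⟨g, hg⟩ := exists_ne_zero hn
  exact Finset.sum_pos (fun g _ => phi2_pos ρ r g) ⟨g, mem_erase.2 ⟨hg, mem_univ _⟩⟩

lemma le_alpha1 (r : ℝ) {g : ZMod n} (hg : g ≠ 0) : phi2 ρ r g ≤ alpha1 ρ r :=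
  le_ciSup (f := fun g : {g : ZMod n // g ≠ 0} => varphi ρ r g.1 ^ 2) (Set.finite_range _).bddAbove
    ⟨g, hg⟩

lemma exists_alpha1 (hn : 2 ≤ n) (r : ℝ) : ∃ g : ZMod n, g ≠ 0 ∧ phi2 ρ r g = alpha1 ρ r := by
  obtain ⟨g, hg⟩ := exists_ne_zero hn
  have : Nonempty {g : ZMod n // g ≠ 0} := ⟨⟨g, hg⟩⟩
  obtain ⟨x, hx⟩ := exists_eq_ciSup_of_finite (f := fun g : {g : ZMod n // g ≠ 0} =>
    varphi ρ r g.1 ^ 2)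
  exact ⟨x.1, x.2, hx⟩

lemma alpha1_pos (hn : 2 ≤ n) (r : ℝ) : 0 < alpha1 ρ r := by
  obtain ⟨g, -, h⟩ := exists_alpha1 ρ hn r
  rw [← h]; exact phi2_pos ρ r g

lemma alpha1_le_one (hn : 2 ≤ n) {r : ℝ} (hr : 0 ≤ r) : alpha1 ρ r ≤ 1 := by
  obtain ⟨g, -, h⟩ := exists_alpha1 ρ hn r
  rw [← h]; exact phi2_le_one ρ hr g

lemma alpha1_le_alpha0 (hn : 2 ≤ n) (r : ℝ) : alpha1 ρ r ≤ alpha0 ρ r := by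
  obtain ⟨g, hg, h⟩ := exists_alpha1 ρ hn r
  rw [← h]
  exact Finset.single_le_sum (f := phi2 ρ r) (fun g _ => (phi2_pos ρ r g).le)
    (mem_erase.2 ⟨hg, mem_univ _⟩)

lemma higgs_q_le : (higgs ρ hβ κ).q ≤ alpha0 ρ β * alpha1 ρ β ^ 5 := by
  rw [Weights.q, alpha0, sum_mul]
  refine sum_le_sum fun g hg => ?_
  have h0 : 0 ≤ phi2 ρ β g := (phi2_pos ρ β g).le
  change phi2 ρ β g ^ 6 ≤ phi2 ρ β g * alpha1 ρ β ^ 5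
  rw [pow_succ' (phi2 ρ β g) 5]
  exact mul_le_mul_of_nonneg_left (pow_le_pow_left₀ h0 (le_alpha1 ρ β (mem_erase.1 hg).1) 5)
    h0

lemma norm_theta_sub_le (g : ZMod n) : ‖theta ρ β κ g - theta ρ β κ 0‖ ≤ alpha4 ρ β κ :=
  le_ciSup (f := fun g : ZMod n => ‖theta ρ β κ g - theta ρ β κ 0‖) (Set.finite_range _).bddAbove g

lemma alpha4_nonneg : 0 ≤ alpha4 ρ β κ := (norm_nonneg _).trans (norm_theta_sub_le ρ κ 0)

lemma alpha4_le {M : ℝ} (h : ∀ g, ‖theta ρ β κ g‖ ≤ M) : alpha4 ρ β κ ≤ 2 * M :=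
  ciSup_le fun g => (norm_sub_le _ _).trans (by linarith [h g, h 0])

lemma phaseBound_alpha5 : PhaseBound (higgs ρ hβ κ) ρ (alpha5 ρ β κ) := by
  intro v
  have hpos : 0 < ∑ g, (∏ i, phi2 ρ β (g + v i)) * phi2 ρ κ g := Finset.sum_pos
    (fun g _ => mul_pos (Finset.prod_pos fun i _ => phi2_pos ρ β _) (phi2_pos ρ κ g))
    Finset.univ_nonempty
  have h := ciInf_le (f := fun v : Fin 6 → ZMod n => (1 - ‖(∑ g : ZMod n,
          (ρ g : ℂ) * (((∏ k, varphi ρ β (g + v k) ^ 2) * varphi ρ κ g ^ 2 : ℝ) : ℂ)) /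
        ∑ g : ZMod n, (((∏ k, varphi ρ β (g + v k) ^ 2) * varphi ρ κ g ^ 2 : ℝ) : ℂ)‖))
    (Set.finite_range _).bddBelow v
  change alpha5 ρ β κ ≤ _ at h
  rw [← Complex.ofReal_sum, norm_div, Complex.norm_real] at h
  change _ ≤ 1 - _ / ‖∑ g, (∏ i, phi2 ρ β (g + v i)) * phi2 ρ κ g‖ at h
  rw [Real.norm_of_nonneg hpos.le] at h
  have h2 := (div_le_iff₀ hpos).1 (by linarith : _ ≤ 1 - alpha5 ρ β κ)
  exact h2

variable {ρ} in
/-- The triangle inequality is strict, since two of the phases differ. -/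
lemma norm_sum_phase_lt (hn : 2 ≤ n) (hρ : Function.Injective ρ) {W : ZMod n → ℝ}
    (hW : ∀ g, 0 < W g) : ‖∑ g, ((ρ g : Circle) : ℂ) * (W g : ℂ)‖ < ∑ g, W g := by
  obtain ⟨g₁, hg⟩ := exists_ne_zero hn
  have hne : ((ρ 0 : Circle) : ℂ) * (W 0 : ℂ) + ((ρ g₁ : Circle) : ℂ) * (W g₁ : ℂ) =
      (W 0 : ℂ) + ((ρ g₁ : Circle) : ℂ) * (W g₁ : ℂ) := by
    rw [AddChar.map_zero_eq_one, Circle.coe_one, one_mul]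
  have hre : ((ρ g₁ : Circle) : ℂ).re < 1 := by
    refine lt_of_le_of_ne (rho_re_le_one ρ g₁) fun h => hg (hρ ?_)
    rw [AddChar.map_zero_eq_one]
    have h1 : Complex.normSq ((ρ g₁ : Circle) : ℂ) = 1 := Circle.normSq_coe _
    rw [Complex.normSq_apply, h] at h1
    have him : ((ρ g₁ : Circle) : ℂ).im = 0 := by nlinarith
    exact Circle.ext (Complex.ext (by rw [h, Circle.coe_one, Complex.one_re])
      (by rw [him, Circle.coe_one, Complex.one_im]))
  have h2 : ‖(W 0 : ℂ) + ((ρ g₁ : Circle) : ℂ) * (W g₁ : ℂ)‖ < W 0 + W g₁ := by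
    have hp := hW 0; have hq := hW g₁
    refine lt_of_pow_lt_pow_left₀ 2 (by linarith) ?_
    have h1 : Complex.normSq ((ρ g₁ : Circle) : ℂ) = 1 := Circle.normSq_coe _
    rw [Complex.normSq_apply] at h1
    rw [Complex.sq_norm, Complex.normSq_apply]
    simp only [Complex.add_re, Complex.mul_re, Complex.ofReal_re, Complex.ofReal_im, mul_zero,
      sub_zero, Complex.add_im, Complex.mul_im, zero_add]
    set u := ((ρ g₁ : Circle) : ℂ).re
    set v := ((ρ g₁ : Circle) : ℂ).im
    have e : (W 0 + u * W g₁) * (W 0 + u * W g₁) + v * W g₁ * (v * W g₁) =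
        W 0 ^ 2 + 2 * (W 0 * W g₁ * u) + W g₁ ^ 2 * (u * u + v * v) := by ring
    rw [e, h1]
    have := mul_pos (mul_pos hp hq) (sub_pos.2 hre)
    nlinarith
  have hmem : g₁ ∈ univ.erase (0 : ZMod n) := mem_erase.2 ⟨hg, mem_univ _⟩
  rw [← Finset.add_sum_erase univ _ (mem_univ (0 : ZMod n)),
    ← Finset.add_sum_erase _ _ hmem, ← add_assoc, hne,
    ← Finset.add_sum_erase univ W (mem_univ (0 : ZMod n)),
    ← Finset.add_sum_erase _ W hmem, ← add_assoc]
  refine (norm_add_le _ _).trans_lt (add_lt_add_of_lt_of_le h2 ((norm_sum_le _ _).trans ?_))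
  refine sum_le_sum fun g _ => ?_
  rw [norm_mul, Circle.norm_coe, one_mul, Complex.norm_real, Real.norm_of_nonneg (hW g).le]

lemma alpha5_pos (hn : 2 ≤ n) (hρ : Function.Injective ρ) : 0 < alpha5 ρ β κ := by
  obtain ⟨v, hv⟩ := exists_eq_ciInf_of_finite (f := fun v : Fin 6 → ZMod n => (1 - ‖(∑ g : ZMod n,
          (ρ g : ℂ) * (((∏ k, varphi ρ β (g + v k) ^ 2) * varphi ρ κ g ^ 2 : ℝ) : ℂ)) /
        ∑ g : ZMod n, (((∏ k, varphi ρ β (g + v k) ^ 2) * varphi ρ κ g ^ 2 : ℝ) : ℂ)‖))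
  rw [alpha5, ← hv, sub_pos, ← Complex.ofReal_sum, norm_div, Complex.norm_real]
  have hW : ∀ g, 0 < (∏ k, varphi ρ β (g + v k) ^ 2) * varphi ρ κ g ^ 2 := fun g =>
    mul_pos (Finset.prod_pos fun i _ => phi2_pos ρ β _) (phi2_pos ρ κ g)
  have hpos := Finset.sum_pos (fun g _ => hW g) Finset.univ_nonempty
  rw [Real.norm_of_nonneg hpos.le, div_lt_one hpos]
  exact norm_sum_phase_lt hn hρ hW

/-- The powers of a primitive root of unity move away from one at least linearly. -/
lemma exp_sin_le {β : ℝ} (hβ : 0 ≤ β) {j : ℕ} (hj : 1 ≤ j) (hjn : 2 * j ≤ n)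
    (hY : Real.exp (-(2 * β * Real.sin (Real.pi / n) ^ 2)) ≤ 1 / 2) :
    Real.exp (-(4 * β * Real.sin (Real.pi * j / n) ^ 2)) ≤
      Real.exp (-(4 * β * Real.sin (Real.pi / n) ^ 2)) * (1 / 2) ^ (j - 1) := by
  set x := Real.pi / n with hx
  have hn0 : (0 : ℝ) < n := by
    have : 0 < n := by omega
    exact_mod_cast this
  have hx0 : 0 < x := div_pos Real.pi_pos hn0
  have hj1 : (1 : ℝ) ≤ j := by exact_mod_cast hj
  have hjn' : (2 : ℝ) * j ≤ n := by exact_mod_cast hjn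
  have e : Real.pi * j / n = j * x := by rw [hx]; ring
  have hxn : x * n = Real.pi := div_mul_cancel₀ _ hn0.ne'
  have hle : j * x ≤ Real.pi / 2 := by nlinarith
  have hxle : x ≤ Real.pi / 2 := by nlinarith
  -- Jordan's inequality.
  have h1 : 2 / Real.pi * (j * x) ≤ Real.sin (j * x) :=
    Real.mul_le_sin (by positivity) hle
  have h2 : Real.sin x ≤ x := Real.sin_le hx0.le
  have h3 : 0 ≤ Real.sin x := Real.sin_nonneg_of_nonneg_of_le_pi hx0.le (by linarith [Real.pi_pos])
  have hkey : (j + 1) / 2 * Real.sin x ^ 2 ≤ Real.sin (j * x) ^ 2 := by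
    rcases Nat.lt_or_ge 1 j with hj2 | hj2
    · have hj2 : (2 : ℝ) ≤ j := by exact_mod_cast hj2
      have h4 : (2 / Real.pi * (j * x)) ^ 2 ≤ Real.sin (j * x) ^ 2 :=
        pow_le_pow_left₀ (by positivity) h1 2
      have h5 : Real.sin x ^ 2 ≤ x ^ 2 := pow_le_pow_left₀ h3 h2 2
      refine le_trans ?_ h4
      -- As `π ^ 2 ≤ 10` and `j ≥ 2`, the ratio of the squares grows at least like `(j + 1) / 2`.
      have h6 : (j + 1) / 2 ≤ (2 / Real.pi * j) ^ 2 := by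
        have hp : Real.pi ^ 2 ≤ 10 := by nlinarith [Real.pi_lt_d2, Real.pi_pos]
        rw [div_mul_eq_mul_div, div_pow, div_le_div_iff₀ (by norm_num) (by positivity)]
        nlinarith [mul_le_mul_of_nonneg_left hp (by linarith : (0 : ℝ) ≤ j + 1)]
      calc _ ≤ (2 / Real.pi * j) ^ 2 * x ^ 2 := mul_le_mul h6 h5 (by positivity) (by positivity)
        _ = _ := by ring
    · have : (j : ℝ) = 1 := by exact_mod_cast le_antisymm hj2 hj
      rw [this]; norm_num
  have hexp : Real.exp (-(4 * β * Real.sin (j * x) ^ 2)) ≤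
      Real.exp (-(2 * β * Real.sin x ^ 2)) ^ (j + 1) := by
    rw [← Real.exp_nat_mul, Real.exp_le_exp]
    push_cast
    nlinarith [mul_le_mul_of_nonneg_left hkey hβ]
  rw [e]
  refine hexp.trans ?_
  obtain ⟨l, rfl⟩ : ∃ l, j = l + 1 := ⟨j - 1, by omega⟩
  have e2 : Real.exp (-(4 * β * Real.sin x ^ 2)) = Real.exp (-(2 * β * Real.sin x ^ 2)) ^ 2 := by
    rw [← Real.exp_nat_mul]; congr 1; push_cast; ring
  rw [e2, Nat.add_sub_cancel, show l + 1 + 1 = 2 + l by ring, pow_add]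
  exact mul_le_mul_of_nonneg_left (pow_le_pow_left₀ (Real.exp_pos _).le hY l) (by positivity)

variable {ρ} in
/-- The values of an injective character of `ℤ/n` are the `n`-th roots of unity. -/
lemma exists_mul_zmod (hρ : Function.Injective ρ) :
    ∃ x : ZMod n, Function.Bijective (fun g => x * g) ∧ ∀ g, ρ g = AddChar.zmod n 1 (x * g) := by
  obtain ⟨x, hx⟩ := AddChar.zmodAddEquiv.surjective (AddChar.circleEquivComplex ρ)
  rw [AddChar.zmodAddEquiv_apply] at hx
  have hx' := AddChar.circleEquivComplex.injective hx
  have h1 : ∀ g, ρ g = AddChar.zmod n 1 (x * g) := fun g => by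
    rw [← hx']
    obtain ⟨i, rfl⟩ := ZMod.intCast_surjective x
    obtain ⟨j, rfl⟩ := ZMod.intCast_surjective g
    have h2 := AddChar.zmod_intCast n 1 (i * j)
    rw [Int.cast_one, Int.cast_mul, Int.cast_one, one_mul, Int.cast_mul] at h2
    rw [AddChar.zmod_intCast, h2]
  refine ⟨x, Finite.injective_iff_bijective.1 fun g g' h => hρ ?_, h1⟩
  rw [h1, h1]
  exact congrArg _ h

variable {ρ} in
/-- The non-trivial `n`-th roots of unity closest to one dominate `alpha0` as soon as their
weight is small. -/
theorem alpha0_le (hn : 2 ≤ n) (hρ : Function.Injective ρ) {r : ℝ} (hr : 0 ≤ r)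
    (h : alpha1 ρ r ≤ 1 / 4) : alpha0 ρ r ≤ 4 * alpha1 ρ r := by
  obtain ⟨x, hx, hρx⟩ := exists_mul_zmod hρ
  -- In terms of the exponent `j` of the root of unity, the real part of the phase is `1 - 2 sin² (π
  -- j / n)`.
  set F : ZMod n → ℝ := fun g => Real.exp (-(4 * r * Real.sin (Real.pi * g.val / n) ^ 2)) with hF
  have hphi : ∀ g, phi2 ρ r g = F (x * g) := by
    intro g
    have e1 : ((ρ g : Circle) : ℂ).re = 1 - 2 * Real.sin (Real.pi * (x * g).val / n) ^ 2 := by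
      have e2 : x * g = (((x * g).val : ℤ) : ZMod n) := by simp
      have e3 : AddChar.zmod n 1 (x * g) =
          Circle.exp (2 * Real.pi * (((1 : ℤ) : ℝ) * (((x * g).val : ℤ) : ℝ) / n)) := by
        rw [← AddChar.zmod_intCast, ← e2, Int.cast_one]
      rw [hρx, e3, Circle.coe_exp, Complex.exp_ofReal_mul_I_re]
      push_cast
      rw [show 2 * Real.pi * (1 * ((x * g).val : ℝ) / n) = 2 * (Real.pi * (x * g).val / n) by ring,
        Real.cos_two_mul, Real.cos_sq']
      ring
    rw [phi2, varphi, ← Real.exp_nat_mul]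
    simp only [hF]
    congr 1
    rw [Complex.sub_re, e1, AddChar.map_zero_eq_one, Circle.coe_one, Complex.one_re]
    push_cast; ring
  obtain ⟨g₁, hg₁⟩ := hx.surjective 1
  simp only at hg₁
  have hn1 : n ≠ 1 := by omega
  have hF1 : F 1 = Real.exp (-(4 * r * Real.sin (Real.pi / n) ^ 2)) := by
    simp only [hF]
    rw [ZMod.val_one'' hn1]; simp
  set y := Real.exp (-(4 * r * Real.sin (Real.pi / n) ^ 2)) with hy
  have hyα : y ≤ alpha1 ρ r := by
    rw [← hF1, ← hg₁, ← hphi]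
    refine le_alpha1 ρ r ?_
    rintro rfl
    have : Nontrivial (ZMod n) := ZMod.nontrivial_iff.2 hn1
    exact zero_ne_one (by rw [← hg₁, mul_zero])
  have hY : Real.exp (-(2 * r * Real.sin (Real.pi / n) ^ 2)) ≤ 1 / 2 := by
    refine le_of_pow_le_pow_left₀ two_ne_zero (by norm_num) ?_
    rw [← Real.exp_nat_mul]
    refine (le_of_eq ?_).trans ((hyα.trans h).trans (by norm_num))
    rw [hy]; congr 1; push_cast; ring
  have hn0 : (0 : ℝ) < n := by
    have : 0 < n := by omega
    exact_mod_cast this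
  have hy0 : 0 < y := Real.exp_pos _
  -- The weights decay geometrically from both ends of `1, …, n - 1`.
  have hterm : ∀ j : ℕ, 1 ≤ j → j < n → Real.exp (-(4 * r * Real.sin (Real.pi * j / n) ^ 2)) ≤
      y * (1 / 2) ^ (j - 1) + y * (1 / 2) ^ (n - 1 - j) := by
    intro j hj hjn
    rcases le_total (2 * j) n with h2 | h2
    · have := exp_sin_le hr hj h2 hY
      have h0 : 0 ≤ y * (1 / 2) ^ (n - 1 - j) := by positivity
      linarith
    · have h3 := exp_sin_le (n := n) (j := n - j) hr (by omega) (by omega) hY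
      have e : Real.sin (Real.pi * ((n - j : ℕ) : ℝ) / n) = Real.sin (Real.pi * j / n) := by
        rw [Nat.cast_sub hjn.le, ← Real.sin_pi_sub]
        congr 1
        field_simp
        ring
      rw [e, show n - j - 1 = n - 1 - j by omega] at h3
      have h0 : 0 ≤ y * (1 / 2) ^ (j - 1) := by positivity
      linarith
  have hgeo : ∑ i ∈ range (n - 1), ((1 : ℝ) / 2) ^ i ≤ 2 := by
    rw [geom_sum_eq (by norm_num)]
    have : (0 : ℝ) ≤ (1 / 2) ^ (n - 1) := by positivity
    rw [div_le_iff_of_neg (by norm_num)]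
    linarith
  have hsub : (univ.erase (0 : ZMod n)).image ZMod.val ⊆ Finset.Ico 1 n := by
    intro j hj
    obtain ⟨g, hg, rfl⟩ := Finset.mem_image.1 hj
    refine Finset.mem_Ico.2 ⟨Nat.one_le_iff_ne_zero.2 fun h0 => (mem_erase.1 hg).1 ?_,
      ZMod.val_lt g⟩
    exact (ZMod.val_eq_zero g).1 h0
  calc alpha0 ρ r = ∑ g ∈ univ.erase (0 : ZMod n), F (x * g) :=
        sum_congr rfl fun g _ => hphi g
    _ = ∑ g ∈ univ.erase (0 : ZMod n), F g := by
        refine Finset.sum_bij (fun g _ => x * g) (fun g hg => ?_) (fun a _ b _ h => hx.injective h)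
          (fun b hb => ?_) fun _ _ => rfl
        · refine mem_erase.2 ⟨fun h0 => (mem_erase.1 hg).1 (hx.injective ?_),
            mem_univ _⟩
          simp only [h0, mul_zero]
        · obtain ⟨a, rfl⟩ := hx.surjective b
          refine ⟨a, mem_erase.2 ⟨?_, mem_univ _⟩, rfl⟩
          rintro rfl
          exact (mem_erase.1 hb).1 (mul_zero x)
    _ = ∑ j ∈ (univ.erase (0 : ZMod n)).image ZMod.val,
          Real.exp (-(4 * r * Real.sin (Real.pi * j / n) ^ 2)) :=
        (Finset.sum_image (f := fun j : ℕ => Real.exp (-(4 * r * Real.sin (Real.pi * j / n) ^ 2)))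
          fun a _ b _ hab => ZMod.val_injective n hab).symm
    _ ≤ ∑ j ∈ Finset.Ico 1 n, Real.exp (-(4 * r * Real.sin (Real.pi * j / n) ^ 2)) :=
        Finset.sum_le_sum_of_subset_of_nonneg hsub fun _ _ _ => (Real.exp_pos _).le
    _ ≤ ∑ j ∈ Finset.Ico 1 n, (y * (1 / 2) ^ (j - 1) + y * (1 / 2) ^ (n - 1 - j)) :=
        sum_le_sum fun j hj => hterm j (Finset.mem_Ico.1 hj).1 (Finset.mem_Ico.1 hj).2
    _ = y * ∑ i ∈ range (n - 1), ((1 : ℝ) / 2) ^ i +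
          y * ∑ i ∈ range (n - 1), ((1 : ℝ) / 2) ^ i := by
        rw [sum_add_distrib, ← mul_sum, ← mul_sum]
        congr 2
        · rw [Finset.sum_Ico_eq_sum_range]
          exact sum_congr rfl fun i _ => by rw [Nat.add_sub_cancel_left]
        · rw [← Finset.sum_range_reflect, Finset.sum_Ico_eq_sum_range]
          refine sum_congr rfl fun i hi => ?_
          rw [Finset.mem_range] at hi
          congr 1; omega
    _ ≤ y * 2 + y * 2 := by gcongr
    _ ≤ _ := by linarith

end Scalars

/-! ### The finite volume estimate -/

section Combine

variable {n : ℕ} [NeZero n] {w : Weights n} {H : ZMod n → Prop} {T : Finset Edge}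
  {ρ : AddChar (ZMod n) Circle}

open Classical in
/-- The sum of the four comparisons: the original and the tilted weight, the tilted weight and the
flat model, phase and mean phases in the flat model, pinned and true mean phases. -/
theorem norm_avg_sub_mul_le {γ : Edge →₀ ℤ} (hγ : IsPath γ) (hc : ∀ e ∈ γ.support, γ e = 1 ∨ γ e = -1)
    (hTS : T ⊆ γ.support) (hT : Separated T) {W : Finset Edge} (hSW : γ.support ⊆ W) (H0 : H 0)
    {α : ℝ} (hα : ∀ g ≠ 0, w.b g ≤ α) (hα0 : 0 ≤ α) (hα1 : α ≤ 1)
    (hmean : ∀ h, ‖w.mean ρ h‖ ≤ 1) (hθ : w.mean ρ 0 ≠ 0) {μ A u x ε m : ℝ}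
    (hμ : μ = ‖w.mean ρ 0‖⁻¹) (hA : ∀ h, ‖w.mean ρ h / w.mean ρ 0 - 1‖ ≤ A)
    (hu : ∑ h ∈ univ.erase 0, w.k h * excess w H h = u)
    (hx : ∑ h ∈ univ.erase 0, w.k h * meanMark w H ρ h = x)
    (hP : 51 * edgeSum w H ≤ 1)
    (hXu : 102 * (μ * ((1 + w.a + u) * (1 + w.a + u) - 1)) ≤ 1 / 2)
    (hXx : 102 * ((1 + w.a + x) * (1 + w.a + x) - 1) ≤ 1 / 2) (hε : 0 ≤ ε)
    (hθε : ‖w.mean ρ 0 - 1‖ ≤ 2 * ε)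
    (hm : ∑ h ∈ univ.erase 0, w.k h * (‖w.mean ρ h - 1‖ + ‖w.mean ρ (-h) - 1‖) ≤ m)
    (ha : 51 * w.a ≤ 1) :
    ‖avg (wt w.k w.b W (stars W)) W (phase ρ γ.support γ) -
      avg (wt w.k delta W (stars W)) W (fun σ => ∏ e ∈ γ.support, w.mean ρ (γ e • σ e)) *
        avg (wt w.k delta W (stars W)) W (phase ρ γ.support γ)‖ ≤
      2 * T.card * defectBound w H α +
      (flatBound w.a u μ A T.card +
      2 / 19 * (γ.support.card * (α ^ 7 * (51 * pairSum w H μ) ^ 2) +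
        4 * (γ.support \ T).card * (α ^ 6 * (51 * pairSum w H μ)) +
        4 * T.card * ((if ∀ h, H h then 0 else 1) * (α ^ 6 * (51 * pairSum w H μ) ^ 6)) +
        T.card * (A * (α ^ 6 * (102 * pairSum w H μ) ^ 6)) +
        16 * (α ^ 6 * (51 * pairSum w H μ)))) +
      flatBound w.a x 1 0 T.card +
      ((γ.support \ T).card * (2 * ε + m * (51 * (51 * w.a) ^ 6 / 19)) +
        T.card * ((if ∀ h, H h then 0 else 1) *
          ((m + 2 * ε * w.a) * (51 * (51 * w.a) ^ 6 / 19)))) := by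
  have hθ0 : 0 < ‖w.mean ρ 0‖ := norm_pos_iff.2 hθ
  have hμ1 : 1 ≤ μ := by rw [hμ]; exact (one_le_inv₀ hθ0).2 (hmean 0)
  have hμb : ∀ h, ‖w.mean ρ h / w.mean ρ 0‖ ≤ μ := fun h => by
    rw [norm_div, hμ, div_eq_mul_inv]
    exact mul_le_of_le_one_left (by positivity) (hmean h)
  have hpow : (μ ^ T.card)⁻¹ = ‖w.mean ρ 0 ^ T.card‖ := by
    rw [hμ, inv_pow, inv_inv, norm_pow]
  have hTc : ∀ e ∈ T, γ e = 1 ∨ γ e = -1 := fun e he => hc e (hTS he)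
  have d1 := norm_avg_wt_sub_tilt_le ρ hTS (hTS.trans hSW) hT hTc H0 hα hα0 hα1 hP hθ hmean
  have d2 := norm_avg_tilt_sub_le hγ hTS H0 W hα hα0 hα1 hμb hμ1 hA hu hXu
  have d3 := norm_avg_phase_mean_sub_le hγ hTc W hμb hμ1 hx hXx
  have d4 := norm_avg_mean_sub_le (H := H) hTS hSW hc hε hmean hθ hθε hm ha
  have hR : ‖avg (wt w.k delta W (stars W)) W (phase ρ γ.support γ)‖ ≤ 1 :=
    norm_avg_le (wt_nonneg w.k_nonneg delta_nonneg _ _) (separable_wt w.k_zero delta_zero _ _).1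
      fun σ => (norm_phase ρ _ _ σ).le
  -- The normalisation by powers of `mean 0` is the one of the bounds `d2` and `d3`.
  rw [hpow, ← norm_mul] at d2 d3
  generalize avg (wt w.k w.b W (stars W)) W (phase ρ γ.support γ) = a1 at *
  generalize avg (tilt w H T W) W
    (fun σ => phase ρ γ.support γ σ * pinMean w H T ρ γ σ) = a2 at *
  generalize avg (wt w.k delta W (stars W)) W
    (fun σ => phase ρ γ.support γ σ * pinMean w H T ρ γ σ) = a3 at *
  generalize avg (wt w.k delta W (stars W)) W (phase ρ γ.support γ) = a4 at *
  generalize avg (wt w.k delta W (stars W)) W (pinMean w H T ρ γ) = a5 at *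
  generalize avg (wt w.k delta W (stars W)) W
    (fun σ => ∏ e ∈ γ.support, w.mean ρ (γ e • σ e)) = a6 at *
  generalize w.mean ρ 0 ^ T.card = q at *
  have e : a1 - a6 * a4 = (a1 - q * a2) + q * (a2 - a3) + q * (a3 - a4 * a5) +
      a4 * (q * a5 - a6) := by ring
  rw [e]
  refine (norm_add_le _ _).trans (add_le_add ((norm_add_le _ _).trans (add_le_add
    ((norm_add_le _ _).trans (add_le_add d1 d2)) d3)) ?_)
  rw [norm_mul]
  exact (mul_le_of_le_one_left (norm_nonneg _) hR).trans d4

end Combine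

section Numeric

variable {a α δ s : ℝ}

/-- The error at pinned edges. In this and the following estimates `ι` is zero if all values are
admissible and one otherwise, in which case `a ≤ δ`; this is the assumption `ι * a ≤ δ`. -/
lemma defect_numeric (ha0 : 0 ≤ a) (ha : a ≤ 1 / 648) (hα0 : 0 ≤ α) (hα1 : α ≤ 1) (hαδ : α * a ≤ δ)
    {P ι : ℝ} (hP0 : 0 ≤ P) (hP : P ≤ 101 / 100 * a) (hι0 : 0 ≤ ι) (hι : ι * a ≤ δ) :
    51 / 19 * (1 + P) * (α ^ 7 * (51 * P) ^ 6 + 3 * (α ^ 6 * a) * (α ^ 6 * (51 * P) +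
      ι * (51 * P) ^ 6)) ≤ 430 * (α ^ 6 * a * δ) := by
  have hδ : 0 ≤ δ := (mul_nonneg hα0 ha0).trans hαδ
  have hP1 : 51 * P ≤ 52 * a := by linarith
  have h1 : α ^ 7 * (51 * P) ^ 6 ≤ α ^ 6 * a * δ * (1 / 5) :=
    calc _ ≤ α ^ 7 * (52 * a) ^ 6 := by gcongr
      _ = α ^ 6 * a * (α * a) * (52 ^ 6 * a ^ 4) := by ring
      _ ≤ α ^ 6 * a * δ * (52 ^ 6 * (1 / 648) ^ 4) := by gcongr
      _ ≤ _ := by gcongr; norm_num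
  have h2 : α ^ 6 * (51 * P) ≤ 52 * δ :=
    calc _ ≤ α ^ 1 * (52 * a) :=
          mul_le_mul (pow_le_pow_of_le_one hα0 hα1 (by norm_num)) hP1 (by positivity) (by positivity)
      _ = 52 * (α * a) := by ring
      _ ≤ _ := by gcongr
  have h3 : ι * (51 * P) ^ 6 ≤ 1 / 100 * δ :=
    calc _ ≤ ι * (52 * a) ^ 6 := by gcongr
      _ = ι * a * (52 ^ 6 * a ^ 5) := by ring
      _ ≤ δ * (52 ^ 6 * (1 / 648) ^ 5) := by gcongr
      _ ≤ _ := by rw [mul_comm]; gcongr; norm_num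
  calc _ ≤ 51 / 19 * (1 + 1 / 600) * (α ^ 6 * a * δ * (1 / 5) +
        3 * (α ^ 6 * a) * (52 * δ + 1 / 100 * δ)) := by
        gcongr
        linarith
    _ = 51 / 19 * (1 + 1 / 600) * (1 / 5 + 3 * (52 + 1 / 100)) * (α ^ 6 * a * δ) := by ring
    _ ≤ _ := by gcongr; norm_num

/-- The contribution of non-flat configurations. The number `c` of edges outside `T` and the
constant number of endpoints are absorbed by `s * δ`. -/
lemma nonflat_numeric (ha0 : 0 ≤ a) (ha : a ≤ 1 / 648) (hα0 : 0 ≤ α) (hαδ : α * a ≤ δ)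
    {X ι c t A : ℝ} (hX0 : 0 ≤ X) (hX : X ≤ 206 / 100 * a) (hι0 : 0 ≤ ι) (hι : ι * a ≤ δ)
    (hc : 324 * c ≤ s * δ) (hs : 324 ≤ s * δ) (ht0 : 0 ≤ t) (hts : t ≤ s)
    (hA : 0 ≤ A) :
    2 / 19 * (s * (α ^ 7 * (51 * X) ^ 2) + 4 * c * (α ^ 6 * (51 * X)) +
      4 * t * (ι * (α ^ 6 * (51 * X) ^ 6)) + t * (A * (α ^ 6 * (102 * X) ^ 6)) +
      16 * (α ^ 6 * (51 * X))) ≤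
    1200 * (s * δ * (α ^ 6 * a)) + 10 ^ 13 * (t * A * (α ^ 6 * a) * a ^ 5) := by
  have hδ : 0 ≤ δ := (mul_nonneg hα0 ha0).trans hαδ
  have hs0 : 0 ≤ s := ht0.trans hts
  have hX1 : 51 * X ≤ 106 * a := by linarith
  have hX2 : 102 * X ≤ 212 * a := by linarith
  have h1 : s * (α ^ 7 * (51 * X) ^ 2) ≤ 11236 * (s * δ * (α ^ 6 * a)) :=
    calc _ ≤ s * (α ^ 7 * (106 * a) ^ 2) := by gcongr
      _ = 11236 * (s * (α * a) * (α ^ 6 * a)) := by ring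
      _ ≤ _ := by gcongr
  have h2 : α ^ 6 * (51 * X) ≤ 106 * (α ^ 6 * a) :=
    calc _ ≤ α ^ 6 * (106 * a) := by gcongr
      _ = _ := by ring
  have h2' : 0 ≤ α ^ 6 * (51 * X) := by positivity
  have h3 : 4 * c * (α ^ 6 * (51 * X)) + 16 * (α ^ 6 * (51 * X)) ≤ 7 * (s * δ * (α ^ 6 * a)) :=
    calc _ = (4 * c + 16) * (α ^ 6 * (51 * X)) := by ring
      _ ≤ (20 / 324 * (s * δ)) * (α ^ 6 * (51 * X)) := by gcongr; linarith
      _ ≤ (20 / 324 * (s * δ)) * (106 * (α ^ 6 * a)) := by gcongr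
      _ = 20 / 324 * 106 * (s * δ * (α ^ 6 * a)) := by ring
      _ ≤ _ := by gcongr; norm_num
  have h4 : 4 * t * (ι * (α ^ 6 * (51 * X) ^ 6)) ≤ 33 * (s * δ * (α ^ 6 * a)) :=
    calc _ ≤ 4 * s * (ι * (α ^ 6 * (106 * a) ^ 6)) := by gcongr
      _ = 4 * 106 ^ 6 * a ^ 4 * (s * (ι * a) * (α ^ 6 * a)) := by ring
      _ ≤ 4 * 106 ^ 6 * (1 / 648) ^ 4 * (s * δ * (α ^ 6 * a)) := by gcongr
      _ ≤ _ := by gcongr; norm_num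
  have h5 : t * (A * (α ^ 6 * (102 * X) ^ 6)) ≤ 212 ^ 6 * (t * A * (α ^ 6 * a) * a ^ 5) :=
    calc _ ≤ t * (A * (α ^ 6 * (212 * a) ^ 6)) := by gcongr
      _ = _ := by ring
  have h6 : 0 ≤ t * A * (α ^ 6 * a) * a ^ 5 := by positivity
  have h7 : 0 ≤ s * δ * (α ^ 6 * a) := by positivity
  linarith

/-- The total weight of the non-zero pairs is about `2 * a`. -/
lemma square_numeric (ha0 : 0 ≤ a) (ha : a ≤ 1 / 648) {u : ℝ} (hu0 : 0 ≤ u) (hu : u ≤ a / 100) :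
    0 ≤ (1 + a + u) * (1 + a + u) - 1 ∧ (1 + a + u) * (1 + a + u) - 1 ≤ 2022 / 1000 * a := by
  constructor
  · nlinarith
  · have h1 : a + u ≤ 101 / 100 * a := by linarith
    nlinarith [mul_le_mul h1 h1 (by linarith) (by linarith : 0 ≤ 101 / 100 * a)]

lemma flatBound_numeric (ha0 : 0 ≤ a) (ha : a ≤ 1 / 648) (hs : 324 ≤ s * δ) {u μ A t : ℝ}
    (hu0 : 0 ≤ u) (hu : u ≤ a / 100) (huα : u ≤ 41 / 10 * α ^ 6) (hμ1 : 1 ≤ μ)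
    (hμ : μ ≤ 1004 / 1000) (hA : 0 ≤ A) (ht : 0 ≤ t) :
    flatBound a u μ A t ≤
      120 * (s * δ * (α ^ 6 * a)) + 37 * 10 ^ 14 * (t * A * (α ^ 6 * a) * a ^ 5) := by
  obtain ⟨hz0, hz⟩ := square_numeric ha0 ha hu0 hu
  rw [flatBound]
  set y := (1 + a + u) * (1 + a + u) - 1
  have hy : 102 * (μ * y) ≤ 208 * a :=
    calc 102 * (μ * y) ≤ 102 * (1004 / 1000 * (2022 / 1000 * a)) := by gcongr
      _ ≤ _ := by linarith
  have h1 : u * (2 + 2 * a + u) * μ * 51 / 19 ≤ 223 / 10 * α ^ 6 :=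
    calc _ ≤ 41 / 10 * α ^ 6 * (2 + 1 / 100) * (1004 / 1000) * 51 / 19 := by
          have : 2 + 2 * a + u ≤ 2 + 1 / 100 := by linarith
          gcongr
      _ = 41 / 10 * (2 + 1 / 100) * (1004 / 1000) * 51 / 19 * α ^ 6 := by ring
      _ ≤ _ := mul_le_mul_of_nonneg_right (by norm_num) (by positivity)
  have h7 : 0 ≤ t * A * (α ^ 6 * a) * a ^ 5 := by positivity
  calc _ ≤ 223 / 10 * α ^ 6 * (8 * (208 * a) + 2 * A * t * (208 * a) ^ 6) := by gcongr
    _ = 223 / 10 * 8 * 208 * (1 * (α ^ 6 * a)) +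
        223 / 10 * 2 * 208 ^ 6 * (t * A * (α ^ 6 * a) * a ^ 5) := by ring
    _ ≤ 223 / 10 * 8 * 208 * (s * δ / 324 * (α ^ 6 * a)) +
        223 / 10 * 2 * 208 ^ 6 * (t * A * (α ^ 6 * a) * a ^ 5) := by gcongr; linarith
    _ = 223 / 10 * 8 * 208 / 324 * (s * δ * (α ^ 6 * a)) +
        223 / 10 * 2 * 208 ^ 6 * (t * A * (α ^ 6 * a) * a ^ 5) := by ring
    _ ≤ _ := by
        have : 0 ≤ s * δ * (α ^ 6 * a) := by
          have : 0 ≤ s * δ := by linarith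
          positivity
        linarith

lemma flatBound_zero_numeric (ha0 : 0 ≤ a) (ha : a ≤ 1 / 648) (hs : 324 ≤ s * δ)
    {x t : ℝ} (hx0 : 0 ≤ x) (hx : x ≤ a / 100) (hxα : x ≤ 17 * α ^ 6) :
    flatBound a x 1 0 t ≤ 480 * (s * δ * (α ^ 6 * a)) := by
  obtain ⟨hz0, hz⟩ := square_numeric ha0 ha hx0 hx
  rw [flatBound, mul_zero, zero_mul, zero_mul, add_zero, one_mul, mul_one]
  set y := (1 + a + x) * (1 + a + x) - 1
  calc _ ≤ 17 * α ^ 6 * (2 + 1 / 100) * 51 / 19 * (8 * (102 * (2022 / 1000 * a))) := by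
        have : 2 + 2 * a + x ≤ 2 + 1 / 100 := by linarith
        gcongr
    _ = 17 * (2 + 1 / 100) * 51 / 19 * (8 * (102 * (2022 / 1000))) * (1 * (α ^ 6 * a)) := by ring
    _ ≤ 17 * (2 + 1 / 100) * 51 / 19 * (8 * (102 * (2022 / 1000))) *
          (s * δ / 324 * (α ^ 6 * a)) := by gcongr; linarith
    _ = 17 * (2 + 1 / 100) * 51 / 19 * (8 * (102 * (2022 / 1000))) / 324 *
          (s * δ * (α ^ 6 * a)) := by ring
    _ ≤ _ := by
        have : 0 ≤ s * δ * (α ^ 6 * a) := by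
          have : 0 ≤ s * δ := by linarith
          positivity
        linarith

/-- The deviation of the mean phases. The factor `r`, the sixth root of `a`, that is needed to bound
`q` is taken from the weight `(51 * a) ^ 6` of a cluster of seven edges. -/
lemma mean_numeric {r : ℝ} (hr0 : 0 ≤ r) (hr : r ^ 6 = a) (ha : a ≤ 1 / 648) (hα0 : 0 ≤ α)
    (hαδ : α * a ≤ δ)
    {q c t ι : ℝ} (hq0 : 0 ≤ q) (hq : q * r ≤ 4 * α ^ 6) (hι0 : 0 ≤ ι) (hι : ι * a ≤ δ)
    (hc : 324 * c ≤ s * δ) (ht0 : 0 ≤ t) (hts : t ≤ s) :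
    c * (2 * (α ^ 6 * a) + 4 * (q * (1 + a)) * (51 * (51 * a) ^ 6 / 19)) +
      t * (ι * ((4 * (q * (1 + a)) + 2 * (α ^ 6 * a) * a) * (51 * (51 * a) ^ 6 / 19))) ≤
    15 * (s * δ * (α ^ 6 * a)) := by
  have ha0 : 0 ≤ a := by rw [← hr]; positivity
  have hδ : 0 ≤ δ := (mul_nonneg hα0 ha0).trans hαδ
  have hs0 : 0 ≤ s := ht0.trans hts
  have hr1 : r ≤ 34 / 100 := by
    refine le_of_pow_le_pow_left₀ (n := 6) (by norm_num) (by norm_num) ?_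
    rw [hr]; exact ha.trans (by norm_num)
  have hm : 4 * (q * (1 + a)) * (51 * (51 * a) ^ 6 / 19) ≤ 13 * (α ^ 6 * a * a) :=
    calc _ = 4 * (1 + a) * (51 ^ 7 / 19) * (q * r) * (a * a ^ 4 * r ^ 5) := by
          rw [← hr]; ring
      _ ≤ 4 * (1 + 1 / 648) * (51 ^ 7 / 19) * (4 * α ^ 6) * (a * (a * (1 / 648) ^ 3) *
            (34 / 100) ^ 5) := by
          gcongr
          rw [pow_succ' a 3]
          gcongr
      _ = 4 * (1 + 1 / 648) * (51 ^ 7 / 19) * 4 * ((1 / 648) ^ 3 * (34 / 100) ^ 5) *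
            (α ^ 6 * a * a) := by ring
      _ ≤ _ := by gcongr; norm_num
  have hE : 2 * (α ^ 6 * a) * a * (51 * (51 * a) ^ 6 / 19) ≤ 1 * (α ^ 6 * a * a) :=
    calc _ = 2 * (51 ^ 7 / 19) * a ^ 6 * (α ^ 6 * a * a) := by ring
      _ ≤ 2 * (51 ^ 7 / 19) * (1 / 648) ^ 6 * (α ^ 6 * a * a) := by gcongr
      _ ≤ _ := by gcongr; norm_num
  have hεa : α ^ 6 * a * a ≤ α ^ 6 * a * (1 / 648) := by gcongr
  have h1 : c * (2 * (α ^ 6 * a) + 4 * (q * (1 + a)) * (51 * (51 * a) ^ 6 / 19)) ≤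
      1 / 100 * (s * δ * (α ^ 6 * a)) :=
    calc _ ≤ s * δ / 324 * (3 * (α ^ 6 * a)) := by
          have h0 : 0 ≤ α ^ 6 * a := by positivity
          refine mul_le_mul (by linarith) (by linarith) (by positivity) (by positivity)
      _ = 3 / 324 * (s * δ * (α ^ 6 * a)) := by ring
      _ ≤ _ := mul_le_mul_of_nonneg_right (by norm_num) (by positivity)
  have h2 : t * (ι * ((4 * (q * (1 + a)) + 2 * (α ^ 6 * a) * a) * (51 * (51 * a) ^ 6 / 19))) ≤
      14 * (s * δ * (α ^ 6 * a)) :=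
    calc _ ≤ s * (ι * (14 * (α ^ 6 * a * a))) := by
          have h3 : (4 * (q * (1 + a)) + 2 * (α ^ 6 * a) * a) * (51 * (51 * a) ^ 6 / 19) ≤
              14 * (α ^ 6 * a * a) := by rw [add_mul]; linarith
          exact mul_le_mul hts (mul_le_mul_of_nonneg_left h3 hι0) (by positivity) hs0
      _ = 14 * (s * (ι * a) * (α ^ 6 * a)) := by ring
      _ ≤ _ := by gcongr
  have h7 : 0 ≤ s * δ * (α ^ 6 * a) := by positivity
  linarith

/-- The term with the difference `A` of the mean phases. With `Q ^ 2 = M * (α ^ 6 * a)`, one factor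
`Q` is kept and the other is bounded by `M ≤ 2`, which leaves powers of `α * r ≤ δ`. -/
lemma gain_numeric {r : ℝ} (hr0 : 0 ≤ r) (hr : r ^ 6 = a) (ha : a ≤ 1 / 648) (hα0 : 0 ≤ α)
    (hαδ : α * r ≤ δ) (hαr : α ≤ r ^ 5) {A M t : ℝ} (hts : t ≤ s) (ht0 : 0 ≤ t)
    (hM0 : 0 ≤ M) (hM : M ≤ 2) (hA0 : 0 ≤ A) (hA : A ≤ 1004 / 1000 * M) :
    371 * 10 ^ 13 * (t * A * (α ^ 6 * a) * a ^ 5) ≤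
      3 * 10 ^ 6 * (s * δ * (a ^ 3 * √(M * (α ^ 6 * a)))) := by
  have ha0 : 0 ≤ a := by rw [← hr]; positivity
  have hδ : 0 ≤ δ := (mul_nonneg hα0 hr0).trans hαδ
  have hs0 : 0 ≤ s := ht0.trans hts
  set Q := √(M * (α ^ 6 * a)) with hQ
  have hQ0 : 0 ≤ Q := Real.sqrt_nonneg _
  have hQ2 : Q * Q = M * (α ^ 6 * a) := Real.mul_self_sqrt (by positivity)
  have hQ1 : Q ≤ 3 / 2 * (α ^ 3 * r ^ 3) := by
    rw [hQ, Real.sqrt_le_left (by positivity), ← hr]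
    have h0 : 0 ≤ α ^ 6 * r ^ 6 := by positivity
    calc _ ≤ 2 * (α ^ 6 * r ^ 6) := by gcongr
      _ ≤ 9 / 4 * (α ^ 6 * r ^ 6) := by linarith
      _ = _ := by ring
  calc 371 * 10 ^ 13 * (t * A * (α ^ 6 * a) * a ^ 5)
      ≤ 371 * 10 ^ 13 * (s * (1004 / 1000 * M) * (α ^ 6 * a) * a ^ 5) := by gcongr
    _ = 371 * 10 ^ 13 * (1004 / 1000) * (s * (a ^ 3 * Q)) * (a ^ 2 * Q) := by
        rw [show s * (1004 / 1000 * M) * (α ^ 6 * a) * a ^ 5 =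
          s * (1004 / 1000) * (M * (α ^ 6 * a)) * a ^ 5 by ring, ← hQ2]; ring
    _ ≤ 371 * 10 ^ 13 * (1004 / 1000) * (s * (a ^ 3 * Q)) *
          (a ^ 2 * (3 / 2 * (α ^ 3 * r ^ 3))) := by gcongr
    _ = 371 * 10 ^ 13 * (1004 / 1000) * (3 / 2) * (s * (a ^ 3 * Q)) *
          ((α * r) * (α * α * r ^ 14)) := by rw [← hr]; ring
    _ ≤ 371 * 10 ^ 13 * (1004 / 1000) * (3 / 2) * (s * (a ^ 3 * Q)) *
          (δ * (r ^ 5 * r ^ 5 * r ^ 14)) := by gcongr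
    _ = 371 * 10 ^ 13 * (1004 / 1000) * (3 / 2) * a ^ 4 * (s * δ * (a ^ 3 * Q)) := by
        rw [← hr]; ring
    _ ≤ 371 * 10 ^ 13 * (1004 / 1000) * (3 / 2) * (1 / 648) ^ 4 * (s * δ * (a ^ 3 * Q)) := by gcongr
    _ ≤ _ := mul_le_mul_of_nonneg_right (by norm_num) (by positivity)

end Numeric

section Budget

variable {n : ℕ} [NeZero n] {w : Weights n} {T : Finset Edge} {ρ : AddChar (ZMod n) Circle}

lemma sum_mean_pair_le : ∑ h ∈ univ.erase 0, w.k h *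
    (‖w.mean ρ h - 1‖ + ‖w.mean ρ (-h) - 1‖) ≤ 4 * (w.q * (1 + w.a)) := by
  have e : ∑ h ∈ univ.erase 0, w.k h * ‖w.mean ρ (-h) - 1‖ =
      ∑ h ∈ univ.erase 0, w.k h * ‖w.mean ρ h - 1‖ := by
    refine Finset.sum_equiv (Equiv.neg _) (fun h => ?_) fun h _ => ?_
    · simp
    · rw [Equiv.neg_apply, w.k_neg]
  simp only [mul_add, sum_add_distrib]
  rw [e]
  have := w.sum_mean_sub_one_le ρ
  linarith

/-- The total weight of the marks is at most of the order of the fluctuations. -/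
lemma sum_meanMark_le {H : ZMod n → Prop} {μ ε : ℝ} (hθ : w.mean ρ 0 ≠ 0)
    (hμ : μ = ‖w.mean ρ 0‖⁻¹) (hθε : ‖w.mean ρ 0 - 1‖ ≤ 2 * ε) :
    ∑ h ∈ univ.erase 0, w.k h * meanMark w H ρ h ≤
      μ * (4 * (w.q * (1 + w.a)) + 4 * ε * w.a) := by
  have hθ0 : 0 < ‖w.mean ρ 0‖ := norm_pos_iff.2 hθ
  have hμ0 : 0 ≤ μ := by rw [hμ]; positivity
  have h1 : ∀ h, ‖w.mean ρ h / w.mean ρ 0 - 1‖ ≤ μ * (‖w.mean ρ h - 1‖ + 2 * ε) := by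
    intro h
    have e : w.mean ρ h / w.mean ρ 0 - 1 = ((w.mean ρ h - 1) - (w.mean ρ 0 - 1)) / w.mean ρ 0 := by
      field_simp; ring
    rw [e, norm_div, hμ, div_eq_inv_mul]
    exact mul_le_mul_of_nonneg_left ((norm_sub_le _ _).trans (by linarith)) (by positivity)
  calc _ ≤ ∑ h ∈ univ.erase 0, μ * (w.k h * (‖w.mean ρ h - 1‖ + ‖w.mean ρ (-h) - 1‖) +
        w.k h * (4 * ε)) := by
        refine sum_le_sum fun h _ => ?_
        have h2 : meanMark w H ρ h ≤
            μ * (‖w.mean ρ h - 1‖ + ‖w.mean ρ (-h) - 1‖ + 4 * ε) := by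
          unfold meanMark
          split_ifs
          · have := h1 h; have := h1 (-h); linarith
          · have : 0 ≤ 2 * ε := (norm_nonneg _).trans hθε
            have h3 := norm_nonneg (w.mean ρ h - 1)
            have h4 := norm_nonneg (w.mean ρ (-h) - 1)
            exact mul_nonneg hμ0 (by linarith)
        calc _ ≤ w.k h * (μ * (‖w.mean ρ h - 1‖ + ‖w.mean ρ (-h) - 1‖ + 4 * ε)) :=
              mul_le_mul_of_nonneg_left h2 (w.k_nonneg h)
          _ = _ := by ring
    _ = μ * (∑ h ∈ univ.erase 0, w.k h * (‖w.mean ρ h - 1‖ + ‖w.mean ρ (-h) - 1‖) +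
          w.a * (4 * ε)) := by
        rw [← mul_sum, sum_add_distrib, ← sum_mul]; rfl
    _ ≤ _ := by
        refine mul_le_mul_of_nonneg_left ?_ hμ0
        have := sum_mean_pair_le (w := w) (ρ := ρ)
        linarith

open Classical in
set_option maxHeartbeats 800000 in
/-- The sum of all error terms in a finite volume. If `a ≤ δ`, only the edges fluctuating around
the value zero are pinned, and otherwise all of them. -/
theorem norm_avg_sub_mul_le_numeric {γ : Edge →₀ ℤ} (hγ : IsPath γ)
    (hc : ∀ e ∈ γ.support, γ e = 1 ∨ γ e = -1) (hTS : T ⊆ γ.support) (hT : Separated T)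
    {W : Finset Edge} (hSW : γ.support ⊆ W) {α r δ M : ℝ} (hα : ∀ g ≠ 0, w.b g ≤ α) (hα0 : 0 ≤ α)
    (hα1 : α ≤ 1) (hmean : ∀ h, ‖w.mean ρ h‖ ≤ 1) (ha : w.a ≤ 1 / 648) (hr0 : 0 ≤ r)
    (hr : r ^ 6 = w.a) (hαδ : α * r ≤ δ) (hq : w.q * r ≤ 4 * α ^ 6)
    (hcase : w.a ≤ δ ∨ (α ≤ r ^ 5 ∧ w.q ≤ 4 * α ^ 6)) (hM : M ≤ 2)
    (hMθ : ∀ h, ‖w.mean ρ h - w.mean ρ 0‖ ≤ M) (hcs : 324 * (γ.support \ T).card ≤ γ.support.card * δ)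
    (hs : 324 ≤ γ.support.card * δ) :
    ‖avg (wt w.k w.b W (stars W)) W (phase ρ γ.support γ) -
      avg (wt w.k delta W (stars W)) W (fun σ => ∏ e ∈ γ.support, w.mean ρ (γ e • σ e)) *
        avg (wt w.k delta W (stars W)) W (phase ρ γ.support γ)‖ ≤
      2700 * (γ.support.card * δ * (α ^ 6 * w.a)) +
        3 * 10 ^ 6 * (γ.support.card * δ * (w.a ^ 3 * √(M * (α ^ 6 * w.a)))) := by
  have ha0 := w.a_nonneg
  have hq0 := w.q_nonneg
  have hM0 : 0 ≤ M := (norm_nonneg _).trans (hMθ 0)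
  have hδ : 0 ≤ δ := (mul_nonneg hα0 hr0).trans hαδ
  have hr1 : r ≤ 34 / 100 := by
    refine le_of_pow_le_pow_left₀ (n := 6) (by norm_num) (by norm_num) ?_
    rw [hr]; exact ha.trans (by norm_num)
  have har : w.a ≤ r := by
    rw [← hr]; exact pow_le_of_le_one hr0 (by linarith) (by norm_num)
  have hαa : α * w.a ≤ δ := (mul_le_mul_of_nonneg_left har hα0).trans hαδ
  set ε := α ^ 6 * w.a with hε
  have hε0 : 0 ≤ ε := by positivity
  have hα6 : α ^ 6 ≤ 1 := pow_le_one₀ hα0 hα1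
  have hεa : ε ≤ w.a := by
    calc ε ≤ 1 * w.a := mul_le_mul_of_nonneg_right hα6 ha0
      _ = w.a := one_mul _
  have hθε : ‖w.mean ρ 0 - 1‖ ≤ 2 * ε := w.norm_mean_zero_sub_one_le ρ hα
  have hθn : 323 / 324 ≤ ‖w.mean ρ 0‖ := by
    have h1 : ‖(1 : ℂ)‖ ≤ ‖w.mean ρ 0‖ + ‖1 - w.mean ρ 0‖ := by
      calc ‖(1 : ℂ)‖ = ‖w.mean ρ 0 + (1 - w.mean ρ 0)‖ := by congr 1; ring
        _ ≤ _ := norm_add_le _ _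
    rw [norm_one, norm_sub_rev] at h1
    linarith
  have hθ : w.mean ρ 0 ≠ 0 := norm_pos_iff.1 (by linarith)
  obtain ⟨μ, hμ⟩ : ∃ μ, μ = ‖w.mean ρ 0‖⁻¹ := ⟨_, rfl⟩
  have hμ1 : 1 ≤ μ := by rw [hμ]; exact (one_le_inv₀ (by linarith)).2 (hmean 0)
  have hμ2 : μ ≤ 1004 / 1000 := by
    rw [hμ]
    calc _ ≤ (323 / 324 : ℝ)⁻¹ := inv_anti₀ (by norm_num) hθn
      _ ≤ _ := by norm_num
  set A := 1004 / 1000 * M with hA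
  have hA0 : 0 ≤ A := by positivity
  have hAθ : ∀ h, ‖w.mean ρ h / w.mean ρ 0 - 1‖ ≤ A := by
    intro h
    have e : w.mean ρ h / w.mean ρ 0 - 1 = (w.mean ρ h - w.mean ρ 0) / w.mean ρ 0 := by
      field_simp
    rw [e, norm_div, div_eq_inv_mul, ← hμ]
    exact mul_le_mul hμ2 (hMθ h) (norm_nonneg _) (by norm_num)
  set s : ℝ := (γ.support.card : ℝ) with hs'
  set t : ℝ := (T.card : ℝ) with ht'
  have ht0 : 0 ≤ t := Nat.cast_nonneg _
  have hts : t ≤ s := Nat.cast_le.2 (Finset.card_le_card hTS)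
  have hs0 : 0 ≤ s := ht0.trans hts
  have hsδ : 0 ≤ s * δ := by positivity
  -- all error terms except for the one comparing the gains
  have main : ∀ (H : ZMod n → Prop) (u x : ℝ), H 0 →
      ∑ h ∈ univ.erase 0, w.k h * excess w H h = u →
      ∑ h ∈ univ.erase 0, w.k h * meanMark w H ρ h = x →
      (if ∀ h, H h then (0 : ℝ) else 1) * w.a ≤ δ → u ≤ w.a / 100 → x ≤ w.a / 100 →
      x ≤ 17 * α ^ 6 →
      ‖avg (wt w.k w.b W (stars W)) W (phase ρ γ.support γ) -
        avg (wt w.k delta W (stars W)) W (fun σ => ∏ e ∈ γ.support, w.mean ρ (γ e • σ e)) *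
          avg (wt w.k delta W (stars W)) W (phase ρ γ.support γ)‖ ≤
        flatBound w.a u μ A t + 2560 * (s * δ * ε) + 10 ^ 13 * (t * A * ε * w.a ^ 5) := by
    intro H u x H0 hu hx hι hua hxa hxα
    have hu0 : 0 ≤ u := by
      rw [← hu]
      exact sum_nonneg fun h _ => mul_nonneg (w.k_nonneg h) (excess_nonneg w H h)
    have hx0 : 0 ≤ x := by
      rw [← hx]
      exact sum_nonneg fun h _ => mul_nonneg (w.k_nonneg h) (meanMark_nonneg h)
    obtain ⟨hzu0, hzu⟩ := square_numeric ha0 ha hu0 hua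
    obtain ⟨hzx0, hzx⟩ := square_numeric ha0 ha hx0 hxa
    have hP : edgeSum w H = w.a + u := by rw [edgeSum_eq, hu]
    have hP0 := edgeSum_nonneg w H
    have hX : pairSum w H μ ≤ 206 / 100 * w.a := by
      rw [pairSum, hP]
      have h2 : (1 + (w.a + u)) * (1 + w.a) - 1 ≤ 2022 / 1000 * w.a := by nlinarith
      calc _ ≤ 2022 / 1000 * w.a * (1004 / 1000) := mul_le_mul h2 hμ2 (by linarith) (by positivity)
        _ ≤ _ := by linarith
    have hX0 : 0 ≤ pairSum w H μ := pairSum_nonneg (by linarith)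
    have h1 := norm_avg_sub_mul_le (T := T) (H := H) hγ hc hTS hT hSW H0 hα hα0 hα1 hmean hθ hμ hAθ
      hu hx (by linarith) (by
        calc _ ≤ 102 * (1004 / 1000 * (2022 / 1000 * w.a)) := by gcongr
          _ ≤ _ := by linarith) (by linarith) hε0 hθε sum_mean_pair_le (by linarith)
    have hι0 : 0 ≤ (if ∀ h, H h then (0 : ℝ) else 1) := by split_ifs <;> norm_num
    have h2 := defect_numeric ha0 ha hα0 hα1 hαa hP0 (by linarith : edgeSum w H ≤ 101 / 100 * w.a)
      hι0 hι
    have h3 := nonflat_numeric (s := s) (t := t) (c := ((γ.support \ T).card : ℝ)) ha0 ha hα0 hαa hX0 hX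
      hι0 hι hcs hs ht0 hts hA0
    have h4 := flatBound_zero_numeric (t := t) (α := α) ha0 ha hs hx0 hxa hxα
    have h5 := mean_numeric (t := t) (c := ((γ.support \ T).card : ℝ)) hr0 hr ha hα0 hαa hq0 hq hι0
      hι hcs ht0 hts
    have h6 : 2 * t * defectBound w H α ≤ 860 * (s * δ * ε) :=
      calc _ ≤ 2 * t * (430 * (α ^ 6 * w.a * δ)) :=
            mul_le_mul_of_nonneg_left h2 (mul_nonneg zero_le_two ht0)
        _ ≤ 2 * s * (430 * (α ^ 6 * w.a * δ)) :=
            mul_le_mul_of_nonneg_right (mul_le_mul_of_nonneg_left hts zero_le_two)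
              (mul_nonneg (by norm_num) (mul_nonneg hε0 hδ))
        _ = _ := by rw [hε]; ring
    have h7 : 0 ≤ s * δ * ε := mul_nonneg hsδ hε0
    calc _ ≤ 860 * (s * δ * ε) + (flatBound w.a u μ A t + (1200 * (s * δ * ε) +
          10 ^ 13 * (t * A * ε * w.a ^ 5))) + 480 * (s * δ * ε) + 15 * (s * δ * ε) :=
          h1.trans (add_le_add (add_le_add (add_le_add h6 (add_le_add le_rfl h3)) h4) h5)
      _ ≤ _ := by linarith only [h7]
  rcases hcase with h | ⟨hαr, hqα⟩
  -- If `a ≤ δ`, zero is the only admissible value: no gains and no marks occur.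
  · have h1 := main (fun h => h = 0) 0 0 rfl
      (Finset.sum_eq_zero fun h _ => by rw [excess, if_neg fun h' => h'.2 h'.1, mul_zero])
      (Finset.sum_eq_zero fun h _ => by rw [meanMark, if_neg fun h' => h'.1 h'.2, mul_zero])
      (by split_ifs <;> linarith) (by positivity) (by positivity) (by positivity)
    have h2 : flatBound w.a 0 μ A t = 0 := by rw [flatBound]; ring
    have h3 : 10 ^ 13 * (t * A * ε * w.a ^ 5) ≤ 120 * (s * δ * ε) :=
      calc _ = 10 ^ 13 * A * w.a ^ 4 * (t * w.a * ε) := by ring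
        _ ≤ 10 ^ 13 * (1004 / 1000 * 2) * (1 / 648) ^ 4 * (s * δ * ε) := by rw [hA]; gcongr
        _ ≤ _ := mul_le_mul_of_nonneg_right (by norm_num) (by positivity)
    have h4 : 0 ≤ s * δ * (w.a ^ 3 * √(M * ε)) := by positivity
    have h7 : 0 ≤ s * δ * ε := mul_nonneg hsδ hε0
    calc _ ≤ 0 + 2560 * (s * δ * ε) + 120 * (s * δ * ε) :=
          h1.trans (add_le_add (add_le_add h2.le le_rfl) h3)
      _ ≤ _ := by linarith only [h4, h7]
  -- Otherwise all values are admissible, and the sums of gains and marks are of order `α ^ 6`,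
  -- which is far below `a` because `α ≤ r ^ 5`.
  · have hα30 : α ^ 6 ≤ w.a ^ 4 * w.a := by
      calc α ^ 6 ≤ (r ^ 5) ^ 6 := by gcongr
        _ = _ := by rw [← hr]; ring
    have ha4 : w.a ^ 4 * w.a ≤ (1 / 648) ^ 4 * w.a := by gcongr
    have hαa6 : α ^ 6 ≤ w.a / 100000 := (hα30.trans ha4).trans (by linarith)
    have hα60 : 0 ≤ α ^ 6 := by positivity
    have hqa : w.q * w.a ≤ 4 * α ^ 6 * (1 / 648) := by gcongr
    have hεa1 : ε ≤ α ^ 6 * (1 / 648) := by rw [hε]; gcongr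
    have hεa2 : ε * w.a ≤ α ^ 6 * (1 / 648) := by
      have : ε * w.a ≤ ε * 1 := by gcongr; linarith
      linarith
    obtain ⟨u, hu⟩ : ∃ u, ∑ h ∈ univ.erase 0, w.k h * excess w (fun _ => True) h = u :=
      ⟨_, rfl⟩
    obtain ⟨x, hx⟩ : ∃ x, ∑ h ∈ univ.erase 0, w.k h * meanMark w (fun _ => True) ρ h = x :=
      ⟨_, rfl⟩
    have hu0 : 0 ≤ u := by
      rw [← hu]
      exact sum_nonneg fun h _ => mul_nonneg (w.k_nonneg h) (excess_nonneg w _ h)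
    have huα : u ≤ 41 / 10 * α ^ 6 := by
      have h1 := w.sum_gain_sub_one_le hα
      have h2 : ∑ h ∈ univ.erase 0, w.k h * excess w (fun _ => True) h =
          ∑ h ∈ univ.erase 0, w.k h * |w.gain h / w.gain 0 - 1| :=
        sum_congr rfl fun h hh => by
          rw [excess, if_pos ⟨trivial, (mem_erase.1 hh).1⟩]
      rw [← h2, hu] at h1
      linarith
    have hxα : x ≤ 17 * α ^ 6 := by
      have h1 := sum_meanMark_le (H := fun _ => True) hθ hμ hθε
      rw [hx] at h1
      have h2 : 4 * (w.q * (1 + w.a)) + 4 * ε * w.a ≤ 165 / 10 * α ^ 6 := by linarith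
      calc x ≤ 1004 / 1000 * (165 / 10 * α ^ 6) :=
            h1.trans (mul_le_mul hμ2 h2 (by positivity) (by norm_num))
        _ ≤ _ := by linarith
    have h1 := main (fun _ => True) u x trivial hu hx (by rw [if_pos fun _ => trivial]; linarith)
      (by linarith) (by linarith) hxα
    have h2 := flatBound_numeric (t := t) (α := α) ha0 ha hs hu0 (by linarith) huα hμ1 hμ2 hA0 ht0
    have h3 := gain_numeric (t := t) hr0 hr ha hα0 hαδ hαr hts ht0 hM0 hM hA0 hA.le
    have h7 : 0 ≤ s * δ * ε := mul_nonneg hsδ hε0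
    calc _ ≤ 120 * (s * δ * ε) + 37 * 10 ^ 14 * (t * A * ε * w.a ^ 5) + 2560 * (s * δ * ε) +
          10 ^ 13 * (t * A * ε * w.a ^ 5) := h1.trans (add_le_add (add_le_add h2 le_rfl) le_rfl)
      _ = 2680 * (s * δ * ε) + 371 * 10 ^ 13 * (t * A * ε * w.a ^ 5) := by ring
      _ ≤ 2700 * (s * δ * ε) + 3 * 10 ^ 6 * (s * δ * (w.a ^ 3 * √(M * ε))) :=
          add_le_add (by linarith only [h7]) h3

end Budget

/-! ### Infinite volume limits and interpolation -/

section Paths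

lemma IsPath.apply_eq {γ : Edge →₀ ℤ} (h : IsPath γ) {e : Edge} (he : e ∈ γ.support) :
    γ e = 1 ∨ γ e = -1 := by
  have h0 := Finsupp.mem_support_iff.1 he
  rcases h with ⟨h, -⟩ | ⟨_, _, h, -⟩ <;> rcases h e with h | h | h <;> simp_all

open Classical in
/-- The edges of `γ` that are not corner edges. -/
def straightEdges (γ : Edge →₀ ℤ) : Finset Edge := γ.support.filter fun e => ¬ IsCornerEdge γ e

lemma straightEdges_subset (γ : Edge →₀ ℤ) : straightEdges γ ⊆ γ.support := by
  classical exact Finset.filter_subset _ _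

lemma separated_straightEdges (γ : Edge →₀ ℤ) : Separated (straightEdges γ) := by
  intro e he e' he' hne hmem
  obtain ⟨-, p, h1, h2⟩ := mem_nbr.1 hmem
  classical
  refine (mem_filter.1 he).2 ⟨straightEdges_subset γ he, e', straightEdges_subset γ he', hne,
    p, ?_, ?_⟩ <;> rwa [support_plaquetteBoundary]

lemma suppCard_sub_cornerPart (γ : Edge →₀ ℤ) :
    suppCard (γ - cornerPart γ) = (straightEdges γ).card := by
  classical
  have e : γ - cornerPart γ = γ.filter fun e => ¬ IsCornerEdge γ e := by
    rw [sub_eq_iff_eq_add, cornerPart, add_comm]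
    exact (Finsupp.filter_add_filter_not γ _).symm
  rw [suppCard, e, Finsupp.support_filter, straightEdges]

lemma suppCard_cornerPart (γ : Edge →₀ ℤ) :
    suppCard (cornerPart γ) = (γ.support \ straightEdges γ).card := by
  classical
  rw [suppCard, cornerPart, Finsupp.support_filter]
  congr 2
  ext e
  simp only [straightEdges, mem_filter, mem_sdiff, not_and, not_not]
  exact ⟨fun h => ⟨h.1, fun _ => h.2⟩, fun h => ⟨h.1, h.2 h.1⟩⟩

end Paths

section Limits

variable {n : ℕ} [NeZero n] (ρ : AddChar (ZMod n) Circle)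

/-- By the lattice version of Stokes' theorem, a gauge transformation turns the Wilson line into the
phase of the gauge field along the path. -/
lemma wilsonLine_eq {γ : Edge →₀ ℤ} {N : ℕ} (hN : γ.support ⊆ boxEdges N) (σ τ : Edge → ZMod n)
    (φ : Vertex → ZMod n) (h : ∀ e ∈ boxEdges N, τ e = σ e + grad φ e) :
    wilsonLine ρ γ τ φ = phase ρ γ.support γ σ := by
  have e : evalChain τ γ - evalChain φ (boundary γ) = evalChain σ γ := by
    rw [evalChain_boundary, sub_eq_iff_eq_add]
    simp only [evalChain, Finsupp.sum]
    rw [← sum_add_distrib]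
    refine sum_congr rfl fun e he => ?_
    rw [h e (hN he), smul_add]
    rfl
  rw [wilsonLine, e, rho_evalChain, phase]

lemma thetaProd_eq {γ : Edge →₀ ℤ} {N : ℕ} (hN : γ.support ⊆ boxEdges N) (β κ : ℝ)
    (σ τ : Edge → ZMod n) (φ : Vertex → ZMod n) (h : ∀ e ∈ boxEdges N, τ e = σ e + grad φ e) :
    thetaProd ρ β κ γ τ φ = ∏ e ∈ γ.support, theta ρ β κ (γ e • σ e) :=
  prod_congr rfl fun e he => by
    rw [h e (hN he)]
    change theta ρ β κ (γ e • (σ e + grad φ e - grad φ e)) = _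
    rw [add_sub_cancel_right]

variable {ρ} in
lemma hasInfiniteVolumeLimit_of {β κ : ℝ} {γ : Edge →₀ ℤ}
    {f : (Edge → ZMod n) → (Vertex → ZMod n) → ℂ} {F : (Edge → ZMod n) → ℂ} {L : ℂ}
    (hf : ∀ N, γ.support ⊆ boxEdges N → ∀ σ τ φ, (∀ e ∈ boxEdges N, τ e = σ e + grad φ e) →
      f τ φ = F σ)
    (hL : Filter.Tendsto (fun N => avg (wt (phi2 ρ κ) (phi2 ρ β) (boxEdges N) (boxPlaquettes N))
      (boxEdges N) F) Filter.atTop (𝓝 L)) : HasInfiniteVolumeLimit ρ β κ f L := by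
  refine hL.congr' ?_
  filter_upwards [eventually_subset_boxEdges γ.support] with N hN
  exact (expectation_eq_avg (Real.exp_pos _).ne' (fun σ τ φ h => weight_eq ρ N β κ h)
    (hf N hN)).symm

variable {ρ} in
lemma hasInfiniteVolumeLimitInfty_of {κ : ℝ} {γ : Edge →₀ ℤ}
    {f : (Edge → ZMod n) → (Vertex → ZMod n) → ℂ} {F : (Edge → ZMod n) → ℂ} {L : ℂ}
    (hf : ∀ N, γ.support ⊆ boxEdges N → ∀ σ τ φ, (∀ e ∈ boxEdges N, τ e = σ e + grad φ e) →
      f τ φ = F σ)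
    (hL : Filter.Tendsto (fun N => avg (wt (phi2 ρ κ) delta (boxEdges N) (boxPlaquettes N))
      (boxEdges N) F) Filter.atTop (𝓝 L)) : HasInfiniteVolumeLimitInfty ρ κ f L := by
  refine hL.congr' ?_
  filter_upwards [eventually_subset_boxEdges γ.support] with N hN
  exact (expectation_eq_avg (Real.exp_pos _).ne' (fun σ τ φ h => weightInfty_eq ρ N κ h)
    (hf N hN)).symm

lemma avg_const_mul (v : (Edge → ZMod n) → ℝ) (W : Finset Edge) (c : ℂ) (f : (Edge → ZMod n) → ℂ) :
    avg v W (fun σ => c * f σ) = c * avg v W f := by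
  simp only [avg, mul_left_comm _ c, ← mul_sum, mul_div_assoc]

/-- The infinite volume limits exist, with free and with zero boundary conditions. -/
theorem exists_limits {β : ℝ} (hβ : 0 ≤ β) (κ : ℝ) {μ : ℝ} (hμ : 1 ≤ μ)
    (hθ : theta ρ β κ 0 ≠ 0) (hμθ : ∀ h, ‖theta ρ β κ h / theta ρ β κ 0‖ ≤ μ)
    (hX : 51 * (((1 + alpha0 ρ κ) * (1 + alpha0 ρ κ) - 1) * μ) ≤ 1 / 2) (γ : Edge →₀ ℤ) :
    ∃ L Θ H : ℂ, HasInfiniteVolumeLimit ρ β κ (wilsonLine ρ γ) L ∧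
      HasInfiniteVolumeLimitInfty ρ κ (thetaProd ρ β κ γ) Θ ∧
      HasInfiniteVolumeLimitInfty ρ κ (wilsonLine ρ γ) H ∧
      Filter.Tendsto (fun N => avg (wt (phi2 ρ κ) (phi2 ρ β) (boxEdges N) (stars (boxEdges N)))
        (boxEdges N) (phase ρ γ.support γ)) Filter.atTop (𝓝 L) ∧
      Filter.Tendsto (fun N => avg (wt (phi2 ρ κ) delta (boxEdges N) (stars (boxEdges N)))
        (boxEdges N) fun σ => ∏ e ∈ γ.support, theta ρ β κ (γ e • σ e)) Filter.atTop (𝓝 Θ) ∧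
      Filter.Tendsto (fun N => avg (wt (phi2 ρ κ) delta (boxEdges N) (stars (boxEdges N)))
        (boxEdges N) (phase ρ γ.support γ)) Filter.atTop (𝓝 H) := by
  have ha := (higgs ρ hβ κ).a_nonneg
  rw [higgs_a] at ha
  have hX1 : 51 * (((1 + alpha0 ρ κ) * (1 + alpha0 ρ κ) - 1) * 1) ≤ 1 / 2 := by
    refine le_trans ?_ hX
    have : 0 ≤ (1 + alpha0 ρ κ) * (1 + alpha0 ρ κ) - 1 := by nlinarith
    gcongr
  have hk := fun g => (phi2_pos ρ κ g).le
  have hph0 : ∀ e : Edge, ((ρ (γ e • (0 : ZMod n)) : Circle) : ℂ) = 1 := fun e => by simp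
  have hph1 : ∀ (e : Edge) (g : ZMod n), ‖((ρ (γ e • g) : Circle) : ℂ)‖ ≤ 1 := fun e g => by
    rw [Circle.norm_coe]
  obtain ⟨L, hL1, hL2⟩ := exists_limit (phi2_zero ρ κ) hk (phi2_zero ρ β)
    (fun g => (phi2_pos ρ β g).le) (phi2_le_one ρ hβ) rfl le_rfl hX1 γ.support hph0 hph1
  obtain ⟨H, hH1, hH2⟩ := exists_limit (phi2_zero ρ κ) hk delta_zero delta_nonneg delta_le_one
    rfl le_rfl hX1 γ.support hph0 hph1
  -- the factors are divided by `theta 0`, so that the observable is one on the zero configuration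
  obtain ⟨Θ, hΘ1, hΘ2⟩ := exists_limit (phi2_zero ρ κ) hk delta_zero delta_nonneg delta_le_one
    rfl hμ hX γ.support (y := fun e g => theta ρ β κ (γ e • g) / theta ρ β κ 0)
    (fun e => by rw [smul_zero, div_self hθ]) fun e g => hμθ _
  have e : (fun σ : Edge → ZMod n => ∏ e ∈ γ.support, theta ρ β κ (γ e • σ e)) = fun σ =>
      theta ρ β κ 0 ^ γ.support.card *
        siteProd γ.support (fun e g => theta ρ β κ (γ e • g) / theta ρ β κ 0) σ := by
    funext σ
    rw [siteProd, ← prod_const, ← prod_mul_distrib]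
    exact prod_congr rfl fun e _ => by field_simp
  refine ⟨L, theta ρ β κ 0 ^ γ.support.card * Θ, H,
    hasInfiniteVolumeLimit_of (γ := γ) (fun N hN => wilsonLine_eq ρ hN) hL1,
    hasInfiniteVolumeLimitInfty_of (γ := γ) (fun N hN => thetaProd_eq ρ hN β κ) ?_,
    hasInfiniteVolumeLimitInfty_of (γ := γ) (fun N hN => wilsonLine_eq ρ hN) hH1, hL2, ?_, hH2⟩
  · rw [e]; simp only [avg_const_mul]
    exact hΘ1.const_mul _
  · rw [e]; simp only [avg_const_mul]
    exact hΘ2.const_mul _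

/-- The bound that comes from the conditional independence of the edges that are not corner
edges. -/
lemma norm_avg_phase_le {w : Weights n} {T W S : Finset Edge} {δ : ℝ} (hδ : PhaseBound w ρ δ)
    (hTS : T ⊆ S) (hSW : S ⊆ W) (hT : Separated T) {c : Edge → ℤ}
    (hc : ∀ e ∈ T, c e = 1 ∨ c e = -1) :
    ‖avg (wt w.k w.b W (stars W)) W (phase ρ S c)‖ ≤ (1 - δ) ^ T.card := by
  have h := norm_sum_wt_le (W := W) hδ (hTS.trans hSW) hT hc (G := phase ρ (S \ T) c)
    (fun e he σ x => prod_congr rfl fun e' he' => by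
      rw [update_of_ne (by rintro rfl; exact (mem_sdiff.1 he').2 he)])
    (fun σ => (norm_phase ρ _ _ σ).le)
  have hZ : 0 < ∑ σ ∈ Conf (ZMod n) W, wt w.k w.b W (stars W) σ :=
    sum_weight_pos (wt_nonneg w.k_nonneg w.b_nonneg _ _) (separable_wt w.k_zero w.b_zero _ _).1 W
  rw [avg, norm_div, Complex.norm_real, Real.norm_of_nonneg hZ.le,
    div_le_iff₀ hZ]
  refine le_trans (le_of_eq ?_) h
  congr 1
  refine sum_congr rfl fun σ _ => ?_
  rw [phase, ← Finset.prod_sdiff hTS]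
  rfl

end Limits

section Interpolation

/-- Interpolation between an exponentially small bound and a bound that is only good as long as
the exponential is not too small. -/
lemma interpolate {D B s t α : ℝ} (hD : 0 ≤ D) (hB : 0 ≤ B) (ht : 0 ≤ t) (hs : 0 < s) (hα : 0 ≤ α)
    (h1 : D ≤ 2 * Real.exp (-(α * t))) (h2 : B < 2 → D ≤ B * Real.exp (2 * s * α)) :
    D ≤ 2 ^ (2 * s / (2 * s + t)) * B ^ (t / (t + 2 * s)) := by
  have hts : 0 < t + 2 * s := by linarith
  set p := t / (t + 2 * s) with hp
  have hp0 : 0 ≤ p := by positivity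
  have hq : 2 * s / (2 * s + t) = 1 - p := by rw [hp]; field_simp; ring
  have hq0 : 0 ≤ 1 - p := by rw [← hq]; positivity
  rw [hq]
  -- the geometric mean of the two bounds with exponents `1 - p` and `p`, for which the exponentials
  -- cancel; if `2 ≤ B`, the trivial bound `D ≤ 2` is enough
  rcases lt_or_ge B 2 with hB2 | hB2
  · calc D = D ^ (1 - p) * D ^ p := by
          rw [← Real.rpow_add' hD (by norm_num), sub_add_cancel, Real.rpow_one]
      _ ≤ (2 * Real.exp (-(α * t))) ^ (1 - p) * (B * Real.exp (2 * s * α)) ^ p :=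
          mul_le_mul (Real.rpow_le_rpow hD h1 hq0) (Real.rpow_le_rpow hD (h2 hB2) hp0)
            (by positivity) (by positivity)
      _ = 2 ^ (1 - p) * B ^ p * (Real.exp (-(α * t) * (1 - p)) * Real.exp (2 * s * α * p)) := by
          rw [Real.mul_rpow (by norm_num) (Real.exp_pos _).le,
            Real.mul_rpow hB (Real.exp_pos _).le, ← Real.exp_mul, ← Real.exp_mul]
          ring
      _ = _ := by
          rw [← Real.exp_add, ← hq, hp,
            show -(α * t) * (2 * s / (2 * s + t)) + 2 * s * α * (t / (t + 2 * s)) = 0 by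
              field_simp; ring, Real.exp_zero, mul_one]
  · calc D ≤ 2 * 1 := h1.trans (by
          gcongr
          exact Real.exp_le_one_iff.2 (neg_nonpos.2 (mul_nonneg hα ht)))
      _ = 2 ^ (1 - p) * 2 ^ p := by
          rw [← Real.rpow_add (by norm_num), sub_add_cancel, Real.rpow_one, mul_one]
      _ ≤ _ := by gcongr

variable {n : ℕ} [NeZero n] (ρ : AddChar (ZMod n) Circle)

open Classical in
/-- Two terms in the constant `boldK` that suffice to bound all errors. -/
lemma le_bracket (hn : 2 ≤ n) (hρ : Function.Injective ρ) {β κ : ℝ}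
    (hA : 18 ^ 2 * alpha0 ρ κ * (2 + alpha0 ρ κ) < 1) (N : ℕ) (γ γ₀ : Edge →₀ ℤ) :
    1296 * (alpha1 ρ β ^ 6 * alpha0 ρ κ) / alpha5 ρ β κ +
      560000 * (alpha0 ρ κ ^ 3 * √(alpha4 ρ β κ * (alpha1 ρ β ^ 6 * alpha0 ρ κ))) / alpha5 ρ β κ ≤
  ((if boundary γ ≠ 0 then
      2 * constK ρ κ * constKp ρ κ ^ 8 * alpha0 ρ κ ^ 7 *
        (∑ e ∈ γ.support,
          (18 ^ 2 * (2 + alpha0 ρ κ) * alpha0 ρ κ) ^ (distZero n N e γ₀.support - 8)) *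
        (alpha1 ρ β / alpha0 ρ β) ^ 6 * (alpha2 ρ β κ ^ 6 / alpha5 ρ β κ)
    else 0)
    + constKpp ρ β κ * (alpha2 ρ β κ ^ 6 / alpha5 ρ β κ)
    + constK ρ κ * constKp ρ κ ^ 2 * alpha0 ρ κ ^ (5 / 6 : ℝ) *
        (alpha1 ρ β / alpha0 ρ β) ^ 7 * (alpha2 ρ β κ ^ 6 / alpha5 ρ β κ)
    + constK3 ρ κ * alpha2 ρ β κ ^ 5 / 2 *
        (alpha1 ρ β / alpha0 ρ β) ^ 12 * (alpha2 ρ β κ ^ 6 / alpha5 ρ β κ)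
    + √(2 * constK5 ρ κ * alpha0 ρ κ ^ 5 * alpha4 ρ β κ *
          max (alpha0 ρ κ) (alpha1 ρ β ^ 6) / alpha5 ρ β κ) *
        √((alpha1 ρ β / alpha0 ρ β) ^ 6) * √(alpha2 ρ β κ ^ 6 / alpha5 ρ β κ)
    + 2 * √(2 * constK4 ρ κ * alpha0 ρ κ ^ 8 * alpha4 ρ β κ / alpha5 ρ β κ) *
        √((alpha1 ρ β / alpha0 ρ β) ^ 6) * √(alpha2 ρ β κ ^ 6 / alpha5 ρ β κ)
    + √(2 * constK7 ρ β κ) * √(alpha2 ρ β κ ^ 6 / alpha5 ρ β κ) *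
        √(alpha3 ρ β κ / alpha5 ρ β κ)
    + √(constK6 ρ κ * alpha0 ρ κ ^ 8 * alpha4 ρ β κ / alpha5 ρ β κ)
    + √(alpha3 ρ β κ / alpha5 ρ β κ)) := by
  have ha : 0 < alpha0 ρ κ := alpha0_pos ρ hn κ
  have hb : 0 < alpha0 ρ β := alpha0_pos ρ hn β
  have h1 : 0 < alpha1 ρ β := alpha1_pos ρ hn β
  have h4 : 0 ≤ alpha4 ρ β κ := alpha4_nonneg ρ κ
  have h5 : 0 < alpha5 ρ β κ := alpha5_pos ρ κ hn hρ
  have h2 : 0 ≤ alpha2 ρ β κ := mul_nonneg hb.le (Real.rpow_nonneg ha.le _)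
  have h26 : alpha2 ρ β κ ^ 6 = alpha0 ρ β ^ 6 * alpha0 ρ κ := by
    rw [alpha2, mul_pow, ← Real.rpow_natCast (_ ^ (1 / 6 : ℝ)), ← Real.rpow_mul ha.le]
    norm_num
  set a := alpha0 ρ κ with hadef
  set b := alpha0 ρ β
  set α := alpha1 ρ β
  set α4 := alpha4 ρ β κ
  set α5 := alpha5 ρ β κ
  have hK1 : 0 < 1 - 18 ^ 2 * (2 + a) * a := by linarith
  have hK2 : 0 < 1 - 18 ^ 2 * a := by nlinarith
  have hK : ((18 : ℝ) ^ 3)⁻¹ ≤ constK ρ κ := by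
    rw [constK]
    refine le_mul_of_one_le_right (by positivity) ((one_le_inv₀ hK1).2 ?_)
    have : 0 ≤ 18 ^ 2 * (2 + a) * a := by positivity
    linarith
  have hK0 : 0 ≤ constK ρ κ := le_trans (by positivity) hK
  have hKp : 0 ≤ constKp ρ κ := by rw [constKp]; positivity
  have hK3 : 0 ≤ constK3 ρ κ := by rw [constK3, constKppp]; positivity
  have hq : 0 ≤ α / b := by positivity
  have hr : 0 ≤ alpha2 ρ β κ ^ 6 / α5 := by positivity
  have e1 : (α / b) ^ 6 * (alpha2 ρ β κ ^ 6 / α5) = α ^ 6 * a / α5 := by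
    rw [h26]; field_simp
  -- the second term of the bracket, in which `α ^ 6 * a` is the weight of a single fluctuating edge
  have hT2 : 1296 * (α ^ 6 * a) / α5 ≤ constKpp ρ β κ * (alpha2 ρ β κ ^ 6 / α5) := by
    have h324 : (1296 : ℝ) ≤ 4 * (18 ^ 2 + 18 * a * (1 - 18 ^ 2 * a)⁻¹) := by
      have : 0 ≤ 18 * a * (1 - 18 ^ 2 * a)⁻¹ := by positivity
      linarith
    calc 1296 * (α ^ 6 * a) / α5 = 1296 * ((α / b) ^ 6 * (alpha2 ρ β κ ^ 6 / α5)) := by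
          rw [e1]; ring
      _ ≤ 4 * (18 ^ 2 + 18 * a * (1 - 18 ^ 2 * a)⁻¹) *
            ((α / b) ^ 6 * (alpha2 ρ β κ ^ 6 / α5)) := by gcongr
      _ = _ := by rw [constKpp, ← hadef, div_pow]; ring
  -- the fifth term of the bracket
  have hT5 : 560000 * (a ^ 3 * √(α4 * (α ^ 6 * a))) / α5 ≤
      √(2 * constK5 ρ κ * a ^ 5 * α4 * max a (α ^ 6) / α5) * √((α / b) ^ 6) *
        √(alpha2 ρ β κ ^ 6 / α5) := by
    rw [mul_assoc, ← Real.sqrt_mul (by positivity), e1, ← Real.sqrt_mul' _ (by positivity)]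
    refine Real.le_sqrt_of_sq_le ?_
    rw [div_pow, mul_pow, mul_pow, Real.sq_sqrt (by positivity)]
    have hK5 : 560000 ^ 2 ≤ 2 * constK5 ρ κ := by
      rw [constK5, ← hadef]
      calc (560000 : ℝ) ^ 2 ≤ 2 * (((18 : ℝ) ^ 3)⁻¹ * 2 * 18 ^ 8 * (18 ^ 2 + 1) * (2 + 0) ^ 7) := by
            norm_num
        _ ≤ _ := by gcongr
    calc _ = 560000 ^ 2 * a ^ 5 * α4 * a / α5 * (α ^ 6 * a / α5) := by field_simp
      _ ≤ _ := by
          gcongr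
          exact le_max_left _ _
  -- the other terms are non-negative
  have hT1 : 0 ≤ (if boundary γ ≠ 0 then 2 * constK ρ κ * constKp ρ κ ^ 8 * a ^ 7 *
        (∑ e ∈ γ.support, (18 ^ 2 * (2 + a) * a) ^ (distZero n N e γ₀.support - 8)) *
        (α / b) ^ 6 * (alpha2 ρ β κ ^ 6 / α5) else 0) := by
    split_ifs
    · have : 0 ≤ ∑ e ∈ γ.support, (18 ^ 2 * (2 + a) * a) ^ (distZero n N e γ₀.support - 8) :=
        sum_nonneg fun e _ => by positivity
      positivity
    · exact le_rfl
  have hT3 : 0 ≤ constK ρ κ * constKp ρ κ ^ 2 * a ^ (5 / 6 : ℝ) * (α / b) ^ 7 *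
      (alpha2 ρ β κ ^ 6 / α5) := by positivity
  have hT4 : 0 ≤ constK3 ρ κ * alpha2 ρ β κ ^ 5 / 2 * (α / b) ^ 12 * (alpha2 ρ β κ ^ 6 / α5) := by
    positivity
  have hT6 : 0 ≤ 2 * √(2 * constK4 ρ κ * a ^ 8 * α4 / α5) * √((α / b) ^ 6) *
      √(alpha2 ρ β κ ^ 6 / α5) := by positivity
  have hT7 : 0 ≤ √(2 * constK7 ρ β κ) * √(alpha2 ρ β κ ^ 6 / α5) * √(alpha3 ρ β κ / α5) := by
    positivity
  have hT8 := Real.sqrt_nonneg (constK6 ρ κ * a ^ 8 * α4 / α5)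
  have hT9 := Real.sqrt_nonneg (alpha3 ρ β κ / α5)
  linarith only [hT1, hT2, hT3, hT4, hT5, hT6, hT7, hT8, hT9]

/-- The comparison of the budget with the growth of the exponential. -/
lemma le_mul_exp {B s δ ε Y α5 : ℝ} (h5 : 0 < α5) (hs : 0 ≤ s) (hδ : 0 ≤ δ) (hε : 0 ≤ ε) (hY : 0 ≤ Y)
    (hB : (1296 * ε / α5 + 560000 * Y / α5) * δ ≤ B) :
    2700 * (s * δ * ε) + 3 * 10 ^ 6 * (s * δ * Y) ≤ B * Real.exp (2 * s * α5) := by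
  -- `exp x ≥ e * x` absorbs the factor `s` into the exponential
  have h1 : 54 / 10 * (s * α5) ≤ Real.exp (2 * s * α5) := by
    have h2 := Real.add_one_le_exp (2 * s * α5 - 1)
    have h3 : Real.exp (2 * s * α5) = Real.exp (2 * s * α5 - 1) * Real.exp 1 := by
      rw [← Real.exp_add]; congr 1; ring
    have h4 : (27 / 10 : ℝ) ≤ Real.exp 1 := by linarith [Real.exp_one_gt_d9]
    rw [h3]
    calc 54 / 10 * (s * α5) = (2 * s * α5 - 1 + 1) * (27 / 10) := by ring
      _ ≤ _ := mul_le_mul h2 h4 (by norm_num) (Real.exp_pos _).le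
  have h0 : 0 ≤ (1296 * ε / α5 + 560000 * Y / α5) * δ := by positivity
  calc _ ≤ 54 / 10 * (s * δ) * (1296 * ε + 560000 * Y) := by
        have h6 : 0 ≤ s * δ * ε := by positivity
        have h7 : 0 ≤ s * δ * Y := by positivity
        linarith only [h6, h7]
    _ = (1296 * ε / α5 + 560000 * Y / α5) * δ * (54 / 10 * (s * α5)) := by field_simp
    _ ≤ _ := mul_le_mul hB h1 (by positivity) (h0.trans hB)

end Interpolation

section Final

variable {n : ℕ} [NeZero n] {ρ : AddChar (ZMod n) Circle}

/-- The infinite volume limits satisfy both bounds that are to be interpolated. -/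
theorem exists_limits_bounds (hn : 2 ≤ n) (hρ : Function.Injective ρ) {β κ : ℝ} (hβ : 0 ≤ β)
    (hA : 18 ^ 2 * alpha0 ρ κ * (2 + alpha0 ρ κ) < 1) {γ : Edge →₀ ℤ} (hγ : IsPath γ)
    (hγ_ne : γ ≠ 0) : ∃ L Θ H : ℂ,
      HasInfiniteVolumeLimit ρ β κ (wilsonLine ρ γ) L ∧
      HasInfiniteVolumeLimitInfty ρ κ (thetaProd ρ β κ γ) Θ ∧
      HasInfiniteVolumeLimitInfty ρ κ (wilsonLine ρ γ) H ∧
      ‖L - Θ * H‖ ≤ 2 * Real.exp (-(alpha5 ρ β κ * (straightEdges γ).card)) ∧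
      ∀ B δ : ℝ, δ = alpha2 ρ β κ + √(max 1 (suppCard (cornerPart γ)) / suppCard γ) →
        (1296 * (alpha1 ρ β ^ 6 * alpha0 ρ κ) / alpha5 ρ β κ + 560000 * (alpha0 ρ κ ^ 3 *
          √(alpha4 ρ β κ * (alpha1 ρ β ^ 6 * alpha0 ρ κ))) / alpha5 ρ β κ) * δ ≤ B → B < 2 →
        ‖L - Θ * H‖ ≤ B * Real.exp (2 * suppCard γ * alpha5 ρ β κ) := by
  set w := higgs ρ hβ κ with hw
  set a := alpha0 ρ κ with ha_def
  set α := alpha1 ρ β with hα_def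
  set t := straightEdges γ with ht_def
  have ha : 0 < a := alpha0_pos ρ hn κ
  have ha1 : a ≤ 1 / 648 := by nlinarith
  have hα0 : 0 < α := alpha1_pos ρ hn β
  have hα1 : α ≤ 1 := alpha1_le_one ρ hn hβ
  have hαb : ∀ g ≠ 0, w.b g ≤ α := fun g hg => le_alpha1 ρ β hg
  have hPB : PhaseBound w ρ (alpha5 ρ β κ) := phaseBound_alpha5 ρ hβ κ
  have h5 : 0 < alpha5 ρ β κ := alpha5_pos ρ κ hn hρ
  have hθm : ∀ h, theta ρ β κ h = w.mean ρ h := theta_eq_mean ρ hβ κ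
  have hmean5 : ∀ h, ‖theta ρ β κ h‖ ≤ 1 - alpha5 ρ β κ := fun h => by
    rw [hθm]; exact hPB.norm_mean_le h
  have hmean : ∀ h, ‖theta ρ β κ h‖ ≤ 1 := fun h => (hmean5 h).trans (by linarith)
  have h51 : 0 ≤ 1 - alpha5 ρ β κ := (norm_nonneg _).trans (hmean5 0)
  have hα6 : α ^ 6 ≤ 1 := pow_le_one₀ hα0.le hα1
  have hθε : ‖theta ρ β κ 0 - 1‖ ≤ 2 * (α ^ 6 * a) := by
    rw [hθm]; exact w.norm_mean_zero_sub_one_le ρ hαb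
  have hεa : α ^ 6 * a ≤ a := mul_le_of_le_one_left ha.le hα6
  have hθn : 1 - 2 * (α ^ 6 * a) ≤ ‖theta ρ β κ 0‖ := by
    have h1 : ‖(1 : ℂ)‖ ≤ ‖theta ρ β κ 0‖ + ‖1 - theta ρ β κ 0‖ := by
      calc ‖(1 : ℂ)‖ = ‖theta ρ β κ 0 + (1 - theta ρ β κ 0)‖ := by congr 1; ring
        _ ≤ _ := norm_add_le _ _
    rw [norm_one, norm_sub_rev] at h1
    linarith
  have hθpos : 323 / 324 ≤ ‖theta ρ β κ 0‖ := by linarith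
  have hθ : theta ρ β κ 0 ≠ 0 := norm_pos_iff.1 (by linarith)
  -- `alpha5` is at most twice the weight of a single fluctuation
  have h5ε : alpha5 ρ β κ ≤ 2 * (α ^ 6 * a) := by have := hmean5 0; linarith
  obtain ⟨L, Θ, H, hL, hΘ, hH, tL, tΘ, tH⟩ := exists_limits ρ hβ κ (μ := ‖theta ρ β κ 0‖⁻¹)
    ((one_le_inv₀ (by linarith)).2 (hmean 0)) hθ (fun h => by
      rw [norm_div, div_eq_mul_inv]
      exact mul_le_of_le_one_left (by positivity) (hmean h)) (by
      have hμ : ‖theta ρ β κ 0‖⁻¹ ≤ 324 / 323 := by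
        calc _ ≤ (323 / 324 : ℝ)⁻¹ := inv_anti₀ (by norm_num) hθpos
          _ = _ := by norm_num
      have h1 : (1 + a) * (1 + a) - 1 ≤ 2 / 648 + 1 / 648 ^ 2 := by nlinarith
      calc _ ≤ 51 * ((2 / 648 + 1 / 648 ^ 2) * (324 / 323 : ℝ)) := by
            gcongr
        _ ≤ _ := by norm_num) γ
  refine ⟨L, Θ, H, hL, hΘ, hH, ?_, ?_⟩
  -- both `L` and `Θ * H` are exponentially small in the number of edges that are not corner edges
  · have nL : ‖L‖ ≤ (1 - alpha5 ρ β κ) ^ t.card := by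
      refine le_of_tendsto tL.norm ?_
      filter_upwards [eventually_subset_boxEdges γ.support] with N hN
      exact norm_avg_phase_le ρ hPB (straightEdges_subset γ) hN (separated_straightEdges γ)
        fun e he => hγ.apply_eq (straightEdges_subset γ he)
    have h0 : ∀ N : ℕ, ∀ ω : Edge → ZMod n,
        0 ≤ wt (phi2 ρ κ) delta (boxEdges N) (stars (boxEdges N)) ω := fun N =>
      wt_nonneg w.k_nonneg delta_nonneg _ _
    have h1 : ∀ N : ℕ, wt (phi2 ρ κ) delta (boxEdges N) (stars (boxEdges N)) 0 = 1 := fun N =>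
      (separable_wt w.k_zero delta_zero _ _).1
    have nΘ : ‖Θ‖ ≤ (1 - alpha5 ρ β κ) ^ t.card := by
      refine le_of_tendsto tΘ.norm (Filter.Eventually.of_forall fun N => norm_avg_le (h0 N) (h1 N)
        fun σ => ?_)
      rw [norm_prod]
      calc _ ≤ ∏ e ∈ γ.support, (1 - alpha5 ρ β κ) :=
            Finset.prod_le_prod (fun _ _ => norm_nonneg _) fun e _ => hmean5 _
        _ = (1 - alpha5 ρ β κ) ^ γ.support.card := prod_const _
        _ ≤ _ := pow_le_pow_of_le_one h51 (by linarith)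
            (Finset.card_le_card (straightEdges_subset γ))
    have nH : ‖H‖ ≤ 1 := le_of_tendsto tH.norm (Filter.Eventually.of_forall fun N =>
      norm_avg_le (h0 N) (h1 N) fun σ => (norm_phase ρ _ _ σ).le)
    have hexp : (1 - alpha5 ρ β κ) ^ t.card ≤ Real.exp (-(alpha5 ρ β κ * t.card)) := by
      calc _ ≤ Real.exp (-alpha5 ρ β κ) ^ t.card :=
            pow_le_pow_left₀ h51 (Real.one_sub_le_exp_neg _) _
        _ = _ := by rw [← Real.exp_nat_mul]; congr 1; ring
    calc ‖L - Θ * H‖ ≤ ‖L‖ + ‖Θ‖ * ‖H‖ := (norm_sub_le _ _).trans (by rw [norm_mul])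
      _ ≤ (1 - alpha5 ρ β κ) ^ t.card + (1 - alpha5 ρ β κ) ^ t.card * 1 :=
          add_le_add nL (mul_le_mul nΘ nH (norm_nonneg _) (by positivity))
      _ ≤ _ := by linarith
  · intro B δ hδ hB hB2
    set c : ℝ := ((γ.support \ t).card : ℝ) with hc_def
    set s : ℝ := (γ.support.card : ℝ) with hs_def
    set m : ℝ := max 1 c with hm_def
    set Y := a ^ 3 * √(alpha4 ρ β κ * (α ^ 6 * a)) with hY_def
    have h4 := alpha4_nonneg ρ κ (β := β)
    have hY : 0 ≤ Y := by positivity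
    have hs : 0 < s := by
      rw [hs_def, Nat.cast_pos, Finset.card_pos, Finsupp.support_nonempty_iff]
      exact hγ_ne
    set r := a ^ (1 / 6 : ℝ) with hr_def
    have hr0 : 0 ≤ r := Real.rpow_nonneg ha.le _
    have hr6 : r ^ 6 = a := by
      rw [hr_def, ← Real.rpow_natCast, ← Real.rpow_mul ha.le]; norm_num
    have hr1 : r ≤ 34 / 100 := by
      refine le_of_pow_le_pow_left₀ (n := 6) (by norm_num) (by norm_num) ?_
      rw [hr6]; exact ha1.trans (by norm_num)
    rw [suppCard_cornerPart, suppCard, ← hc_def, ← hs_def, ← hm_def] at hδ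
    set b := alpha0 ρ β with hb_def
    have hα2 : alpha2 ρ β κ = b * r := rfl
    have hb : 0 < b := alpha0_pos ρ hn β
    have hαb0 : α ≤ b := alpha1_le_alpha0 ρ hn β
    rw [hα2] at hδ
    have hm1 : 1 ≤ m := le_max_left _ _
    have hsq0 := Real.sqrt_nonneg (m / s)
    have hbrδ : b * r ≤ δ := by linarith
    have hδ0 : 0 ≤ δ := (mul_nonneg hb.le hr0).trans hbrδ
    -- the bound is only needed if `δ` is small
    have hδ1 : δ ≤ 1 / 324 := by
      -- `alpha5 ≤ 2 * (α ^ 6 * a)` makes the first term of `B` at least `648 * δ`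
      have h1 : 648 ≤ 1296 * (α ^ 6 * a) / alpha5 ρ β κ := by
        rw [le_div_iff₀ h5]; linarith
      have h2 : 0 ≤ 560000 * Y / alpha5 ρ β κ := by positivity
      have h3 : 648 * δ ≤ B := by
        refine le_trans ?_ hB
        gcongr
        linarith
      linarith
    have hsm : 324 * m ≤ s * δ := by
      have h1 : √(m / s) ≤ δ := by
        have := mul_nonneg hb.le hr0
        linarith
      have h2 : √(m / s) * √(m / s) * s = m := by
        rw [Real.mul_self_sqrt (by positivity), div_mul_cancel₀ _ hs.ne']
      have h3 : √(m / s) * √(m / s) ≤ δ * (1 / 324) := by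
        gcongr
        exact h1.trans hδ1
      have := mul_le_mul_of_nonneg_right h3 hs.le
      linarith
    have hαδ : α * r ≤ δ := (mul_le_mul_of_nonneg_right hαb0 hr0).trans hbrδ
    have hq0 := w.q_nonneg
    have hqb : w.q ≤ b * α ^ 5 := higgs_q_le ρ hβ κ
    have hq4 : α ≤ 1 / 4 → w.q ≤ 4 * α ^ 6 := fun h => by
      calc w.q ≤ b * α ^ 5 := hqb
        _ ≤ 4 * α * α ^ 5 := by gcongr; exact alpha0_le hn hρ hβ h
        _ = _ := by ring
    have hqr : w.q * r ≤ 4 * α ^ 6 := by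
      rcases le_total α (1 / 4) with h | h
      · calc w.q * r ≤ w.q * 1 := by gcongr; linarith
          _ ≤ _ := by rw [mul_one]; exact hq4 h
      · calc w.q * r ≤ b * α ^ 5 * r := by gcongr
          _ = b * r * α ^ 5 := by ring
          _ ≤ 4 * α * α ^ 5 := mul_le_mul_of_nonneg_right (by linarith) (by positivity)
          _ = _ := by ring
    -- if `δ < a`, then `b * r ≤ δ < a = r ^ 6` forces `b ≤ r ^ 5`
    have hcase : a ≤ δ ∨ (α ≤ r ^ 5 ∧ w.q ≤ 4 * α ^ 6) := by
      rcases le_or_gt a δ with h | h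
      · exact Or.inl h
      · right
        have hr_pos : 0 < r := Real.rpow_pos_of_pos ha _
        have h1 : b ≤ r ^ 5 := by
          refine le_of_mul_le_mul_right ?_ hr_pos
          rw [← pow_succ, hr6]; linarith
        have h2 : r ^ 5 ≤ r := pow_le_of_le_one hr0 (by linarith) (by norm_num)
        have h3 : r ^ 5 ≤ r ^ 2 := pow_le_pow_of_le_one hr0 (by linarith) (by norm_num)
        have h4 : r ^ 2 ≤ 1 / 4 := by nlinarith
        exact ⟨hαb0.trans h1, hq4 (by linarith)⟩
    have hM2 : alpha4 ρ β κ ≤ 2 := (alpha4_le ρ κ hmean).trans (by norm_num)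
    have key : ‖L - Θ * H‖ ≤ 2700 * (s * δ * (α ^ 6 * a)) + 3 * 10 ^ 6 * (s * δ * Y) := by
      refine le_of_tendsto (tL.sub (tΘ.mul tH)).norm ?_
      filter_upwards [eventually_subset_boxEdges γ.support] with N hN
      have h := norm_avg_sub_mul_le_numeric (w := w) (ρ := ρ) (M := alpha4 ρ β κ) hγ
        (fun e he => hγ.apply_eq he) (straightEdges_subset γ) (separated_straightEdges γ) hN hαb
        hα0.le hα1 (fun h => by rw [← hθm]; exact hmean h) ha1 hr0 hr6 hαδ hqr hcase hM2
        (fun h => by rw [← hθm, ← hθm]; exact norm_theta_sub_le ρ κ h)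
        (by have := le_max_right 1 c; linarith) (by linarith)
      simp only [← hθm] at h
      exact h
    exact key.trans (le_mul_exp h5 hs.le hδ0 (by positivity) hY hB)

end Final

end LatticeHiggs

end

open LatticeHiggs

theorem mainTheorem2 (n : ℕ) [NeZero n] (hn : 2 ≤ n)
    (ρ : AddChar (ZMod n) Circle) (hρ : Function.Injective ρ)
    (β κ : ℝ) (hβ : 0 ≤ β) (hκ : 0 ≤ κ)
    (hA : 18 ^ 2 * alpha0 ρ κ * (2 + alpha0 ρ κ) < 1)
    (γ γ₀ : Edge →₀ ℤ) (hγ : IsPath γ) (hγ_ne : γ ≠ 0)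
    (hγ₀ : IsPath γ₀) (hbd : boundary γ₀ = -boundary γ) :
    ∃ L Θ H : ℂ,
      HasInfiniteVolumeLimit ρ β κ (wilsonLine ρ γ) L ∧
      HasInfiniteVolumeLimitInfty ρ κ (thetaProd ρ β κ γ) Θ ∧
      HasInfiniteVolumeLimitInfty ρ κ (wilsonLine ρ γ) H ∧
      ∀ᶠ N : ℕ in Filter.atTop,
        ‖L - Θ * H‖ ≤ boldK ρ N β κ γ γ₀ *
          (alpha2 ρ β κ + √(max 1 (suppCard (cornerPart γ)) / suppCard γ)) ^ boldKp γ := by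
  obtain ⟨L, Θ, H, hL, hΘ, hH, h1, h2⟩ := exists_limits_bounds hn hρ hβ hA hγ hγ_ne
  refine ⟨L, Θ, H, hL, hΘ, hH, Filter.Eventually.of_forall fun N => ?_⟩
  have h5 : 0 < alpha5 ρ β κ := alpha5_pos ρ κ hn hρ
  have hs : 0 < suppCard γ := by
    rw [suppCard, Nat.cast_pos, Finset.card_pos, Finsupp.support_nonempty_iff]
    exact hγ_ne
  have hδ : 0 ≤ alpha2 ρ β κ + √(max 1 (suppCard (cornerPart γ)) / suppCard γ) :=
    add_nonneg (mul_nonneg (alpha0_pos ρ hn β).le (Real.rpow_nonneg (alpha0_pos ρ hn κ).le _))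
      (Real.sqrt_nonneg _)
  have hbr := le_bracket ρ (β := β) hn hρ hA N γ γ₀
  rw [boldK, boldKp]
  have hlow : 0 ≤ 1296 * (alpha1 ρ β ^ 6 * alpha0 ρ κ) / alpha5 ρ β κ +
      560000 * (alpha0 ρ κ ^ 3 * √(alpha4 ρ β κ * (alpha1 ρ β ^ 6 * alpha0 ρ κ))) /
        alpha5 ρ β κ := by
    have := alpha0_pos ρ hn κ
    have := alpha1_pos ρ hn β
    positivity
  rw [mul_assoc, ← Real.mul_rpow (hlow.trans hbr) hδ]
  rw [← suppCard_sub_cornerPart] at h1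
  exact interpolate (norm_nonneg _) (mul_nonneg (hlow.trans hbr) hδ) (Nat.cast_nonneg _) hs h5.le h1
    (h2 _ _ rfl (mul_le_mul_of_nonneg_right hbr hδ))
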